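/- Let $F$ be a non-archimedean local field of characteristic $0$ with ring of integers $\mathcal O$, uniformizer $\varpi$, residue field of cardinality $q$ prime to $6$, and absolute value normalized by $|\varpi|=q^{-1}$. Write $\zeta(z)=(1-q^{-z})^{-1}$, and let $\psi$ be a unitary additive character of $F$ of conductor $\mathcal O$ (that is, $\psi(x\mathcal O)=1$ if and only if $x\in\mathcal O$). Let $dr$ be the Haar measure on $F$ with $\int_{\mathcal O}dr=1$. Let $G$ be the split group of type $G_2$, realized as the automorphism group of the split octonions, with short simple root $\alpha$, long simple root $\beta$, torus $T=\{h_\alpha(t_1)h_\beta(t_2)\}$, root subgroups $x_\gamma$, and $K=G(\mathcal O)$. Let $\mu_G$ be the Haar measure on $G(F)$ with $\mu_G(K)=1$. Let $MU$ be the Heisenberg parabolic subgroup, with Levi factor $M$ generated by $T$ and $x_{\pm\alpha}$ and with $$U=\{u(r_1,\dots,r_5)=x_\beta(r_1)x_{\alpha+\beta}(r_2)x_{2\alpha+\beta}(r_3)x_{3\alpha+\beta}(r_4)x_{3\alpha+2\beta}(r_5)\}$$ (with $du=dr_1\cdots dr_5$). Let $\Psi_s(u(r_1,\dots,r_5))=\psi(r_2+r_3)$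 be the split character and $S_{\Psi_s}$ its stabilizer in $M$. Let $s\in\mathbb C$ with $\operatorname{Re}s>1$. * $D(\cdot,s)$ is the bi-$K$-invariant function on $G(F)$ with $D(t,s)=|\omega_1(t)|^{5s+1}$, $\omega_1=2\alpha+\beta$, for all $t\in T$ such that $|\gamma(t)|\le1$ for every positive root $\gamma$; and $D^{\Psi_s}(g,s)=\int_U D(ug,s)\overline{\Psi_s(u)}\,du$. * $H=Spin_8$ with simple roots $\alpha_1,\dots,\alpha_4$ ($\alpha_2$ the central node) contains $G$ as the fixed points of the triality group $S_3$, with $x_\beta=x_{\alpha_2}$ and $x_{\pm\alpha}(r)=x_{\pm\alpha_1}(r)x_{\pm\alpha_3}(r)x_{\pm\alpha_4}(r)$. $P_H$ is the Heisenberg parabolic subgroup of $H$, $\delta_{P_H}$ its modulus character, $f_s(pk)=\delta_{P_H}(p)^s$ ($p\in P_H(F)$, $k\in H(\mathcal O)$), $\mu=w_2w_3x_{-\alpha_1}(1)$ where $w_2,w_3$ represent the simple reflections for $\alpha_2,\alpha_3$, and $$F^*(g,s)=\zeta(5s)\,\zeta(5s-1)^2\,\zeta(10s-4)\int_F f_s\big(\mu\,x_{\alpha+\beta}(r)\,g\big)\,\overline{\psi(r)}\,dr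 .$$ Here the root subgroups are normalized so that $U\cap\mu^{-1}P_H\mu=\{u(r_1,r_2,-r_2,r_4,r_5)\}$. * $A_0,A_1$ are the elements of the spherical Hecke algebra of $(G(F),K)$ corresponding under the Satake isomorphism to the trivial representation and to the $7$-dimensional representation of the dual group $G_2(\mathbb C)$, and $$P(\cdot,s)=\frac{P_0(q^{2-5s})A_0-P_1(q^{2-5s})A_1}{\zeta(5s-1)\zeta(5s+1)\zeta(5s-2)},$$ $$P_0(z)=\frac{z^4}{q^2}+\Big(\frac1{q^2}+\frac1q\Big)z^3+\frac{z^2}{q}+\Big(\frac1q+1\Big)z+1,\qquad P_1(z)=\frac{z^2}{q}.$$ * $(F^* * P)(g,s)=\int_G F^*(gx^{-1},s)P(x,s)\,d\mu_G(x)$. **Theorem.** All these integrals converge absolutely for every $g\in G(F)$. Both $D^{\Psi_s}(\cdot,s)$ and $(F^* * P)(\cdot,s)$ vanish outside $S_{\Psi_s}UTK$. For $t=h_\alpha(t_1)h_\beta(t_2)$ with $t_1,\frac{t_2}{t_1}\in\mathcal O$, $$D^{\Psi_s}(t,s)=(F^* * P)(t,s)=\begin{cases}\dfrac{1+q^{1-5s}}{\zeta(5s+1)}\left|\dfrac{t_2}{t_1}\right||t_1|^{5s},&\left|\dfrac{t_1^2}{t_2}\right|<1,\\[2mm]\dfrac{1+q^{1-5s}}{\zeta(5s+1)}\left|\dfrac{t_2}{t_1}\right|^{5s}|t_1|,&\left|\dfrac{t_1^2}{t_2}\right|>1,\\[2mm]\dfrac{1+2q^{1-5s}}{\zeta(5s+1)}|t_1|^{5s+1},&\left|\dfrac{t_1^2}{t_2}\right|=1.\end{cases}$$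 Moreover $D^{\Psi_s}(g,s)=(F^* * P)(g,s)$ for all $g\in G(F)$. -/

import Mathlib

open MeasureTheory Matrix

namespace SplitG2

noncomputable section

open scoped Classical

/-! ## The split octonion algebra

Zorn's vector matrices `(a, u; v, b)` with `a, b ∈ F` and `u, v ∈ F³`, norm `ab - u·v` and product
`(aa' + u·v', au' + b'u - v×v'; a'v + bv' + u×u', bb' + v·u')`.
The eight coordinates are `u = (x 0, x 5, x 6)`, `v = (x 7, x 2, x 1)`, `a = x 3`, `b = x 4`; with
respect to the maximal torus below the coordinates `0, …, 7` have the weights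
`2α+β, α+β, α, 0, 0, -α, -(α+β), -(2α+β)`. -/

section Algebraic

variable {F : Type*} [Field F]

theorem ext8 {R : Type*} {f g : Fin 8 → R} (h0 : f 0 = g 0) (h1 : f 1 = g 1) (h2 : f 2 = g 2)
    (h3 : f 3 = g 3) (h4 : f 4 = g 4) (h5 : f 5 = g 5) (h6 : f 6 = g 6) (h7 : f 7 = g 7) :
    f = g := by
  ext k
  fin_cases k <;> assumption

/-- The product of split octonions. -/
def octMul (x y : Fin 8 → F) : Fin 8 → F :=
  ![x 3 * y 0 + y 4 * x 0 - (x 2 * y 1 - x 1 * y 2),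
    y 3 * x 1 + x 4 * y 1 + (x 0 * y 5 - x 5 * y 0),
    y 3 * x 2 + x 4 * y 2 + (x 6 * y 0 - x 0 * y 6),
    x 3 * y 3 + (x 0 * y 7 + x 5 * y 2 + x 6 * y 1),
    x 4 * y 4 + (x 7 * y 0 + x 2 * y 5 + x 1 * y 6),
    x 3 * y 5 + y 4 * x 5 - (x 1 * y 7 - x 7 * y 1),
    x 3 * y 6 + y 4 * x 6 - (x 7 * y 2 - x 2 * y 7),
    y 3 * x 7 + x 4 * y 7 + (x 5 * y 6 - x 6 * y 5)]

/-- The norm form of the split octonions. -/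
def octNorm (x : Fin 8 → F) : F := x 3 * x 4 - (x 0 * x 7 + x 5 * x 2 + x 6 * x 1)

variable (F) in
/-- The split group of type `G₂` over `F`: the automorphism group of the split octonions. -/
def G2 : Subgroup (GL (Fin 8) F) where
  carrier := {g | ∀ x y, g.1 *ᵥ octMul x y = octMul (g.1 *ᵥ x) (g.1 *ᵥ y)}
  one_mem' := by intro x y; simp
  mul_mem' := by
    intro a b ha hb x y
    simp only [Units.val_mul, ← Matrix.mulVec_mulVec]
    rw [hb x y, ha]
  inv_mem' := by
    intro a ha x y
    have h1 : ∀ z : Fin 8 → F, a.1 *ᵥ (a⁻¹.1 *ᵥ z) = z := by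
      intro z; rw [Matrix.mulVec_mulVec, ← Units.val_mul]; simp
    have h2 : ∀ z : Fin 8 → F, a⁻¹.1 *ᵥ (a.1 *ᵥ z) = z := by
      intro z; rw [Matrix.mulVec_mulVec, ← Units.val_mul]; simp
    rw [← h2 (octMul (a⁻¹.1 *ᵥ x) (a⁻¹.1 *ᵥ y)), ha, h1, h1]

variable (F) in
/-- The simply connected split group of type `D₄` (that is, `Spin₈`) over `F`: the group of related
triples `(t₁, t₂, t₃)` of isometries of the split octonions, `t₁(xy) = t₂(x) t₃(y)`. -/
def Spin8 : Subgroup (GL (Fin 8) F × GL (Fin 8) F × GL (Fin 8) F) where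
  carrier := {t | (∀ x, octNorm (t.1.1 *ᵥ x) = octNorm x) ∧
    (∀ x, octNorm (t.2.1.1 *ᵥ x) = octNorm x) ∧ (∀ x, octNorm (t.2.2.1 *ᵥ x) = octNorm x) ∧
    ∀ x y, t.1.1 *ᵥ octMul x y = octMul (t.2.1.1 *ᵥ x) (t.2.2.1 *ᵥ y)}
  one_mem' := by refine ⟨?_, ?_, ?_, ?_⟩ <;> simp
  mul_mem' := by
    rintro a b ⟨a1, a2, a3, a4⟩ ⟨b1, b2, b3, b4⟩
    refine ⟨?_, ?_, ?_, ?_⟩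
    · intro x; simp only [Prod.fst_mul, Units.val_mul, ← Matrix.mulVec_mulVec, a1, b1]
    · intro x; simp only [Prod.fst_mul, Prod.snd_mul, Units.val_mul, ← Matrix.mulVec_mulVec, a2, b2]
    · intro x; simp only [Prod.snd_mul, Units.val_mul, ← Matrix.mulVec_mulVec, a3, b3]
    · intro x y
      simp only [Prod.fst_mul, Prod.snd_mul, Units.val_mul, ← Matrix.mulVec_mulVec, b4, a4]
  inv_mem' := by
    rintro a ⟨a1, a2, a3, a4⟩
    have h1 : ∀ (c : GL (Fin 8) F) (z : Fin 8 → F), c.1 *ᵥ (c⁻¹.1 *ᵥ z) = z := by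
      intro c z; rw [Matrix.mulVec_mulVec, ← Units.val_mul]; simp
    have h2 : ∀ (c : GL (Fin 8) F) (z : Fin 8 → F), c⁻¹.1 *ᵥ (c.1 *ᵥ z) = z := by
      intro c z; rw [Matrix.mulVec_mulVec, ← Units.val_mul]; simp
    refine ⟨?_, ?_, ?_, ?_⟩
    · intro x; rw [← a1, Prod.fst_inv, h1]
    · intro x; rw [← a2, Prod.snd_inv, Prod.fst_inv, h1]
    · intro x; rw [← a3, Prod.snd_inv, Prod.snd_inv, h1]
    · intro x y
      simp only [Prod.fst_inv, Prod.snd_inv]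
      rw [← h2 a.1 (octMul (a.2.1⁻¹.1 *ᵥ x) (a.2.2⁻¹.1 *ᵥ y)), a4, h1, h1]

/-! ## Root elements and torus of `G₂` -/

/-- The matrix of the root element `x_α(r)`. -/
def matA (r : F) : Matrix (Fin 8) (Fin 8) F :=
  !![1, r, 0, 0, 0, 0, 0, 0;
     0, 1, 0, 0, 0, 0, 0, 0;
     0, 0, 1, r, -r, -r ^ 2, 0, 0;
     0, 0, 0, 1, 0, -r, 0, 0;
     0, 0, 0, 0, 1, r, 0, 0;
     0, 0, 0, 0, 0, 1, 0, 0;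
     0, 0, 0, 0, 0, 0, 1, -r;
     0, 0, 0, 0, 0, 0, 0, 1]

/-- The matrix of the root element `x_β(r)`. -/
def matB (r : F) : Matrix (Fin 8) (Fin 8) F :=
  !![1, 0, 0, 0, 0, 0, 0, 0;
     0, 1, r, 0, 0, 0, 0, 0;
     0, 0, 1, 0, 0, 0, 0, 0;
     0, 0, 0, 1, 0, 0, 0, 0;
     0, 0, 0, 0, 1, 0, 0, 0;
     0, 0, 0, 0, 0, 1, -r, 0;
     0, 0, 0, 0, 0, 0, 1, 0;
     0, 0, 0, 0, 0, 0, 0, 1]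

/-- The matrix of the root element `x_{α+β}(r)`. -/
def matAB (r : F) : Matrix (Fin 8) (Fin 8) F :=
  !![1, 0, r, 0, 0, 0, 0, 0;
     0, 1, 0, -r, r, 0, -r ^ 2, 0;
     0, 0, 1, 0, 0, 0, 0, 0;
     0, 0, 0, 1, 0, 0, r, 0;
     0, 0, 0, 0, 1, 0, -r, 0;
     0, 0, 0, 0, 0, 1, 0, -r;
     0, 0, 0, 0, 0, 0, 1, 0;
     0, 0, 0, 0, 0, 0, 0, 1]

/-- The matrix of the root element `x_{2α+β}(r)`. -/
def mat2AB (r : F) : Matrix (Fin 8) (Fin 8) F :=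
  !![1, 0, 0, -r, r, 0, 0, -r ^ 2;
     0, 1, 0, 0, 0, -r, 0, 0;
     0, 0, 1, 0, 0, 0, r, 0;
     0, 0, 0, 1, 0, 0, 0, r;
     0, 0, 0, 0, 1, 0, 0, -r;
     0, 0, 0, 0, 0, 1, 0, 0;
     0, 0, 0, 0, 0, 0, 1, 0;
     0, 0, 0, 0, 0, 0, 0, 1]

/-- The matrix of the root element `x_{3α+β}(r)`. -/
def mat3AB (r : F) : Matrix (Fin 8) (Fin 8) F :=
  !![1, 0, 0, 0, 0, -r, 0, 0;
     0, 1, 0, 0, 0, 0, 0, 0;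
     0, 0, 1, 0, 0, 0, 0, r;
     0, 0, 0, 1, 0, 0, 0, 0;
     0, 0, 0, 0, 1, 0, 0, 0;
     0, 0, 0, 0, 0, 1, 0, 0;
     0, 0, 0, 0, 0, 0, 1, 0;
     0, 0, 0, 0, 0, 0, 0, 1]

/-- The matrix of the root element `x_{3α+2β}(r)`. -/
def mat3A2B (r : F) : Matrix (Fin 8) (Fin 8) F :=
  !![1, 0, 0, 0, 0, 0, r, 0;
     0, 1, 0, 0, 0, 0, 0, -r;
     0, 0, 1, 0, 0, 0, 0, 0;
     0, 0, 0, 1, 0, 0, 0, 0;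
     0, 0, 0, 0, 1, 0, 0, 0;
     0, 0, 0, 0, 0, 1, 0, 0;
     0, 0, 0, 0, 0, 0, 1, 0;
     0, 0, 0, 0, 0, 0, 0, 1]

/-- First of the three commuting factors of `matA`. -/
def matP (r : F) : Matrix (Fin 8) (Fin 8) F :=
  !![1, r, 0, 0, 0, 0, 0, 0;
     0, 1, 0, 0, 0, 0, 0, 0;
     0, 0, 1, 0, 0, 0, 0, 0;
     0, 0, 0, 1, 0, 0, 0, 0;
     0, 0, 0, 0, 1, 0, 0, 0;
     0, 0, 0, 0, 0, 1, 0, 0;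
     0, 0, 0, 0, 0, 0, 1, -r;
     0, 0, 0, 0, 0, 0, 0, 1]

/-- Second of the three commuting factors of `matA`. -/
def matQ (r : F) : Matrix (Fin 8) (Fin 8) F :=
  !![1, 0, 0, 0, 0, 0, 0, 0;
     0, 1, 0, 0, 0, 0, 0, 0;
     0, 0, 1, 0, -r, 0, 0, 0;
     0, 0, 0, 1, 0, -r, 0, 0;
     0, 0, 0, 0, 1, 0, 0, 0;
     0, 0, 0, 0, 0, 1, 0, 0;
     0, 0, 0, 0, 0, 0, 1, 0;
     0, 0, 0, 0, 0, 0, 0, 1]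

/-- Third of the three commuting factors of `matA`. -/
def matR (r : F) : Matrix (Fin 8) (Fin 8) F :=
  !![1, 0, 0, 0, 0, 0, 0, 0;
     0, 1, 0, 0, 0, 0, 0, 0;
     0, 0, 1, r, 0, 0, 0, 0;
     0, 0, 0, 1, 0, 0, 0, 0;
     0, 0, 0, 0, 1, r, 0, 0;
     0, 0, 0, 0, 0, 1, 0, 0;
     0, 0, 0, 0, 0, 0, 1, 0;
     0, 0, 0, 0, 0, 0, 0, 1]

/-- The element of `GL₈` given by a family of matrices with `M r * M (-r) = 1`. -/
def oneParam (M : F → Matrix (Fin 8) (Fin 8) F) (h : ∀ r, M r * M (-r) = 1) (r : F) :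
    GL (Fin 8) F :=
  ⟨M r, M (-r), h r, by simpa using h (-r)⟩

theorem transpose_mul_neg {M : F → Matrix (Fin 8) (Fin 8) F} (h : ∀ r, M r * M (-r) = 1) (r : F) :
    (M r)ᵀ * (M (-r))ᵀ = 1 := by
  rw [← Matrix.transpose_mul]
  have := h (-r)
  rw [neg_neg] at this
  rw [this, Matrix.transpose_one]

theorem matA_mulVec (r : F) (v : Fin 8 → F) : matA r *ᵥ v =
  ![v 0 + r * v 1, v 1, v 2 + r * v 3 - r * v 4 - r ^ 2 * v 5, v 3 - r * v 5, v 4 + r * v 5,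
    v 5, v 6 - r * v 7, v 7] := by
  apply ext8 <;>
    simp only [matA, Matrix.mulVec, dotProduct, Fin.sum_univ_eight, Matrix.of_apply,
      Matrix.cons_val] <;>
    ring

theorem matA_transpose_mulVec (r : F) (v : Fin 8 → F) : (matA r)ᵀ *ᵥ v =
  ![v 0, v 1 + r * v 0, v 2, v 3 + r * v 2, v 4 - r * v 2,
    v 5 - r ^ 2 * v 2 - r * v 3 + r * v 4, v 6, v 7 - r * v 6] := by
  apply ext8 <;>
    simp only [matA, Matrix.mulVec, dotProduct, Fin.sum_univ_eight, Matrix.transpose_apply,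
      Matrix.of_apply, Matrix.cons_val] <;>
    ring

theorem matA_mul_neg (r : F) : matA r * matA (-r) = 1 := by
  have h : ∀ v, (matA r * matA (-r)) *ᵥ v = v := by
    intro v
    rw [← Matrix.mulVec_mulVec, matA_mulVec, matA_mulVec]
    apply ext8 <;> simp only [Matrix.cons_val] <;> ring
  exact Matrix.ext_of_mulVec_single fun i => by rw [h, Matrix.one_mulVec]

theorem matB_mulVec (r : F) (v : Fin 8 → F) : matB r *ᵥ v =
  ![v 0, v 1 + r * v 2, v 2, v 3, v 4, v 5 - r * v 6, v 6, v 7] := by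
  apply ext8 <;>
    simp only [matB, Matrix.mulVec, dotProduct, Fin.sum_univ_eight, Matrix.of_apply,
      Matrix.cons_val] <;>
    ring

theorem matB_transpose_mulVec (r : F) (v : Fin 8 → F) : (matB r)ᵀ *ᵥ v =
  ![v 0, v 1, v 2 + r * v 1, v 3, v 4, v 5, v 6 - r * v 5, v 7] := by
  apply ext8 <;>
    simp only [matB, Matrix.mulVec, dotProduct, Fin.sum_univ_eight, Matrix.transpose_apply,
      Matrix.of_apply, Matrix.cons_val] <;>
    ring

theorem matB_mul_neg (r : F) : matB r * matB (-r) = 1 := by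
  have h : ∀ v, (matB r * matB (-r)) *ᵥ v = v := by
    intro v
    rw [← Matrix.mulVec_mulVec, matB_mulVec, matB_mulVec]
    apply ext8 <;> simp only [Matrix.cons_val] <;> ring
  exact Matrix.ext_of_mulVec_single fun i => by rw [h, Matrix.one_mulVec]

theorem matAB_mulVec (r : F) (v : Fin 8 → F) : matAB r *ᵥ v =
  ![v 0 + r * v 2, v 1 - r * v 3 + r * v 4 - r ^ 2 * v 6, v 2, v 3 + r * v 6, v 4 - r * v 6,
    v 5 - r * v 7, v 6, v 7] := by
  apply ext8 <;>
    simp only [matAB, Matrix.mulVec, dotProduct, Fin.sum_univ_eight, Matrix.of_apply,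
      Matrix.cons_val] <;>
    ring

theorem matAB_mul_neg (r : F) : matAB r * matAB (-r) = 1 := by
  have h : ∀ v, (matAB r * matAB (-r)) *ᵥ v = v := by
    intro v
    rw [← Matrix.mulVec_mulVec, matAB_mulVec, matAB_mulVec]
    apply ext8 <;> simp only [Matrix.cons_val] <;> ring
  exact Matrix.ext_of_mulVec_single fun i => by rw [h, Matrix.one_mulVec]

theorem mat2AB_mulVec (r : F) (v : Fin 8 → F) : mat2AB r *ᵥ v =
  ![v 0 - r * v 3 + r * v 4 - r ^ 2 * v 7, v 1 - r * v 5, v 2 + r * v 6, v 3 + r * v 7,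
    v 4 - r * v 7, v 5, v 6, v 7] := by
  apply ext8 <;>
    simp only [mat2AB, Matrix.mulVec, dotProduct, Fin.sum_univ_eight, Matrix.of_apply,
      Matrix.cons_val] <;>
    ring

theorem mat2AB_mul_neg (r : F) : mat2AB r * mat2AB (-r) = 1 := by
  have h : ∀ v, (mat2AB r * mat2AB (-r)) *ᵥ v = v := by
    intro v
    rw [← Matrix.mulVec_mulVec, mat2AB_mulVec, mat2AB_mulVec]
    apply ext8 <;> simp only [Matrix.cons_val] <;> ring
  exact Matrix.ext_of_mulVec_single fun i => by rw [h, Matrix.one_mulVec]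

theorem mat3AB_mulVec (r : F) (v : Fin 8 → F) : mat3AB r *ᵥ v =
  ![v 0 - r * v 5, v 1, v 2 + r * v 7, v 3, v 4, v 5, v 6, v 7] := by
  apply ext8 <;>
    simp only [mat3AB, Matrix.mulVec, dotProduct, Fin.sum_univ_eight, Matrix.of_apply,
      Matrix.cons_val] <;>
    ring

theorem mat3AB_mul_neg (r : F) : mat3AB r * mat3AB (-r) = 1 := by
  have h : ∀ v, (mat3AB r * mat3AB (-r)) *ᵥ v = v := by
    intro v
    rw [← Matrix.mulVec_mulVec, mat3AB_mulVec, mat3AB_mulVec]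
    apply ext8 <;> simp only [Matrix.cons_val] <;> ring
  exact Matrix.ext_of_mulVec_single fun i => by rw [h, Matrix.one_mulVec]

theorem mat3A2B_mulVec (r : F) (v : Fin 8 → F) : mat3A2B r *ᵥ v =
  ![v 0 + r * v 6, v 1 - r * v 7, v 2, v 3, v 4, v 5, v 6, v 7] := by
  apply ext8 <;>
    simp only [mat3A2B, Matrix.mulVec, dotProduct, Fin.sum_univ_eight, Matrix.of_apply,
      Matrix.cons_val] <;>
    ring

theorem mat3A2B_mul_neg (r : F) : mat3A2B r * mat3A2B (-r) = 1 := by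
  have h : ∀ v, (mat3A2B r * mat3A2B (-r)) *ᵥ v = v := by
    intro v
    rw [← Matrix.mulVec_mulVec, mat3A2B_mulVec, mat3A2B_mulVec]
    apply ext8 <;> simp only [Matrix.cons_val] <;> ring
  exact Matrix.ext_of_mulVec_single fun i => by rw [h, Matrix.one_mulVec]

theorem matP_mulVec (r : F) (v : Fin 8 → F) : matP r *ᵥ v =
  ![v 0 + r * v 1, v 1, v 2, v 3, v 4, v 5, v 6 - r * v 7, v 7] := by
  apply ext8 <;>
    simp only [matP, Matrix.mulVec, dotProduct, Fin.sum_univ_eight, Matrix.of_apply,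
      Matrix.cons_val] <;>
    ring

theorem matP_transpose_mulVec (r : F) (v : Fin 8 → F) : (matP r)ᵀ *ᵥ v =
  ![v 0, v 1 + r * v 0, v 2, v 3, v 4, v 5, v 6, v 7 - r * v 6] := by
  apply ext8 <;>
    simp only [matP, Matrix.mulVec, dotProduct, Fin.sum_univ_eight, Matrix.transpose_apply,
      Matrix.of_apply, Matrix.cons_val] <;>
    ring

theorem matP_mul_neg (r : F) : matP r * matP (-r) = 1 := by
  have h : ∀ v, (matP r * matP (-r)) *ᵥ v = v := by
    intro v
    rw [← Matrix.mulVec_mulVec, matP_mulVec, matP_mulVec]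
    apply ext8 <;> simp only [Matrix.cons_val] <;> ring
  exact Matrix.ext_of_mulVec_single fun i => by rw [h, Matrix.one_mulVec]

theorem matQ_mulVec (r : F) (v : Fin 8 → F) : matQ r *ᵥ v =
  ![v 0, v 1, v 2 - r * v 4, v 3 - r * v 5, v 4, v 5, v 6, v 7] := by
  apply ext8 <;>
    simp only [matQ, Matrix.mulVec, dotProduct, Fin.sum_univ_eight, Matrix.of_apply,
      Matrix.cons_val] <;>
    ring

theorem matQ_transpose_mulVec (r : F) (v : Fin 8 → F) : (matQ r)ᵀ *ᵥ v =
  ![v 0, v 1, v 2, v 3, v 4 - r * v 2, v 5 - r * v 3, v 6, v 7] := by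
  apply ext8 <;>
    simp only [matQ, Matrix.mulVec, dotProduct, Fin.sum_univ_eight, Matrix.transpose_apply,
      Matrix.of_apply, Matrix.cons_val] <;>
    ring

theorem matQ_mul_neg (r : F) : matQ r * matQ (-r) = 1 := by
  have h : ∀ v, (matQ r * matQ (-r)) *ᵥ v = v := by
    intro v
    rw [← Matrix.mulVec_mulVec, matQ_mulVec, matQ_mulVec]
    apply ext8 <;> simp only [Matrix.cons_val] <;> ring
  exact Matrix.ext_of_mulVec_single fun i => by rw [h, Matrix.one_mulVec]

theorem matR_mulVec (r : F) (v : Fin 8 → F) : matR r *ᵥ v =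
  ![v 0, v 1, v 2 + r * v 3, v 3, v 4 + r * v 5, v 5, v 6, v 7] := by
  apply ext8 <;>
    simp only [matR, Matrix.mulVec, dotProduct, Fin.sum_univ_eight, Matrix.of_apply,
      Matrix.cons_val] <;>
    ring

theorem matR_transpose_mulVec (r : F) (v : Fin 8 → F) : (matR r)ᵀ *ᵥ v =
  ![v 0, v 1, v 2, v 3 + r * v 2, v 4, v 5 + r * v 4, v 6, v 7] := by
  apply ext8 <;>
    simp only [matR, Matrix.mulVec, dotProduct, Fin.sum_univ_eight, Matrix.transpose_apply,
      Matrix.of_apply, Matrix.cons_val] <;>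
    ring

theorem matR_mul_neg (r : F) : matR r * matR (-r) = 1 := by
  have h : ∀ v, (matR r * matR (-r)) *ᵥ v = v := by
    intro v
    rw [← Matrix.mulVec_mulVec, matR_mulVec, matR_mulVec]
    apply ext8 <;> simp only [Matrix.cons_val] <;> ring
  exact Matrix.ext_of_mulVec_single fun i => by rw [h, Matrix.one_mulVec]

/-- The one-parameter subgroup `x_α`. -/
def xA (r : F) : G2 F :=
  ⟨oneParam matA matA_mul_neg r, by
    intro x y
    change matA r *ᵥ octMul x y = octMul (matA r *ᵥ x) (matA r *ᵥ y)
    simp only [matA_mulVec]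
    apply ext8 <;> simp only [octMul, Matrix.cons_val] <;> ring⟩

/-- The one-parameter subgroup `x_β`. -/
def xB (r : F) : G2 F :=
  ⟨oneParam matB matB_mul_neg r, by
    intro x y
    change matB r *ᵥ octMul x y = octMul (matB r *ᵥ x) (matB r *ᵥ y)
    simp only [matB_mulVec]
    apply ext8 <;> simp only [octMul, Matrix.cons_val] <;> ring⟩

/-- The one-parameter subgroup `x_{α+β}`. -/
def xAB (r : F) : G2 F :=
  ⟨oneParam matAB matAB_mul_neg r, by
    intro x y
    change matAB r *ᵥ octMul x y = octMul (matAB r *ᵥ x) (matAB r *ᵥ y)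
    simp only [matAB_mulVec]
    apply ext8 <;> simp only [octMul, Matrix.cons_val] <;> ring⟩

/-- The one-parameter subgroup `x_{2α+β}`. -/
def x2AB (r : F) : G2 F :=
  ⟨oneParam mat2AB mat2AB_mul_neg r, by
    intro x y
    change mat2AB r *ᵥ octMul x y = octMul (mat2AB r *ᵥ x) (mat2AB r *ᵥ y)
    simp only [mat2AB_mulVec]
    apply ext8 <;> simp only [octMul, Matrix.cons_val] <;> ring⟩

/-- The one-parameter subgroup `x_{3α+β}`. -/
def x3AB (r : F) : G2 F :=
  ⟨oneParam mat3AB mat3AB_mul_neg r, by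
    intro x y
    change mat3AB r *ᵥ octMul x y = octMul (mat3AB r *ᵥ x) (mat3AB r *ᵥ y)
    simp only [mat3AB_mulVec]
    apply ext8 <;> simp only [octMul, Matrix.cons_val] <;> ring⟩

/-- The one-parameter subgroup `x_{3α+2β}`. -/
def x3A2B (r : F) : G2 F :=
  ⟨oneParam mat3A2B mat3A2B_mul_neg r, by
    intro x y
    change mat3A2B r *ᵥ octMul x y = octMul (mat3A2B r *ᵥ x) (mat3A2B r *ᵥ y)
    simp only [mat3A2B_mulVec]
    apply ext8 <;> simp only [octMul, Matrix.cons_val] <;> ring⟩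

/-- The one-parameter subgroup `x_{-α}`. -/
def xAneg (r : F) : G2 F :=
  ⟨oneParam (fun r => (matA r)ᵀ) (transpose_mul_neg matA_mul_neg) r, by
    intro x y
    change (matA r)ᵀ *ᵥ octMul x y = octMul ((matA r)ᵀ *ᵥ x) ((matA r)ᵀ *ᵥ y)
    simp only [matA_transpose_mulVec]
    apply ext8 <;> simp only [octMul, Matrix.cons_val] <;> ring⟩

/-- The one-parameter subgroup `x_{-β}`. -/
def xBneg (r : F) : G2 F :=
  ⟨oneParam (fun r => (matB r)ᵀ) (transpose_mul_neg matB_mul_neg) r, by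
    intro x y
    change (matB r)ᵀ *ᵥ octMul x y = octMul ((matB r)ᵀ *ᵥ x) ((matB r)ᵀ *ᵥ y)
    simp only [matB_transpose_mulVec]
    apply ext8 <;> simp only [octMul, Matrix.cons_val] <;> ring⟩

/-- The element `h_α(t₁) h_β(t₂)` of the maximal torus. -/
def torusElt (t₁ t₂ : Fˣ) : G2 F :=
  ⟨⟨Matrix.diagonal ![(t₁ : F), t₂ / t₁, t₁ ^ 2 / t₂, 1, 1, t₂ / t₁ ^ 2, t₁ / t₂, 1 / t₁],
    Matrix.diagonal ![1 / (t₁ : F), t₁ / t₂, t₂ / t₁ ^ 2, 1, 1, t₁ ^ 2 / t₂, t₂ / t₁, t₁],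
    by
      rw [Matrix.diagonal_mul_diagonal, ← Matrix.diagonal_one]
      congr 1
      ext i
      fin_cases i <;> simp,
    by
      rw [Matrix.diagonal_mul_diagonal, ← Matrix.diagonal_one]
      congr 1
      ext i
      fin_cases i <;> simp⟩, by
    intro x y
    have h1 := t₁.ne_zero
    have h2 := t₂.ne_zero
    ext k
    fin_cases k <;> simp [octMul, Matrix.mulVec_diagonal] <;> field_simp⟩

/-- The element `u(r₁, r₂, r₃, r₄, r₅)` of the unipotent radical `U` of the Heisenberg parabolic
subgroup of `G₂` (the coordinates are indexed from `0`). -/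
def uElt (r : Fin 5 → F) : G2 F :=
  xB (r 0) * xAB (r 1) * x2AB (r 2) * x3AB (r 3) * x3A2B (r 4)

/-- The value of the root (or weight) `mα + nβ` at `h_α(t₁) h_β(t₂)`. -/
def rootChar (m n : ℤ) (t₁ t₂ : Fˣ) : F := ((t₁ ^ 2 / t₂) ^ m * (t₂ ^ 2 / t₁ ^ 3) ^ n : Fˣ)

/-- The positive roots `mα + nβ`, as pairs `(m, n)`. -/
def posRoots : Finset (ℤ × ℤ) := {(1, 0), (0, 1), (1, 1), (2, 1), (3, 1), (3, 2)}

variable (F) in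
/-- The Levi factor `M` of the Heisenberg parabolic subgroup, generated by the torus and the root
subgroups of `±α`. -/
def leviM : Subgroup (G2 F) :=
  Subgroup.closure
    ({g | ∃ t₁ t₂, g = torusElt t₁ t₂} ∪ {g | ∃ r, g = xA r ∨ g = xAneg r})

/-! ## The embedding of `G₂` in `Spin₈` and root elements of `Spin₈` -/

/-- Automorphisms of the octonions preserve the norm. -/
theorem octNorm_of_mem {g : GL (Fin 8) F} (hg : g ∈ G2 F) (x : Fin 8 → F) :
    octNorm (g.1 *ᵥ x) = octNorm x := by
  set e : Fin 8 → F := ![0, 0, 0, 1, 1, 0, 0, 0] with he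
  have hinv : ∀ z : Fin 8 → F, g.1 *ᵥ (g⁻¹.1 *ᵥ z) = z := by
    intro z; rw [Matrix.mulVec_mulVec, ← Units.val_mul]; simp
  have hinv' : ∀ z : Fin 8 → F, g⁻¹.1 *ᵥ (g.1 *ᵥ z) = z := by
    intro z; rw [Matrix.mulVec_mulVec, ← Units.val_mul]; simp
  have hle : ∀ z : Fin 8 → F, octMul z e = z := by
    intro z; ext k; fin_cases k <;> simp [octMul, he]
  have hel : ∀ z : Fin 8 → F, octMul e z = z := by
    intro z; ext k; fin_cases k <;> simp [octMul, he]
  have hge : g.1 *ᵥ e = e := by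
    have h := hg (g⁻¹.1 *ᵥ e) e
    rw [hle, hinv, hel] at h
    exact h.symm
  have hsq : ∀ z : Fin 8 → F, octMul z z = (z 3 + z 4) • z - octNorm z • e := by
    intro z; ext k; fin_cases k <;> simp [octMul, octNorm, he] <;> ring
  have key : (x 3 + x 4 - ((g.1 *ᵥ x) 3 + (g.1 *ᵥ x) 4)) • (g.1 *ᵥ x)
      = (octNorm x - octNorm (g.1 *ᵥ x)) • e := by
    have h := hg x x
    rw [hsq x, hsq (g.1 *ᵥ x), Matrix.mulVec_sub, Matrix.mulVec_smul, Matrix.mulVec_smul, hge] at h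
    rw [sub_smul, sub_smul]
    rw [sub_eq_sub_iff_add_eq_add] at h ⊢
    rw [h, add_comm]
  by_cases hc : x 3 + x 4 - ((g.1 *ᵥ x) 3 + (g.1 *ᵥ x) 4) = 0
  · rw [hc, zero_smul] at key
    have h3 := congrFun key 3
    simp [he] at h3
    exact (sub_eq_zero.mp h3.symm).symm
  · have hx : g.1 *ᵥ x = ((x 3 + x 4 - ((g.1 *ᵥ x) 3 + (g.1 *ᵥ x) 4))⁻¹
        * (octNorm x - octNorm (g.1 *ᵥ x))) • e := by
      rw [mul_smul, ← key, smul_smul, inv_mul_cancel₀ hc, one_smul]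
    generalize ((x 3 + x 4 - ((g.1 *ᵥ x) 3 + (g.1 *ᵥ x) 4))⁻¹
        * (octNorm x - octNorm (g.1 *ᵥ x))) = c at hx
    have hx' : x = c • e := by
      rw [← hinv' x, hx, Matrix.mulVec_smul]
      congr 1
      rw [← hge, hinv', hge]
    rw [hx, ← hx']

/-- The embedding `g ↦ (g, g, g)` of `G₂` in `Spin₈`; its image is the group of fixed points of the
group `S₃` of triality automorphisms. -/
def toSpin8 (g : G2 F) : Spin8 F :=
  ⟨(g.1, g.1, g.1), octNorm_of_mem g.2, octNorm_of_mem g.2, octNorm_of_mem g.2, g.2⟩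

/-- The root elements `x_{α₁}(r)` of `Spin₈`. The simple roots of `Spin₈` are `α₂`, which restricts
to `β`, and `α₁, α₃, α₄`, which restrict to `α`; the root elements are normalized by
`x_α(r) = x_{α₁}(r) x_{α₃}(r) x_{α₄}(r)`, where `x_{α₄}(r)` is given by the triple
`(matR r, matR r, matP r)`. -/
def xα₁ (r : F) : Spin8 F :=
  ⟨(oneParam matP matP_mul_neg r, oneParam matQ matQ_mul_neg r, oneParam matR matR_mul_neg r), by
    refine ⟨?_, ?_, ?_, ?_⟩
    · intro x
      change octNorm (matP r *ᵥ x) = octNorm x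
      rw [matP_mulVec]
      simp only [octNorm, Matrix.cons_val]
      ring
    · intro x
      change octNorm (matQ r *ᵥ x) = octNorm x
      rw [matQ_mulVec]
      simp only [octNorm, Matrix.cons_val]
      ring
    · intro x
      change octNorm (matR r *ᵥ x) = octNorm x
      rw [matR_mulVec]
      simp only [octNorm, Matrix.cons_val]
      ring
    · intro x y
      change matP r *ᵥ octMul x y = octMul (matQ r *ᵥ x) (matR r *ᵥ y)
      simp only [matP_mulVec, matQ_mulVec, matR_mulVec]
      apply ext8 <;> simp only [octMul, Matrix.cons_val] <;> ring⟩

/-- The root elements `x_{-α₁}(r)` of `Spin₈`. -/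
def xα₁neg (r : F) : Spin8 F :=
  ⟨(oneParam (fun r => (matP r)ᵀ) (transpose_mul_neg matP_mul_neg) r,
    oneParam (fun r => (matQ r)ᵀ) (transpose_mul_neg matQ_mul_neg) r,
    oneParam (fun r => (matR r)ᵀ) (transpose_mul_neg matR_mul_neg) r), by
    refine ⟨?_, ?_, ?_, ?_⟩
    · intro x
      change octNorm ((matP r)ᵀ *ᵥ x) = octNorm x
      rw [matP_transpose_mulVec]
      simp only [octNorm, Matrix.cons_val]
      ring
    · intro x
      change octNorm ((matQ r)ᵀ *ᵥ x) = octNorm x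
      rw [matQ_transpose_mulVec]
      simp only [octNorm, Matrix.cons_val]
      ring
    · intro x
      change octNorm ((matR r)ᵀ *ᵥ x) = octNorm x
      rw [matR_transpose_mulVec]
      simp only [octNorm, Matrix.cons_val]
      ring
    · intro x y
      change (matP r)ᵀ *ᵥ octMul x y = octMul ((matQ r)ᵀ *ᵥ x) ((matR r)ᵀ *ᵥ y)
      simp only [matP_transpose_mulVec, matQ_transpose_mulVec, matR_transpose_mulVec]
      apply ext8 <;> simp only [octMul, Matrix.cons_val] <;> ring⟩

/-- The root elements `x_{α₃}(r)` of `Spin₈`. -/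
def xα₃ (r : F) : Spin8 F :=
  ⟨(oneParam matQ matQ_mul_neg r, oneParam matP matP_mul_neg r, oneParam matQ matQ_mul_neg r), by
    refine ⟨?_, ?_, ?_, ?_⟩
    · intro x
      change octNorm (matQ r *ᵥ x) = octNorm x
      rw [matQ_mulVec]
      simp only [octNorm, Matrix.cons_val]
      ring
    · intro x
      change octNorm (matP r *ᵥ x) = octNorm x
      rw [matP_mulVec]
      simp only [octNorm, Matrix.cons_val]
      ring
    · intro x
      change octNorm (matQ r *ᵥ x) = octNorm x
      rw [matQ_mulVec]
      simp only [octNorm, Matrix.cons_val]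
      ring
    · intro x y
      change matQ r *ᵥ octMul x y = octMul (matP r *ᵥ x) (matQ r *ᵥ y)
      simp only [matQ_mulVec, matP_mulVec]
      apply ext8 <;> simp only [octMul, Matrix.cons_val] <;> ring⟩

/-- The root elements `x_{-α₃}(r)` of `Spin₈`. -/
def xα₃neg (r : F) : Spin8 F :=
  ⟨(oneParam (fun r => (matQ r)ᵀ) (transpose_mul_neg matQ_mul_neg) r,
    oneParam (fun r => (matP r)ᵀ) (transpose_mul_neg matP_mul_neg) r,
    oneParam (fun r => (matQ r)ᵀ) (transpose_mul_neg matQ_mul_neg) r), by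
    refine ⟨?_, ?_, ?_, ?_⟩
    · intro x
      change octNorm ((matQ r)ᵀ *ᵥ x) = octNorm x
      rw [matQ_transpose_mulVec]
      simp only [octNorm, Matrix.cons_val]
      ring
    · intro x
      change octNorm ((matP r)ᵀ *ᵥ x) = octNorm x
      rw [matP_transpose_mulVec]
      simp only [octNorm, Matrix.cons_val]
      ring
    · intro x
      change octNorm ((matQ r)ᵀ *ᵥ x) = octNorm x
      rw [matQ_transpose_mulVec]
      simp only [octNorm, Matrix.cons_val]
      ring
    · intro x y
      change (matQ r)ᵀ *ᵥ octMul x y = octMul ((matP r)ᵀ *ᵥ x) ((matQ r)ᵀ *ᵥ y)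
      simp only [matQ_transpose_mulVec, matP_transpose_mulVec]
      apply ext8 <;> simp only [octMul, Matrix.cons_val] <;> ring⟩

variable (F) in
/-- A representative of the simple reflection `w₂` of `Spin₈`. -/
def w₂ : Spin8 F := toSpin8 (xB 1 * xBneg (-1) * xB 1)

variable (F) in
/-- A representative of the simple reflection `w₃` of `Spin₈`. -/
def w₃ : Spin8 F := xα₃ 1 * xα₃neg (-1) * xα₃ 1

variable (F) in
/-- The representative `μ = w₂ w₃ x_{-α₁}(1)` of the open `G₂`-orbit on `P_H \ Spin₈`. With the
root elements chosen here the part of its stabilizer in `U` is `{u(r₁, r₂, -r₂, r₄, r₅)}`, the kernel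
of `r₂ + r₃`. -/
def muElt : Spin8 F := w₂ F * w₃ F * xα₁neg 1

variable (F) in
/-- The Heisenberg parabolic subgroup `P_H` of `Spin₈`: the stabilizer, under the first component, of
the isotropic plane spanned by the coordinate vectors of weights `2α+β` and `α+β`. -/
def parabolicH : Set (Spin8 F) := {p | ∀ i j : Fin 8, 2 ≤ i → j < 2 → p.1.1.1 i j = 0}

end Algebraic

/-! ## Analysis over a non-archimedean local field -/

section Local

variable {F : Type*} [NontriviallyNormedField F]

/-- All entries of the matrix and of its inverse are integral. -/
def HasIntegralEntries (g : GL (Fin 8) F) : Prop := ∀ i j, ‖g.1 i j‖ ≤ 1 ∧ ‖g⁻¹.1 i j‖ ≤ 1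

variable (F) in
/-- The maximal compact subgroup `K = G₂(𝒪)`. -/
def maxCompact : Set (G2 F) := {g | HasIntegralEntries g.1}

variable (F) in
/-- The maximal compact subgroup `Spin₈(𝒪)`. -/
def maxCompactH : Set (Spin8 F) :=
  {h | HasIntegralEntries h.1.1 ∧ HasIntegralEntries h.1.2.1 ∧ HasIntegralEntries h.1.2.2}

variable (F) in
/-- The cardinality `q` of the residue field. -/
def residueCard [IsUltrametricDist F] : ℕ :=
  Nat.card (IsLocalRing.ResidueField (NormedField.valuation (K := F)).valuationSubring)

variable (F) in
/-- The norm of `F` is the normalized one: `q⁻¹` is the largest value smaller than `1`. -/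
def IsNormalizedNorm [IsUltrametricDist F] : Prop :=
  (∃ ϖ : F, ‖ϖ‖ = (residueCard F : ℝ)⁻¹) ∧ ∀ x : F, ‖x‖ < 1 → ‖x‖ ≤ (residueCard F : ℝ)⁻¹

variable (F) in
/-- The local zeta factor `ζ(z) = (1 - q^{-z})⁻¹`. -/
def localZeta [IsUltrametricDist F] (z : ℂ) : ℂ := (1 - (residueCard F : ℂ) ^ (-z))⁻¹

/-- The split character `Ψ_s(u(r₁, …, r₅)) = ψ(r₂ + r₃)` of `U`. -/
def splitChar (ψ : AddChar F Circle) (r : Fin 5 → F) : ℂ := ψ (r 1 + r 2)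

/-- The stabilizer `S_{Ψ_s}` of the split character in `M`. -/
def splitStabilizer (ψ : AddChar F Circle) : Set (G2 F) :=
  {m | m ∈ leviM F ∧ ∀ r r' : Fin 5 → F, m * uElt r * m⁻¹ = uElt r' →
    splitChar ψ r' = splitChar ψ r}

/-- The set `S_{Ψ_s} U T K`. -/
def supportSet (ψ : AddChar F Circle) : Set (G2 F) :=
  {g | ∃ s ∈ splitStabilizer ψ, ∃ (r : Fin 5 → F) (t₁ t₂ : Fˣ), ∃ k ∈ maxCompact F,
    g = s * uElt r * torusElt t₁ t₂ * k}

/-- `g ∈ K t K` with `t = h_α(t₁) h_β(t₂)` in `T⁺ = {t | |γ(t)| ≤ 1 for all positive roots γ}`. -/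
def IsCartanPart (g : G2 F) (t : Fˣ × Fˣ) : Prop :=
  (∀ γ ∈ posRoots, ‖rootChar γ.1 γ.2 t.1 t.2‖ ≤ 1) ∧
    ∃ k ∈ maxCompact F, ∃ k' ∈ maxCompact F, g = k * torusElt t.1 t.2 * k'

/-- The bi-`K`-invariant function `D(·, s)` with `D(t, s) = |ω₁(t)|^{5s+1}` for `t ∈ T⁺`, where
`ω₁ = 2α+β`. -/
def functionD (s : ℂ) (g : G2 F) : ℂ :=
  if h : ∃ t : Fˣ × Fˣ, IsCartanPart g t then
    (‖rootChar 2 1 h.choose.1 h.choose.2‖ : ℂ) ^ (5 * s + 1)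
  else 0

variable [MeasurableSpace F]

/-- The Fourier transform `f^{Ψ_s}(g) = ∫_U f(ug) \overline{Ψ_s(u)} du`. -/
def fourierTransform (ψ : AddChar F Circle) (dr : Measure F) (f : G2 F → ℂ) (g : G2 F) : ℂ :=
  ∫ r : Fin 5 → F, f (uElt r * g) * star (splitChar ψ r) ∂(Measure.pi fun _ => dr)

/-- Elements of the spherical Hecke algebra of `G₂` with respect to `K`. -/
def IsHecke (f : G2 F → ℂ) : Prop :=
  HasCompactSupport f ∧ ∀ k ∈ maxCompact F, ∀ g, f (k * g) = f g ∧ f (g * k) = f g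

/-- The Satake transform `δ_B(t)^{1/2} ∫_N f(tn) dn` at `t = h_α(t₁) h_β(t₂)`, where
`n = x_α(r₀) u(r₁, …, r₅)` runs over the unipotent radical `N` of the Borel subgroup. -/
def satakeTransform (dr : Measure F) (f : G2 F → ℂ) (t₁ t₂ : Fˣ) : ℂ :=
  (Real.sqrt (∏ γ ∈ posRoots, ‖rootChar γ.1 γ.2 t₁ t₂‖) : ℂ) *
    ∫ r : Fin 6 → F, f (torusElt t₁ t₂ * (xA (r 0) * uElt fun i => r i.succ))
      ∂(Measure.pi fun _ => dr)

/-- `f` is the element of the Hecke algebra that corresponds, under the Satake isomorphism, to the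
representation of the dual group in which the weight `aα^∨ + bβ^∨` has multiplicity `m (a, b)`.
The weight `aα^∨ + bβ^∨` is identified with the coset of `h_α(ϖ^a) h_β(ϖ^b)` modulo `T(𝒪)`. -/
def IsSatakePreimage [IsUltrametricDist F] (dr : Measure F) (m : ℤ × ℤ → ℂ) (f : G2 F → ℂ) :
    Prop :=
  IsHecke f ∧ ∀ (a b : ℤ) (t₁ t₂ : Fˣ), ‖(t₁ : F)‖ = (residueCard F : ℝ) ^ (-a) →
    ‖(t₂ : F)‖ = (residueCard F : ℝ) ^ (-b) → satakeTransform dr f t₁ t₂ = m (a, b)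

/-- The element of the Hecke algebra that corresponds to the weight multiplicities `m` under the
Satake isomorphism. -/
def heckeElt [IsUltrametricDist F] (dr : Measure F) (m : ℤ × ℤ → ℂ) : G2 F → ℂ :=
  Classical.epsilon (IsSatakePreimage dr m)

/-- Weight multiplicities of the trivial representation of the dual group. -/
def trivialMult (w : ℤ × ℤ) : ℂ := if w = (0, 0) then 1 else 0

/-- Weight multiplicities of the seven-dimensional representation `st` of the dual group `G₂(ℂ)`:
the weights are `0` and the short roots of the dual group, which are the coroots
`±β^∨`, `±(3α+β)^∨ = ±(α^∨ + β^∨)`, `±(3α+2β)^∨ = ±(α^∨ + 2β^∨)` of the long roots. -/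
def standardMult (w : ℤ × ℤ) : ℂ :=
  if w ∈ ({(0, 0), (0, 1), (0, -1), (1, 1), (-1, -1), (1, 2), (-1, -2)} : Finset (ℤ × ℤ)) then 1
  else 0

variable (F) in
/-- The polynomial `P₀(z) = z⁴/q² + (1/q² + 1/q) z³ + z²/q + (1/q + 1) z + 1`. -/
def polyP₀ [IsUltrametricDist F] (z : ℂ) : ℂ :=
  let q : ℂ := residueCard F
  z ^ 4 / q ^ 2 + (1 / q ^ 2 + 1 / q) * z ^ 3 + z ^ 2 / q + (1 / q + 1) * z + 1

variable (F) in
/-- The polynomial `P₁(z) = z²/q`. -/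
def polyP₁ [IsUltrametricDist F] (z : ℂ) : ℂ := z ^ 2 / (residueCard F : ℂ)

/-- The element `P(·, s) = (P₀(q^{2-5s}) A₀ - P₁(q^{2-5s}) A₁) / (ζ(5s-1) ζ(5s+1) ζ(5s-2))` of the
Hecke algebra, where `A₀`, `A₁` correspond to the trivial representation and to `st`. -/
def functionP [IsUltrametricDist F] (dr : Measure F) (s : ℂ) (g : G2 F) : ℂ :=
  (polyP₀ F ((residueCard F : ℂ) ^ (2 - 5 * s)) * heckeElt dr trivialMult g
    - polyP₁ F ((residueCard F : ℂ) ^ (2 - 5 * s)) * heckeElt dr standardMult g)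
    / (localZeta F (5 * s - 1) * localZeta F (5 * s + 1) * localZeta F (5 * s - 2))

/-- The modulus character `|det g₁|⁵` of `P_H`, where `g₁` is the action of the first component on
the isotropic plane. -/
def modulusH (p : Spin8 F) : ℝ :=
  ‖p.1.1.1 0 0 * p.1.1.1 1 1 - p.1.1.1 0 1 * p.1.1.1 1 0‖ ^ 5

/-- The normalized spherical section `f_s` of the unnormalized induced representation
`Ind δ_{P_H}^s`: `f_s(pk) = δ_{P_H}(p)^s` for `p ∈ P_H`, `k ∈ Spin₈(𝒪)`. -/
def sphericalSection (s : ℂ) (h : Spin8 F) : ℂ :=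
  if hp : ∃ p ∈ parabolicH F, ∃ k ∈ maxCompactH F, h = p * k then
    (modulusH hp.choose : ℂ) ^ s
  else 0

/-- The integrand of the function `F*`. -/
def integrandF (ψ : AddChar F Circle) (s : ℂ) (g : G2 F) (r : F) : ℂ :=
  sphericalSection s (muElt F * toSpin8 (xAB r * g)) * star (ψ r : ℂ)

/-- The function `F*(g, s) = j(s) ∫_F f_s(μ x_{α+β}(r) g) \overline{ψ(r)} dr`, where
`j(s) = ζ(5s) ζ(5s-1)² ζ(10s-4)`. -/
def functionF [IsUltrametricDist F] (ψ : AddChar F Circle) (dr : Measure F) (s : ℂ) (g : G2 F) :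
    ℂ :=
  localZeta F (5 * s) * localZeta F (5 * s - 1) ^ 2 * localZeta F (10 * s - 4) *
    ∫ r, integrandF ψ s g r ∂dr

/-- The convolution `(f * h)(g) = ∫_G f(g x⁻¹) h(x) dx`. -/
def heckeConv [MeasurableSpace (G2 F)] (μ : Measure (G2 F)) (f h : G2 F → ℂ) (g : G2 F) : ℂ :=
  ∫ x, f (g * x⁻¹) * h x ∂μ

variable (F) in
/-- The explicit value at `h_α(t₁) h_β(t₂)`. -/
def toralValue [IsUltrametricDist F] (s : ℂ) (t₁ t₂ : Fˣ) : ℂ :=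
  let q : ℂ := residueCard F
  let a₁ : ℂ := (‖(t₁ : F)‖ : ℝ)
  let a₂ : ℂ := (‖(t₂ : F) / t₁‖ : ℝ)
  if ‖(t₁ : F) ^ 2 / t₂‖ < 1 then
    (1 + q ^ (1 - 5 * s)) / localZeta F (5 * s + 1) * a₂ * a₁ ^ (5 * s)
  else if 1 < ‖(t₁ : F) ^ 2 / t₂‖ then
    (1 + q ^ (1 - 5 * s)) / localZeta F (5 * s + 1) * a₂ ^ (5 * s) * a₁
  else (1 + 2 * q ^ (1 - 5 * s)) / localZeta F (5 * s + 1) * a₁ ^ (5 * s + 1)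

end Local

end

end SplitG2

open SplitG2

namespace SplitG2
noncomputable section
open scoped Classical
set_option linter.unusedSectionVars false

/-- The product measure of copies of `μ`. -/
notation:max "𝛑" μ:max => Measure.pi fun _ => μ

section LocalField

variable {F : Type*} [NontriviallyNormedField F] [IsUltrametricDist F]

local notation "𝐪" => ((residueCard F : ℕ) : ℝ)

/-! ## Norms and residues in a non-archimedean local field -/

variable (F) in
/-- The residue field. -/
abbrev ResField : Type _ :=
  IsLocalRing.ResidueField (NormedField.valuation (K := F)).valuationSubring

theorem mem_valuationSubring_iff_norm_le (x : F) :
    x ∈ (NormedField.valuation (K := F)).valuationSubring ↔ ‖x‖ ≤ 1 := by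
  rw [Valuation.mem_valuationSubring_iff, NormedField.valuation_apply, ← NNReal.coe_le_coe]
  simp

theorem norm_sub_le_max' (x y : F) : ‖x - y‖ ≤ max ‖x‖ ‖y‖ := by
  rw [sub_eq_add_neg, ← norm_neg y]; exact IsUltrametricDist.norm_add_le_max _ _

/-- Reduction of integral elements modulo the maximal ideal, extended by `0`. -/
def red (x : F) : ResField F :=
  if h : ‖x‖ ≤ 1 then
    IsLocalRing.residue _ (⟨x, (mem_valuationSubring_iff_norm_le x).2 h⟩ :
      (NormedField.valuation (K := F)).valuationSubring)
  else 0

theorem red_add {x y : F} (hx : ‖x‖ ≤ 1) (hy : ‖y‖ ≤ 1) : red (x + y) = red x + red y := by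
  have h : ‖x + y‖ ≤ 1 := (IsUltrametricDist.norm_add_le_max x y).trans (max_le hx hy)
  rw [red, red, red, dif_pos h, dif_pos hx, dif_pos hy, ← map_add]
  rfl

theorem red_mul {x y : F} (hx : ‖x‖ ≤ 1) (hy : ‖y‖ ≤ 1) : red (x * y) = red x * red y := by
  have h : ‖x * y‖ ≤ 1 := by
    rw [norm_mul]; exact mul_le_one₀ hx (norm_nonneg _) hy
  rw [red, red, red, dif_pos h, dif_pos hx, dif_pos hy, ← map_mul]
  rfl

theorem red_neg {x : F} (hx : ‖x‖ ≤ 1) : red (-x) = -red x := by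
  have h : ‖-x‖ ≤ 1 := by rwa [norm_neg]
  rw [red, red, dif_pos h, dif_pos hx, ← map_neg]
  rfl

theorem red_sub {x y : F} (hx : ‖x‖ ≤ 1) (hy : ‖y‖ ≤ 1) : red (x - y) = red x - red y := by
  rw [sub_eq_add_neg, red_add hx (by rwa [norm_neg]), red_neg hy, sub_eq_add_neg]

theorem red_eq_zero_iff {x : F} (hx : ‖x‖ ≤ 1) : red x = 0 ↔ ‖x‖ < 1 := by
  rw [red, dif_pos hx, IsLocalRing.residue_eq_zero_iff, IsLocalRing.mem_maximalIdeal,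
    mem_nonunits_iff, ← not_le, not_iff_not]
  symm
  constructor
  · intro h
    have hx0 : x ≠ 0 := by rintro rfl; norm_num at h
    have hi : ‖x⁻¹‖ ≤ 1 := by rw [norm_inv]; exact inv_le_one_of_one_le₀ h
    exact ⟨⟨⟨x, (mem_valuationSubring_iff_norm_le x).2 hx⟩,
      ⟨x⁻¹, (mem_valuationSubring_iff_norm_le _).2 hi⟩,
      Subtype.ext (mul_inv_cancel₀ hx0), Subtype.ext (inv_mul_cancel₀ hx0)⟩, rfl⟩
  · rintro ⟨u, hu⟩
    by_contra h
    have h1 : x * (u⁻¹.1 : F) = 1 := by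
      have := congrArg Subtype.val u.mul_inv
      rw [hu] at this
      exact this
    have h2 : ‖(u⁻¹.1 : F)‖ ≤ 1 := (mem_valuationSubring_iff_norm_le _).1 u⁻¹.1.2
    have h3 : ‖x‖ * ‖(u⁻¹.1 : F)‖ = 1 := by rw [← norm_mul, h1, norm_one]
    nlinarith [norm_nonneg x, norm_nonneg (u⁻¹.1 : F), not_le.1 h]

theorem exists_red_eq (z : ResField F) : ∃ x : F, ‖x‖ ≤ 1 ∧ red x = z := by
  obtain ⟨x, hx⟩ := IsLocalRing.residue_surjective z
  have h := (mem_valuationSubring_iff_norm_le x.1).1 x.2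
  exact ⟨x.1, h, by rw [red, dif_pos h]; exact hx⟩

/-- A representative of a residue class. -/
def lift (z : ResField F) : F := (exists_red_eq z).choose

theorem norm_lift_le (z : ResField F) : ‖lift z‖ ≤ 1 := (exists_red_eq z).choose_spec.1

@[simp] theorem red_lift (z : ResField F) : red (lift z) = z := (exists_red_eq z).choose_spec.2

theorem red_eq_red_iff {x y : F} (hx : ‖x‖ ≤ 1) (hy : ‖y‖ ≤ 1) :
    red x = red y ↔ ‖x - y‖ < 1 := by
  rw [← sub_eq_zero, ← red_sub hx hy, red_eq_zero_iff]
  exact (norm_sub_le_max' x y).trans (max_le hx hy)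

theorem norm_lift_lt_one_iff (z : ResField F) : ‖lift z‖ < 1 ↔ z = 0 := by
  rw [← red_eq_zero_iff (norm_lift_le z), red_lift]

theorem two_le_residueCard (hV : IsNormalizedNorm F) : 2 ≤ residueCard F := by
  obtain ⟨⟨ϖ, h1⟩, h2⟩ := hV
  have h0 : residueCard F ≠ 0 := by
    intro h
    obtain ⟨x, hx0, hx⟩ := NormedField.exists_norm_lt F one_pos
    have := h2 x hx
    rw [h] at this
    simp at this
    subst this
    simp at hx0
  have : Finite (ResField F) := Nat.finite_of_card_ne_zero h0
  exact Finite.one_lt_card_iff_nontrivial.2 inferInstance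

theorem one_lt_q (hV : IsNormalizedNorm F) : 1 < 𝐪 := by
  exact_mod_cast two_le_residueCard hV

theorem q_pos (hV : IsNormalizedNorm F) : 0 < 𝐪 := one_pos.trans (one_lt_q hV)

theorem finite_resField (hV : IsNormalizedNorm F) : Finite (ResField F) :=
  Nat.finite_of_card_ne_zero (by
    have := two_le_residueCard hV
    change residueCard F ≠ 0
    omega)

theorem norm_le_zpow_of_lt (hV : IsNormalizedNorm F) {x : F} {n : ℤ} (h : ‖x‖ < 𝐪 ^ (n + 1)) :
    ‖x‖ ≤ 𝐪 ^ n := by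
  have hq := q_pos hV
  obtain ⟨⟨ϖ, h1⟩, h2⟩ := hV
  have h3 := h2 (x * ϖ ^ (n + 1)) (by
    rw [norm_mul, norm_zpow, h1, _root_.inv_zpow, ← div_eq_mul_inv, div_lt_one (by positivity)]
    exact h)
  rw [norm_mul, norm_zpow, h1, _root_.inv_zpow, ← div_eq_mul_inv, div_le_iff₀ (by positivity),
    zpow_add_one₀ hq.ne', mul_comm (𝐪 ^ n), inv_mul_cancel_left₀ hq.ne'] at h3
  exact h3

theorem norm_eq_zpow (hV : IsNormalizedNorm F) {x : F} (hx : x ≠ 0) :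
    ∃ n : ℤ, ‖x‖ = 𝐪 ^ n := by
  obtain ⟨n, h1, h2⟩ := exists_mem_Ico_zpow (norm_pos_iff.2 hx) (one_lt_q hV)
  exact ⟨n, le_antisymm (norm_le_zpow_of_lt hV h2) h1⟩

theorem norm_lt_one_iff (hV : IsNormalizedNorm F) {x : F} : ‖x‖ < 1 ↔ ‖x‖ ≤ 𝐪⁻¹ :=
  ⟨hV.2 x, fun h => h.trans_lt (inv_lt_one_of_one_lt₀ (one_lt_q hV))⟩

theorem norm_lt_zpow_iff (hV : IsNormalizedNorm F) {x : F} {n : ℤ} :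
    ‖x‖ < 𝐪 ^ n ↔ ‖x‖ ≤ 𝐪 ^ (n - 1) := by
  constructor
  · intro h; apply norm_le_zpow_of_lt hV; simpa using h
  · intro h; exact h.trans_lt (zpow_lt_zpow_right₀ (one_lt_q hV) (by omega))

theorem norm_add_eq_of_lt {x y : F} (h : ‖y‖ < ‖x‖) : ‖x + y‖ = ‖x‖ := by
  rw [IsUltrametricDist.norm_add_eq_max_of_norm_ne_norm h.ne', max_eq_left h.le]

theorem norm_sub_eq_of_lt {x y : F} (h : ‖y‖ < ‖x‖) : ‖x - y‖ = ‖x‖ := by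
  rw [sub_eq_add_neg]; exact norm_add_eq_of_lt (by rwa [norm_neg])

theorem norm_add_le_of_le' {x y : F} {c : ℝ} (hx : ‖x‖ ≤ c) (hy : ‖y‖ ≤ c) : ‖x + y‖ ≤ c :=
  (IsUltrametricDist.norm_add_le_max x y).trans (max_le hx hy)

theorem norm_sub_le_of_le' {x y : F} {c : ℝ} (hx : ‖x‖ ≤ c) (hy : ‖y‖ ≤ c) : ‖x - y‖ ≤ c :=
  (norm_sub_le_max' x y).trans (max_le hx hy)

theorem norm_add_le_iff {x y : F} {c : ℝ} (hy : ‖y‖ ≤ c) : ‖x + y‖ ≤ c ↔ ‖x‖ ≤ c :=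
  ⟨fun h => by simpa using norm_sub_le_of_le' h hy, fun h => norm_add_le_of_le' h hy⟩

theorem norm_sub_le_iff {x y : F} {c : ℝ} (hy : ‖y‖ ≤ c) : ‖x - y‖ ≤ c ↔ ‖x‖ ≤ c :=
  ⟨fun h => by simpa using norm_add_le_of_le' h hy, fun h => norm_sub_le_of_le' h hy⟩

/-! ## Integration on `F ^ n` -/

section Measure

variable [ProperSpace F] [MeasurableSpace F] [BorelSpace F] (dr : Measure F) [dr.IsAddHaarMeasure]

instance : SecondCountableTopology F := secondCountable_of_proper

theorem volume_closedBall_one (hV : IsNormalizedNorm F) :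
    dr (Metric.closedBall 0 1) = ENNReal.ofReal 𝐪 * dr (Metric.closedBall 0 𝐪⁻¹) := by
  have := finite_resField hV
  have := Fintype.ofFinite (ResField F)
  have h1 : Metric.closedBall (0 : F) 1 =
      ⋃ z : ResField F, (fun x => lift z + x) '' Metric.closedBall 0 𝐪⁻¹ := by
    ext x
    simp only [Metric.mem_closedBall, dist_zero_right, Set.mem_iUnion, Set.mem_image]
    constructor
    · intro hx
      refine ⟨red x, x - lift (red x), ?_, by ring⟩
      rw [← norm_lt_one_iff hV, ← red_eq_red_iff hx (norm_lift_le _), red_lift]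
    · rintro ⟨z, y, hy, rfl⟩
      exact norm_add_le_of_le' (norm_lift_le z) ((norm_lt_one_iff hV).2 hy).le
  rw [h1, measure_iUnion]
  · simp only [Set.image_add_left, measure_preimage_add]
    rw [tsum_fintype, Finset.sum_const, nsmul_eq_mul, Finset.card_univ, ← Nat.card_eq_fintype_card,
      ENNReal.ofReal_natCast]
    rfl
  · intro z w hzw
    rw [Function.onFun, Set.disjoint_left]
    rintro x ⟨y, hy, rfl⟩ ⟨y', hy', h⟩
    apply hzw
    rw [← red_lift z, ← red_lift w, red_eq_red_iff (norm_lift_le _) (norm_lift_le _),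
      norm_lt_one_iff hV]
    simp only [Metric.mem_closedBall, dist_zero_right] at hy hy'
    have h : lift w + y' = lift z + y := h
    rw [show lift z - lift w = y' - y by linear_combination -h]
    exact norm_sub_le_of_le' hy' hy
  · intro z
    rw [Set.image_add_left]
    exact measurable_const_add _ Metric.isClosed_closedBall.measurableSet

theorem map_mul_left_isAddHaar {c : F} (hc : c ≠ 0) :
    (dr.map (fun x => c * x)).IsAddHaarMeasure :=
  (AddEquiv.isAddHaarMeasure_map dr (AddAut.mulLeft (Units.mk0 c hc))
    (continuous_const_mul c) (continuous_const_mul c⁻¹))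

theorem preimage_mul_closedBall {c : F} (hc : c ≠ 0) (ρ : ℝ) :
    (fun x => c * x) ⁻¹' Metric.closedBall (0 : F) ρ = Metric.closedBall 0 (‖c‖⁻¹ * ρ) := by
  ext x
  simp only [Set.mem_preimage, Metric.mem_closedBall, dist_zero_right, norm_mul]
  rw [inv_mul_eq_div, le_div_iff₀ (norm_pos_iff.2 hc), mul_comm]

variable {dr} in
theorem volume_closedBall (hV : IsNormalizedNorm F) (hdr : dr (Metric.closedBall 0 1) = 1)
    (n : ℤ) : dr (Metric.closedBall 0 (𝐪 ^ n)) = ENNReal.ofReal (𝐪 ^ n) := by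
  have hq := q_pos hV
  obtain ⟨ϖ, hϖ⟩ := hV.1
  have hϖ0 : ϖ ≠ 0 := by rintro rfl; rw [norm_zero] at hϖ; exact (inv_pos.2 hq).ne hϖ
  have := map_mul_left_isAddHaar dr hϖ0
  obtain ⟨κ, hκ⟩ : ∃ κ : ENNReal, ∀ s : Set F, MeasurableSet s →
      dr ((fun x => ϖ * x) ⁻¹' s) = κ * dr s := by
    have h := Measure.isAddLeftInvariant_eq_smul (dr.map (fun x => ϖ * x)) dr
    refine ⟨((dr.map (fun x => ϖ * x)).addHaarScalarFactor dr : NNReal), fun s hs => ?_⟩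
    rw [← Measure.map_apply (measurable_const_mul ϖ) hs]
    exact congrArg (fun m : Measure F => m s) h
  have step : ∀ n : ℤ, dr (Metric.closedBall 0 (𝐪 ^ (n + 1))) =
      κ * dr (Metric.closedBall 0 (𝐪 ^ n)) := by
    intro n
    rw [← hκ _ Metric.isClosed_closedBall.measurableSet, preimage_mul_closedBall hϖ0, hϖ, inv_inv,
      ← zpow_one_add₀ hq.ne', add_comm]
  have hm1 : ENNReal.ofReal 𝐪 * dr (Metric.closedBall 0 (𝐪 ^ (-1 : ℤ))) = 1 := by
    rw [_root_.zpow_neg_one, ← volume_closedBall_one dr hV, hdr]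
  have hκq : κ = ENNReal.ofReal 𝐪 := by
    have h1 := step (-1)
    rw [neg_add_cancel, zpow_zero, hdr] at h1
    have h2 : dr (Metric.closedBall 0 (𝐪 ^ (-1 : ℤ))) ≠ 0 := by
      intro h; rw [h, mul_zero] at hm1; exact zero_ne_one hm1
    have h3 : dr (Metric.closedBall 0 (𝐪 ^ (-1 : ℤ))) ≠ ⊤ :=
      (isCompact_closedBall _ _).measure_lt_top.ne
    exact (ENNReal.mul_left_inj h2 h3).1 (h1.symm.trans hm1.symm)
  rw [hκq] at step
  induction n using Int.induction_on with
  | zero => simp [hdr]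
  | succ n ih => rw [step, ih, ← ENNReal.ofReal_mul hq.le, ← zpow_one_add₀ hq.ne', add_comm]
  | pred n ih =>
    have h := step (-n - 1)
    rw [sub_add_cancel, ih] at h
    have h0 : ENNReal.ofReal 𝐪 ≠ 0 := (ENNReal.ofReal_pos.2 hq).ne'
    rw [← ENNReal.mul_right_inj h0 ENNReal.ofReal_ne_top, ← h, ← ENNReal.ofReal_mul hq.le,
      ← zpow_one_add₀ hq.ne']
    congr 2; ring

variable {dr} in
theorem map_mul_left (hV : IsNormalizedNorm F) (hdr : dr (Metric.closedBall 0 1) = 1)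
    {c : F} (hc : c ≠ 0) : dr.map (fun x => c * x) = ENNReal.ofReal ‖c‖⁻¹ • dr := by
  have := map_mul_left_isAddHaar dr hc
  have h := Measure.isAddLeftInvariant_eq_smul (dr.map (fun x => c * x)) dr
  have h2 := congrArg (fun m : Measure F => m (Metric.closedBall 0 1)) h
  simp only [Measure.smul_apply, hdr] at h2
  rw [Measure.map_apply (measurable_const_mul c) Metric.isClosed_closedBall.measurableSet,
    preimage_mul_closedBall hc, mul_one] at h2
  obtain ⟨n, hn⟩ := norm_eq_zpow hV hc
  rw [hn, ← _root_.zpow_neg, volume_closedBall hV hdr] at h2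
  rw [hn, ← _root_.zpow_neg, h2]
  conv_lhs => rw [h]
  ext s hs
  change (_ : ENNReal) * dr s = ((_ : ENNReal) * 1) * dr s
  rw [mul_one]

variable {dr} in
theorem map_pi_mul (hV : IsNormalizedNorm F) (hdr : dr (Metric.closedBall 0 1) = 1)
    {n : ℕ} {c : Fin n → F} (hc : ∀ i, c i ≠ 0) :
    (Measure.pi fun _ : Fin n => dr).map (fun r i => c i * r i) =
      ENNReal.ofReal (∏ i, ‖c i‖⁻¹) • Measure.pi fun _ : Fin n => dr := by
  have key : ∀ i, SigmaFinite (dr.map (fun x => c i * x)) := fun i => by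
    have := map_mul_left_isAddHaar dr (hc i)
    infer_instance
  rw [Measure.pi_map_pi (f := fun i x => c i * x) fun i => (measurable_const_mul _).aemeasurable]
  refine Measure.pi_eq fun s hs => ?_
  rw [Measure.smul_apply, Measure.pi_pi, smul_eq_mul,
    ENNReal.ofReal_prod_of_nonneg fun i _ => by positivity, ← Finset.prod_mul_distrib]
  exact Finset.prod_congr rfl fun i _ => by rw [map_mul_left hV hdr (hc i)]; rfl

variable {dr} in
theorem integral_comp_pi_mul (hV : IsNormalizedNorm F) (hdr : dr (Metric.closedBall 0 1) = 1)
    {n : ℕ} {c : Fin n → F} (hc : ∀ i, c i ≠ 0) (f : (Fin n → F) → ℂ) :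
    ∫ r, f (fun i => c i * r i) ∂𝛑 dr =
      ((∏ i, ‖c i‖⁻¹ : ℝ) : ℂ) * ∫ r, f r ∂𝛑 dr := by
  have hemb : MeasurableEmbedding (fun (r : Fin n → F) i => c i * r i) :=
    (Homeomorph.piCongrRight fun i => Homeomorph.mulLeft₀ (c i) (hc i)).measurableEmbedding
  rw [← hemb.integral_map, map_pi_mul hV hdr hc, integral_smul_measure,
    ENNReal.toReal_ofReal (Finset.prod_nonneg fun i _ => by positivity)]
  rfl

variable {dr} in
theorem integral_comp_mul (hV : IsNormalizedNorm F) (hdr : dr (Metric.closedBall 0 1) = 1)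
    {c : F} (hc : c ≠ 0) (f : F → ℂ) :
    ∫ r, f (c * r) ∂dr = ((‖c‖⁻¹ : ℝ) : ℂ) * ∫ r, f r ∂dr := by
  have hemb : MeasurableEmbedding (fun (r : F) => c * r) :=
    (Homeomorph.mulLeft₀ c hc).measurableEmbedding
  rw [← hemb.integral_map, map_mul_left hV hdr hc, integral_smul_measure,
    ENNReal.toReal_ofReal (by positivity)]
  rfl

/-- A box in `F ^ n`. -/
def box {n : ℕ} (ρ : Fin n → ℝ) : Set (Fin n → F) := {r | ∀ i, ‖r i‖ ≤ ρ i}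

theorem box_eq_pi {n : ℕ} (ρ : Fin n → ℝ) :
    (box ρ : Set (Fin n → F)) = Set.pi Set.univ fun i => Metric.closedBall 0 (ρ i) := by
  ext r; simp [box]

theorem measurableSet_box {n : ℕ} (ρ : Fin n → ℝ) : MeasurableSet (box ρ : Set (Fin n → F)) := by
  rw [box_eq_pi]
  exact MeasurableSet.univ_pi fun i => Metric.isClosed_closedBall.measurableSet

variable {dr} in
theorem volume_box (hV : IsNormalizedNorm F) (hdr : dr (Metric.closedBall 0 1) = 1)
    {n : ℕ} (m : Fin n → ℤ) :
    (Measure.pi fun _ : Fin n => dr) (box fun i => 𝐪 ^ m i) = ENNReal.ofReal (∏ i, 𝐪 ^ m i) := by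
  have hq := q_pos hV
  rw [box_eq_pi, Measure.pi_pi, ENNReal.ofReal_prod_of_nonneg fun i _ => by positivity]
  exact Finset.prod_congr rfl fun i _ => volume_closedBall hV hdr _

/-- An integral vanishes if a translation multiplies the integrand by a scalar other than `1`. -/
theorem integral_eq_zero_of_translate {G : Type*} [AddGroup G] [MeasurableSpace G] [MeasurableAdd G]
    (m : Measure G) [m.IsAddRightInvariant] (f : G → ℂ) (v : G) (ζ : ℂ) (hζ : ζ ≠ 1)
    (h : ∀ r, f (r + v) = ζ * f r) : ∫ r, f r ∂m = 0 := by
  have h1 := integral_add_right_eq_self (μ := m) f v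
  simp_rw [h, integral_const_mul] at h1
  have h2 : (ζ - 1) * ∫ r, f r ∂m = 0 := by rw [sub_mul, h1]; ring
  exact (mul_eq_zero.1 h2).resolve_left (sub_ne_zero.2 hζ)

/-- Triangular unipotent transformations of `F ^ n` preserve the measure. -/
theorem measurePreserving_triangular : ∀ {n : ℕ} (p : Fin n → (Fin n → F) → F),
    (∀ i, Measurable (p i)) → (∀ i r r', (∀ j < i, r j = r' j) → p i r = p i r') →
    MeasurePreserving (fun r i => r i + p i r) (Measure.pi fun _ : Fin n => dr)
      (Measure.pi fun _ : Fin n => dr) := by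
  intro n
  induction n with
  | zero =>
    intro p _ _
    convert MeasurePreserving.id _ using 1
  | succ n ih =>
    intro p hm hp
    set e := MeasurableEquiv.piFinSuccAbove (fun _ : Fin (n + 1) => F) (Fin.last n) with he
    have h1 : MeasurePreserving e _ _ := measurePreserving_piFinSuccAbove (fun _ => dr) (Fin.last n)
    have hsw : MeasurePreserving (Prod.swap : F × (Fin n → F) → _)
        (dr.prod (𝛑 dr)) ((𝛑 dr).prod dr) :=
      Measure.measurePreserving_swap
    have hsw' : MeasurePreserving (Prod.swap : (Fin n → F) × F → _)
        ((𝛑 dr).prod dr) (dr.prod (𝛑 dr)) :=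
      Measure.measurePreserving_swap
    have hsn : Measurable fun r : Fin n → F => (Fin.snoc (α := fun _ => F) r 0 : Fin (n + 1) → F) := by
      refine measurable_pi_lambda _ fun i => ?_
      refine Fin.lastCases ?_ (fun j => ?_) i
      · simp
      · simpa using measurable_pi_apply j
    have hb := ih (fun i r => p i.castSucc (Fin.snoc (α := fun _ => F) r 0))
      (fun i => (hm _).comp hsn) (by
        intro i r r' h
        refine hp _ _ _ fun j hj => ?_
        obtain ⟨j, rfl⟩ := Fin.exists_castSucc_eq.2 (ne_of_lt (hj.trans (Fin.castSucc_lt_last i)))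
        simpa using h j (by simpa using hj))
    have hsk := hb.skew_product (μc := dr) (μd := dr)
      (g := fun r x => x + p (Fin.last n) (Fin.snoc (α := fun _ => F) r 0))
      (measurable_snd.add ((hm _).comp (hsn.comp measurable_fst)))
      (.of_forall fun r => (measurePreserving_add_right dr _).map_eq)
    have := h1.symm.comp (hsw'.comp (hsk.comp (hsw.comp h1)))
    convert this using 1
    ext r i
    have hr : ∀ i, p i r = p i (Fin.snoc (α := fun _ => F) (fun j => r j.castSucc) 0) := by
      intro i
      refine hp _ _ _ fun j hj => ?_
      obtain ⟨j, rfl⟩ := Fin.exists_castSucc_eq.2 (ne_of_lt (hj.trans_le (Fin.le_last i)))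
      simp
    refine Fin.lastCases ?_ (fun j => ?_) i
    · simp [e, MeasurableEquiv.piFinSuccAbove, hr]
      rfl
    · simp [e, MeasurableEquiv.piFinSuccAbove, hr]
      rfl

variable {dr} in
/-- The integral over `𝒪 ^ n` of a function of the residues is a sum over the residue field. -/
theorem integral_eq_sum_residue (hV : IsNormalizedNorm F)
    (hdr : dr (Metric.closedBall 0 1) = 1) [Fintype (ResField F)] {n : ℕ} (f : (Fin n → F) → ℂ)
    (hf0 : ∀ r, (∃ i, 1 < ‖r i‖) → f r = 0)
    (hf : ∀ r v, (∀ i, ‖r i‖ ≤ 1) → (∀ i, ‖v i‖ < 1) → f (r + v) = f r) :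
    ∫ r, f r ∂𝛑 dr =
      (((𝐪 : ℝ) : ℂ) ^ n)⁻¹ * ∑ z : Fin n → ResField F, f fun i => lift (z i) := by
  have hq := q_pos hV
  set B : Set (Fin n → F) := box fun _ => 𝐪 ^ (-1 : ℤ) with hB
  have h1 : ∀ r, f r = ∑ z : Fin n → ResField F,
      B.indicator (fun _ => f fun i => lift (z i)) (r - fun i => lift (z i)) := by
    intro r
    by_cases hr : ∀ i, ‖r i‖ ≤ 1
    · rw [Finset.sum_eq_single fun i => red (r i)]
      · have hv : ∀ i, ‖(r - fun i => lift (red (r i))) i‖ < 1 := fun i => by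
          rw [Pi.sub_apply, ← red_eq_red_iff (hr i) (norm_lift_le _), red_lift]
        rw [Set.indicator_of_mem]
        · conv_lhs => rw [show r = (fun i => lift (red (r i))) + (r - fun i => lift (red (r i))) by
            abel]
          exact hf _ _ (fun i => norm_lift_le _) hv
        · intro i
          have := (norm_lt_one_iff hV).1 (hv i)
          rwa [← _root_.zpow_neg_one] at this
      · intro z _ hz
        rw [Set.indicator_of_notMem]
        intro h
        apply hz
        ext i
        have := h i
        rw [_root_.zpow_neg_one, ← norm_lt_one_iff hV, Pi.sub_apply] at this
        rw [← red_eq_red_iff (hr i) (norm_lift_le _), red_lift] at this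
        exact this.symm
      · simp
    · push Not at hr
      obtain ⟨i, hi⟩ := hr
      rw [hf0 r ⟨i, hi⟩, Finset.sum_eq_zero]
      intro z _
      rw [Set.indicator_of_notMem]
      intro h
      have := h i
      rw [_root_.zpow_neg_one, ← norm_lt_one_iff hV, Pi.sub_apply] at this
      have h2 := norm_add_le_of_le' this.le (norm_lift_le (z i))
      rw [sub_add_cancel] at h2
      exact absurd h2 (not_le.2 hi)
  have hBm : MeasurableSet B := measurableSet_box _
  have hvol := volume_box hV hdr fun _ : Fin n => (-1 : ℤ)
  rw [integral_congr_ae (Filter.Eventually.of_forall h1), integral_finsetSum, Finset.mul_sum]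
  · refine Finset.sum_congr rfl fun z _ => ?_
    rw [integral_sub_right_eq_self (μ := Measure.pi fun _ : Fin n => dr)
      (B.indicator (fun _ => f fun i => lift (z i))), integral_indicator_const _ hBm,
      Measure.real, hvol, ENNReal.toReal_ofReal (Finset.prod_nonneg fun i _ => by positivity)]
    rw [Finset.prod_const, Finset.card_univ, Fintype.card_fin, _root_.zpow_neg_one, Complex.real_smul]
    push_cast
    rw [inv_pow]
  · intro z _
    have : Integrable (B.indicator (fun _ => f fun i => lift (z i)))
        (Measure.pi fun _ : Fin n => dr) := by
      refine (integrable_indicator_iff hBm).2 (integrableOn_const (by rw [hvol]; exact ENNReal.ofReal_ne_top))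
    exact this.comp_sub_right _

end Measure

end LocalField

section Algebra

variable {F : Type*} [Field F]

/-! ## The action of `G₂` on the octonions -/

/-- The action of `G₂` on the octonions. -/
def act (g : G2 F) (v : Fin 8 → F) : Fin 8 → F := g.1.1 *ᵥ v

theorem act_mul (g h : G2 F) (v : Fin 8 → F) : act (g * h) v = act g (act h v) := by
  simp [act, Matrix.mulVec_mulVec]

@[simp] theorem act_one (v : Fin 8 → F) : act (1 : G2 F) v = v := by simp [act]

@[simp] theorem act_inv_act (g : G2 F) (v : Fin 8 → F) : act g⁻¹ (act g v) = v := by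
  rw [← act_mul, inv_mul_cancel, act_one]

@[simp] theorem act_act_inv (g : G2 F) (v : Fin 8 → F) : act g (act g⁻¹ v) = v := by
  rw [← act_mul, mul_inv_cancel, act_one]

theorem act_add (g : G2 F) (v w : Fin 8 → F) : act g (v + w) = act g v + act g w :=
  Matrix.mulVec_add _ _ _

theorem act_smul (g : G2 F) (c : F) (v : Fin 8 → F) : act g (c • v) = c • act g v :=
  Matrix.mulVec_smul _ _ _

theorem act_octMul (g : G2 F) (v w : Fin 8 → F) :
    act g (octMul v w) = octMul (act g v) (act g w) := g.2 v w

theorem octNorm_act (g : G2 F) (v : Fin 8 → F) : octNorm (act g v) = octNorm v :=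
  octNorm_of_mem g.2 v

/-- The coordinate vectors. -/
def bas (i : Fin 8) : Fin 8 → F := Pi.single i 1

theorem act_bas (g : G2 F) (i j : Fin 8) : act g (bas j) i = g.1.1 i j := by
  simp [act, bas]

theorem ext_act_bas {g h : G2 F} (H : ∀ j, act g (bas j) = act h (bas j)) : g = h := by
  apply Subtype.ext
  apply Units.ext
  ext i j
  rw [← act_bas, ← act_bas, H]

theorem ext_act {g h : G2 F} (H : ∀ v, act g v = act h v) : g = h := ext_act_bas fun _ => H _

theorem bas0 : (bas 0 : Fin 8 → F) = ![1, 0, 0, 0, 0, 0, 0, 0] := by apply ext8 <;> simp [bas]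
theorem bas1 : (bas 1 : Fin 8 → F) = ![0, 1, 0, 0, 0, 0, 0, 0] := by apply ext8 <;> simp [bas]
theorem bas2 : (bas 2 : Fin 8 → F) = ![0, 0, 1, 0, 0, 0, 0, 0] := by apply ext8 <;> simp [bas]
theorem bas3 : (bas 3 : Fin 8 → F) = ![0, 0, 0, 1, 0, 0, 0, 0] := by apply ext8 <;> simp [bas]
theorem bas4 : (bas 4 : Fin 8 → F) = ![0, 0, 0, 0, 1, 0, 0, 0] := by apply ext8 <;> simp [bas]
theorem bas5 : (bas 5 : Fin 8 → F) = ![0, 0, 0, 0, 0, 1, 0, 0] := by apply ext8 <;> simp [bas]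
theorem bas6 : (bas 6 : Fin 8 → F) = ![0, 0, 0, 0, 0, 0, 1, 0] := by apply ext8 <;> simp [bas]
theorem bas7 : (bas 7 : Fin 8 → F) = ![0, 0, 0, 0, 0, 0, 0, 1] := by apply ext8 <;> simp [bas]

theorem act_xA (r : F) (v : Fin 8 → F) : act (xA r) v =
    ![v 0 + r * v 1, v 1, v 2 + r * v 3 - r * v 4 - r ^ 2 * v 5, v 3 - r * v 5, v 4 + r * v 5,
      v 5, v 6 - r * v 7, v 7] := matA_mulVec r v

theorem act_xAneg (r : F) (v : Fin 8 → F) : act (xAneg r) v =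
    ![v 0, v 1 + r * v 0, v 2, v 3 + r * v 2, v 4 - r * v 2,
      v 5 - r ^ 2 * v 2 - r * v 3 + r * v 4, v 6, v 7 - r * v 6] := matA_transpose_mulVec r v

theorem act_xB (r : F) (v : Fin 8 → F) : act (xB r) v =
    ![v 0, v 1 + r * v 2, v 2, v 3, v 4, v 5 - r * v 6, v 6, v 7] := matB_mulVec r v

theorem act_xBneg (r : F) (v : Fin 8 → F) : act (xBneg r) v =
    ![v 0, v 1, v 2 + r * v 1, v 3, v 4, v 5, v 6 - r * v 5, v 7] := matB_transpose_mulVec r v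

theorem act_torusElt (t₁ t₂ : Fˣ) (v : Fin 8 → F) : act (torusElt t₁ t₂) v =
    ![t₁ * v 0, t₂ / t₁ * v 1, t₁ ^ 2 / t₂ * v 2, v 3, v 4, t₂ / t₁ ^ 2 * v 5, t₁ / t₂ * v 6,
      1 / t₁ * v 7] := by
  apply ext8 <;> simp [act, torusElt, Matrix.mulVec_diagonal]

theorem act_uElt (r : Fin 5 → F) (v : Fin 8 → F) : act (uElt r) v =
    ![v 0 + r 1 * v 2 - r 2 * v 3 + r 2 * v 4 - r 3 * v 5 + (r 4 + r 1 * r 2) * v 6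
        + (r 1 * r 3 - r 2 ^ 2) * v 7,
      v 1 + r 0 * v 2 - r 1 * v 3 + r 1 * v 4 - r 2 * v 5 + (r 0 * r 2 - r 1 ^ 2) * v 6
        + (r 0 * r 3 - 2 * r 1 * r 2 - r 4) * v 7,
      v 2 + r 2 * v 6 + r 3 * v 7, v 3 + r 1 * v 6 + r 2 * v 7, v 4 - r 1 * v 6 - r 2 * v 7,
      v 5 - r 0 * v 6 - r 1 * v 7, v 6, v 7] := by
  have h : act (uElt r) v = matB (r 0) *ᵥ (matAB (r 1) *ᵥ (mat2AB (r 2) *ᵥ (mat3AB (r 3) *ᵥ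
      (mat3A2B (r 4) *ᵥ v)))) := by
    rw [uElt, act_mul, act_mul, act_mul, act_mul]
    rfl
  rw [h]
  simp only [matB_mulVec, matAB_mulVec, mat2AB_mulVec, mat3AB_mulVec, mat3A2B_mulVec]
  apply ext8 <;> simp only [Matrix.cons_val] <;> ring

theorem act_octOne (g : G2 F) :
    act g ![0, 0, 0, 1, 1, 0, 0, 0] = ![0, 0, 0, 1, 1, 0, 0, 0] := by
  have h := act_octMul g (act g⁻¹ ![0, 0, 0, 1, 1, 0, 0, 0]) ![0, 0, 0, 1, 1, 0, 0, 0]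
  have h1 : ∀ z : Fin 8 → F, octMul z ![0, 0, 0, 1, 1, 0, 0, 0] = z := by
    intro z; apply ext8 <;> simp [octMul]
  have h2 : ∀ z : Fin 8 → F, octMul ![0, 0, 0, 1, 1, 0, 0, 0] z = z := by
    intro z; apply ext8 <;> simp [octMul]
  rw [h1, act_act_inv, h2] at h
  exact h.symm

theorem octTrace_act (g : G2 F) (v : Fin 8 → F) : act g v 3 + act g v 4 = v 3 + v 4 := by
  have h := octNorm_act g (v + ![0, 0, 0, 1, 1, 0, 0, 0])
  have h1 := octNorm_act g v
  rw [act_add, act_octOne] at h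
  simp only [octNorm, Pi.add_apply, Matrix.cons_val] at h h1
  linear_combination h - h1

/-- The polar form of the norm is invariant. -/
theorem octPolar_act (g : G2 F) (v w : Fin 8 → F) :
    octNorm (act g v + act g w) - octNorm (act g v) - octNorm (act g w) =
      octNorm (v + w) - octNorm v - octNorm w := by
  rw [← act_add, octNorm_act, octNorm_act, octNorm_act]

/-- An automorphism of the octonions is determined by the images of `e₀, e₁, e₆, e₇`. -/
theorem ext_act_generators {g h : G2 F} (h0 : act g (bas 0) = act h (bas 0))
    (h1 : act g (bas 1) = act h (bas 1)) (h6 : act g (bas 6) = act h (bas 6))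
    (h7 : act g (bas 7) = act h (bas 7)) : g = h := by
  have e3 : (bas 3 : Fin 8 → F) = octMul (bas 0) (bas 7) := by
    rw [bas0, bas7, bas3]; apply ext8 <;> simp [octMul]
  have e4 : (bas 4 : Fin 8 → F) = octMul (bas 7) (bas 0) := by
    rw [bas0, bas7, bas4]; apply ext8 <;> simp [octMul]
  have e5 : (bas 5 : Fin 8 → F) = octMul (bas 7) (bas 1) := by
    rw [bas1, bas7, bas5]; apply ext8 <;> simp [octMul]
  have e2 : (bas 2 : Fin 8 → F) = octMul (bas 6) (bas 0) := by
    rw [bas0, bas6, bas2]; apply ext8 <;> simp [octMul]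
  apply ext_act_bas
  intro j
  fin_cases j
  · exact h0
  · exact h1
  · change act g (bas 2) = act h (bas 2); rw [e2, act_octMul, act_octMul, h0, h6]
  · change act g (bas 3) = act h (bas 3); rw [e3, act_octMul, act_octMul, h0, h7]
  · change act g (bas 4) = act h (bas 4); rw [e4, act_octMul, act_octMul, h0, h7]
  · change act g (bas 5) = act h (bas 5); rw [e5, act_octMul, act_octMul, h1, h7]
  · exact h6
  · exact h7

/-- The unipotent radical `U` is the pointwise stabilizer of `e₀` and `e₁`. -/
theorem exists_eq_uElt {g : G2 F} (h0 : act g (bas 0) = bas 0) (h1 : act g (bas 1) = bas 1) :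
    ∃ r : Fin 5 → F, g = uElt r := by
  set v := act g (bas 6) with hv
  set w := act g (bas 7) with hw
  have p06 := octPolar_act g (bas 0) (bas 6)
  have p07 := octPolar_act g (bas 0) (bas 7)
  have p16 := octPolar_act g (bas 1) (bas 6)
  have p17 := octPolar_act g (bas 1) (bas 7)
  have p67 := octPolar_act g (bas 6) (bas 7)
  have n6 := octNorm_act g (bas 6)
  have n7 := octNorm_act g (bas 7)
  have t6 := octTrace_act g (bas 6)
  have t7 := octTrace_act g (bas 7)
  have m67 := act_octMul g (bas 6) (bas 7)
  have z67 : octMul (bas 6) (bas 7) = (0 : F) • (bas 0 : Fin 8 → F) := by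
    rw [bas0, bas6, bas7]; apply ext8 <;> simp [octMul]
  rw [z67, act_smul, zero_smul, ← hv, ← hw] at m67
  rw [h0, ← hv] at p06
  rw [h0, ← hw] at p07
  rw [h1, ← hv] at p16
  rw [h1, ← hw] at p17
  rw [← hv, ← hw] at p67
  rw [← hv] at n6 t6
  rw [← hw] at n7 t7
  have m5 := congrFun m67 5
  have m6 := congrFun m67 6
  have m7 := congrFun m67 7
  clear_value v w
  simp only [bas0, bas1, bas6, bas7, octNorm, octMul, Pi.add_apply, Pi.zero_apply,
    Matrix.cons_val] at p06 p07 p16 p17 p67 n6 n7 t6 t7 m5 m6 m7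
  have v7 : v 7 = 0 := by linear_combination -p06
  have w7 : w 7 = 1 := by linear_combination -p07
  have v6 : v 6 = 1 := by linear_combination -p16
  have w6 : w 6 = 0 := by linear_combination -p17
  have v4 : v 4 = -v 3 := by linear_combination t6
  have w4 : w 4 = -w 3 := by linear_combination t7
  rw [v7, w7, v6, w6, v4, w4] at p67
  rw [v7, v6, v4] at n6
  rw [w7, w6, w4] at n7
  rw [v7, v6, w7, w6, w4] at m6
  rw [v7, v6, w7, w6, v4] at m7
  have v2 : v 2 = w 3 := by linear_combination -m6
  have w5 : w 5 = -v 3 := by linear_combination m7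
  rw [v2, w5] at p67
  rw [v2] at n6
  rw [w5] at n7
  have v1 : v 1 = -v 3 ^ 2 - v 5 * w 3 := by linear_combination -n6
  have w0 : w 0 = -w 3 ^ 2 + v 3 * w 2 := by linear_combination -n7
  have w1 : w 1 = -2 * v 3 * w 3 - v 0 - v 5 * w 2 + v 3 * w 3 := by
    linear_combination -p67
  refine ⟨![-v 5, v 3, w 3, w 2, v 0 - v 3 * w 3], ext_act_generators ?_ ?_ ?_ ?_⟩
  · rw [h0, act_uElt, bas0]; apply ext8 <;> simp
  · rw [h1, act_uElt, bas1]; apply ext8 <;> simp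
  · rw [← hv, act_uElt, bas6]
    apply ext8 <;> simp only [Matrix.cons_val, v1, v2, v4, v6, v7] <;> ring
  · rw [← hw, act_uElt, bas7]
    apply ext8 <;> simp only [Matrix.cons_val, w0, w1, w5, w4, w6, w7] <;> ring

/-! ## Relations between root elements -/

theorem xA_mul_xA (r s : F) : (xA r * xA s : G2 F) = xA (r + s) :=
  ext_act fun v => by
    rw [act_mul]; simp only [act_xA]; apply ext8 <;> simp only [Matrix.cons_val] <;> ring

@[simp] theorem xA_zero : (xA 0 : G2 F) = 1 :=
  ext_act fun v => by rw [act_xA, act_one]; apply ext8 <;> simp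

theorem xA_inv (r : F) : (xA r : G2 F)⁻¹ = xA (-r) :=
  inv_eq_of_mul_eq_one_right (by rw [xA_mul_xA, add_neg_cancel, xA_zero])

theorem torusElt_mul (t₁ t₂ s₁ s₂ : Fˣ) :
    torusElt t₁ t₂ * torusElt s₁ s₂ = torusElt (t₁ * s₁) (t₂ * s₂) :=
  ext_act fun v => by
    have := t₁.ne_zero; have := t₂.ne_zero; have := s₁.ne_zero; have := s₂.ne_zero
    rw [act_mul]; simp only [act_torusElt]
    apply ext8 <;> simp only [Matrix.cons_val, Units.val_mul] <;> field_simp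

@[simp] theorem torusElt_one : (torusElt 1 1 : G2 F) = 1 :=
  ext_act fun v => by rw [act_torusElt, act_one]; apply ext8 <;> simp

theorem torusElt_inv (t₁ t₂ : Fˣ) : (torusElt t₁ t₂)⁻¹ = torusElt t₁⁻¹ t₂⁻¹ :=
  inv_eq_of_mul_eq_one_right (by rw [torusElt_mul, mul_inv_cancel, mul_inv_cancel, torusElt_one])

theorem torusElt_mul_xA (t₁ t₂ : Fˣ) (r : F) :
    torusElt t₁ t₂ * xA r = xA (t₁ ^ 2 / t₂ * r) * torusElt t₁ t₂ :=
  ext_act fun v => by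
    have := t₁.ne_zero; have := t₂.ne_zero
    simp only [act_mul, act_torusElt, act_xA]
    apply ext8 <;> simp only [Matrix.cons_val] <;> field_simp

theorem torusElt_mul_xAneg (t₁ t₂ : Fˣ) (r : F) :
    torusElt t₁ t₂ * xAneg (t₁ ^ 2 / t₂ * r) = xAneg r * torusElt t₁ t₂ :=
  ext_act fun v => by
    have := t₁.ne_zero; have := t₂.ne_zero
    simp only [act_mul, act_torusElt, act_xAneg]
    apply ext8 <;> simp only [Matrix.cons_val] <;> field_simp

theorem torusElt_mul_xB (t₁ t₂ : Fˣ) (r : F) :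
    torusElt t₁ t₂ * xB r = xB (t₂ ^ 2 / t₁ ^ 3 * r) * torusElt t₁ t₂ :=
  ext_act fun v => by
    have := t₁.ne_zero; have := t₂.ne_zero
    simp only [act_mul, act_torusElt, act_xB]
    apply ext8 <;> simp only [Matrix.cons_val] <;> field_simp

theorem torusElt_mul_xBneg (t₁ t₂ : Fˣ) (r : F) :
    torusElt t₁ t₂ * xBneg (t₂ ^ 2 / t₁ ^ 3 * r) = xBneg r * torusElt t₁ t₂ :=
  ext_act fun v => by
    have := t₁.ne_zero; have := t₂.ne_zero
    simp only [act_mul, act_torusElt, act_xBneg]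
    apply ext8 <;> simp only [Matrix.cons_val] <;> field_simp

/-- The values at the torus of the roots of `U`. -/
def rootsU (t₁ t₂ : Fˣ) : Fin 5 → F :=
  ![t₂ ^ 2 / t₁ ^ 3, t₂ / t₁, t₁, t₁ ^ 3 / t₂, t₂]

theorem torusElt_mul_uElt (t₁ t₂ : Fˣ) (r : Fin 5 → F) :
    torusElt t₁ t₂ * uElt r = uElt (fun i => rootsU t₁ t₂ i * r i) * torusElt t₁ t₂ :=
  ext_act fun v => by
    have := t₁.ne_zero; have := t₂.ne_zero
    simp only [act_mul, act_torusElt, act_uElt, rootsU]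
    apply ext8 <;> simp only [Matrix.cons_val] <;> field_simp

/-- Conjugation by `x_α(s)` in the coordinates of `U`. -/
def conjA (s : F) (r : Fin 5 → F) : Fin 5 → F :=
  ![r 0, r 1 + s * r 0, r 2 + (2 * s * r 1 + s ^ 2 * r 0),
    r 3 + (3 * s * r 2 + 3 * s ^ 2 * r 1 + s ^ 3 * r 0),
    r 4 + (-3 * s * r 1 ^ 2 - 3 * s ^ 2 * r 0 * r 1 - s ^ 3 * r 0 ^ 2)]

theorem xA_mul_uElt (s : F) (r : Fin 5 → F) : xA s * uElt r = uElt (conjA s r) * xA s :=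
  ext_act fun v => by
    simp only [act_mul, act_xA, act_uElt, conjA]
    apply ext8 <;> simp only [Matrix.cons_val] <;> ring

/-- Multiplication in the coordinates of `U`. -/
def mulU (s r : Fin 5 → F) : Fin 5 → F :=
  ![r 0 + s 0, r 1 + s 1, r 2 + s 2, r 3 + s 3, r 4 + (s 4 - 3 * s 2 * r 1 + s 3 * r 0)]

theorem uElt_mul_uElt (s r : Fin 5 → F) : uElt s * uElt r = uElt (mulU s r) :=
  ext_act fun v => by
    simp only [act_mul, act_uElt, mulU]
    apply ext8 <;> simp only [Matrix.cons_val] <;> ring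

/-- Inversion in the coordinates of `U`. -/
def invU (r : Fin 5 → F) : Fin 5 → F :=
  ![-r 0, -r 1, -r 2, -r 3, -r 4 - 3 * r 2 * r 1 + r 3 * r 0]

@[simp] theorem uElt_zero : (uElt 0 : G2 F) = 1 :=
  ext_act fun v => by rw [act_uElt, act_one]; apply ext8 <;> simp

theorem uElt_inv (r : Fin 5 → F) : (uElt r)⁻¹ = uElt (invU r) :=
  inv_eq_of_mul_eq_one_right (by
    rw [uElt_mul_uElt, ← uElt_zero]
    congr 1
    ext i
    fin_cases i <;> simp [mulU, invU] <;> ring)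

theorem uElt_injective : Function.Injective (uElt : (Fin 5 → F) → G2 F) := by
  intro r s h
  have h6 := congrArg (fun g => act g (bas 6)) h
  have h7 := congrArg (fun g => act g (bas 7)) h
  simp only [act_uElt, bas6, bas7] at h6 h7
  have h60 := congrFun h6 0
  have h63 := congrFun h6 3
  have h65 := congrFun h6 5
  have h73 := congrFun h7 3
  have h72 := congrFun h7 2
  simp only [Matrix.cons_val, mul_one, mul_zero, add_zero, zero_add, sub_zero, zero_sub,
    neg_inj] at h60 h63 h65 h73 h72
  ext i
  fin_cases i
  · exact h65
  · exact h63
  · exact h73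
  · exact h72
  · rw [h63, h73] at h60
    exact add_right_cancel h60

variable (F) in
/-- The representative `σ` of a transposition in the stabilizer of the split character. -/
def symS : G2 F := xA (-1) * torusElt 1 (-1)

variable (F) in
/-- The representative `ω` of another transposition in the stabilizer of the split character. -/
def symW : G2 F := xA 1 * xAneg (-1) * xA 1 * torusElt 1 (-1)

/-- Conjugation by `σ` in the coordinates of `U`. -/
def conjS (r : Fin 5 → F) : Fin 5 → F :=
  ![r 0, -r 1 - r 0, r 2 + 2 * r 1 + r 0, -r 3 - 3 * r 2 - 3 * r 1 - r 0,
    -r 4 + 3 * r 1 ^ 2 + 3 * r 0 * r 1 + r 0 ^ 2]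

/-- Conjugation by `ω` in the coordinates of `U`. -/
def conjW (r : Fin 5 → F) : Fin 5 → F :=
  ![r 3, r 2, r 1, r 0, -r 4 - 3 * r 1 * r 2 + r 0 * r 3]

theorem act_symS (v : Fin 8 → F) : act (symS F) v =
    ![v 0 + v 1, -v 1, -v 2 - v 3 + v 4 + v 5, v 3 - v 5, v 4 + v 5, -v 5, -v 6 + v 7, v 7] := by
  simp only [symS, act_mul, act_xA, act_torusElt]
  apply ext8 <;> simp only [Matrix.cons_val] <;> push_cast <;>
    (try field_simp) <;> (try ring)

theorem act_symW (v : Fin 8 → F) : act (symW F) v =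
    ![-v 1, -v 0, v 5, v 4, v 3, v 2, -v 7, -v 6] := by
  simp only [symW, act_mul, act_xA, act_xAneg, act_torusElt]
  apply ext8 <;> simp only [Matrix.cons_val] <;> push_cast <;>
    (try field_simp) <;> (try ring)

theorem symS_mul_uElt (r : Fin 5 → F) : symS F * uElt r = uElt (conjS r) * symS F :=
  ext_act fun v => by
    simp only [act_mul, act_symS, act_uElt, conjS]
    apply ext8 <;> simp only [Matrix.cons_val] <;> ring

theorem symW_mul_uElt (r : Fin 5 → F) : symW F * uElt r = uElt (conjW r) * symW F :=
  ext_act fun v => by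
    simp only [act_mul, act_symW, act_uElt, conjW]
    apply ext8 <;> simp only [Matrix.cons_val] <;> ring

theorem symS_mul_xA (y : F) : symS F * xA y = xA (-1 - y) * torusElt 1 (-1) :=
  ext_act fun v => by
    simp only [act_mul, act_symS, act_xA, act_torusElt]
    apply ext8 <;> simp only [Matrix.cons_val] <;> push_cast <;>
    (try field_simp) <;> (try ring)

theorem symW_mul_xA (y : Fˣ) :
    symW F * xA (y : F) = xA ((y⁻¹ : Fˣ) : F) * torusElt y⁻¹ (-1) * xAneg ((y⁻¹ : Fˣ) : F) :=
  ext_act fun v => by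
    have := y.ne_zero
    simp only [act_mul, act_symW, act_xA, act_xAneg, act_torusElt]
    apply ext8 <;> simp only [Matrix.cons_val] <;> push_cast <;>
    (try field_simp) <;> (try ring)

theorem symW_mul_torusElt (t₁ t₂ : Fˣ) :
    symW F * torusElt t₁ t₂ = torusElt (t₂ / t₁) t₂ * symW F :=
  ext_act fun v => by
    have := t₁.ne_zero; have := t₂.ne_zero
    simp only [act_mul, act_symW, act_torusElt]
    apply ext8 <;> simp only [Matrix.cons_val] <;> push_cast <;>
    (try field_simp) <;> (try ring)

variable (F) in
/-- A representative of the simple reflection for `β`. -/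
def weylB : G2 F := xB 1 * xBneg (-1) * xB 1

theorem act_weylB (v : Fin 8 → F) : act (weylB F) v =
    ![v 0, v 2, -v 1, v 3, v 4, -v 6, v 5, v 7] := by
  simp only [weylB, act_mul, act_xB, act_xBneg]
  apply ext8 <;> simp only [Matrix.cons_val] <;> push_cast <;>
    (try field_simp) <;> (try ring)

theorem xB_eq (r : Fˣ) : (xB (r : F) : G2 F) =
    xBneg ((r⁻¹ : Fˣ) : F) * torusElt 1 r * weylB F * xBneg ((r⁻¹ : Fˣ) : F) :=
  ext_act fun v => by
    have := r.ne_zero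
    simp only [act_mul, act_weylB, act_xB, act_xBneg, act_torusElt]
    apply ext8 <;> simp only [Matrix.cons_val] <;> push_cast <;>
    (try field_simp) <;> (try ring)

theorem weylB_mul_torusElt (t₁ t₂ : Fˣ) :
    weylB F * torusElt t₁ t₂ = torusElt t₁ (t₁ ^ 3 / t₂) * weylB F :=
  ext_act fun v => by
    have := t₁.ne_zero; have := t₂.ne_zero
    simp only [act_mul, act_weylB, act_torusElt]
    apply ext8 <;> simp only [Matrix.cons_val] <;> push_cast <;>
    (try field_simp) <;> (try ring)

variable (F) in
/-- The matrix of the representative of the longest element of the Weyl group. -/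
def weylLongMat : Matrix (Fin 8) (Fin 8) F :=
  !![0, 0, 0, 0, 0, 0, 0, -1;
     0, 0, 0, 0, 0, 0, -1, 0;
     0, 0, 0, 0, 0, -1, 0, 0;
     0, 0, 0, 0, 1, 0, 0, 0;
     0, 0, 0, 1, 0, 0, 0, 0;
     0, 0, -1, 0, 0, 0, 0, 0;
     0, -1, 0, 0, 0, 0, 0, 0;
     -1, 0, 0, 0, 0, 0, 0, 0]

theorem weylLongMat_mulVec (v : Fin 8 → F) : weylLongMat F *ᵥ v =
    ![-v 7, -v 6, -v 5, v 4, v 3, -v 2, -v 1, -v 0] := by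
  apply ext8 <;>
    simp only [weylLongMat, Matrix.mulVec, dotProduct, Fin.sum_univ_eight, Matrix.of_apply,
      Matrix.cons_val] <;>
    ring

theorem weylLongMat_mul_self : weylLongMat F * weylLongMat F = 1 := by
  have h : ∀ v, (weylLongMat F * weylLongMat F) *ᵥ v = v := by
    intro v
    rw [← Matrix.mulVec_mulVec, weylLongMat_mulVec, weylLongMat_mulVec]
    apply ext8 <;> simp only [Matrix.cons_val] <;> push_cast <;>
    (try field_simp) <;> (try ring)
  exact Matrix.ext_of_mulVec_single fun i => by rw [h, Matrix.one_mulVec]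

variable (F) in
/-- A representative of the longest element of the Weyl group. -/
def weylLong : G2 F :=
  ⟨⟨weylLongMat F, weylLongMat F, weylLongMat_mul_self, weylLongMat_mul_self⟩, by
    intro x y
    change weylLongMat F *ᵥ octMul x y = octMul (weylLongMat F *ᵥ x) (weylLongMat F *ᵥ y)
    simp only [weylLongMat_mulVec]
    apply ext8 <;> simp only [octMul, Matrix.cons_val] <;> ring⟩

theorem act_weylLong (v : Fin 8 → F) : act (weylLong F) v =
    ![-v 7, -v 6, -v 5, v 4, v 3, -v 2, -v 1, -v 0] := weylLongMat_mulVec v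

theorem weylLong_mul_torusElt (t₁ t₂ : Fˣ) :
    weylLong F * torusElt t₁ t₂ = torusElt t₁⁻¹ t₂⁻¹ * weylLong F :=
  ext_act fun v => by
    simp only [act_mul, act_weylLong, act_torusElt]
    apply ext8 <;> simp only [Matrix.cons_val] <;> push_cast <;>
    (try field_simp) <;> (try ring)

end Algebra

section Lattice

variable {F : Type*} [NontriviallyNormedField F]

/-! ## The norm on `G₂` and the maximal compact subgroup -/

/-- The polar form of the octonion norm. -/
def octPolar (v w : Fin 8 → F) : F :=
  v 3 * w 4 + v 4 * w 3
    - (v 0 * w 7 + v 7 * w 0 + v 5 * w 2 + v 2 * w 5 + v 6 * w 1 + v 1 * w 6)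

theorem octPolar_eq (v w : Fin 8 → F) :
    octPolar v w = octNorm (v + w) - octNorm v - octNorm w := by
  simp only [octPolar, octNorm, Pi.add_apply]; ring

theorem octPolar_act' (g : G2 F) (v w : Fin 8 → F) :
    octPolar (act g v) (act g w) = octPolar v w := by
  rw [octPolar_eq, octPolar_eq, octPolar_act]

theorem octPolar_comm (v w : Fin 8 → F) : octPolar v w = octPolar w v := by
  simp only [octPolar]; ring

theorem norm_octPolar_bas (i : Fin 8) (w : Fin 8 → F) : ‖octPolar (bas i.rev) w‖ = ‖w i‖ := by
  fin_cases i
  · change ‖octPolar (bas 7) w‖ = ‖w 0‖; simp [octPolar, bas7]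
  · change ‖octPolar (bas 6) w‖ = ‖w 1‖; simp [octPolar, bas6]
  · change ‖octPolar (bas 5) w‖ = ‖w 2‖; simp [octPolar, bas5]
  · change ‖octPolar (bas 4) w‖ = ‖w 3‖; simp [octPolar, bas4]
  · change ‖octPolar (bas 3) w‖ = ‖w 4‖; simp [octPolar, bas3]
  · change ‖octPolar (bas 2) w‖ = ‖w 5‖; simp [octPolar, bas2]
  · change ‖octPolar (bas 1) w‖ = ‖w 6‖; simp [octPolar, bas1]
  · change ‖octPolar (bas 0) w‖ = ‖w 7‖; simp [octPolar, bas0]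

theorem norm_inv_apply (g : G2 F) (i j : Fin 8) :
    ‖(g⁻¹).1.1 i j‖ = ‖g.1.1 j.rev i.rev‖ := by
  rw [← act_bas, ← act_bas, ← norm_octPolar_bas i, ← norm_octPolar_bas j.rev, Fin.rev_rev,
    ← octPolar_act' g, act_act_inv, octPolar_comm]

/-- The largest norm of an entry. -/
def gn (g : G2 F) : ℝ := ‖fun i j => g.1.1 i j‖

theorem gn_le_iff {g : G2 F} {c : ℝ} (hc : 0 ≤ c) : gn g ≤ c ↔ ∀ i j, ‖g.1.1 i j‖ ≤ c := by
  simp only [gn, pi_norm_le_iff_of_nonneg hc]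

theorem norm_apply_le_gn (g : G2 F) (i j : Fin 8) : ‖g.1.1 i j‖ ≤ gn g :=
  (gn_le_iff (norm_nonneg _)).1 le_rfl i j

theorem gn_nonneg (g : G2 F) : 0 ≤ gn g := norm_nonneg _

theorem gn_inv (g : G2 F) : gn g⁻¹ = gn g := by
  have h : ∀ g : G2 F, gn g⁻¹ ≤ gn g := fun g => (gn_le_iff (gn_nonneg g)).2 fun i j => by
    rw [norm_inv_apply]; exact norm_apply_le_gn g _ _
  exact le_antisymm (h g) (by simpa using h g⁻¹)

theorem gn_attained (g : G2 F) : ∃ i j, ‖g.1.1 i j‖ = gn g := by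
  obtain ⟨i, -, hi⟩ := Finset.exists_max_image Finset.univ (fun i : Fin 8 × Fin 8 => ‖g.1.1 i.1 i.2‖)
    ⟨(0, 0), Finset.mem_univ _⟩
  refine ⟨i.1, i.2, le_antisymm (norm_apply_le_gn g _ _) ?_⟩
  exact (gn_le_iff (norm_nonneg _)).2 fun a b => hi (a, b) (Finset.mem_univ _)

variable [IsUltrametricDist F]

theorem norm_act_apply_le {g : G2 F} {v : Fin 8 → F} {c d : ℝ} (hc : 0 ≤ c) (hd : 0 ≤ d)
    (hg : ∀ i j, ‖g.1.1 i j‖ ≤ c) (hv : ∀ i, ‖v i‖ ≤ d) (i : Fin 8) :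
    ‖act g v i‖ ≤ c * d := by
  simp only [act, Matrix.mulVec, dotProduct]
  refine IsUltrametricDist.norm_sum_le_of_forall_le_of_nonneg (by positivity) fun j _ => ?_
  rw [norm_mul]
  exact mul_le_mul (hg i j) (hv j) (norm_nonneg _) hc

theorem norm_act_apply_le_gn (g : G2 F) (v : Fin 8 → F) (i : Fin 8) :
    ‖act g v i‖ ≤ gn g * ‖v‖ :=
  norm_act_apply_le (gn_nonneg g) (norm_nonneg _) (norm_apply_le_gn g) (norm_le_pi_norm v) i

theorem norm_act_le (g : G2 F) (v : Fin 8 → F) : ‖act g v‖ ≤ gn g * ‖v‖ :=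
  (pi_norm_le_iff_of_nonneg (mul_nonneg (gn_nonneg g) (norm_nonneg _))).2 (norm_act_apply_le_gn g v)

theorem gn_mul_le (g h : G2 F) : gn (g * h) ≤ gn g * gn h := by
  refine (gn_le_iff (mul_nonneg (gn_nonneg g) (gn_nonneg h))).2 fun i j => ?_
  rw [← act_bas, act_mul]
  refine norm_act_apply_le (gn_nonneg g) (gn_nonneg h) (norm_apply_le_gn g) (fun k => ?_) i
  rw [act_bas]; exact norm_apply_le_gn h _ _

theorem gn_one_le : gn (1 : G2 F) ≤ 1 := by
  refine (gn_le_iff zero_le_one).2 fun i j => ?_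
  rw [← act_bas, act_one, bas, Pi.single_apply]
  split_ifs <;> simp

theorem one_le_gn (g : G2 F) : 1 ≤ gn g := by
  have h1 : (1 : ℝ) ≤ gn (1 : G2 F) := by
    refine le_trans ?_ (norm_apply_le_gn 1 0 0)
    rw [← act_bas, act_one, bas, Pi.single_eq_same, norm_one]
  have h2 : gn (1 : G2 F) ≤ gn g * gn g := by
    have := gn_mul_le g g⁻¹
    rwa [mul_inv_cancel, gn_inv] at this
  nlinarith [gn_nonneg g]

theorem gn_pos (g : G2 F) : 0 < gn g := one_pos.trans_le (one_le_gn g)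

theorem mem_maxCompact_iff {g : G2 F} : g ∈ maxCompact F ↔ gn g ≤ 1 := by
  constructor
  · intro h; exact (gn_le_iff zero_le_one).2 fun i j => (h i j).1
  · intro h i j
    refine ⟨(gn_le_iff zero_le_one).1 h i j, ?_⟩
    have h' : gn g⁻¹ ≤ 1 := by rwa [gn_inv]
    exact (gn_le_iff zero_le_one).1 h' i j

variable (F) in
/-- The maximal compact subgroup, as a subgroup. -/
def groupK : Subgroup (G2 F) where
  carrier := maxCompact F
  one_mem' := mem_maxCompact_iff.2 gn_one_le
  mul_mem' := by
    intro a b ha hb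
    rw [mem_maxCompact_iff] at *
    exact (gn_mul_le a b).trans (mul_le_one₀ ha (gn_nonneg b) hb)
  inv_mem' := by
    intro a ha
    rw [mem_maxCompact_iff] at *
    rwa [gn_inv]

theorem mem_groupK_iff {g : G2 F} : g ∈ groupK F ↔ gn g ≤ 1 := mem_maxCompact_iff

theorem mem_maxCompact_iff_groupK {g : G2 F} : g ∈ maxCompact F ↔ g ∈ groupK F := Iff.rfl

theorem gn_mul_K (g : G2 F) {k : G2 F} (hk : k ∈ groupK F) : gn (g * k) = gn g := by
  have h : ∀ (g k : G2 F), k ∈ groupK F → gn (g * k) ≤ gn g := fun g k hk =>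
    (gn_mul_le g k).trans (mul_le_of_le_one_right (gn_nonneg g) (mem_groupK_iff.1 hk))
  refine le_antisymm (h g k hk) ?_
  simpa using h (g * k) k⁻¹ (inv_mem hk)

theorem gn_K_mul (g : G2 F) {k : G2 F} (hk : k ∈ groupK F) : gn (k * g) = gn g := by
  rw [← gn_inv, _root_.mul_inv_rev, gn_mul_K _ (inv_mem hk), gn_inv]

theorem norm_act_K {k : G2 F} (hk : k ∈ groupK F) (v : Fin 8 → F) : ‖act k v‖ = ‖v‖ := by
  have h : ∀ (k : G2 F), k ∈ groupK F → ∀ v, ‖act k v‖ ≤ ‖v‖ := fun k hk v =>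
    (norm_act_le k v).trans (mul_le_of_le_one_left (norm_nonneg _) (mem_groupK_iff.1 hk))
  refine le_antisymm (h k hk v) ?_
  simpa using h k⁻¹ (inv_mem hk) (act k v)

/-- An element is in `K` as soon as the images of the coordinate vectors are integral. -/
theorem mem_groupK_of_act {g : G2 F} (h : ∀ v : Fin 8 → F, (∀ i, ‖v i‖ ≤ 1) → ∀ i, ‖act g v i‖ ≤ 1) :
    g ∈ groupK F := by
  refine mem_groupK_iff.2 ((gn_le_iff zero_le_one).2 fun i j => ?_)
  rw [← act_bas]
  refine h _ (fun k => ?_) i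
  rw [bas, Pi.single_apply]; split_ifs <;> simp

theorem norm_le_one_add {x y : F} (hx : ‖x‖ ≤ 1) (hy : ‖y‖ ≤ 1) : ‖x + y‖ ≤ 1 :=
  norm_add_le_of_le' hx hy
theorem norm_le_one_sub {x y : F} (hx : ‖x‖ ≤ 1) (hy : ‖y‖ ≤ 1) : ‖x - y‖ ≤ 1 :=
  norm_sub_le_of_le' hx hy
theorem norm_le_one_mul {x y : F} (hx : ‖x‖ ≤ 1) (hy : ‖y‖ ≤ 1) : ‖x * y‖ ≤ 1 := by
  rw [norm_mul]; exact mul_le_one₀ hx (norm_nonneg _) hy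
theorem norm_le_one_pow {x : F} (hx : ‖x‖ ≤ 1) (n : ℕ) : ‖x ^ n‖ ≤ 1 := by
  rw [norm_pow]; exact pow_le_one₀ (norm_nonneg _) hx
theorem norm_le_one_neg {x : F} (hx : ‖x‖ ≤ 1) : ‖-x‖ ≤ 1 := by rwa [norm_neg]

theorem xA_mem_K {r : F} (hr : ‖r‖ ≤ 1) : xA r ∈ groupK F := by
  refine mem_groupK_of_act fun v hv i => ?_
  rw [act_xA]
  fin_cases i <;> simp only [Fin.zero_eta, Fin.mk_one, Fin.reduceFinMk, Matrix.cons_val] <;>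
    (repeat' first | exact hv _ | exact hr | apply norm_le_one_add | apply norm_le_one_sub |
      apply norm_le_one_mul | apply norm_le_one_pow | apply norm_le_one_neg)

theorem xAneg_mem_K {r : F} (hr : ‖r‖ ≤ 1) : xAneg r ∈ groupK F := by
  refine mem_groupK_of_act fun v hv i => ?_
  rw [act_xAneg]
  fin_cases i <;> simp only [Fin.zero_eta, Fin.mk_one, Fin.reduceFinMk, Matrix.cons_val] <;>
    (repeat' first | exact hv _ | exact hr | apply norm_le_one_add | apply norm_le_one_sub |
      apply norm_le_one_mul | apply norm_le_one_pow | apply norm_le_one_neg)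

theorem xB_mem_K {r : F} (hr : ‖r‖ ≤ 1) : xB r ∈ groupK F := by
  refine mem_groupK_of_act fun v hv i => ?_
  rw [act_xB]
  fin_cases i <;> simp only [Fin.zero_eta, Fin.mk_one, Fin.reduceFinMk, Matrix.cons_val] <;>
    (repeat' first | exact hv _ | exact hr | apply norm_le_one_add | apply norm_le_one_sub |
      apply norm_le_one_mul | apply norm_le_one_pow | apply norm_le_one_neg)

theorem xBneg_mem_K {r : F} (hr : ‖r‖ ≤ 1) : xBneg r ∈ groupK F := by
  refine mem_groupK_of_act fun v hv i => ?_
  rw [act_xBneg]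
  fin_cases i <;> simp only [Fin.zero_eta, Fin.mk_one, Fin.reduceFinMk, Matrix.cons_val] <;>
    (repeat' first | exact hv _ | exact hr | apply norm_le_one_add | apply norm_le_one_sub |
      apply norm_le_one_mul | apply norm_le_one_pow | apply norm_le_one_neg)

theorem uElt_mem_K {r : Fin 5 → F} (hr : ∀ i, ‖r i‖ ≤ 1) : uElt r ∈ groupK F := by
  have h2 : ‖(2 : F)‖ ≤ 1 := by simpa using IsUltrametricDist.norm_natCast_le_one F 2
  refine mem_groupK_of_act fun v hv i => ?_
  rw [act_uElt]
  fin_cases i <;> simp only [Fin.zero_eta, Fin.mk_one, Fin.reduceFinMk, Matrix.cons_val] <;>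
    (repeat' first | exact hv _ | exact hr _ | exact h2 | apply norm_le_one_add |
      apply norm_le_one_sub | apply norm_le_one_mul | apply norm_le_one_pow | apply norm_le_one_neg)

theorem torusElt_mem_K {t₁ t₂ : Fˣ} (h1 : ‖(t₁ : F)‖ = 1) (h2 : ‖(t₂ : F)‖ = 1) :
    torusElt t₁ t₂ ∈ groupK F := by
  refine mem_groupK_of_act fun v hv i => ?_
  rw [act_torusElt]
  fin_cases i <;> simp [h1, h2, hv]

theorem weylB_mem_K : weylB F ∈ groupK F :=
  mul_mem (mul_mem (xB_mem_K (by simp)) (xBneg_mem_K (by simp))) (xB_mem_K (by simp))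

theorem weylLong_mem_K : weylLong F ∈ groupK F := by
  refine mem_groupK_of_act fun v hv i => ?_
  rw [act_weylLong]
  fin_cases i <;> simp [hv]

theorem symS_mem_K : symS F ∈ groupK F := by
  refine mem_groupK_of_act fun v hv i => ?_
  rw [act_symS]
  fin_cases i <;> simp only [Fin.zero_eta, Fin.mk_one, Fin.reduceFinMk, Matrix.cons_val] <;>
    (repeat' first | exact hv _ | apply norm_le_one_add | apply norm_le_one_sub |
      apply norm_le_one_neg)

theorem symW_mem_K : symW F ∈ groupK F := by
  refine mem_groupK_of_act fun v hv i => ?_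
  rw [act_symW]
  fin_cases i <;> simp [hv]

/-! ## Topology -/

theorem continuous_apply_G2 (i j : Fin 8) : Continuous fun g : G2 F => g.1.1 i j := by
  have h : Continuous fun g : G2 F => g.1.1 := Units.continuous_val.comp continuous_subtype_val
  exact h.matrix_elem i j

theorem continuous_gn : Continuous (gn : G2 F → ℝ) :=
  (continuous_pi fun i => continuous_pi fun j => continuous_apply_G2 i j).norm

theorem isClosed_G2 : IsClosed (G2 F : Set (GL (Fin 8) F)) := by
  have : (G2 F : Set (GL (Fin 8) F)) =
      {g | ∀ x y, g.1 *ᵥ octMul x y = octMul (g.1 *ᵥ x) (g.1 *ᵥ y)} := rfl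
  rw [this]
  simp only [Set.ofPred_forall]
  refine isClosed_iInter fun x => isClosed_iInter fun y => ?_
  have hv : ∀ v : Fin 8 → F, Continuous fun g : GL (Fin 8) F => g.1 *ᵥ v := fun v =>
    Units.continuous_val.matrix_mulVec continuous_const
  refine isClosed_eq (hv _) ?_
  have hx : ∀ i, Continuous fun g : GL (Fin 8) F => (g.1 *ᵥ x) i := fun i =>
    (continuous_apply i).comp (hv x)
  have hy : ∀ i, Continuous fun g : GL (Fin 8) F => (g.1 *ᵥ y) i := fun i =>
    (continuous_apply i).comp (hv y)
  refine continuous_pi fun i => ?_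
  fin_cases i <;> simp only [octMul, Fin.zero_eta, Fin.mk_one, Fin.reduceFinMk, Matrix.cons_val] <;>
    fun_prop

theorem isOpen_groupK : IsOpen (groupK F : Set (G2 F)) := by
  have h : (groupK F : Set (G2 F)) = ⋂ i, ⋂ j, {g : G2 F | ‖g.1.1 i j‖ ≤ 1} := by
    ext g
    simp only [Set.mem_iInter, Set.mem_setOf_eq, SetLike.mem_coe, mem_groupK_iff,
      gn_le_iff zero_le_one]
  rw [h]
  refine isOpen_iInter_of_finite fun i => isOpen_iInter_of_finite fun j => ?_
  have : {g : G2 F | ‖g.1.1 i j‖ ≤ 1} = (fun g : G2 F => g.1.1 i j) ⁻¹' Metric.closedBall 0 1 := by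
    ext; simp
  rw [this]
  exact (IsUltrametricDist.isOpen_closedBall _ one_ne_zero).preimage (continuous_apply_G2 i j)

theorem isCompact_gn_le [ProperSpace F] (c : ℝ) : IsCompact {g : G2 F | gn g ≤ c} := by
  rcases lt_or_ge c 0 with hc | hc
  · convert isCompact_empty
    ext g; simpa using hc.trans_le (gn_nonneg g)
  have hemb : Topology.IsClosedEmbedding fun g : G2 F => Units.embedProduct _ g.1 :=
    Units.isClosedEmbedding_embedProduct.comp isClosed_G2.isClosedEmbedding_subtypeVal
  have hcomp : IsCompact ((Set.univ.pi fun _ => Set.univ.pi fun _ => Metric.closedBall (0 : F) c :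
      Set (Matrix (Fin 8) (Fin 8) F))) :=
    isCompact_univ_pi fun _ => isCompact_univ_pi fun _ => isCompact_closedBall _ _
  have h := hemb.isCompact_preimage
    (hcomp.prod (MulOpposite.opHomeomorph.symm.isClosedEmbedding.isCompact_preimage hcomp))
  convert h using 1
  ext g
  have hinv : (∀ i j, ‖(g⁻¹).1.1 i j‖ ≤ c) ↔ gn g ≤ c := by rw [← gn_inv, gn_le_iff hc]
  simp only [Units.embedProduct_apply, Set.mem_setOf_eq]
  constructor
  · intro h
    exact ⟨fun i _ j _ => by simpa using (gn_le_iff hc).1 h i j,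
      fun i _ j _ => by simpa using hinv.2 h i j⟩
  · intro h
    exact (gn_le_iff hc).2 fun i j => by simpa using h.1 i trivial j trivial

theorem isCompact_groupK [ProperSpace F] : IsCompact (groupK F : Set (G2 F)) := by
  convert isCompact_gn_le (F := F) 1
  ext g; exact mem_groupK_iff

theorem locallyCompactSpace_G2 [ProperSpace F] : LocallyCompactSpace (G2 F) := by
  have : LocallyCompactSpace (Matrix (Fin 8) (Fin 8) F) :=
    inferInstanceAs (LocallyCompactSpace (Fin 8 → Fin 8 → F))
  exact (isClosed_G2.isClosedEmbedding_subtypeVal).locallyCompactSpace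

end Lattice

section Decompositions

variable {F : Type*} [NontriviallyNormedField F] [IsUltrametricDist F]

/-! ## The Iwasawa decomposition -/

theorem exists_eq_mul_of_norm_le {x y : F} (h : ‖y‖ ≤ ‖x‖) : ∃ r : F, ‖r‖ ≤ 1 ∧ y = r * x := by
  by_cases hx : x = 0
  · refine ⟨0, by simp, ?_⟩
    rw [hx, norm_zero] at h
    rw [zero_mul, norm_le_zero_iff.1 h]
  · refine ⟨y / x, ?_, by field_simp⟩
    rw [norm_div]
    exact div_le_one_of_le₀ h (norm_nonneg _)

theorem exists_K_act_seven (v : Fin 8 → F) : ∃ k ∈ groupK F, act k v 7 = 0 := by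
  have H : ∀ v : Fin 8 → F, ‖v 7‖ ≤ ‖v 6‖ → ∃ k ∈ groupK F, act k v 7 = 0 := by
    intro v hv
    obtain ⟨r, hr, h⟩ := exists_eq_mul_of_norm_le hv
    refine ⟨xAneg r, xAneg_mem_K hr, ?_⟩
    simp [act_xAneg, h]
  rcases le_or_gt ‖v 7‖ ‖v 6‖ with hv | hv
  · exact H v hv
  · obtain ⟨k, hk, h⟩ := H (act (xA 1) v) (by
      simp only [act_xA, Matrix.cons_val, one_mul]
      rw [norm_sub_rev, norm_sub_eq_of_lt hv])
    exact ⟨k * xA 1, mul_mem hk (xA_mem_K (by simp)), by rwa [act_mul]⟩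

theorem exists_K_act_six {v : Fin 8 → F} (h7 : v 7 = 0) :
    ∃ k ∈ groupK F, act k v 7 = 0 ∧ act k v 6 = 0 := by
  have H : ∀ v : Fin 8 → F, v 7 = 0 → ‖v 6‖ ≤ ‖v 5‖ →
      ∃ k ∈ groupK F, act k v 7 = 0 ∧ act k v 6 = 0 := by
    intro v h7 hv
    obtain ⟨r, hr, h⟩ := exists_eq_mul_of_norm_le hv
    refine ⟨xBneg r, xBneg_mem_K hr, ?_⟩
    simp [act_xBneg, h, h7]
  rcases le_or_gt ‖v 6‖ ‖v 5‖ with hv | hv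
  · exact H v h7 hv
  · obtain ⟨k, hk, h⟩ := H (act (xB 1) v) (by simpa [act_xB] using h7) (by
      simp only [act_xB, Matrix.cons_val, one_mul]
      rw [norm_sub_rev, norm_sub_eq_of_lt hv])
    exact ⟨k * xB 1, mul_mem hk (xB_mem_K (by simp)), by rwa [act_mul]⟩

theorem exists_K_act_middle {v : Fin 8 → F} (h7 : v 7 = 0) (h6 : v 6 = 0) (h4 : v 3 + v 4 = 0)
    (hn : octNorm v = 0) :
    ∃ k ∈ groupK F, act k v 3 = 0 ∧ act k v 4 = 0 ∧ act k v 5 = 0 ∧ act k v 6 = 0 ∧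
      act k v 7 = 0 := by
  have sq : ∀ v : Fin 8 → F, v 7 = 0 → v 6 = 0 → v 3 + v 4 = 0 → octNorm v = 0 →
      v 3 * v 3 = - (v 5 * v 2) := by
    intro v h7 h6 h4 hn
    simp only [octNorm, h7, h6] at hn
    linear_combination v 3 * h4 - hn
  have H : ∀ v : Fin 8 → F, v 7 = 0 → v 6 = 0 → v 3 + v 4 = 0 → octNorm v = 0 →
      ‖v 5‖ ≤ ‖v 2‖ →
      ∃ k ∈ groupK F, act k v 3 = 0 ∧ act k v 4 = 0 ∧ act k v 5 = 0 ∧ act k v 6 = 0 ∧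
        act k v 7 = 0 := by
    intro v h7 h6 h4 hn hv
    have hs := sq v h7 h6 h4 hn
    have h32 : ‖v 3‖ ≤ ‖v 2‖ := by
      have := congrArg norm hs
      rw [norm_neg, norm_mul, norm_mul] at this
      nlinarith [norm_nonneg (v 3), norm_nonneg (v 2), norm_nonneg (v 5)]
    obtain ⟨r, hr, h⟩ := exists_eq_mul_of_norm_le h32
    have h4' : v 4 = - v 3 := by linear_combination h4
    refine ⟨xAneg (-r), xAneg_mem_K (by simpa), ?_⟩
    have h5 : v 5 = - r ^ 2 * v 2 := by
      by_cases h2 : v 2 = 0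
      · rw [h2, norm_zero] at hv
        rw [norm_le_zero_iff.1 hv, h2, mul_zero]
      · apply mul_right_cancel₀ h2
        rw [h] at hs
        linear_combination hs
    simp only [act_xAneg, Matrix.cons_val, h7, h6, h4', h, h5]
    refine ⟨?_, ?_, ?_, ?_, ?_⟩ <;> first | ring1 | simp
  rcases le_or_gt ‖v 5‖ ‖v 2‖ with hv | hv
  · exact H v h7 h6 h4 hn hv
  · have hs := sq v h7 h6 h4 hn
    have h35 : ‖v 3‖ < ‖v 5‖ := by
      have := congrArg norm hs
      rw [norm_neg, norm_mul, norm_mul] at this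
      nlinarith [norm_nonneg (v 3), norm_nonneg (v 2), norm_nonneg (v 5)]
    have h4' : v 4 = - v 3 := by linear_combination h4
    obtain ⟨k, hk, h⟩ := H (act (xA 1) v) (by simpa [act_xA] using h7) (by simp [act_xA, h7, h6])
      (by simp [act_xA, h4']) (by rw [octNorm_act, hn]) (by
        have h23 : ‖v 2 + (v 3 + v 3)‖ < ‖v 5‖ :=
          (IsUltrametricDist.norm_add_le_max _ _).trans_lt (max_lt hv
            ((IsUltrametricDist.norm_add_le_max _ _).trans_lt (max_lt h35 h35)))
        simp only [act_xA, Matrix.cons_val, one_mul]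
        have : v 2 + v 3 - v 4 - 1 ^ 2 * v 5 = (v 2 + (v 3 + v 3)) - v 5 := by rw [h4']; ring
        rw [this, norm_sub_rev, norm_sub_eq_of_lt h23])
    exact ⟨k * xA 1, mul_mem hk (xA_mem_K (by simp)), by rwa [act_mul]⟩

/-- Integral root elements for `±β` bring `(w₀, w₁, w₂, 0, …)` to the form `(w₀, w₁', 0, …)`, and
fix `e₀`. -/
theorem exists_K_act_two (v : Fin 8 → F) :
    ∃ k ∈ groupK F, act k v 2 = 0 ∧ act k v 0 = v 0 ∧ act k (bas 0) = bas 0 ∧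
      (∀ i : Fin 8, v 5 = 0 → v 6 = 0 → 3 ≤ i → act k v i = v i) := by
  have H : ∀ v : Fin 8 → F, ‖v 2‖ ≤ ‖v 1‖ → ∃ k ∈ groupK F, act k v 2 = 0 ∧ act k v 0 = v 0 ∧
      act k (bas 0) = bas 0 ∧ (∀ i : Fin 8, v 5 = 0 → v 6 = 0 → 3 ≤ i → act k v i = v i) := by
    intro v hv
    obtain ⟨r, hr, h⟩ := exists_eq_mul_of_norm_le hv
    refine ⟨xBneg (-r), xBneg_mem_K (by simpa), ?_, ?_, ?_, ?_⟩
    · simp [act_xBneg, h]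
    · simp [act_xBneg]
    · rw [act_xBneg, bas0]; apply ext8 <;> simp
    · intro i h5 h6 hi
      rw [act_xBneg]
      fin_cases i <;> simp_all
  rcases le_or_gt ‖v 2‖ ‖v 1‖ with hv | hv
  · exact H v hv
  · obtain ⟨k, hk, h, h', hb, hi⟩ := H (act (xB 1) v) (by
      simp only [act_xB, Matrix.cons_val, one_mul]
      rw [add_comm, norm_add_eq_of_lt hv])
    refine ⟨k * xB 1, mul_mem hk (xB_mem_K (by simp)), by rwa [act_mul], ?_, ?_, ?_⟩
    · rw [act_mul, h']; simp [act_xB]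
    · rw [act_mul]
      have : act (xB 1) (bas 0) = (bas 0 : Fin 8 → F) := by
        rw [act_xB, bas0]; apply ext8 <;> simp
      rw [this, hb]
    · intro i h5 h6 h3
      rw [act_mul, hi i (by simp [act_xB, h5, h6]) (by simp [act_xB, h6]) h3]
      rw [act_xB]
      fin_cases i <;> simp_all

theorem exists_K_act_one {v : Fin 8 → F} (h : ∀ i : Fin 8, 2 ≤ i → v i = 0) :
    ∃ k ∈ groupK F, ∃ c : F, act k v = c • bas 0 := by
  have hv : v = ![v 0, v 1, 0, 0, 0, 0, 0, 0] := by
    apply ext8 <;> simp [h]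
  have H : ∀ x y : F, ‖y‖ ≤ ‖x‖ → ∃ k ∈ groupK F, ∃ c : F,
      act k ![x, y, 0, 0, 0, 0, 0, 0] = c • bas 0 := by
    intro x y hv
    obtain ⟨r, hr, h⟩ := exists_eq_mul_of_norm_le hv
    refine ⟨xAneg (-r), xAneg_mem_K (by simpa), x, ?_⟩
    rw [act_xAneg, bas0]; apply ext8 <;> simp [h]
  rw [hv]
  rcases le_or_gt ‖v 1‖ ‖v 0‖ with hv | hv
  · exact H _ _ hv
  · obtain ⟨k, hk, c, h⟩ := H (v 0 + v 1) (v 1) (by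
      rw [add_comm, norm_add_eq_of_lt hv])
    refine ⟨k * xA 1, mul_mem hk (xA_mem_K (by simp)), c, ?_⟩
    rw [act_mul, ← h]
    congr 1
    rw [act_xA]; apply ext8 <;> simp

/-- `K` acts transitively on lines of traceless null vectors. -/
theorem exists_K_act_eq_smul {v : Fin 8 → F} (ht : v 3 + v 4 = 0) (hn : octNorm v = 0) :
    ∃ k ∈ groupK F, ∃ c : F, act k v = c • bas 0 := by
  obtain ⟨k₁, hk₁, h₁⟩ := exists_K_act_seven v
  obtain ⟨k₂, hk₂, h₂, h₂'⟩ := exists_K_act_six h₁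
  obtain ⟨k₃, hk₃, a3, a4, a5, a6, a7⟩ := exists_K_act_middle h₂ h₂'
    (by rw [octTrace_act, octTrace_act, ht]) (by rw [octNorm_act, octNorm_act, hn])
  obtain ⟨k₄, hk₄, b2, -, -, hi⟩ := exists_K_act_two (act k₃ (act k₂ (act k₁ v)))
  obtain ⟨k₅, hk₅, c, h₅⟩ := exists_K_act_one (v := act k₄ (act k₃ (act k₂ (act k₁ v)))) (by
    intro i h
    have hi' := fun j hj => hi j a5 a6 hj
    fin_cases i
    · simp at h
    · simp at h
    · exact b2
    · exact (hi' 3 (by decide)).trans a3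
    · exact (hi' 4 (by decide)).trans a4
    · exact (hi' 5 (by decide)).trans a5
    · exact (hi' 6 (by decide)).trans a6
    · exact (hi' 7 (by decide)).trans a7)
  refine ⟨k₅ * k₄ * k₃ * k₂ * k₁, ?_, c, ?_⟩
  · exact mul_mem (mul_mem (mul_mem (mul_mem hk₅ hk₄) hk₃) hk₂) hk₁
  · rw [act_mul, act_mul, act_mul, act_mul, h₅]

theorem octNorm_bas0 : octNorm (bas 0 : Fin 8 → F) = 0 := by simp [octNorm, bas0]

theorem act_bas_ne_zero (g : G2 F) (i : Fin 8) : act g (bas i) ≠ 0 := by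
  intro h
  have h' : act g⁻¹ (act g (bas i)) = act g⁻¹ 0 := by rw [h]
  rw [act_inv_act, act, Matrix.mulVec_zero] at h'
  have := congrFun h' i
  simp [bas] at this

/-- An element of the stabilizer of the line of `e₀` becomes upper triangular after
multiplication by `K`. -/
theorem exists_K_mul_eq_of_act_bas0 {h : G2 F} {c : F} (h0 : act h (bas 0) = c • bas 0) :
    ∃ k ∈ groupK F, ∃ (y : F) (t₁ t₂ : Fˣ) (r : Fin 5 → F), (t₁ : F) = c ∧
      k * h = xA y * torusElt t₁ t₂ * uElt r := by
  have hc : c ≠ 0 := by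
    rintro rfl
    exact act_bas_ne_zero h 0 (by rw [h0, zero_smul])
  have hm : octMul (act h (bas 0)) (act h (bas 1)) = 0 := by
    rw [← act_octMul]
    have : octMul (bas 0) (bas 1) = (0 : Fin 8 → F) := by
      rw [bas0, bas1]; apply ext8 <;> simp [octMul]
    rw [this, act, Matrix.mulVec_zero]
  have htr := octTrace_act h (bas 1)
  set w := act h (bas 1) with hw
  rw [h0] at hm
  simp only [bas1, Matrix.cons_val, add_zero] at htr
  have m0 := congrFun hm 0
  have m1 := congrFun hm 1
  have m2 := congrFun hm 2
  have m3 := congrFun hm 3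
  simp only [octMul, bas0, Pi.smul_apply, smul_eq_mul, Pi.zero_apply, Matrix.cons_val, mul_one,
    mul_zero, zero_mul, add_zero, zero_add, sub_zero, zero_sub, neg_eq_zero] at m0 m1 m2 m3
  have w4 : w 4 = 0 := by simpa [hc] using m0
  have w5 : w 5 = 0 := by simpa [hc] using m1
  have w6 : w 6 = 0 := by simpa [hc] using m2
  have w7 : w 7 = 0 := by simpa [hc] using m3
  have w3 : w 3 = 0 := by rw [w4, add_zero] at htr; exact htr
  obtain ⟨k, hk, h2, -, hb, hi⟩ := exists_K_act_two w
  have hi' := fun i => hi i w5 w6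
  have hkw : act k w = ![act k w 0, act k w 1, 0, 0, 0, 0, 0, 0] := by
    apply ext8 <;> simp only [Matrix.cons_val]
    · exact h2
    · rw [hi' 3 (by decide), w3]
    · rw [hi' 4 (by decide), w4]
    · rw [hi' 5 (by decide), w5]
    · rw [hi' 6 (by decide), w6]
    · rw [hi' 7 (by decide), w7]
  set x := act k w 0
  set z := act k w 1
  have hk0 : act (k * h) (bas 0) = c • bas 0 := by rw [act_mul, h0, act_smul, hb]
  have hk1 : act (k * h) (bas 1) = ![x, z, 0, 0, 0, 0, 0, 0] := by rw [act_mul, ← hw, hkw]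
  have hz : z ≠ 0 := by
    intro hz
    have e1 : act (k * h) (c • bas 1 - x • bas 0) = 0 := by
      rw [sub_eq_add_neg, ← neg_smul, act_add, act_smul, act_smul, hk0, hk1, bas0, hz]
      apply ext8 <;> simp [mul_comm]
    have e2 : act (k * h)⁻¹ (act (k * h) (c • bas 1 - x • bas 0)) = act (k * h)⁻¹ 0 := by rw [e1]
    rw [act_inv_act, act, Matrix.mulVec_zero] at e2
    have := congrFun e2 1
    simp [bas0, bas1] at this
    exact hc this
  set t₁ : Fˣ := Units.mk0 c hc
  set t₂ : Fˣ := Units.mk0 (c * z) (mul_ne_zero hc hz)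
  have ht1 : (t₁ : F) = c := rfl
  have ht2 : (t₂ : F) = c * z := rfl
  have b0 : act (xA (x / z) * torusElt t₁ t₂) (bas 0) = c • bas 0 := by
    rw [act_mul, act_torusElt, act_xA, bas0]
    apply ext8 <;> simp [ht1]
  have b1 : act (xA (x / z) * torusElt t₁ t₂) (bas 1) = ![x, z, 0, 0, 0, 0, 0, 0] := by
    rw [act_mul, act_torusElt, act_xA, bas1]
    apply ext8 <;> simp [ht1, ht2] <;> field_simp
  set b := xA (x / z) * torusElt t₁ t₂ with hbdef
  obtain ⟨r, hr⟩ := exists_eq_uElt (g := b⁻¹ * (k * h))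
    (by rw [act_mul, hk0, ← b0, act_inv_act]) (by rw [act_mul, hk1, ← b1, act_inv_act])
  refine ⟨k, hk, x / z, t₁, t₂, r, rfl, ?_⟩
  rw [← hbdef, ← hr, mul_inv_cancel_left]

/-- The Iwasawa decomposition. -/
theorem iwasawa (g : G2 F) : ∃ (r : Fin 5 → F) (y : F) (t₁ t₂ : Fˣ), ∃ k ∈ groupK F,
    g = uElt r * xA y * torusElt t₁ t₂ * k := by
  obtain ⟨k, hk, c, h⟩ := exists_K_act_eq_smul (v := act g⁻¹ (bas 0))
    (by rw [octTrace_act]; simp [bas0]) (by rw [octNorm_act, octNorm_bas0])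
  rw [← act_mul] at h
  obtain ⟨k', hk', y, t₁, t₂, r, -, h'⟩ := exists_K_mul_eq_of_act_bas0 h
  refine ⟨invU r, t₁⁻¹ ^ 2 / t₂⁻¹ * (-y), t₁⁻¹, t₂⁻¹, k' * k, mul_mem hk' hk, ?_⟩
  have hg : g = (xA y * torusElt t₁ t₂ * uElt r)⁻¹ * (k' * k) := by
    rw [← h']; group
  rw [hg, _root_.mul_inv_rev, _root_.mul_inv_rev, uElt_inv, torusElt_inv, xA_inv, torusElt_mul_xA,
    Units.val_inv_eq_inv_val, Units.val_inv_eq_inv_val]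
  group

/-! ## The Cartan decomposition -/

/-- Equivalence modulo `K` on both sides. -/
def KEquiv (g h : G2 F) : Prop := ∃ k ∈ groupK F, ∃ k' ∈ groupK F, g = k * h * k'

theorem KEquiv.trans {g h l : G2 F} (h₁ : KEquiv g h) (h₂ : KEquiv h l) : KEquiv g l := by
  obtain ⟨k, hk, k', hk', rfl⟩ := h₁
  obtain ⟨a, ha, a', ha', rfl⟩ := h₂
  exact ⟨k * a, mul_mem hk ha, a' * k', mul_mem ha' hk', by group⟩

theorem KEquiv.gn_eq {g h : G2 F} (H : KEquiv g h) : gn g = gn h := by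
  obtain ⟨k, hk, k', hk', rfl⟩ := H
  rw [gn_mul_K _ hk', gn_K_mul _ hk]

theorem KEquiv.refl (g : G2 F) : KEquiv g g := ⟨1, one_mem _, 1, one_mem _, by simp⟩

theorem KEquiv.K_mul {g : G2 F} {k : G2 F} (hk : k ∈ groupK F) : KEquiv (k * g) g :=
  ⟨k, hk, 1, one_mem _, by simp⟩

theorem KEquiv.mul_K {g : G2 F} {k : G2 F} (hk : k ∈ groupK F) : KEquiv (g * k) g :=
  ⟨1, one_mem _, k, hk, by simp⟩

theorem KEquiv.torus_of_conj {w : G2 F} (hw : w ∈ groupK F) {t t' : G2 F} (h : w * t = t' * w) :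
    KEquiv t t' := ⟨w⁻¹, inv_mem hw, w, hw, by rw [mul_assoc, ← h]; group⟩

theorem exists_K_norm_act_bas0 (h2 : ‖(2 : F)‖ = 1) (g : G2 F) :
    ∃ k ∈ groupK F, ‖act (g * k) (bas 0)‖ = gn g := by
  by_contra! hne
  have hlt : ∀ k ∈ groupK F, ∀ i, ‖act g (act k (bas 0)) i‖ < gn g := by
    intro k hk i
    rw [← act_mul]
    refine (norm_le_pi_norm _ i).trans_lt (lt_of_le_of_ne ?_ (hne k hk))
    refine (norm_act_le _ _).trans ?_
    rw [gn_mul_K _ hk]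
    refine mul_le_of_le_one_right (gn_nonneg g) ((pi_norm_le_iff_of_nonneg zero_le_one).2 fun j => ?_)
    rw [bas, Pi.single_apply]; split_ifs <;> simp
  have b0 : ∃ k ∈ groupK F, act k (bas 0) = (bas 0 : Fin 8 → F) := ⟨1, one_mem _, act_one _⟩
  have step : ∀ (w : G2 F), w ∈ groupK F → ∀ (x y : Fin 8 → F), act w x = y →
      (∃ k ∈ groupK F, act k (bas 0) = x) → ∃ k ∈ groupK F, act k (bas 0) = y := by
    rintro w hw x y rfl ⟨k, hk, rfl⟩
    exact ⟨w * k, mul_mem hw hk, act_mul _ _ _⟩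
  have b1 := step (symW F) symW_mem_K _ (-bas 1)
    (by rw [act_symW, bas0, bas1]; apply ext8 <;> simp) b0
  have b2 := step (weylB F) weylB_mem_K _ (bas 2)
    (by rw [act_weylB, bas1, bas2]; apply ext8 <;> simp) b1
  have b5 := step (symW F) symW_mem_K _ (bas 5)
    (by rw [act_symW, bas2, bas5]; apply ext8 <;> simp) b2
  have b6 := step (weylB F) weylB_mem_K _ (bas 6)
    (by rw [act_weylB, bas5, bas6]; apply ext8 <;> simp) b5
  have b7 := step (symW F) symW_mem_K _ (-bas 7)
    (by rw [act_symW, bas6, bas7]; apply ext8 <;> simp) b6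
  have b34 := step (xAneg 1) (xAneg_mem_K (by simp)) _ (bas 2 + bas 3 + (-1 : F) • bas 4 +
      (-1 : F) • bas 5)
    (by rw [act_xAneg, bas2, bas3, bas4, bas5]; apply ext8 <;> simp) b2
  have use : ∀ x : Fin 8 → F, (∃ k ∈ groupK F, act k (bas 0) = x) → ∀ i, ‖act g x i‖ < gn g := by
    rintro x ⟨k, hk, rfl⟩ i
    exact hlt k hk i
  have hnegact : ∀ v, act g (-v) = -act g v := fun v => Matrix.mulVec_neg _ _
  have hg1 : 1 < gn g := by
    refine lt_of_le_of_ne (one_le_gn g) fun h => hne 1 (one_mem _) ?_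
    have hgK : g ∈ groupK F := mem_groupK_iff.2 h.symm.le
    rw [mul_one, norm_act_K hgK, ← h]
    refine le_antisymm ((pi_norm_le_iff_of_nonneg zero_le_one).2 fun j => ?_) ?_
    · rw [bas, Pi.single_apply]; split_ifs <;> simp
    · refine le_trans ?_ (norm_le_pi_norm _ 0)
      simp [bas]
  have c34 : ∀ i, ‖act g (bas 3) i - act g (bas 4) i‖ < gn g := by
    intro i
    have e := use _ b34 i
    have e2 := use _ b2 i
    have e5 := use _ b5 i
    simp only [act_add, act_smul, Pi.add_apply, Pi.smul_apply, smul_eq_mul] at e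
    have : act g (bas 3) i - act g (bas 4) i =
        (act g (bas 2) i + act g (bas 3) i + -1 * act g (bas 4) i + -1 * act g (bas 5) i)
          - (act g (bas 2) i - act g (bas 5) i) := by ring
    rw [this]
    exact (norm_sub_le_max' _ _).trans_lt (max_lt e ((norm_sub_le_max' _ _).trans_lt (max_lt e2 e5)))
  have s34 : ∀ i, ‖act g (bas 3) i + act g (bas 4) i‖ < gn g := by
    intro i
    have e : act g (bas 3 + bas 4) = ![0, 0, 0, 1, 1, 0, 0, 0] := by
      rw [← act_octOne g]; congr 1; rw [bas3, bas4]; apply ext8 <;> simp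
    rw [act_add] at e
    have := congrFun e i
    rw [Pi.add_apply] at this
    rw [this]
    refine lt_of_le_of_lt ?_ hg1
    fin_cases i <;> simp
  have d3 : ∀ i, ‖act g (bas 3) i‖ < gn g := by
    intro i
    have : 2 * act g (bas 3) i = (act g (bas 3) i + act g (bas 4) i) +
        (act g (bas 3) i - act g (bas 4) i) := by ring
    rw [← one_mul ‖_‖, ← h2, ← norm_mul, this]
    exact (IsUltrametricDist.norm_add_le_max _ _).trans_lt (max_lt (s34 i) (c34 i))
  have d4 : ∀ i, ‖act g (bas 4) i‖ < gn g := by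
    intro i
    have : act g (bas 4) i = (act g (bas 3) i + act g (bas 4) i) - act g (bas 3) i := by ring
    rw [this]
    exact (norm_sub_le_max' _ _).trans_lt (max_lt (s34 i) (d3 i))
  obtain ⟨i, j, hij⟩ := gn_attained g
  rw [← act_bas] at hij
  have u1 := use _ b1 i
  have u7 := use _ b7 i
  rw [hnegact, Pi.neg_apply, norm_neg] at u1 u7
  fin_cases j
  · exact (use _ b0 i).ne hij
  · exact u1.ne hij
  · exact (use _ b2 i).ne hij
  · exact (d3 i).ne hij
  · exact (d4 i).ne hij
  · exact (use _ b5 i).ne hij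
  · exact (use _ b6 i).ne hij
  · exact u7.ne hij

theorem kEquiv_torus_xB (t₁ t₂ : Fˣ) (r : F) :
    ∃ s₁ s₂ : Fˣ, KEquiv (torusElt t₁ t₂ * xB r) (torusElt s₁ s₂) := by
  rcases le_or_gt ‖r‖ 1 with hr | hr
  · exact ⟨t₁, t₂, KEquiv.mul_K (xB_mem_K hr)⟩
  rcases le_or_gt ‖(t₂ : F) ^ 2 / t₁ ^ 3 * r‖ 1 with hb | hb
  · exact ⟨t₁, t₂, by rw [torusElt_mul_xB]; exact KEquiv.K_mul (xB_mem_K hb)⟩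
  have hr0 : r ≠ 0 := by rintro rfl; simp at hr; linarith
  have h1 := t₁.ne_zero
  have h2 := t₂.ne_zero
  set u : Fˣ := Units.mk0 r hr0
  have hu : (u : F) = r := rfl
  refine ⟨t₁ * 1, t₂ * u, ?_⟩
  rw [← hu, xB_eq]
  have e : torusElt t₁ t₂ * xBneg ((u⁻¹ : Fˣ) : F) =
      xBneg ((t₂ ^ 2 / t₁ ^ 3 * r)⁻¹) * torusElt t₁ t₂ := by
    rw [← torusElt_mul_xBneg]
    congr 2
    simp only [Units.val_inv_eq_inv_val, hu]
    field_simp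
  have : torusElt t₁ t₂ * (xBneg ((u⁻¹ : Fˣ) : F) * torusElt 1 u * weylB F * xBneg ((u⁻¹ : Fˣ) : F))
      = xBneg ((t₂ ^ 2 / t₁ ^ 3 * r)⁻¹) * torusElt (t₁ * 1) (t₂ * u) *
        (weylB F * xBneg ((u⁻¹ : Fˣ) : F)) := by
    rw [← torusElt_mul]
    simp only [← mul_assoc]
    rw [e]
  rw [this]
  refine ⟨_, xBneg_mem_K ?_, _, mul_mem weylB_mem_K (xBneg_mem_K ?_), rfl⟩
  · rw [norm_inv]; exact inv_le_one_of_one_le₀ hb.le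
  · rw [Units.val_inv_eq_inv_val, norm_inv]; exact inv_le_one_of_one_le₀ hr.le

theorem exists_kEquiv_torus (h2 : ‖(2 : F)‖ = 1) (g : G2 F) :
    ∃ t₁ t₂ : Fˣ, KEquiv g (torusElt t₁ t₂) := by
  obtain ⟨k, hk, hmax⟩ := exists_K_norm_act_bas0 h2 g
  obtain ⟨k₁, hk₁, c, h⟩ := exists_K_act_eq_smul (v := act (g * k) (bas 0))
    (by rw [octTrace_act]; simp [bas0]) (by rw [octNorm_act, octNorm_bas0])
  have hc : ‖c‖ = gn g := by
    rw [← hmax, ← norm_act_K hk₁, h, norm_smul]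
    have : ‖(bas 0 : Fin 8 → F)‖ = 1 := by
      refine le_antisymm ((pi_norm_le_iff_of_nonneg zero_le_one).2 fun j => ?_) ?_
      · rw [bas, Pi.single_apply]; split_ifs <;> simp
      · refine le_trans ?_ (norm_le_pi_norm _ 0)
        simp [bas]
    rw [this, mul_one]
  rw [← act_mul] at h
  obtain ⟨k₂, hk₂, y, t₁, t₂, r, ht, hkh⟩ := exists_K_mul_eq_of_act_bas0 h
  have e1 : KEquiv g (xA y * torusElt t₁ t₂ * uElt r) :=
    ⟨(k₂ * k₁)⁻¹, inv_mem (mul_mem hk₂ hk₁), k⁻¹, inv_mem hk, by rw [← hkh]; group⟩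
  have hgn : gn (xA y * torusElt t₁ t₂ * uElt r) = ‖(t₁ : F)‖ := by rw [← e1.gn_eq, ht, hc]
  have n1 := t₁.ne_zero
  have n2 := t₂.ne_zero
  obtain ⟨y', hy'⟩ : ∃ y' : F, y = t₁ ^ 2 / t₂ * y' := ⟨t₂ / t₁ ^ 2 * y, by field_simp⟩
  rw [hy', ← torusElt_mul_xA, mul_assoc, xA_mul_uElt] at hgn e1
  set r' := conjA y' r with hr'
  clear_value r'
  have bound : ∀ j, ‖act (uElt r' * xA y') (bas j) 0‖ ≤ 1 := by
    intro j
    have := norm_apply_le_gn (torusElt t₁ t₂ * (uElt r' * xA y')) 0 j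
    rw [hgn, ← act_bas, act_mul, act_torusElt] at this
    simp only [Matrix.cons_val, norm_mul] at this
    exact (mul_le_iff_le_one_right (norm_pos_iff.2 n1)).1 this
  have hy : ‖y'‖ ≤ 1 := by
    have := bound 1
    rw [act_mul, act_xA, act_uElt] at this
    simpa [bas1] using this
  have hxA := xA_mem_K hy
  have bound' : ∀ j, ‖act (uElt r') (bas j) 0‖ ≤ 1 := by
    intro j
    have e : act (uElt r') (bas j) 0 =
        ∑ i, act (uElt r' * xA y') (bas i) 0 * act (xA y')⁻¹ (bas j) i := by
      have : uElt r' = (uElt r' * xA y') * (xA y')⁻¹ := by group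
      conv_lhs => rw [this, act_mul]
      simp only [act_bas (uElt r' * xA y')]
      rfl
    rw [e]
    refine IsUltrametricDist.norm_sum_le_of_forall_le_of_nonneg zero_le_one fun i _ => ?_
    refine norm_le_one_mul (bound i) ?_
    rw [act_bas]
    exact (gn_le_iff zero_le_one).1 (mem_groupK_iff.1 (inv_mem hxA)) i j
  have q2 := bound' 2
  have q3 := bound' 3
  have q5 := bound' 5
  have q6 := bound' 6
  rw [act_uElt] at q2 q3 q5 q6
  simp [bas2] at q2
  simp [bas3] at q3
  simp [bas5] at q5
  simp [bas6] at q6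
  have q4 : ‖r' 4‖ ≤ 1 := (norm_add_le_iff (norm_le_one_mul q2 q3)).1 q6
  have split : uElt r' = xB (r' 0) * uElt ![0, r' 1, r' 2, r' 3, r' 4] := by
    refine ext_act fun v => ?_
    simp only [act_mul, act_xB, act_uElt]
    apply ext8 <;> simp only [Matrix.cons_val] <;> ring
  have hu : uElt ![0, r' 1, r' 2, r' 3, r' 4] ∈ groupK F := uElt_mem_K fun i => by
    fin_cases i <;> simp [q2, q3, q4, q5]
  obtain ⟨s₁, s₂, hs⟩ := kEquiv_torus_xB t₁ t₂ (r' 0)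
  refine ⟨s₁, s₂, e1.trans (KEquiv.trans ?_ hs)⟩
  rw [split]
  have : torusElt t₁ t₂ * (xB (r' 0) * uElt ![0, r' 1, r' 2, r' 3, r' 4] * xA y') =
      torusElt t₁ t₂ * xB (r' 0) * (uElt ![0, r' 1, r' 2, r' 3, r' 4] * xA y') := by group
  rw [this]
  exact KEquiv.mul_K (mul_mem hu hxA)

/-- Dominance of a torus element: `|α(t)| ≤ 1` and `|β(t)| ≤ 1`. -/
def Dominant (t₁ t₂ : Fˣ) : Prop := ‖(t₁ : F)‖ ≤ ‖(t₂ : F) / t₁‖ ∧ ‖(t₂ : F) / t₁‖ ^ 2 ≤ ‖(t₁ : F)‖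

theorem exists_dominant (t₁ t₂ : Fˣ) :
    ∃ s₁ s₂ : Fˣ, Dominant s₁ s₂ ∧ KEquiv (torusElt t₁ t₂) (torusElt s₁ s₂) := by
  have eW : ∀ t₁ t₂ : Fˣ, KEquiv (torusElt t₁ t₂) (torusElt (t₂ / t₁) t₂) := fun t₁ t₂ =>
    KEquiv.torus_of_conj symW_mem_K (symW_mul_torusElt t₁ t₂)
  have eB : ∀ t₁ t₂ : Fˣ, KEquiv (torusElt t₁ t₂) (torusElt t₁ (t₁ ^ 3 / t₂)) := fun t₁ t₂ =>
    KEquiv.torus_of_conj weylB_mem_K (weylB_mul_torusElt t₁ t₂)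
  have eL : ∀ t₁ t₂ : Fˣ, KEquiv (torusElt t₁ t₂) (torusElt t₁⁻¹ t₂⁻¹) := fun t₁ t₂ =>
    KEquiv.torus_of_conj weylLong_mem_K (weylLong_mul_torusElt t₁ t₂)
  have np : ∀ t : Fˣ, 0 < ‖(t : F)‖ := fun t => norm_pos_iff.2 t.ne_zero
  have s1 : ∀ t₁ t₂ : Fˣ, ‖(t₁ : F)‖ ≤ 1 → ∃ s₁ s₂ : Fˣ, ‖(s₁ : F)‖ ≤ 1 ∧ ‖(s₂ : F) / s₁‖ ≤ 1 ∧
      KEquiv (torusElt t₁ t₂) (torusElt s₁ s₂) := by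
    intro t₁ t₂ h
    rcases le_or_gt ‖(t₂ : F) / t₁‖ 1 with h' | h'
    · exact ⟨t₁, t₂, h, h', KEquiv.refl _⟩
    · refine ⟨_, _, h, ?_, eB t₁ t₂⟩
      have e : (((t₁ ^ 3 / t₂ : Fˣ)) : F) / t₁ = t₁ * (t₂ / t₁ : F)⁻¹ := by
        have := t₁.ne_zero; have := t₂.ne_zero
        simp only [Units.val_div_eq_div_val, Units.val_pow_eq_pow_val]; field_simp
      rw [e, norm_mul, norm_inv]
      exact mul_le_one₀ h (by positivity) (inv_le_one_of_one_le₀ h'.le)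
  have s2 : ∀ t₁ t₂ : Fˣ, ∃ s₁ s₂ : Fˣ, ‖(s₁ : F)‖ ≤ 1 ∧ ‖(s₂ : F) / s₁‖ ≤ 1 ∧
      KEquiv (torusElt t₁ t₂) (torusElt s₁ s₂) := by
    intro t₁ t₂
    rcases le_or_gt ‖(t₁ : F)‖ 1 with h | h
    · exact s1 t₁ t₂ h
    · obtain ⟨s₁, s₂, a, b, e⟩ := s1 t₁⁻¹ t₂⁻¹ (by
        rw [Units.val_inv_eq_inv_val, norm_inv]; exact inv_le_one_of_one_le₀ h.le)
      exact ⟨s₁, s₂, a, b, (eL _ _).trans e⟩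
  have s3 : ∀ t₁ t₂ : Fˣ, ∃ s₁ s₂ : Fˣ, ‖(s₂ : F) / s₁‖ ≤ 1 ∧ ‖(s₁ : F)‖ ≤ ‖(s₂ : F) / s₁‖ ∧
      KEquiv (torusElt t₁ t₂) (torusElt s₁ s₂) := by
    intro t₁ t₂
    obtain ⟨s₁, s₂, a, b, e⟩ := s2 t₁ t₂
    rcases le_total ‖(s₁ : F)‖ ‖(s₂ : F) / s₁‖ with h | h
    · exact ⟨s₁, s₂, b, h, e⟩
    · refine ⟨_, _, ?_, ?_, e.trans (eW _ _)⟩ <;>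
      · have := s₁.ne_zero; have := s₂.ne_zero
        have e : (s₂ : F) / ((s₂ / s₁ : Fˣ) : F) = s₁ := by
          simp only [Units.val_div_eq_div_val]; field_simp
        rw [e]
        first | exact a | simpa only [Units.val_div_eq_div_val] using h
  obtain ⟨s₁, s₂, a, b, e⟩ := s3 t₁ t₂
  rcases le_total (‖(s₂ : F) / s₁‖ ^ 2) ‖(s₁ : F)‖ with h | h
  · exact ⟨s₁, s₂, ⟨b, h⟩, e⟩
  · refine ⟨_, _, ?_, e.trans (eB _ _)⟩
    have n1 := np s₁
    have hb : 0 < ‖(s₂ : F) / s₁‖ := n1.trans_le b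
    have e : ‖(((s₁ ^ 3 / s₂ : Fˣ)) : F) / s₁‖ = ‖(s₁ : F)‖ / ‖(s₂ : F) / s₁‖ := by
      rw [← norm_div]
      congr 1
      have := s₁.ne_zero; have := s₂.ne_zero
      simp only [Units.val_div_eq_div_val, Units.val_pow_eq_pow_val]; field_simp
    constructor
    · rw [e]; exact le_div_self n1.le hb a
    · rw [e, div_pow, div_le_iff₀ (by positivity), sq]
      exact mul_le_mul_of_nonneg_left h n1.le

theorem cartan (h2 : ‖(2 : F)‖ = 1) (g : G2 F) :
    ∃ t₁ t₂ : Fˣ, Dominant t₁ t₂ ∧ KEquiv g (torusElt t₁ t₂) := by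
  obtain ⟨t₁, t₂, h⟩ := exists_kEquiv_torus h2 g
  obtain ⟨s₁, s₂, d, e⟩ := exists_dominant t₁ t₂
  exact ⟨s₁, s₂, d, h.trans e⟩

theorem gn_torusElt_of_dominant {t₁ t₂ : Fˣ} (h : Dominant t₁ t₂) :
    gn (torusElt t₁ t₂) = ‖(t₁ : F)‖⁻¹ := by
  have n1 : 0 < ‖(t₁ : F)‖ := norm_pos_iff.2 t₁.ne_zero
  have n2 : 0 < ‖(t₂ : F)‖ := norm_pos_iff.2 t₂.ne_zero
  obtain ⟨ha, hb⟩ := h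
  rw [norm_div] at ha hb
  set A := ‖(t₁ : F)‖ with hA
  set B := ‖(t₂ : F)‖ with hB
  have hBA : 0 < B / A := by positivity
  have hB1 : B / A ≤ 1 := by nlinarith
  have hA1 : A ≤ 1 := ha.trans hB1
  have hBA' : B ≤ A := by rwa [div_le_one n1] at hB1
  have haa : A ^ 2 ≤ B := by rw [le_div_iff₀ n1] at ha; nlinarith
  have hbb : B ^ 2 ≤ A ^ 3 := by rw [div_pow, div_le_iff₀ (by positivity)] at hb; nlinarith
  have hi : 1 ≤ A⁻¹ := (one_le_inv₀ n1).2 hA1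
  refine le_antisymm ((gn_le_iff (by positivity)).2 fun i j => ?_) ?_
  · rw [← act_bas, act_torusElt]
    have hz : ∀ (c : F), ‖c‖ ≤ A⁻¹ → ‖c * bas j i‖ ≤ A⁻¹ := by
      intro c hc
      rw [norm_mul]
      refine (mul_le_of_le_one_right (norm_nonneg _) ?_).trans hc
      rw [bas, Pi.single_apply]; split_ifs <;> simp
    fin_cases i <;> simp only [Fin.zero_eta, Fin.mk_one, Fin.reduceFinMk, Matrix.cons_val]
    · exact hz _ (hA1.trans hi)
    · exact hz _ (by rw [norm_div]; exact hB1.trans hi)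
    · refine hz _ ?_
      rw [norm_div, norm_pow, div_le_iff₀ n2, inv_mul_eq_div, le_div_iff₀ n1]
      nlinarith
    · simpa using hz 1 (by simpa using hi)
    · simpa using hz 1 (by simpa using hi)
    · refine hz _ ?_
      rw [norm_div, norm_pow, div_le_iff₀ (by positivity), sq, inv_mul_cancel_left₀ n1.ne']
      exact hBA'
    · refine hz _ ?_
      rw [norm_div, div_le_iff₀ n2, inv_mul_eq_div, le_div_iff₀ n1]
      nlinarith
    · exact hz _ (by rw [norm_div, norm_one, one_div])
  · refine le_trans ?_ (norm_apply_le_gn _ 7 7)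
    rw [← act_bas, act_torusElt]
    simp [bas, hA]

theorem dominant_iff (t₁ t₂ : Fˣ) :
    (∀ γ ∈ posRoots, ‖rootChar γ.1 γ.2 t₁ t₂‖ ≤ 1) ↔ Dominant t₁ t₂ := by
  have n1 : 0 < ‖(t₁ : F)‖ := norm_pos_iff.2 t₁.ne_zero
  have n2 : 0 < ‖(t₂ : F)‖ := norm_pos_iff.2 t₂.ne_zero
  have e : ∀ γ : ℤ × ℤ, ‖rootChar γ.1 γ.2 t₁ t₂‖ =
      (‖(t₁ : F)‖ ^ 2 / ‖(t₂ : F)‖) ^ γ.1 * (‖(t₂ : F)‖ ^ 2 / ‖(t₁ : F)‖ ^ 3) ^ γ.2 := by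
    intro γ
    simp [rootChar]
  simp only [e]
  rw [Dominant, norm_div]
  set A := ‖(t₁ : F)‖ with hA
  set B := ‖(t₂ : F)‖ with hB
  have ea : A ≤ B / A ↔ A ^ 2 / B ≤ 1 := by
    rw [le_div_iff₀ n1, div_le_one n2, sq]
  have eb : (B / A) ^ 2 ≤ A ↔ B ^ 2 / A ^ 3 ≤ 1 := by
    rw [div_pow, div_le_iff₀ (by positivity), div_le_one (by positivity), ← pow_succ']
  rw [ea, eb]
  have pa : 0 ≤ A ^ 2 / B := by positivity
  have pb : 0 ≤ B ^ 2 / A ^ 3 := by positivity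
  generalize A ^ 2 / B = x at *
  generalize B ^ 2 / A ^ 3 = y at *
  simp only [posRoots, Finset.mem_insert, Finset.mem_singleton]
  constructor
  · intro h
    have h1 := h (1, 0) (by simp)
    have h2 := h (0, 1) (by simp)
    simp at h1 h2
    exact ⟨h1, h2⟩
  · rintro ⟨hx, hy⟩ γ (rfl | rfl | rfl | rfl | rfl | rfl) <;> simp only [zpow_zero, zpow_one,
      mul_one, one_mul]
    · exact hx
    · exact hy
    · exact mul_le_one₀ hx pb hy
    · exact mul_le_one₀ (by exact_mod_cast pow_le_one₀ pa hx) pb hy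
    · exact mul_le_one₀ (by exact_mod_cast pow_le_one₀ pa hx) pb hy
    · exact mul_le_one₀ (by exact_mod_cast pow_le_one₀ pa hx) (by positivity)
        (by exact_mod_cast pow_le_one₀ pb hy)

/-- The function `D(·, s)` in terms of the norm. -/
theorem functionD_eq (h2 : ‖(2 : F)‖ = 1) (s : ℂ) (g : G2 F) :
    functionD s g = (((gn g)⁻¹ : ℝ) : ℂ) ^ (5 * s + 1) := by
  have hex : ∃ t : Fˣ × Fˣ, IsCartanPart g t := by
    obtain ⟨t₁, t₂, hd, k, hk, k', hk', h⟩ := cartan h2 g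
    exact ⟨(t₁, t₂), (dominant_iff _ _).2 hd, k, hk, k', hk', h⟩
  rw [functionD, dif_pos hex]
  obtain ⟨hd, k, hk, k', hk', hg⟩ := hex.choose_spec
  set t := hex.choose
  have hroot : rootChar 2 1 t.1 t.2 = (t.1 : F) := by
    have := t.1.ne_zero; have := t.2.ne_zero
    simp only [rootChar, zpow_ofNat, Units.val_mul, Units.val_div_eq_div_val,
      Units.val_pow_eq_pow_val]
    field_simp
  rw [hroot, hg, gn_mul_K _ hk', gn_K_mul _ hk,
    gn_torusElt_of_dominant ((dominant_iff _ _).1 hd), inv_inv]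

end Decompositions

section Radial

variable {F : Type*} [NontriviallyNormedField F] [IsUltrametricDist F]

local notation "𝐪" => ((residueCard F : ℕ) : ℝ)

/-! ## Complex powers of the cardinality of the residue field -/

theorem cpow_zpow_q (hV : IsNormalizedNorm F) (n : ℤ) (w : ℂ) :
    ((𝐪 ^ n : ℝ) : ℂ) ^ w = ((residueCard F : ℂ) ^ w) ^ n := by
  have hq : (0 : ℝ) < 𝐪 := q_pos hV
  have hqc : (residueCard F : ℂ) ≠ 0 := by exact_mod_cast hq.ne'
  have h1 : ((𝐪 ^ n : ℝ) : ℂ) ≠ 0 := by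
    rw [Complex.ofReal_ne_zero]; exact (zpow_pos hq n).ne'
  rw [Complex.cpow_def_of_ne_zero h1, Complex.cpow_def_of_ne_zero hqc, ← Complex.exp_int_mul,
    ← Complex.ofReal_log (zpow_pos hq n).le, Real.log_zpow]
  congr 1
  have : ((residueCard F : ℕ) : ℂ) = ((𝐪 : ℝ) : ℂ) := by simp
  rw [this, ← Complex.ofReal_log hq.le]
  push_cast
  ring

theorem cpow_ofReal_pow {x : ℝ} (hx : 0 < x) (n : ℕ) (w : ℂ) :
    ((x ^ n : ℝ) : ℂ) ^ w = (x : ℂ) ^ (n * w) := by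
  have h1 : ((x ^ n : ℝ) : ℂ) ≠ 0 := by
    rw [Complex.ofReal_ne_zero]; exact (pow_pos hx n).ne'
  have h2 : (x : ℂ) ≠ 0 := by rw [Complex.ofReal_ne_zero]; exact hx.ne'
  rw [Complex.cpow_def_of_ne_zero h1, Complex.cpow_def_of_ne_zero h2,
    ← Complex.ofReal_log (pow_pos hx n).le, ← Complex.ofReal_log hx.le, Real.log_pow]
  congr 1
  push_cast
  ring

theorem cpow_ofReal_inv {x : ℝ} (hx : 0 < x) (w : ℂ) :
    ((x⁻¹ : ℝ) : ℂ) ^ w = (x : ℂ) ^ (-w) := by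
  rw [Complex.ofReal_inv, Complex.inv_cpow _ _ (by
    rw [Complex.arg_ofReal_of_nonneg hx.le]; exact Real.pi_pos.ne), Complex.cpow_neg]

/-! ## Unramified characters -/

/-- The conductor of the additive character is the ring of integers. -/
def Unramified (ψ : AddChar F Circle) : Prop :=
  ∀ x : F, (∀ y : F, ‖y‖ ≤ 1 → ψ (x * y) = 1) ↔ ‖x‖ ≤ 1

theorem Unramified.eq_one {ψ : AddChar F Circle} (hψ : Unramified ψ) {x : F} (hx : ‖x‖ ≤ 1) :
    ψ x = 1 := by
  have := (hψ x).2 hx 1 (by simp)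
  rwa [mul_one] at this

theorem Unramified.exists_ne_one (hV : IsNormalizedNorm F) {ψ : AddChar F Circle}
    (hψ : Unramified ψ) : ∃ v : F, ‖v‖ = 𝐪 ∧ ψ v ≠ 1 := by
  have hq := q_pos hV
  obtain ⟨ϖ, hϖ⟩ := hV.1
  have h1 : ¬ ‖ϖ⁻¹‖ ≤ 1 := by
    rw [norm_inv, hϖ, inv_inv, not_le]; exact one_lt_q hV
  have h2 := mt (hψ ϖ⁻¹).1 h1
  push Not at h2
  obtain ⟨y, hy, h⟩ := h2
  refine ⟨ϖ⁻¹ * y, ?_, h⟩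
  have hy1 : ‖y‖ = 1 := by
    refine le_antisymm hy (not_lt.1 fun hlt => h (hψ.eq_one ?_))
    rw [norm_mul, norm_inv, hϖ, inv_inv]
    calc 𝐪 * ‖y‖ ≤ 𝐪 * 𝐪⁻¹ := mul_le_mul_of_nonneg_left (hV.2 y hlt) hq.le
      _ = 1 := mul_inv_cancel₀ hq.ne'
  rw [norm_mul, norm_inv, hϖ, inv_inv, hy1, mul_one]

theorem Unramified.apply_add {ψ : AddChar F Circle} (hψ : Unramified ψ) (x : F) {y : F}
    (hy : ‖y‖ ≤ 1) : ψ (x + y) = ψ x := by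
  rw [AddChar.map_add_eq_mul, hψ.eq_one hy, mul_one]

theorem Unramified.continuous {ψ : AddChar F Circle} (hψ : Unramified ψ) : Continuous ψ := by
  rw [continuous_iff_continuousAt]
  intro x
  have : ψ =ᶠ[nhds x] fun _ => ψ x := by
    filter_upwards [Metric.closedBall_mem_nhds x one_pos] with y hy
    rw [Metric.mem_closedBall, dist_eq_norm] at hy
    rw [← hψ.apply_add x hy, add_sub_cancel]
  exact this.continuousAt

theorem Unramified.continuous_coe {ψ : AddChar F Circle} (hψ : Unramified ψ) :
    Continuous fun r => (ψ r : ℂ) := continuous_subtype_val.comp hψ.continuous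

theorem AddChar_coe_add (ψ : AddChar F Circle) (x y : F) :
    (ψ (x + y) : ℂ) = (ψ x : ℂ) * (ψ y : ℂ) := by
  rw [AddChar.map_add_eq_mul, Circle.coe_mul]

theorem norm_AddChar (ψ : AddChar F Circle) (x : F) : ‖(ψ x : ℂ)‖ = 1 := Circle.norm_coe _

/-! ## The radial integral -/

variable [ProperSpace F] [MeasurableSpace F] [BorelSpace F] {dr : Measure F} [dr.IsAddHaarMeasure]

theorem integrable_max_one_norm_rpow (hV : IsNormalizedNorm F)
    (hdr : dr (Metric.closedBall 0 1) = 1) {c : ℝ} (hc : 1 < c) :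
    Integrable (fun r : F => (max 1 ‖r‖) ^ (-c)) dr := by
  have hq := q_pos hV
  have hq1 := one_lt_q hV
  have hcont : Continuous fun r : F => (max 1 ‖r‖) ^ (-c) :=
    (continuous_const.max continuous_norm).rpow_const fun r => Or.inl (by positivity)
  refine ⟨hcont.aestronglyMeasurable, ?_⟩
  set x : ℝ := 𝐪 ^ (1 - c) with hx
  have hx0 : 0 ≤ x := by positivity
  have hx1 : x < 1 := Real.rpow_lt_one_of_one_lt_of_neg hq1 (by linarith)
  have hpt : ∀ r : F, ‖(max 1 ‖r‖) ^ (-c)‖ₑ ≤ ∑' n : ℕ,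
      (Metric.closedBall (0 : F) (𝐪 ^ (n : ℤ))).indicator
        (fun _ => ENNReal.ofReal ((𝐪 ^ n) ^ (-c))) r := by
    intro r
    obtain ⟨n, hn⟩ : ∃ n : ℕ, max 1 ‖r‖ = 𝐪 ^ n := by
      rcases le_or_gt ‖r‖ 1 with h | h
      · exact ⟨0, by simp [h]⟩
      · obtain ⟨m, hm⟩ := norm_eq_zpow hV (x := r) (by rintro rfl; simp at h; linarith)
        have hm0 : 0 ≤ m := by
          by_contra hlt
          rw [hm] at h
          exact absurd h (not_lt.2 (zpow_le_one_of_nonpos₀ hq1.le (by omega)))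
        lift m to ℕ using hm0
        exact ⟨m, by rw [max_eq_right h.le, hm, zpow_natCast]⟩
    refine le_trans (le_of_eq ?_) (ENNReal.le_tsum n)
    rw [Set.indicator_of_mem, hn, Real.enorm_eq_ofReal (by positivity)]
    rw [Metric.mem_closedBall, dist_zero_right, zpow_natCast, ← hn]
    exact le_max_right _ _
  refine (lintegral_mono hpt).trans_lt ?_
  rw [lintegral_tsum fun n => (measurable_const.indicator
    Metric.isClosed_closedBall.measurableSet).aemeasurable]
  have hterm : ∀ n : ℕ, ∫⁻ r, (Metric.closedBall (0 : F) (𝐪 ^ (n : ℤ))).indicator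
        (fun _ => ENNReal.ofReal ((𝐪 ^ n) ^ (-c))) r ∂dr = ENNReal.ofReal (x ^ n) := by
    intro n
    rw [lintegral_indicator Metric.isClosed_closedBall.measurableSet, setLIntegral_const,
      volume_closedBall hV hdr, ← ENNReal.ofReal_mul (by positivity)]
    congr 1
    rw [hx, zpow_natCast, ← Real.rpow_natCast, ← Real.rpow_natCast, ← Real.rpow_mul hq.le,
      ← Real.rpow_mul hq.le, ← Real.rpow_add hq]
    congr 1; ring
  simp_rw [hterm]
  rw [← ENNReal.ofReal_tsum_of_nonneg (fun n => by positivity)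
    (summable_geometric_of_lt_one hx0 hx1)]
  exact ENNReal.ofReal_lt_top

theorem integrable_radial (hV : IsNormalizedNorm F)
    (hdr : dr (Metric.closedBall 0 1) = 1) {ψ : AddChar F Circle} (hψ : Unramified ψ) {w : ℂ}
    (hw : 1 < w.re) {A : ℝ} (hA : 0 < A) :
    Integrable (fun r : F => ((max A ‖r‖ : ℝ) : ℂ) ^ (-w) * star (ψ r : ℂ)) dr := by
  have hpos : ∀ r : F, 0 < max A ‖r‖ := fun r => lt_max_of_lt_left hA
  have hcont : Continuous fun r : F => ((max A ‖r‖ : ℝ) : ℂ) ^ (-w) * star (ψ r : ℂ) := by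
    refine Continuous.mul ?_ (hψ.continuous_coe.star)
    refine Continuous.cpow ?_ continuous_const fun r => ?_
    · exact Complex.continuous_ofReal.comp (continuous_const.max continuous_norm)
    · exact Complex.ofReal_mem_slitPlane.2 (hpos r)
  refine ((integrable_max_one_norm_rpow hV hdr hw).const_mul ((min A 1) ^ (-w.re))).mono'
    hcont.aestronglyMeasurable (.of_forall fun r => ?_)
  rw [norm_mul, norm_star, norm_AddChar, mul_one, Complex.norm_cpow_eq_rpow_re_of_pos (hpos r),
    Complex.neg_re, ← Real.mul_rpow (by positivity) (by positivity)]
  refine Real.rpow_le_rpow_of_nonpos (by positivity) ?_ (by linarith)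
  rcases le_total ‖r‖ 1 with h | h
  · rw [max_eq_left h, mul_one]; exact (min_le_left _ _).trans (le_max_left _ _)
  · rw [max_eq_right h]
    exact (mul_le_of_le_one_left (norm_nonneg _) (min_le_right _ _)).trans (le_max_right _ _)

/-- The geometric sum `∑_{0 ≤ i ≤ k} X^i`, for integral `k`. -/
def geomS (X : ℂ) (k : ℤ) : ℂ := ∑ i ∈ Finset.range (k + 1).toNat, X ^ i

theorem geomS_of_neg (X : ℂ) {k : ℤ} (hk : k < 0) : geomS X k = 0 := by
  rw [geomS, Int.toNat_of_nonpos (by omega), Finset.range_zero, Finset.sum_empty]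

/-- The radial integral. -/
theorem integral_radial (hV : IsNormalizedNorm F)
    (hdr : dr (Metric.closedBall 0 1) = 1) {ψ : AddChar F Circle} (hψ : Unramified ψ) {w : ℂ}
    (hw : 1 < w.re) (k : ℤ) :
    ∫ r : F, ((max (𝐪 ^ (-k)) ‖r‖ : ℝ) : ℂ) ^ (-w) * star (ψ r : ℂ) ∂dr =
      (1 - (residueCard F : ℂ) ^ (-w)) * geomS ((residueCard F : ℂ) ^ (w - 1)) k := by
  have hq := q_pos hV
  have hq1 := one_lt_q hV
  have hqc : (residueCard F : ℂ) ≠ 0 := by exact_mod_cast hq.ne'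
  have hneg : ∀ k : ℤ, k < 0 →
      ∫ r : F, ((max (𝐪 ^ (-k)) ‖r‖ : ℝ) : ℂ) ^ (-w) * star (ψ r : ℂ) ∂dr = 0 := by
    intro k hk
    obtain ⟨v, hv, hv1⟩ := hψ.exists_ne_one hV
    refine integral_eq_zero_of_translate dr _ v (star (ψ v : ℂ)) ?_ fun r => ?_
    · intro h
      apply hv1
      have : (ψ v : ℂ) = 1 := by rw [← star_star (ψ v : ℂ), h, star_one]
      exact Circle.ext this
    · have hv' : ‖v‖ ≤ 𝐪 ^ (-k) := by
        rw [hv]; nth_rewrite 1 [← zpow_one 𝐪]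
        exact zpow_le_zpow_right₀ hq1.le (by omega)
      have : max (𝐪 ^ (-k)) ‖r + v‖ = max (𝐪 ^ (-k)) ‖r‖ := by
        rcases le_or_gt ‖r‖ (𝐪 ^ (-k)) with h | h
        · rw [max_eq_left h, max_eq_left ((norm_add_le_iff hv').2 h)]
        · rw [norm_add_eq_of_lt (hv'.trans_lt h)]
      rw [this, AddChar_coe_add, star_mul]
      ring
  rcases lt_or_ge k 0 with hk | hk
  · rw [hneg k hk, geomS_of_neg _ hk, mul_zero]
  lift k to ℕ using hk
  have hstep : ∀ k : ℕ,
      ∫ r : F, ((max (𝐪 ^ (-(k : ℤ))) ‖r‖ : ℝ) : ℂ) ^ (-w) * star (ψ r : ℂ) ∂dr =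
      ∫ r : F, ((max (𝐪 ^ (-((k : ℤ) - 1))) ‖r‖ : ℝ) : ℂ) ^ (-w) * star (ψ r : ℂ) ∂dr +
        (1 - (residueCard F : ℂ) ^ (-w)) * ((residueCard F : ℂ) ^ (w - 1)) ^ k := by
    intro k
    rw [← sub_eq_iff_eq_add', ← integral_sub (integrable_radial hV hdr hψ hw (by positivity))
      (integrable_radial hV hdr hψ hw (by positivity))]
    have hlt : 𝐪 ^ (-(k : ℤ)) < 𝐪 ^ (-((k : ℤ) - 1)) := zpow_lt_zpow_right₀ hq1 (by omega)
    have : ∀ r : F, ((max (𝐪 ^ (-(k : ℤ))) ‖r‖ : ℝ) : ℂ) ^ (-w) * star (ψ r : ℂ) -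
        ((max (𝐪 ^ (-((k : ℤ) - 1))) ‖r‖ : ℝ) : ℂ) ^ (-w) * star (ψ r : ℂ) =
        (Metric.closedBall (0 : F) (𝐪 ^ (-(k : ℤ)))).indicator (fun _ =>
          ((𝐪 ^ (-(k : ℤ)) : ℝ) : ℂ) ^ (-w) - ((𝐪 ^ (-((k : ℤ) - 1)) : ℝ) : ℂ) ^ (-w)) r := by
      intro r
      by_cases hr : ‖r‖ ≤ 𝐪 ^ (-(k : ℤ))
      · rw [Set.indicator_of_mem (by simpa using hr), max_eq_left hr, max_eq_left (hr.trans hlt.le),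
          hψ.eq_one (hr.trans (zpow_le_one_of_nonpos₀ hq1.le (by omega)))]
        simp
      · rw [Set.indicator_of_notMem (by simpa using hr), max_eq_right (not_le.1 hr).le, max_eq_right,
          sub_self]
        by_contra h
        rw [not_le, norm_lt_zpow_iff hV] at h
        exact hr (h.trans (zpow_le_zpow_right₀ hq1.le (by omega)))
    simp_rw [this]
    rw [integral_indicator Metric.isClosed_closedBall.measurableSet, setIntegral_const,
      Measure.real, volume_closedBall hV hdr, ENNReal.toReal_ofReal (by positivity),
      cpow_zpow_q hV, cpow_zpow_q hV, Complex.cpow_sub _ _ hqc, Complex.cpow_one,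
      Complex.cpow_neg, Complex.real_smul]
    have hw0 : (residueCard F : ℂ) ^ w ≠ 0 := by simp [Complex.cpow_eq_zero_iff, hqc]
    generalize (residueCard F : ℂ) ^ w = W at hw0 ⊢
    rw [neg_sub, zpow_sub₀ (inv_ne_zero hw0)]
    simp only [_root_.zpow_neg, inv_inv, zpow_one, zpow_natCast, div_pow,
      Complex.ofReal_inv, Complex.ofReal_pow, Complex.ofReal_natCast, inv_pow]
    field_simp
  induction k with
  | zero =>
    rw [hstep 0, hneg _ (by norm_num)]
    simp [geomS]
  | succ n ih =>
    rw [hstep (n + 1)]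
    have : ((n + 1 : ℕ) : ℤ) - 1 = n := by push_cast; ring
    rw [this, ih]
    have e : (((n + 1 : ℕ) : ℤ) + 1).toNat = ((n : ℤ) + 1).toNat + 1 := by omega
    have e' : ((n : ℤ) + 1).toNat = n + 1 := by omega
    rw [geomS, geomS, e, Finset.sum_range_succ _ (((n : ℤ) + 1).toNat), e']
    ring

end Radial

section SpinAlgebra

variable {F : Type*} [Field F]

/-! ## The first component of `Spin₈` -/

/-- The action of the first component of `Spin₈`. -/
def act1 (h : Spin8 F) (v : Fin 8 → F) : Fin 8 → F := h.1.1.1 *ᵥ v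

theorem act1_mul (g h : Spin8 F) (v : Fin 8 → F) : act1 (g * h) v = act1 g (act1 h v) := by
  simp [act1, Matrix.mulVec_mulVec]

@[simp] theorem act1_one (v : Fin 8 → F) : act1 (1 : Spin8 F) v = v := by simp [act1]

@[simp] theorem act1_inv_act1 (g : Spin8 F) (v : Fin 8 → F) : act1 g⁻¹ (act1 g v) = v := by
  rw [← act1_mul, inv_mul_cancel, act1_one]

theorem act1_add (g : Spin8 F) (v w : Fin 8 → F) : act1 g (v + w) = act1 g v + act1 g w :=
  Matrix.mulVec_add _ _ _

theorem act1_smul (g : Spin8 F) (c : F) (v : Fin 8 → F) : act1 g (c • v) = c • act1 g v :=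
  Matrix.mulVec_smul _ _ _

theorem act1_bas (g : Spin8 F) (i j : Fin 8) : act1 g (bas j) i = g.1.1.1 i j := by
  simp [act1, bas]

theorem octNorm_act1 (g : Spin8 F) (v : Fin 8 → F) : octNorm (act1 g v) = octNorm v := g.2.1 v

theorem octPolar_eq_sub (v w : Fin 8 → F) :
    octNorm (v + w) - octNorm v - octNorm w = v 3 * w 4 + v 4 * w 3
      - (v 0 * w 7 + v 7 * w 0 + v 5 * w 2 + v 2 * w 5 + v 6 * w 1 + v 1 * w 6) := by
  simp only [octNorm, Pi.add_apply]; ring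

theorem act1_toSpin8 (g : G2 F) (v : Fin 8 → F) : act1 (toSpin8 g) v = act g v := rfl

/-- The root elements for `α₄`. -/
def xα₄ (r : F) : Spin8 F :=
  ⟨(oneParam matR matR_mul_neg r, oneParam matR matR_mul_neg r, oneParam matP matP_mul_neg r), by
    refine ⟨?_, ?_, ?_, ?_⟩
    · intro x
      change octNorm (matR r *ᵥ x) = octNorm x
      rw [matR_mulVec]
      simp only [octNorm, Matrix.cons_val]
      ring
    · intro x
      change octNorm (matR r *ᵥ x) = octNorm x
      rw [matR_mulVec]
      simp only [octNorm, Matrix.cons_val]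
      ring
    · intro x
      change octNorm (matP r *ᵥ x) = octNorm x
      rw [matP_mulVec]
      simp only [octNorm, Matrix.cons_val]
      ring
    · intro x y
      change matR r *ᵥ octMul x y = octMul (matR r *ᵥ x) (matP r *ᵥ y)
      simp only [matR_mulVec, matP_mulVec]
      apply ext8 <;> simp only [octMul, Matrix.cons_val] <;> ring⟩

/-- The root elements for `-α₄`. -/
def xα₄neg (r : F) : Spin8 F :=
  ⟨(oneParam (fun r => (matR r)ᵀ) (transpose_mul_neg matR_mul_neg) r,
    oneParam (fun r => (matR r)ᵀ) (transpose_mul_neg matR_mul_neg) r,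
    oneParam (fun r => (matP r)ᵀ) (transpose_mul_neg matP_mul_neg) r), by
    refine ⟨?_, ?_, ?_, ?_⟩
    · intro x
      change octNorm ((matR r)ᵀ *ᵥ x) = octNorm x
      rw [matR_transpose_mulVec]
      simp only [octNorm, Matrix.cons_val]
      ring
    · intro x
      change octNorm ((matR r)ᵀ *ᵥ x) = octNorm x
      rw [matR_transpose_mulVec]
      simp only [octNorm, Matrix.cons_val]
      ring
    · intro x
      change octNorm ((matP r)ᵀ *ᵥ x) = octNorm x
      rw [matP_transpose_mulVec]
      simp only [octNorm, Matrix.cons_val]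
      ring
    · intro x y
      change (matR r)ᵀ *ᵥ octMul x y = octMul ((matR r)ᵀ *ᵥ x) ((matP r)ᵀ *ᵥ y)
      simp only [matR_transpose_mulVec, matP_transpose_mulVec]
      apply ext8 <;> simp only [octMul, Matrix.cons_val] <;> ring⟩

theorem act1_xα₁ (r : F) (v : Fin 8 → F) : act1 (xα₁ r) v =
    ![v 0 + r * v 1, v 1, v 2, v 3, v 4, v 5, v 6 - r * v 7, v 7] := matP_mulVec r v
theorem act1_xα₃ (r : F) (v : Fin 8 → F) : act1 (xα₃ r) v =
    ![v 0, v 1, v 2 - r * v 4, v 3 - r * v 5, v 4, v 5, v 6, v 7] := matQ_mulVec r v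
theorem act1_xα₄ (r : F) (v : Fin 8 → F) : act1 (xα₄ r) v =
    ![v 0, v 1, v 2 + r * v 3, v 3, v 4 + r * v 5, v 5, v 6, v 7] := matR_mulVec r v
theorem act1_xα₁neg (r : F) (v : Fin 8 → F) : act1 (xα₁neg r) v =
    ![v 0, v 1 + r * v 0, v 2, v 3, v 4, v 5, v 6, v 7 - r * v 6] := matP_transpose_mulVec r v
theorem act1_xα₃neg (r : F) (v : Fin 8 → F) : act1 (xα₃neg r) v =
    ![v 0, v 1, v 2, v 3, v 4 - r * v 2, v 5 - r * v 3, v 6, v 7] := matQ_transpose_mulVec r v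
theorem act1_xα₄neg (r : F) (v : Fin 8 → F) : act1 (xα₄neg r) v =
    ![v 0, v 1, v 2, v 3 + r * v 2, v 4, v 5 + r * v 4, v 6, v 7] := matR_transpose_mulVec r v

theorem act1_muElt_inv_bas0 : act1 (muElt F)⁻¹ (bas 0) = ![1, -1, 0, 0, 0, 0, 0, 0] := by
  have h : bas 0 = act1 (muElt F) ![1, -1, 0, 0, 0, 0, 0, 0] := by
    rw [muElt, w₂, w₃]
    simp only [act1_mul, act1_xα₁neg, act1_xα₃, act1_xα₃neg, act1_toSpin8]
    rw [← weylB, act_weylB, bas0]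
    apply ext8 <;> simp
  rw [h, act1_inv_act1]

theorem act1_muElt_inv_bas1 : act1 (muElt F)⁻¹ (bas 1) = ![0, 0, 0, 0, -1, 0, 0, 0] := by
  have h : bas 1 = act1 (muElt F) ![0, 0, 0, 0, -1, 0, 0, 0] := by
    rw [muElt, w₂, w₃]
    simp only [act1_mul, act1_xα₁neg, act1_xα₃, act1_xα₃neg, act1_toSpin8]
    rw [← weylB, act_weylB, bas1]
    apply ext8 <;> simp
  rw [h, act1_inv_act1]

theorem eq_smul_bas_add {v : Fin 8 → F} (h : ∀ i : Fin 8, 2 ≤ i → v i = 0) :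
    v = v 0 • bas 0 + v 1 • bas 1 := by
  rw [bas0, bas1]
  apply ext8 <;> simp [h]

theorem mem_parabolicH_iff {p : Spin8 F} :
    p ∈ parabolicH F ↔ ∀ i : Fin 8, 2 ≤ i → act1 p (bas 0) i = 0 ∧ act1 p (bas 1) i = 0 := by
  simp only [act1_bas]
  constructor
  · intro h i hi
    exact ⟨h i 0 hi (by decide), h i 1 hi (by decide)⟩
  · intro h i j hi hj
    have : j = 0 ∨ j = 1 := by
      rw [Fin.lt_def] at hj; simp only [Fin.ext_iff]; change (j : ℕ) < 2 at hj; simp; omega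
    rcases this with rfl | rfl
    · exact (h i hi).1
    · exact (h i hi).2

end SpinAlgebra

section SpinLattice

variable {F : Type*} [NontriviallyNormedField F] [IsUltrametricDist F]

/-! ## The maximal compact subgroup of `Spin₈` -/

theorem HasIntegralEntries.mul {g h : GL (Fin 8) F} (hg : HasIntegralEntries g)
    (hh : HasIntegralEntries h) : HasIntegralEntries (g * h) := by
  intro i j
  constructor
  · rw [Units.val_mul, Matrix.mul_apply]
    exact IsUltrametricDist.norm_sum_le_of_forall_le_of_nonneg zero_le_one fun k _ =>
      norm_le_one_mul (hg i k).1 (hh k j).1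
  · rw [_root_.mul_inv_rev, Units.val_mul, Matrix.mul_apply]
    exact IsUltrametricDist.norm_sum_le_of_forall_le_of_nonneg zero_le_one fun k _ =>
      norm_le_one_mul (hh i k).2 (hg k j).2

theorem HasIntegralEntries.inv {g : GL (Fin 8) F} (hg : HasIntegralEntries g) :
    HasIntegralEntries g⁻¹ := fun i j => ⟨(hg i j).2, by rw [inv_inv]; exact (hg i j).1⟩

theorem HasIntegralEntries.one : HasIntegralEntries (1 : GL (Fin 8) F) := by
  intro i j
  rw [inv_one, Units.val_one, Matrix.one_apply]
  split_ifs <;> simp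

theorem hasIntegralEntries_oneParam {M : F → Matrix (Fin 8) (Fin 8) F} (h : ∀ r, M r * M (-r) = 1)
    {r : F} (hr : ‖r‖ ≤ 1) (hM : ∀ r : F, ‖r‖ ≤ 1 → ∀ i j, ‖M r i j‖ ≤ 1) :
    HasIntegralEntries (oneParam M h r) :=
  fun i j => ⟨hM r hr i j, hM (-r) (by rwa [norm_neg]) i j⟩

theorem norm_matP_le (r : F) (hr : ‖r‖ ≤ 1) (i j : Fin 8) : ‖matP r i j‖ ≤ 1 := by
  fin_cases i <;> fin_cases j <;> simp [matP, hr]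
theorem norm_matQ_le (r : F) (hr : ‖r‖ ≤ 1) (i j : Fin 8) : ‖matQ r i j‖ ≤ 1 := by
  fin_cases i <;> fin_cases j <;> simp [matQ, hr]
theorem norm_matR_le (r : F) (hr : ‖r‖ ≤ 1) (i j : Fin 8) : ‖matR r i j‖ ≤ 1 := by
  fin_cases i <;> fin_cases j <;> simp [matR, hr]

variable (F) in
/-- The maximal compact subgroup of `Spin₈`, as a subgroup. -/
def groupKH : Subgroup (Spin8 F) where
  carrier := maxCompactH F
  one_mem' := ⟨.one, .one, .one⟩
  mul_mem' := fun ha hb => ⟨ha.1.mul hb.1, ha.2.1.mul hb.2.1, ha.2.2.mul hb.2.2⟩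
  inv_mem' := fun ha => ⟨ha.1.inv, ha.2.1.inv, ha.2.2.inv⟩

theorem toSpin8_mem_KH {k : G2 F} (hk : k ∈ groupK F) : toSpin8 k ∈ groupKH F := ⟨hk, hk, hk⟩

theorem xα₁_mem_KH {r : F} (hr : ‖r‖ ≤ 1) : xα₁ r ∈ groupKH F :=
  ⟨hasIntegralEntries_oneParam _ hr norm_matP_le, hasIntegralEntries_oneParam _ hr norm_matQ_le,
    hasIntegralEntries_oneParam _ hr norm_matR_le⟩
theorem xα₃_mem_KH {r : F} (hr : ‖r‖ ≤ 1) : xα₃ r ∈ groupKH F :=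
  ⟨hasIntegralEntries_oneParam _ hr norm_matQ_le, hasIntegralEntries_oneParam _ hr norm_matP_le,
    hasIntegralEntries_oneParam _ hr norm_matQ_le⟩
theorem xα₄_mem_KH {r : F} (hr : ‖r‖ ≤ 1) : xα₄ r ∈ groupKH F :=
  ⟨hasIntegralEntries_oneParam _ hr norm_matR_le, hasIntegralEntries_oneParam _ hr norm_matR_le,
    hasIntegralEntries_oneParam _ hr norm_matP_le⟩
theorem xα₁neg_mem_KH {r : F} (hr : ‖r‖ ≤ 1) : xα₁neg r ∈ groupKH F :=
  ⟨hasIntegralEntries_oneParam _ hr fun r hr i j => norm_matP_le r hr j i,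
    hasIntegralEntries_oneParam _ hr fun r hr i j => norm_matQ_le r hr j i,
    hasIntegralEntries_oneParam _ hr fun r hr i j => norm_matR_le r hr j i⟩
theorem xα₃neg_mem_KH {r : F} (hr : ‖r‖ ≤ 1) : xα₃neg r ∈ groupKH F :=
  ⟨hasIntegralEntries_oneParam _ hr fun r hr i j => norm_matQ_le r hr j i,
    hasIntegralEntries_oneParam _ hr fun r hr i j => norm_matP_le r hr j i,
    hasIntegralEntries_oneParam _ hr fun r hr i j => norm_matQ_le r hr j i⟩
theorem xα₄neg_mem_KH {r : F} (hr : ‖r‖ ≤ 1) : xα₄neg r ∈ groupKH F :=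
  ⟨hasIntegralEntries_oneParam _ hr fun r hr i j => norm_matR_le r hr j i,
    hasIntegralEntries_oneParam _ hr fun r hr i j => norm_matR_le r hr j i,
    hasIntegralEntries_oneParam _ hr fun r hr i j => norm_matP_le r hr j i⟩

/-! ## Reduction of isotropic planes

The integral root elements for `±α₄, ±α₃, ±α₂` fix `e₀`; they kill the coordinates `5, 4, 3, 2` of
an isotropic vector with vanishing coordinates `6` and `7`. -/

/-- `k` is integral and does not change `e₀`. -/
def FixesZero (k : Spin8 F) : Prop := k ∈ groupKH F ∧ act1 k (bas 0) = bas 0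

theorem FixesZero.mul {k l : Spin8 F} (hk : FixesZero k) (hl : FixesZero l) : FixesZero (k * l) :=
  ⟨mul_mem hk.1 hl.1, by rw [act1_mul, hl.2, hk.2]⟩

theorem fixesZero_xB {r : F} (hr : ‖r‖ ≤ 1) : FixesZero (toSpin8 (xB r)) :=
  ⟨toSpin8_mem_KH (xB_mem_K hr), by rw [act1_toSpin8, act_xB, bas0]; apply ext8 <;> simp⟩
theorem fixesZero_xBneg {r : F} (hr : ‖r‖ ≤ 1) : FixesZero (toSpin8 (xBneg r)) :=
  ⟨toSpin8_mem_KH (xBneg_mem_K hr), by rw [act1_toSpin8, act_xBneg, bas0]; apply ext8 <;> simp⟩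
theorem fixesZero_xα₃ {r : F} (hr : ‖r‖ ≤ 1) : FixesZero (xα₃ r) :=
  ⟨xα₃_mem_KH hr, by rw [act1_xα₃, bas0]; apply ext8 <;> simp⟩
theorem fixesZero_xα₃neg {r : F} (hr : ‖r‖ ≤ 1) : FixesZero (xα₃neg r) :=
  ⟨xα₃neg_mem_KH hr, by rw [act1_xα₃neg, bas0]; apply ext8 <;> simp⟩
theorem fixesZero_xα₄ {r : F} (hr : ‖r‖ ≤ 1) : FixesZero (xα₄ r) :=
  ⟨xα₄_mem_KH hr, by rw [act1_xα₄, bas0]; apply ext8 <;> simp⟩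
theorem fixesZero_xα₄neg {r : F} (hr : ‖r‖ ≤ 1) : FixesZero (xα₄neg r) :=
  ⟨xα₄neg_mem_KH hr, by rw [act1_xα₄neg, bas0]; apply ext8 <;> simp⟩

theorem fixesZero_kill_six {v : Fin 8 → F} (h7 : v 7 = 0) :
    ∃ k, FixesZero k ∧ act1 k v 7 = 0 ∧ act1 k v 6 = 0 := by
  rcases le_or_gt ‖v 6‖ ‖v 5‖ with hv | hv
  · obtain ⟨r, hr, h⟩ := exists_eq_mul_of_norm_le hv
    exact ⟨_, fixesZero_xBneg hr, by simp [act1_toSpin8, act_xBneg, h7],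
      by simp [act1_toSpin8, act_xBneg, h]⟩
  · obtain ⟨r, hr, h⟩ := exists_eq_mul_of_norm_le (x := v 5 - v 6) (y := v 6)
      (by rw [norm_sub_rev, norm_sub_eq_of_lt hv])
    refine ⟨_, (fixesZero_xBneg hr).mul (fixesZero_xB (r := 1) (by simp)), ?_, ?_⟩
    · simp [act1_mul, act1_toSpin8, act_xB, act_xBneg, h7]
    · simp only [act1_mul, act1_toSpin8, act_xB, act_xBneg, Matrix.cons_val]
      linear_combination h

theorem fixesZero_kill_five {v : Fin 8 → F} (h7 : v 7 = 0) (h6 : v 6 = 0) :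
    ∃ k, FixesZero k ∧ act1 k v 7 = 0 ∧ act1 k v 6 = 0 ∧ act1 k v 5 = 0 := by
  rcases le_or_gt ‖v 5‖ ‖v 4‖ with hv | hv
  · obtain ⟨r, hr, h⟩ := exists_eq_mul_of_norm_le hv
    exact ⟨_, fixesZero_xα₄neg (r := -r) (by simpa), by simp [act1_xα₄neg, h7],
      by simp [act1_xα₄neg, h6], by simp [act1_xα₄neg, h]⟩
  · obtain ⟨r, hr, h⟩ := exists_eq_mul_of_norm_le (x := v 4 + v 5) (y := v 5)
      (by rw [add_comm, norm_add_eq_of_lt hv])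
    refine ⟨_, (fixesZero_xα₄neg (r := -r) (by simpa)).mul (fixesZero_xα₄ (r := 1) (by simp)),
      ?_, ?_, ?_⟩
    · simp [act1_mul, act1_xα₄, act1_xα₄neg, h7]
    · simp [act1_mul, act1_xα₄, act1_xα₄neg, h6]
    · simp only [act1_mul, act1_xα₄, act1_xα₄neg, Matrix.cons_val]
      linear_combination h

theorem fixesZero_kill_middle {v : Fin 8 → F} (h7 : v 7 = 0) (h6 : v 6 = 0) (h5 : v 5 = 0)
    (hn : octNorm v = 0) : ∃ k, FixesZero k ∧ ∀ i : Fin 8, 3 ≤ i → act1 k v i = 0 := by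
  have h34 : v 3 * v 4 = 0 := by
    simp only [octNorm, h7, h6, h5] at hn; linear_combination hn
  rcases mul_eq_zero.1 h34 with h3 | h4
  · rcases le_or_gt ‖v 4‖ ‖v 2‖ with hv | hv
    · obtain ⟨r, hr, h⟩ := exists_eq_mul_of_norm_le hv
      refine ⟨_, fixesZero_xα₃neg hr, fun i hi => ?_⟩
      rw [act1_xα₃neg]; fin_cases i <;> simp_all
    · obtain ⟨r, hr, h⟩ := exists_eq_mul_of_norm_le (x := v 2 - v 4) (y := v 4)
        (by rw [norm_sub_rev, norm_sub_eq_of_lt hv])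
      refine ⟨_, (fixesZero_xα₃neg hr).mul (fixesZero_xα₃ (r := 1) (by simp)), fun i hi => ?_⟩
      rw [act1_mul, act1_xα₃, act1_xα₃neg]
      have h' : v 4 - r * (v 2 - v 4) = 0 := sub_eq_zero.2 h
      clear h hv hn
      fin_cases i <;> simp_all
  · rcases le_or_gt ‖v 3‖ ‖v 2‖ with hv | hv
    · obtain ⟨r, hr, h⟩ := exists_eq_mul_of_norm_le hv
      refine ⟨_, fixesZero_xα₄neg (r := -r) (by simpa), fun i hi => ?_⟩
      rw [act1_xα₄neg]; fin_cases i <;> simp_all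
    · obtain ⟨r, hr, h⟩ := exists_eq_mul_of_norm_le (x := v 2 + v 3) (y := v 3)
        (by rw [add_comm, norm_add_eq_of_lt hv])
      refine ⟨_, (fixesZero_xα₄neg (r := -r) (by simpa)).mul (fixesZero_xα₄ (r := 1) (by simp)),
        fun i hi => ?_⟩
      rw [act1_mul, act1_xα₄, act1_xα₄neg]
      have h' : v 3 + -(r * (v 2 + v 3)) = 0 := by linear_combination h
      clear h hv hn
      fin_cases i <;> simp_all

theorem fixesZero_kill {v : Fin 8 → F} (h7 : v 7 = 0) (hn : octNorm v = 0) :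
    ∃ k, FixesZero k ∧ ∀ i : Fin 8, 2 ≤ i → act1 k v i = 0 := by
  obtain ⟨k₁, f₁, a7, a6⟩ := fixesZero_kill_six h7
  obtain ⟨k₂, f₂, b7, b6, b5⟩ := fixesZero_kill_five a7 a6
  obtain ⟨k₃, f₃, c⟩ := fixesZero_kill_middle b7 b6 b5 (by rw [octNorm_act1, octNorm_act1, hn])
  obtain ⟨k₄, hk₄, d2, -, db, di⟩ := exists_K_act_two (act1 k₃ (act1 k₂ (act1 k₁ v)))
  refine ⟨toSpin8 k₄ * k₃ * k₂ * k₁,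
    ((FixesZero.mul ⟨toSpin8_mem_KH hk₄, db⟩ f₃).mul f₂).mul f₁, fun i hi => ?_⟩
  rw [act1_mul, act1_mul, act1_mul, act1_toSpin8]
  rcases hi.eq_or_lt with rfl | hi
  · exact d2
  · have h3 : 3 ≤ i := by
      rw [Fin.lt_def] at hi; rw [Fin.le_def]
      change 2 < (i : ℕ) at hi; change 3 ≤ (i : ℕ); omega
    rw [di i (c 5 (by decide)) (c 6 (by decide)) h3, c i h3]

theorem exists_KH_act_seven (v : Fin 8 → F) : ∃ k ∈ groupKH F, act1 k v 7 = 0 := by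
  rcases le_or_gt ‖v 7‖ ‖v 6‖ with hv | hv
  · obtain ⟨r, hr, h⟩ := exists_eq_mul_of_norm_le hv
    exact ⟨_, xα₁neg_mem_KH hr, by simp [act1_xα₁neg, h]⟩
  · obtain ⟨r, hr, h⟩ := exists_eq_mul_of_norm_le (x := v 6 - v 7) (y := v 7)
      (by rw [norm_sub_rev, norm_sub_eq_of_lt hv])
    refine ⟨_, mul_mem (xα₁neg_mem_KH hr) (xα₁_mem_KH (r := 1) (by simp)), ?_⟩
    simp only [act1_mul, act1_xα₁, act1_xα₁neg, Matrix.cons_val]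
    linear_combination h

/-- The Iwasawa decomposition of `Spin₈` with respect to `P_H`. -/
theorem exists_parabolicH_mul (h : Spin8 F) :
    ∃ p ∈ parabolicH F, ∃ k ∈ maxCompactH F, h = p * k := by
  have hb : octNorm (bas 0 : Fin 8 → F) = 0 ∧ octNorm (bas 1 : Fin 8 → F) = 0 := by
    constructor <;> simp [octNorm, bas0, bas1]
  obtain ⟨k₁, hk₁, a7⟩ := exists_KH_act_seven (act1 h⁻¹ (bas 0))
  obtain ⟨k₂, f₂, b⟩ := fixesZero_kill a7 (by rw [octNorm_act1, octNorm_act1, hb.1])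
  obtain ⟨k₃, hk₃, c, h₃⟩ := exists_K_act_one b
  set v := act1 (toSpin8 k₃ * k₂ * k₁ * h⁻¹) (bas 0) with hv
  have hv0 : v = c • bas 0 := by
    rw [hv, act1_mul, act1_mul, act1_mul, act1_toSpin8, h₃]
  have hc : c ≠ 0 := by
    rintro rfl
    have : act1 (toSpin8 k₃ * k₂ * k₁ * h⁻¹)⁻¹ v = bas 0 := by rw [hv, act1_inv_act1]
    rw [hv0, zero_smul] at this
    have := congrFun this 0
    simp [act1, bas] at this
  set w := act1 (toSpin8 k₃ * k₂ * k₁ * h⁻¹) (bas 1) with hw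
  have w7 : w 7 = 0 := by
    have e := octPolar_eq_sub v w
    rw [hv, hw, ← act1_add, octNorm_act1, octNorm_act1, octNorm_act1, ← hv, ← hw,
      octPolar_eq_sub, hv0] at e
    simp only [bas0, bas1, Matrix.cons_val, Pi.smul_apply, smul_eq_mul] at e
    have e' : c * w 7 = 0 := by linear_combination e
    exact (mul_eq_zero.1 e').resolve_left hc
  obtain ⟨k₄, f₄, d⟩ := fixesZero_kill w7 (by rw [hw, octNorm_act1, hb.2])
  set k := k₄ * (toSpin8 k₃ * k₂ * k₁) with hk
  have hkK : k ∈ groupKH F :=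
    mul_mem f₄.1 (mul_mem (mul_mem (toSpin8_mem_KH hk₃) f₂.1) hk₁)
  have e0 : act1 (k * h⁻¹) (bas 0) = c • bas 0 := by
    rw [hk, mul_assoc, act1_mul, ← hv, hv0, act1_smul, f₄.2]
  have e1 : ∀ i : Fin 8, 2 ≤ i → act1 (k * h⁻¹) (bas 1) i = 0 := by
    intro i hi
    rw [hk, mul_assoc, act1_mul, ← hw, d i hi]
  set x := act1 (k * h⁻¹) (bas 1) 0
  set z := act1 (k * h⁻¹) (bas 1) 1
  have e1' : act1 (k * h⁻¹) (bas 1) = x • bas 0 + z • bas 1 :=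
    eq_smul_bas_add e1
  have p0 : act1 (h * k⁻¹) (bas 0) = c⁻¹ • bas 0 := by
    have : (bas 0 : Fin 8 → F) = act1 (k * h⁻¹) (c⁻¹ • bas 0) := by
      rw [act1_smul, e0, smul_smul, inv_mul_cancel₀ hc, one_smul]
    conv_lhs => rw [this]
    rw [← act1_mul]
    have e : h * k⁻¹ * (k * h⁻¹) = 1 := by group
    rw [e, act1_one]
  have p1 : bas 1 = x • (c⁻¹ • bas 0) + z • act1 (h * k⁻¹) (bas 1) := by
    rw [← p0, ← act1_smul, ← act1_smul, ← act1_add, ← e1', ← act1_mul]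
    have e : h * k⁻¹ * (k * h⁻¹) = 1 := by group
    rw [e, act1_one]
  have hz : z ≠ 0 := by
    intro hz
    have := congrFun p1 1
    simp [bas0, bas1, hz] at this
  refine ⟨h * k⁻¹, mem_parabolicH_iff.2 fun i hi => ?_, k, hkK, by group⟩
  have hi0 : (bas 0 : Fin 8 → F) i = 0 := by
    rw [bas, Pi.single_apply, if_neg]; rintro rfl; simp at hi
  have hi1 : (bas 1 : Fin 8 → F) i = 0 := by
    rw [bas, Pi.single_apply, if_neg]; rintro rfl; simp at hi
  constructor
  · rw [p0, Pi.smul_apply, hi0, smul_zero]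
  · have := congrFun p1 i
    rw [Pi.add_apply, Pi.smul_apply, Pi.smul_apply, Pi.smul_apply, hi0, hi1, smul_zero, smul_zero,
      zero_add, smul_eq_mul] at this
    exact (mul_eq_zero.1 this.symm).resolve_left hz

/-! ## The spherical section -/

/-- The largest norm of a `2 × 2` minor. -/
def wedgeNorm (v w : Fin 8 → F) : ℝ := ‖fun i j => v i * w j - v j * w i‖

theorem wedgeNorm_le_iff {v w : Fin 8 → F} {c : ℝ} (hc : 0 ≤ c) :
    wedgeNorm v w ≤ c ↔ ∀ i j, ‖v i * w j - v j * w i‖ ≤ c := by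
  simp only [wedgeNorm, pi_norm_le_iff_of_nonneg hc]

theorem norm_minor_le (v w : Fin 8 → F) (i j : Fin 8) : ‖v i * w j - v j * w i‖ ≤ wedgeNorm v w :=
  (wedgeNorm_le_iff (norm_nonneg _)).1 le_rfl i j

theorem wedgeNorm_mulVec_le {A : Matrix (Fin 8) (Fin 8) F} {c : ℝ} (hc : 0 ≤ c)
    (hA : ∀ i j, ‖A i j‖ ≤ c) (v w : Fin 8 → F) :
    wedgeNorm (A *ᵥ v) (A *ᵥ w) ≤ c ^ 2 * wedgeNorm v w := by
  have h0 : 0 ≤ wedgeNorm v w := norm_nonneg _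
  refine (wedgeNorm_le_iff (by positivity)).2 fun i j => ?_
  have : (A *ᵥ v) i * (A *ᵥ w) j - (A *ᵥ v) j * (A *ᵥ w) i =
      ∑ a, ∑ b, A i a * A j b * (v a * w b - v b * w a) := by
    simp only [Matrix.mulVec, dotProduct, Finset.sum_mul_sum, mul_sub, Finset.sum_sub_distrib]
    congr 1
    · exact Finset.sum_congr rfl fun a _ => Finset.sum_congr rfl fun b _ => by ring
    · rw [Finset.sum_comm]
      exact Finset.sum_congr rfl fun a _ => Finset.sum_congr rfl fun b _ => by ring
  rw [this]
  refine IsUltrametricDist.norm_sum_le_of_forall_le_of_nonneg (by positivity) fun a _ =>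
    IsUltrametricDist.norm_sum_le_of_forall_le_of_nonneg (by positivity) fun b _ => ?_
  rw [norm_mul, norm_mul, sq]
  exact mul_le_mul (mul_le_mul (hA i a) (hA j b) (norm_nonneg _) hc) (norm_minor_le v w a b)
    (norm_nonneg _) (by positivity)

theorem wedgeNorm_combination (v w : Fin 8 → F) (a b c d : F) :
    wedgeNorm (a • v + b • w) (c • v + d • w) = ‖a * d - b * c‖ * wedgeNorm v w := by
  have : (fun i j => (a • v + b • w) i * (c • v + d • w) j - (a • v + b • w) j * (c • v + d • w) i) =
      (a * d - b * c) • fun i j => v i * w j - v j * w i := by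
    ext i j
    simp only [Pi.add_apply, Pi.smul_apply, smul_eq_mul]
    ring
  rw [wedgeNorm, this, norm_smul]
  rfl

theorem wedgeNorm_act1_KH {k : Spin8 F} (hk : k ∈ groupKH F) (v w : Fin 8 → F) :
    wedgeNorm (act1 k v) (act1 k w) = wedgeNorm v w := by
  have h : ∀ k : Spin8 F, k ∈ groupKH F → ∀ v w, wedgeNorm (act1 k v) (act1 k w) ≤ wedgeNorm v w :=
    fun k hk v w => by
      have := wedgeNorm_mulVec_le zero_le_one (fun i j => (hk.1 i j).1) v w
      rwa [one_pow, one_mul] at this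
  refine le_antisymm (h k hk v w) ?_
  simpa using h k⁻¹ (inv_mem hk) (act1 k v) (act1 k w)

theorem wedgeNorm_act_K {k : G2 F} (hk : k ∈ groupK F) (v w : Fin 8 → F) :
    wedgeNorm (act k v) (act k w) = wedgeNorm v w := wedgeNorm_act1_KH (toSpin8_mem_KH hk) v w

theorem sphericalSection_eq (s : ℂ) (h : Spin8 F) :
    0 < wedgeNorm (act1 h⁻¹ (bas 0)) (act1 h⁻¹ (bas 1)) ∧
    sphericalSection s h =
      ((wedgeNorm (act1 h⁻¹ (bas 0)) (act1 h⁻¹ (bas 1)) : ℝ) : ℂ) ^ (-(5 * s)) := by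
  have hp := exists_parabolicH_mul h
  rw [sphericalSection, dif_pos hp]
  obtain ⟨hP, k, hk, hh⟩ := hp.choose_spec
  set p := hp.choose
  rw [mem_parabolicH_iff] at hP
  have e0 : act1 p (bas 0) = p.1.1.1 0 0 • bas 0 + p.1.1.1 1 0 • bas 1 := by
    rw [← act1_bas, ← act1_bas]
    exact eq_smul_bas_add fun i hi => (hP i hi).1
  have e1 : act1 p (bas 1) = p.1.1.1 0 1 • bas 0 + p.1.1.1 1 1 • bas 1 := by
    rw [← act1_bas, ← act1_bas]
    exact eq_smul_bas_add fun i hi => (hP i hi).2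
  have hN : wedgeNorm (act1 h⁻¹ (bas 0)) (act1 h⁻¹ (bas 1)) =
      wedgeNorm (act1 p⁻¹ (bas 0)) (act1 p⁻¹ (bas 1)) := by
    rw [hh, _root_.mul_inv_rev, act1_mul, act1_mul, wedgeNorm_act1_KH (inv_mem hk)]
  have hbb : wedgeNorm (bas 0 : Fin 8 → F) (bas 1) = 1 := by
    refine le_antisymm ((wedgeNorm_le_iff zero_le_one).2 fun i j => ?_) ?_
    · rw [bas0, bas1]; fin_cases i <;> fin_cases j <;> simp
    · refine le_trans ?_ (norm_minor_le _ _ 0 1)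
      simp [bas]
  set d := p.1.1.1 0 0 * p.1.1.1 1 1 - p.1.1.1 0 1 * p.1.1.1 1 0 with hd
  have hdN : ‖d‖ * wedgeNorm (act1 p⁻¹ (bas 0)) (act1 p⁻¹ (bas 1)) = 1 := by
    have := wedgeNorm_combination (act1 p⁻¹ (bas 0)) (act1 p⁻¹ (bas 1)) (p.1.1.1 0 0) (p.1.1.1 1 0)
      (p.1.1.1 0 1) (p.1.1.1 1 1)
    rw [← act1_smul, ← act1_smul, ← act1_smul, ← act1_smul, ← act1_add, ← act1_add, ← e0, ← e1,
      act1_inv_act1, act1_inv_act1, hbb] at this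
    rw [this, hd, mul_comm (p.1.1.1 1 0)]
  have hd0 : 0 < ‖d‖ := by
    refine lt_of_le_of_ne (norm_nonneg _) fun h => ?_
    rw [← h, zero_mul] at hdN
    exact zero_ne_one hdN
  have hw : wedgeNorm (act1 p⁻¹ (bas 0)) (act1 p⁻¹ (bas 1)) = ‖d‖⁻¹ :=
    eq_inv_of_mul_eq_one_right hdN
  rw [hN, hw]
  refine ⟨inv_pos.2 hd0, ?_⟩
  rw [modulusH, ← hd, cpow_ofReal_pow hd0, cpow_ofReal_inv hd0]
  norm_num

end SpinLattice

variable {F : Type*} [NontriviallyNormedField F] [IsUltrametricDist F]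

local notation "𝐪" => ((residueCard F : ℕ) : ℝ)
local notation "𝐐" => ((residueCard F : ℕ) : ℂ)

section FunctionF

/-! ## The function `F*` -/

/-- The size of `μ x_{α+β}(ρ) g` modulo `P_H` and the maximal compact subgroup. -/
def heightF (ρ : F) (g : G2 F) : ℝ :=
  wedgeNorm (act g⁻¹ (bas 0 - bas 1)) (act g⁻¹ (bas 4 - ρ • bas 1))

theorem wedgeNorm_neg_right (v w : Fin 8 → F) : wedgeNorm v (-w) = wedgeNorm v w := by
  have := wedgeNorm_combination v w 1 0 0 (-1)
  simpa using this

theorem act_neg (g : G2 F) (v : Fin 8 → F) : act g (-v) = -act g v := Matrix.mulVec_neg _ _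

theorem sphericalSection_muElt (s : ℂ) (g : G2 F) (r : F) : 0 < heightF r g ∧
    sphericalSection s (muElt F * toSpin8 (xAB r * g)) = ((heightF r g : ℝ) : ℂ) ^ (-(5 * s)) := by
  have h := sphericalSection_eq s (muElt F * toSpin8 (xAB r * g))
  have hx : (xAB r : G2 F) = uElt ![0, r, 0, 0, 0] := by
    have h1 : (xB 0 : G2 F) = 1 := ext_act fun v => by
      rw [act_xB, act_one]; apply ext8 <;> simp
    have h2 : (x2AB 0 : G2 F) = 1 := ext_act fun v => by
      rw [act_one]; exact (mat2AB_mulVec 0 v).trans (by apply ext8 <;> simp)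
    have h3 : (x3AB 0 : G2 F) = 1 := ext_act fun v => by
      rw [act_one]; exact (mat3AB_mulVec 0 v).trans (by apply ext8 <;> simp)
    have h4 : (x3A2B 0 : G2 F) = 1 := ext_act fun v => by
      rw [act_one]; exact (mat3A2B_mulVec 0 v).trans (by apply ext8 <;> simp)
    simp [uElt, h1, h2, h3, h4]
  have hinv : ∀ v, act1 (muElt F * toSpin8 (xAB r * g))⁻¹ v =
      act g⁻¹ (act (uElt (invU ![0, r, 0, 0, 0])) (act1 (muElt F)⁻¹ v)) := by
    intro v
    rw [← act_mul, ← uElt_inv, ← hx, ← _root_.mul_inv_rev, _root_.mul_inv_rev (muElt F), act1_mul]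
    rfl
  have e0 : act (uElt (invU ![0, r, 0, 0, 0])) ![1, -1, 0, 0, 0, 0, 0, 0] =
      (bas 0 - bas 1 : Fin 8 → F) := by
    rw [act_uElt, bas0, bas1]; apply ext8 <;> simp
  have e1 : act (uElt (invU ![0, r, 0, 0, 0])) ![0, 0, 0, 0, -1, 0, 0, 0] =
      (-(bas 4 - r • bas 1) : Fin 8 → F) := by
    rw [act_uElt, bas4, bas1]; apply ext8 <;> simp [invU]
  rw [hinv, hinv, act1_muElt_inv_bas0, act1_muElt_inv_bas1, e0, e1, act_neg,
    wedgeNorm_neg_right] at h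
  exact h

theorem integrandF_eq (ψ : AddChar F Circle) (s : ℂ) (g : G2 F) (r : F) :
    integrandF ψ s g r = ((heightF r g : ℝ) : ℂ) ^ (-(5 * s)) * star (ψ r : ℂ) := by
  rw [integrandF, (sphericalSection_muElt s g r).2]

theorem heightF_mul_K (ρ : F) (g : G2 F) {k : G2 F} (hk : k ∈ groupK F) :
    heightF ρ (g * k) = heightF ρ g := by
  rw [heightF, _root_.mul_inv_rev, act_mul, act_mul, wedgeNorm_act_K (inv_mem hk)]
  rfl

theorem heightF_uElt_mul (ρ : F) (r : Fin 5 → F) (g : G2 F) :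
    heightF ρ (uElt r * g) = heightF (ρ + (r 1 + r 2)) g := by
  have e0 : act (uElt r)⁻¹ (bas 0 - bas 1) = bas 0 - bas 1 := by
    rw [uElt_inv, act_uElt, bas0, bas1]; apply ext8 <;> simp
  have e1 : act (uElt r)⁻¹ (bas 4 - ρ • bas 1) =
      (-r 2) • (bas 0 - bas 1) + (1 : F) • (bas 4 - (ρ + (r 1 + r 2)) • bas 1) := by
    rw [uElt_inv, act_uElt, bas0, bas1, bas4, invU]
    apply ext8 <;> simp <;> ring
  have h := wedgeNorm_combination (act g⁻¹ (bas 0 - bas 1))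
    (act g⁻¹ (bas 4 - (ρ + (r 1 + r 2)) • bas 1)) 1 0 (-r 2) 1
  rw [heightF, _root_.mul_inv_rev, act_mul, act_mul, e0, e1, act_add, act_smul, act_smul]
  simpa [heightF] using h

theorem wedgeNorm_special (a b c d e f : F) :
    wedgeNorm ![a, b, 0, 0, 0, 0, 0, 0] ![c, d, e, 0, f, 0, 0, 0] =
      max ‖a * d - b * c‖ (max ‖a‖ ‖b‖ * max ‖e‖ ‖f‖) := by
  have ha : ‖a‖ ≤ max ‖a‖ ‖b‖ := le_max_left _ _
  have hb : ‖b‖ ≤ max ‖a‖ ‖b‖ := le_max_right _ _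
  have he : ‖e‖ ≤ max ‖e‖ ‖f‖ := le_max_left _ _
  have hf : ‖f‖ ≤ max ‖e‖ ‖f‖ := le_max_right _ _
  have hm : ∀ x y : F, ‖x‖ ≤ max ‖a‖ ‖b‖ → ‖y‖ ≤ max ‖e‖ ‖f‖ →
      ‖x‖ * ‖y‖ ≤ max ‖a * d - b * c‖ (max ‖a‖ ‖b‖ * max ‖e‖ ‖f‖) := by
    intro x y hx hy
    refine le_trans ?_ (le_max_right _ _)
    exact mul_le_mul hx hy (norm_nonneg _) ((norm_nonneg _).trans hx)
  have hd : ‖a * d - b * c‖ ≤ max ‖a * d - b * c‖ (max ‖a‖ ‖b‖ * max ‖e‖ ‖f‖) := le_max_left _ _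
  have hd' : ‖b * c - a * d‖ ≤ max ‖a * d - b * c‖ (max ‖a‖ ‖b‖ * max ‖e‖ ‖f‖) := by
    rwa [norm_sub_rev]
  have h0 := (norm_nonneg _).trans hd
  refine le_antisymm ((wedgeNorm_le_iff h0).2 fun i j => ?_) ?_
  · have hae := hm a e ha he
    have haf := hm a f ha hf
    have hbe := hm b e hb he
    have hbf := hm b f hb hf
    generalize max ‖a * d - b * c‖ (max ‖a‖ ‖b‖ * max ‖e‖ ‖f‖) = M at *
    fin_cases i <;> fin_cases j <;> simp only [Fin.zero_eta, Fin.mk_one, Fin.reduceFinMk,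
      Matrix.cons_val, mul_zero, zero_mul, sub_zero, zero_sub, norm_neg, norm_mul, norm_zero,
      sub_self] <;> first | exact h0 | assumption | (rw [mul_comm a, mul_comm b] at *; assumption)
  · refine max_le (norm_minor_le ![a, b, 0, 0, 0, 0, 0, 0] ![c, d, e, 0, f, 0, 0, 0] 0 1) ?_
    have n02 := norm_minor_le ![a, b, 0, 0, 0, 0, 0, 0] ![c, d, e, 0, f, 0, 0, 0] 0 2
    have n04 := norm_minor_le ![a, b, 0, 0, 0, 0, 0, 0] ![c, d, e, 0, f, 0, 0, 0] 0 4
    have n12 := norm_minor_le ![a, b, 0, 0, 0, 0, 0, 0] ![c, d, e, 0, f, 0, 0, 0] 1 2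
    have n14 := norm_minor_le ![a, b, 0, 0, 0, 0, 0, 0] ![c, d, e, 0, f, 0, 0, 0] 1 4
    simp only [Matrix.cons_val, zero_mul, sub_zero, norm_mul] at n02 n04 n12 n14
    rcases max_choice ‖a‖ ‖b‖ with h | h <;> rcases max_choice ‖e‖ ‖f‖ with h' | h' <;>
      rw [h, h'] <;> assumption

/-- The factor `max(1, |y| |t₂ / t₁²|)`. -/
def heightA (y : F) (t₁ t₂ : Fˣ) : ℝ := max 1 (‖y‖ * (‖(t₂ : F)‖ / ‖(t₁ : F)‖ ^ 2))

theorem heightF_torus (ρ y : F) (t₁ t₂ : Fˣ) :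
    heightF ρ (xA y * torusElt t₁ t₂) =
      ‖(t₂ : F)‖⁻¹ * max (‖(t₁ : F)‖ * heightA y t₁ t₂ * heightA (1 + y) t₁ t₂) ‖ρ‖ := by
  have n1 := t₁.ne_zero
  have n2 := t₂.ne_zero
  have e0 : act (xA y * torusElt t₁ t₂)⁻¹ (bas 0 - bas 1) =
      ![(1 + y) / t₁, -(t₁ / t₂), 0, 0, 0, 0, 0, 0] := by
    rw [_root_.mul_inv_rev, act_mul, xA_inv, torusElt_inv, act_torusElt, act_xA, bas0, bas1]
    apply ext8 <;> simp <;> field_simp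
  have e1 : act (xA y * torusElt t₁ t₂)⁻¹ (bas 4 - ρ • bas 1) =
      ![ρ * y / t₁, -(ρ * (t₁ / t₂)), y * t₂ / t₁ ^ 2, 0, 1, 0, 0, 0] := by
    rw [_root_.mul_inv_rev, act_mul, xA_inv, torusElt_inv, act_torusElt, act_xA, bas4, bas1]
    apply ext8 <;> simp <;> field_simp
  rw [heightF, e0, e1, wedgeNorm_special]
  have e2 : (1 + y) / (t₁ : F) * -(ρ * (t₁ / t₂)) - -(t₁ / t₂) * (ρ * y / t₁) = -(ρ / t₂) := by
    field_simp; ring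
  rw [e2, norm_neg, norm_neg, norm_div, norm_div, norm_div, norm_div, norm_mul, norm_pow, norm_one]
  have p1 : 0 < ‖(t₁ : F)‖ := norm_pos_iff.2 n1
  have p2 : 0 < ‖(t₂ : F)‖ := norm_pos_iff.2 n2
  set A := ‖(t₁ : F)‖
  set B := ‖(t₂ : F)‖
  have e3 : max (‖1 + y‖ / A) (A / B) = B⁻¹ * (A * heightA (1 + y) t₁ t₂) := by
    rw [heightA, ← mul_assoc, mul_max_of_nonneg _ _ (by positivity), max_comm]
    congr 1
    · field_simp
    · change _ = B⁻¹ * A * (_ * (B / A ^ 2)); field_simp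
  have e4 : max (‖y‖ * B / A ^ 2) 1 = heightA y t₁ t₂ := by
    rw [heightA, max_comm, mul_div_assoc]
  rw [e3, e4, mul_max_of_nonneg _ _ (by positivity), max_comm]
  congr 1
  · ring
  · rw [div_eq_inv_mul]

theorem heightA_pos (y : F) (t₁ t₂ : Fˣ) : 0 < heightA y t₁ t₂ := lt_max_of_lt_left one_pos

/-- The exponent of `max(1, |y| q^e)`. -/
def logA (y : F) (e : ℤ) : ℤ := Int.log (residueCard F) (max 1 (‖y‖ * 𝐪 ^ e))

theorem zpow_logA (hV : IsNormalizedNorm F) (y : F) (e : ℤ) :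
    𝐪 ^ logA y e = max 1 (‖y‖ * 𝐪 ^ e) := by
  have hq := q_pos hV
  have hb : 1 < residueCard F := two_le_residueCard hV
  obtain ⟨n, hn⟩ : ∃ n : ℤ, max 1 (‖y‖ * 𝐪 ^ e) = 𝐪 ^ n := by
    rcases le_or_gt (‖y‖ * 𝐪 ^ e) 1 with h | h
    · exact ⟨0, by rw [max_eq_left h, zpow_zero]⟩
    · obtain ⟨m, hm⟩ := norm_eq_zpow hV (x := y)
        (by rintro rfl; simp at h; linarith)
      exact ⟨m + e, by rw [max_eq_right h.le, hm, zpow_add₀ hq.ne']⟩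
  rw [logA, hn, Int.log_zpow hb]

theorem logA_nonneg (hV : IsNormalizedNorm F) (y : F) (e : ℤ) : 0 ≤ logA y e := by
  by_contra h
  have h1 := zpow_logA hV y e
  have h2 : 𝐪 ^ logA y e < 1 := zpow_lt_one_of_neg₀ (one_lt_q hV) (by omega)
  rw [h1] at h2
  exact absurd (le_max_left _ _) (not_le.2 h2)

theorem logA_eq_zero_iff (hV : IsNormalizedNorm F) (y : F) (e : ℤ) :
    logA y e = 0 ↔ ‖y‖ ≤ 𝐪 ^ (-e) := by
  have hq := q_pos hV
  have h1 := zpow_logA hV y e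
  have h2 : ‖y‖ ≤ 𝐪 ^ (-e) ↔ ‖y‖ * 𝐪 ^ e ≤ 1 := by
    rw [_root_.zpow_neg, ← one_div, le_div_iff₀ (by positivity)]
  rw [h2, ← max_eq_left_iff, ← h1]
  constructor
  · intro h; rw [h, zpow_zero]
  · intro h
    rw [← zpow_zero 𝐪] at h
    exact zpow_right_injective₀ hq (one_lt_q hV).ne' h

theorem logA_eq (hV : IsNormalizedNorm F) {y : F} {n e : ℤ} (hy : ‖y‖ = 𝐪 ^ n) (h : 0 ≤ n + e) :
    logA y e = n + e := by
  have hq := q_pos hV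
  have h1 := zpow_logA hV y e
  rw [hy, ← zpow_add₀ hq.ne', max_eq_right (one_le_zpow₀ (one_lt_q hV).le h)] at h1
  exact zpow_right_injective₀ hq (one_lt_q hV).ne' h1

theorem heightA_eq (hV : IsNormalizedNorm F) (y : F) {t₁ t₂ : Fˣ} {a b : ℤ}
    (h1 : ‖(t₁ : F)‖ = 𝐪 ^ (-a)) (h2 : ‖(t₂ : F)‖ = 𝐪 ^ (-(a + b))) :
    heightA y t₁ t₂ = 𝐪 ^ logA y (a - b) := by
  have hq := q_pos hV
  rw [zpow_logA hV, heightA, h1, h2, ← zpow_natCast, ← _root_.zpow_mul, ← zpow_sub₀ hq.ne']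
  congr 3
  push_cast; ring

theorem localZeta_mul (hV : IsNormalizedNorm F) {z : ℂ} (hz : 0 < z.re) :
    localZeta F z * (1 - (residueCard F : ℂ) ^ (-z)) = 1 := by
  rw [localZeta, inv_mul_cancel₀]
  intro h
  have h1 : (residueCard F : ℂ) ^ (-z) = 1 := (sub_eq_zero.1 h).symm
  have h2 := congrArg norm h1
  have : (residueCard F : ℂ) = ((𝐪 : ℝ) : ℂ) := by simp
  rw [this, Complex.norm_cpow_eq_rpow_re_of_pos (q_pos hV), norm_one, Complex.neg_re] at h2
  exact absurd h2 (Real.rpow_lt_one_of_one_lt_of_neg (one_lt_q hV) (by linarith)).ne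

variable [ProperSpace F] [MeasurableSpace F] [BorelSpace F] {dr : Measure F} [dr.IsAddHaarMeasure]

theorem functionF_mul_K (ψ : AddChar F Circle) (s : ℂ) (g : G2 F) {k : G2 F} (hk : k ∈ groupK F) :
    functionF ψ dr s (g * k) = functionF ψ dr s g := by
  simp only [functionF, integrandF_eq, heightF_mul_K _ _ hk]

theorem integrandF_uElt_mul (ψ : AddChar F Circle) (s : ℂ) (r : Fin 5 → F) (g : G2 F) (x : F) :
    integrandF ψ s (uElt r * g) x = splitChar ψ r * integrandF ψ s g (x + (r 1 + r 2)) := by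
  rw [integrandF_eq, integrandF_eq, heightF_uElt_mul, AddChar_coe_add, star_mul, splitChar]
  have h : (ψ (r 1 + r 2) : ℂ) * star (ψ (r 1 + r 2) : ℂ) = 1 := by
    rw [Complex.star_def, Complex.mul_conj, Complex.normSq_eq_norm_sq, norm_AddChar]; simp
  linear_combination (-((heightF (x + (r 1 + r 2)) g : ℂ) ^ (-(5 * s)) * star (ψ x : ℂ))) * h

theorem functionF_uElt_mul (ψ : AddChar F Circle) (s : ℂ) (r : Fin 5 → F) (g : G2 F) :
    functionF ψ dr s (uElt r * g) = splitChar ψ r * functionF ψ dr s g := by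
  simp only [functionF, integrandF_uElt_mul, integral_const_mul]
  rw [integral_add_right_eq_self (μ := dr) (fun x => integrandF ψ s g x) (r 1 + r 2)]
  ring

theorem integrandF_torus (ψ : AddChar F Circle) (s : ℂ) (y : F) (t₁ t₂ : Fˣ) (r : F) :
    integrandF ψ s (xA y * torusElt t₁ t₂) r = ((‖(t₂ : F)‖ : ℝ) : ℂ) ^ (5 * s) *
      (((max (‖(t₁ : F)‖ * heightA y t₁ t₂ * heightA (1 + y) t₁ t₂) ‖r‖ : ℝ) : ℂ) ^ (-(5 * s)) *
        star (ψ r : ℂ)) := by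
  have p1 : 0 < ‖(t₁ : F)‖ := norm_pos_iff.2 t₁.ne_zero
  have p2 : 0 < ‖(t₂ : F)‖ := norm_pos_iff.2 t₂.ne_zero
  have h1 := heightA_pos y t₁ t₂
  have h2 := heightA_pos (1 + y) t₁ t₂
  rw [integrandF_eq, heightF_torus, Complex.ofReal_mul,
    Complex.mul_cpow_ofReal_nonneg (by positivity) (le_max_of_le_right (norm_nonneg _)),
    cpow_ofReal_inv p2, neg_neg, mul_assoc]

theorem integrable_integrandF (hV : IsNormalizedNorm F) (hdr : dr (Metric.closedBall 0 1) = 1)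
    {ψ : AddChar F Circle} (hψ : Unramified ψ) {s : ℂ} (hs : 1 < s.re) (g : G2 F) :
    Integrable (integrandF ψ s g) dr := by
  obtain ⟨r, y, t₁, t₂, k, hk, rfl⟩ := iwasawa g
  have h : Integrable (integrandF ψ s (xA y * torusElt t₁ t₂)) dr := by
    have e : integrandF ψ s (xA y * torusElt t₁ t₂) = _ :=
      funext fun r => integrandF_torus ψ s y t₁ t₂ r
    rw [e]
    refine (integrable_radial hV hdr hψ (w := 5 * s) ?_ ?_).const_mul _
    · simp; linarith
    · have := heightA_pos y t₁ t₂
      have := heightA_pos (1 + y) t₁ t₂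
      have : 0 < ‖(t₁ : F)‖ := norm_pos_iff.2 t₁.ne_zero
      positivity
  have e : integrandF ψ s (uElt r * xA y * torusElt t₁ t₂ * k) =
      fun x => splitChar ψ r * integrandF ψ s (xA y * torusElt t₁ t₂) (x + (r 1 + r 2)) := by
    ext x
    rw [← integrandF_uElt_mul, ← mul_assoc, integrandF_eq, integrandF_eq, heightF_mul_K _ _ hk]
  rw [e]
  exact (h.comp_add_right _).const_mul _

/-- The value of `F*` on `x_α(y) T`. -/
theorem functionF_torus (hV : IsNormalizedNorm F) (hdr : dr (Metric.closedBall 0 1) = 1)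
    {ψ : AddChar F Circle} (hψ : Unramified ψ) {s : ℂ} (hs : 1 < s.re) (y : F) (t₁ t₂ : Fˣ)
    {k : ℤ} (hk : ‖(t₁ : F)‖ * heightA y t₁ t₂ * heightA (1 + y) t₁ t₂ = 𝐪 ^ (-k)) :
    functionF ψ dr s (xA y * torusElt t₁ t₂) = localZeta F (5 * s - 1) ^ 2 *
      localZeta F (10 * s - 4) * ((‖(t₂ : F)‖ : ℝ) : ℂ) ^ (5 * s) *
        geomS ((residueCard F : ℂ) ^ (5 * s - 1)) k := by
  have hz := localZeta_mul hV (z := 5 * s) (by simp; linarith)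
  have hrad := integral_radial hV hdr hψ (w := 5 * s) (by simp; linarith) k
  simp only [functionF, integrandF_torus, integral_const_mul, hk]
  rw [hrad]
  linear_combination (localZeta F (5 * s - 1) ^ 2 *
      localZeta F (10 * s - 4) * ((‖(t₂ : F)‖ : ℝ) : ℂ) ^ (5 * s) *
        geomS ((residueCard F : ℂ) ^ (5 * s - 1)) k) * hz

/-- The value of `F*` on `x_α(y) T` in terms of exponents. -/
theorem functionF_exponents (hV : IsNormalizedNorm F) (hdr : dr (Metric.closedBall 0 1) = 1)
    {ψ : AddChar F Circle} (hψ : Unramified ψ) {s : ℂ} (hs : 1 < s.re) (y : F) {t₁ t₂ : Fˣ}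
    {a b : ℤ} (h1 : ‖(t₁ : F)‖ = 𝐪 ^ (-a)) (h2 : ‖(t₂ : F)‖ = 𝐪 ^ (-(a + b))) :
    functionF ψ dr s (xA y * torusElt t₁ t₂) = localZeta F (5 * s - 1) ^ 2 *
      localZeta F (10 * s - 4) * ((residueCard F : ℂ) ^ (-(5 * s))) ^ (a + b) *
        geomS ((residueCard F : ℂ) ^ (5 * s - 1)) (a - logA y (a - b) - logA (1 + y) (a - b)) := by
  have hq := q_pos hV
  rw [functionF_torus hV hdr hψ hs y t₁ t₂ (k := a - logA y (a - b) - logA (1 + y) (a - b))]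
  · rw [h2, cpow_zpow_q hV, Complex.cpow_neg, _root_.zpow_neg, _root_.inv_zpow]
  · rw [heightA_eq hV y h1 h2, heightA_eq hV (1 + y) h1 h2, h1, ← zpow_add₀ hq.ne',
      ← zpow_add₀ hq.ne']
    congr 1; ring

end FunctionF

section Topology

/-! ## Continuity of maps to `G₂` -/

theorem octPolar_bas (i : Fin 8) (w : Fin 8 → F) :
    octPolar (bas i.rev) w = ![-1, -1, -1, 1, 1, -1, -1, -1] i * w i := by
  fin_cases i
  · change octPolar (bas 7) w = -1 * w 0; simp [octPolar, bas7]
  · change octPolar (bas 6) w = -1 * w 1; simp [octPolar, bas6]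
  · change octPolar (bas 5) w = -1 * w 2; simp [octPolar, bas5]
  · change octPolar (bas 4) w = 1 * w 3; simp [octPolar, bas4]
  · change octPolar (bas 3) w = 1 * w 4; simp [octPolar, bas3]
  · change octPolar (bas 2) w = -1 * w 5; simp [octPolar, bas2]
  · change octPolar (bas 1) w = -1 * w 6; simp [octPolar, bas1]
  · change octPolar (bas 0) w = -1 * w 7; simp [octPolar, bas0]

theorem inv_apply (g : G2 F) (i j : Fin 8) : (g⁻¹).1.1 i j =
    ![-1, -1, -1, 1, 1, -1, -1, -1] i * ![-1, -1, -1, 1, 1, -1, -1, -1] j.rev *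
      g.1.1 j.rev i.rev := by
  have h : (![-1, -1, -1, 1, 1, -1, -1, -1] : Fin 8 → F) i *
      ![-1, -1, -1, 1, 1, -1, -1, -1] i = 1 := by fin_cases i <;> simp
  have h1 : octPolar (bas i.rev) (act g⁻¹ (bas j)) = octPolar (bas j) (act g (bas i.rev)) := by
    rw [← octPolar_act' g, act_act_inv, octPolar_comm]
  have h2 := octPolar_bas j.rev (act g (bas i.rev))
  rw [Fin.rev_rev, ← h1, octPolar_bas, act_bas, act_bas] at h2
  rw [mul_assoc, ← h2, ← mul_assoc, h, one_mul]

theorem continuous_of_entries {X : Type*} [TopologicalSpace X] {f : X → G2 F}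
    (h : ∀ i j, Continuous fun x => (f x).1.1 i j) : Continuous f := by
  refine Continuous.subtype_mk (f := fun x => (f x).1) (Units.continuous_iff.2 ⟨?_, ?_⟩) _
  · exact continuous_matrix h
  · refine continuous_matrix fun i j => ?_
    have : (fun x => ((f x).1⁻¹).1 i j) = fun x => ![-1, -1, -1, 1, 1, -1, -1, -1] i *
        ![-1, -1, -1, 1, 1, -1, -1, -1] j.rev * (f x).1.1 j.rev i.rev :=
      funext fun x => inv_apply (f x) i j
    rw [this]
    exact continuous_const.mul (h _ _)

theorem continuous_uElt : Continuous (uElt : (Fin 5 → F) → G2 F) := by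
  refine continuous_of_entries fun i j => ?_
  simp only [← act_bas, act_uElt]
  fin_cases i <;> simp only [Fin.zero_eta, Fin.mk_one, Fin.reduceFinMk, Matrix.cons_val] <;> fun_prop

theorem continuous_xA : Continuous (xA : F → G2 F) := by
  refine continuous_of_entries fun i j => ?_
  simp only [← act_bas, act_xA]
  fin_cases i <;> simp only [Fin.zero_eta, Fin.mk_one, Fin.reduceFinMk, Matrix.cons_val] <;> fun_prop

/-- The unipotent radical of the Borel subgroup. -/
def nElt (r : Fin 6 → F) : G2 F := xA (r 0) * uElt fun i => r i.succ

theorem continuous_nElt : Continuous (nElt : (Fin 6 → F) → G2 F) :=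
  (continuous_xA.comp (continuous_apply 0)).mul
    (continuous_uElt.comp (continuous_pi fun i => continuous_apply i.succ))

/-- Functions which are invariant under right multiplication by `K`. -/
def RightK {X : Type*} (f : G2 F → X) : Prop := ∀ k ∈ groupK F, ∀ g, f (g * k) = f g

theorem RightK.continuous {X : Type*} [TopologicalSpace X] {f : G2 F → X} (hf : RightK f) :
    Continuous f := by
  rw [continuous_iff_continuousAt]
  intro g
  have hU : (fun x => g⁻¹ * x) ⁻¹' (groupK F : Set (G2 F)) ∈ nhds g :=
    (isOpen_groupK.preimage (continuous_const.mul continuous_id)).mem_nhds (by simp)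
  have : f =ᶠ[nhds g] fun _ => f g := by
    filter_upwards [hU] with x hx
    rw [← hf _ hx g, mul_inv_cancel_left]
  exact this.continuousAt

theorem RightK.comp_mul_left {X : Type*} {f : G2 F → X} (hf : RightK f) (m : G2 F) :
    RightK fun x => f (m * x) := fun k hk g => by
  change f (m * (g * k)) = f (m * g)
  rw [← mul_assoc, hf k hk]

variable [ProperSpace F]

instance : SecondCountableTopology (G2 F) := by
  have : SecondCountableTopology (Matrix (Fin 8) (Fin 8) F) :=
    inferInstanceAs (SecondCountableTopology (Fin 8 → Fin 8 → F))
  have : SecondCountableTopology (Matrix (Fin 8) (Fin 8) F)ᵐᵒᵖ :=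
    MulOpposite.opHomeomorph.symm.isEmbedding.secondCountableTopology
  have : SecondCountableTopology (GL (Fin 8) F) :=
    Units.isEmbedding_embedProduct.secondCountableTopology
  exact Topology.IsEmbedding.subtypeVal.secondCountableTopology

instance : LocallyCompactSpace (G2 F) := locallyCompactSpace_G2

/-! ## Unimodularity -/

variable [MeasurableSpace (G2 F)] [BorelSpace (G2 F)] (μ : Measure (G2 F)) [μ.IsHaarMeasure]

theorem measure_groupK_ne_top : μ (groupK F) ≠ ⊤ := isCompact_groupK.measure_ne_top

theorem measure_groupK_ne_zero : μ (groupK F) ≠ 0 :=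
  (isOpen_groupK.measure_pos μ ⟨1, one_mem _⟩).ne'

theorem modularCharacter_eq_one (h2 : ‖(2 : F)‖ = 1) (g : G2 F) :
    Measure.modularCharacter g = 1 := by
  have hK : ∀ k ∈ groupK F, Measure.modularCharacter k = 1 := by
    intro k hk
    have h := Measure.map_right_mul_eq_modularCharacterFun_smul (Measure.haar (G := G2 F)) k
    have h' := congrArg (fun m : Measure (G2 F) => m (groupK F)) h
    rw [Measure.map_apply (measurable_mul_const k) isOpen_groupK.measurableSet] at h'
    have e : (fun x => x * k) ⁻¹' (groupK F : Set (G2 F)) = groupK F := by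
      ext x; exact Subgroup.mul_mem_cancel_right _ hk
    rw [e, Measure.smul_apply] at h'
    have h0 := measure_groupK_ne_zero (Measure.haar (G := G2 F))
    have ht := measure_groupK_ne_top (Measure.haar (G := G2 F))
    set M := Measure.haar (G := G2 F) (groupK F)
    have : ((Measure.modularCharacterFun k : NNReal) : ENNReal) * M = 1 * M := by
      rw [one_mul]; exact h'.symm
    have := (ENNReal.mul_left_inj h0 ht).1 this
    exact_mod_cast this
  obtain ⟨t₁, t₂, -, k, hk, k', hk', rfl⟩ := cartan h2 g
  rw [map_mul, map_mul, hK k hk, hK k' hk', one_mul, mul_one]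
  have h := congrArg Measure.modularCharacter (weylLong_mul_torusElt t₁ t₂)
  rw [map_mul, map_mul, hK _ weylLong_mem_K, one_mul, mul_one, ← torusElt_inv] at h
  have h1 : Measure.modularCharacter (torusElt t₁ t₂) * Measure.modularCharacter (torusElt t₁ t₂)
      = 1 := by
    nth_rewrite 2 [h]
    rw [← map_mul, mul_inv_cancel, map_one]
  generalize Measure.modularCharacter (torusElt t₁ t₂) = x at h1
  have : (x : ℝ) * x = 1 := by exact_mod_cast h1
  have hx : (0 : ℝ) ≤ x := x.2
  have : (x : ℝ) = 1 := by nlinarith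
  exact_mod_cast this

theorem isMulRightInvariant (h2 : ‖(2 : F)‖ = 1) : μ.IsMulRightInvariant := by
  refine ⟨fun g => ?_⟩
  have h := Measure.map_right_mul_eq_modularCharacterFun_smul μ g
  have h1 : Measure.modularCharacterFun g = 1 := modularCharacter_eq_one h2 g
  rw [h, h1, one_smul]

theorem isInvInvariant (h2 : ‖(2 : F)‖ = 1) : μ.IsInvInvariant := by
  have := isMulRightInvariant μ h2
  refine ⟨?_⟩
  have h := Measure.isMulLeftInvariant_eq_smul μ.inv μ
  have hK : μ.inv (groupK F) = μ (groupK F) := by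
    rw [Measure.inv_apply]
    congr 1
    ext x; simp
  have h' := congrArg (fun m : Measure (G2 F) => m (groupK F)) h
  simp only [hK, Measure.smul_apply] at h'
  have h0 := measure_groupK_ne_zero μ
  have ht := measure_groupK_ne_top μ
  set M := μ (groupK F)
  have : ((Measure.haarScalarFactor μ.inv μ : NNReal) : ENNReal) * M = 1 * M := by
    rw [one_mul]; exact h'.symm
  have := (ENNReal.mul_left_inj h0 ht).1 this
  have h1 : Measure.haarScalarFactor μ.inv μ = 1 := by exact_mod_cast this
  rw [h, h1, one_smul]

end Topology

section Integration

/-! ## Integration over `N K` -/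

/-- An upper unipotent element whose first row and whose minors of the first two rows are integral
is integral. -/
theorem nElt_bounds {r : Fin 6 → F} (h0 : ∀ j, ‖(nElt r).1.1 0 j‖ ≤ 1)
    (h01 : ∀ i j, ‖(nElt r).1.1 0 i * (nElt r).1.1 1 j - (nElt r).1.1 0 j * (nElt r).1.1 1 i‖ ≤ 1) :
    ∀ i, ‖r i‖ ≤ 1 := by
  have e : (fun i : Fin 5 => r i.succ) = ![r 1, r 2, r 3, r 4, r 5] := by
    ext i; fin_cases i <;> rfl
  have e0 : ∀ i j, (nElt r).1.1 i j = act (xA (r 0)) (act (uElt ![r 1, r 2, r 3, r 4, r 5])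
      (bas j)) i := fun i j => by rw [← act_bas, nElt, act_mul, e]
  have a1 := h0 1
  have a5 := h0 5
  have a6 := h0 6
  have m2 := h01 0 2
  have m3 := h01 0 3
  have m5 := h01 0 5
  simp only [e0, act_xA, act_uElt, bas0, bas1, bas2, bas3, bas5, bas6, Matrix.cons_val, mul_zero,
    mul_one, add_zero, zero_add, sub_zero, zero_sub, one_mul, norm_neg] at a1 a5 a6 m2 m3 m5
  have a5' : ‖r 4‖ ≤ 1 := by
    have : r 4 = -(-r 4 + r 0 * -r 3 + r 0 * r 3) := by ring
    rw [this, norm_neg]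
    exact norm_le_one_add a5 (norm_le_one_mul a1 m5)
  have a6' : ‖r 5‖ ≤ 1 := by
    have : r 5 = (r 5 + r 2 * r 3 + r 0 * (r 1 * r 3 - r 2 ^ 2)) - r 2 * r 3
        - r 0 * (r 1 * r 3 - r 2 ^ 2) := by ring
    rw [this]
    exact norm_le_one_sub (norm_le_one_sub a6 (norm_le_one_mul m3 m5)) (norm_le_one_mul a1
      (norm_le_one_sub (norm_le_one_mul m2 m5) (norm_le_one_pow m3 2)))
  intro i
  fin_cases i <;> assumption

theorem nElt_mem_K {r : Fin 6 → F} (hr : ∀ i, ‖r i‖ ≤ 1) : nElt r ∈ groupK F :=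
  mul_mem (xA_mem_K (hr 0)) (uElt_mem_K fun i => hr i.succ)

theorem nElt_mem_K_iff {r : Fin 6 → F} : nElt r ∈ groupK F ↔ ∀ i, ‖r i‖ ≤ 1 := by
  refine ⟨fun h => ?_, nElt_mem_K⟩
  have h1 := (gn_le_iff zero_le_one).1 (mem_groupK_iff.1 h)
  exact nElt_bounds (h1 0) fun i j =>
    norm_le_one_sub (norm_le_one_mul (h1 _ _) (h1 _ _)) (norm_le_one_mul (h1 _ _) (h1 _ _))

/-- Left translation by `n(s)⁻¹` in the coordinates of `N`. -/
def shiftN (s r : Fin 6 → F) (i : Fin 6) : F :=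
  r i + (![-s 0,
    conjA (-(r 0 - s 0)) (invU fun i => s i.succ) 0,
    conjA (-(r 0 - s 0)) (invU fun i => s i.succ) 1,
    conjA (-(r 0 - s 0)) (invU fun i => s i.succ) 2,
    conjA (-(r 0 - s 0)) (invU fun i => s i.succ) 3,
    conjA (-(r 0 - s 0)) (invU fun i => s i.succ) 4
      - 3 * conjA (-(r 0 - s 0)) (invU fun i => s i.succ) 2 * r 2
      + conjA (-(r 0 - s 0)) (invU fun i => s i.succ) 3 * r 1] : Fin 6 → F) i

theorem nElt_inv_mul (s r : Fin 6 → F) : (nElt s)⁻¹ * nElt r = nElt (shiftN s r) := by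
  have h : shiftN s r 0 = r 0 - s 0 := by simp [shiftN, sub_eq_add_neg]
  have h' : (fun i : Fin 5 => shiftN s r i.succ) =
      mulU (conjA (-(r 0 - s 0)) (invU fun i => s i.succ)) (fun i => r i.succ) := by
    ext i
    fin_cases i <;> rfl
  rw [nElt, nElt, nElt, h, h', ← uElt_mul_uElt, _root_.mul_inv_rev, uElt_inv, xA_inv]
  set δ := r 0 - s 0 with hδ
  have e : xA (r 0) = xA (s 0) * xA δ := by rw [xA_mul_xA, hδ, add_sub_cancel]
  have e2 := xA_mul_uElt (-δ) (invU fun i => s i.succ)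
  rw [← xA_inv, inv_mul_eq_iff_eq_mul] at e2
  rw [e, ← xA_inv]
  have : uElt (invU fun i => s i.succ) * (xA (s 0))⁻¹ * (xA (s 0) * xA δ * uElt fun i => r i.succ) =
      uElt (invU fun i => s i.succ) * xA δ * uElt fun i => r i.succ := by group
  rw [this, e2]
  group

variable [ProperSpace F] [MeasurableSpace F] [BorelSpace F] {dr : Measure F} [dr.IsAddHaarMeasure]

theorem measurePreserving_shiftN (s : Fin 6 → F) :
    MeasurePreserving (shiftN s) (𝛑 dr) (𝛑 dr) := by
  refine measurePreserving_triangular dr (n := 6) (fun i r => (![-s 0,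
    conjA (-(r 0 - s 0)) (invU fun i => s i.succ) 0,
    conjA (-(r 0 - s 0)) (invU fun i => s i.succ) 1,
    conjA (-(r 0 - s 0)) (invU fun i => s i.succ) 2,
    conjA (-(r 0 - s 0)) (invU fun i => s i.succ) 3,
    conjA (-(r 0 - s 0)) (invU fun i => s i.succ) 4
      - 3 * conjA (-(r 0 - s 0)) (invU fun i => s i.succ) 2 * r 2
      + conjA (-(r 0 - s 0)) (invU fun i => s i.succ) 3 * r 1] : Fin 6 → F) i) ?_ ?_
  · intro i
    refine Continuous.measurable ?_
    fin_cases i <;> simp only [conjA, Fin.zero_eta, Fin.mk_one, Fin.reduceFinMk, Matrix.cons_val] <;>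
      fun_prop
  · intro i r r' h
    fin_cases i <;> simp only [Fin.zero_eta, Fin.mk_one, Fin.reduceFinMk, Matrix.cons_val] <;>
      simp (disch := decide) only [h]

theorem volume_unit_box (hV : IsNormalizedNorm F) (hdr : dr (Metric.closedBall 0 1) = 1)
    {n : ℕ} : (Measure.pi fun _ : Fin n => dr) {r | ∀ i, ‖r i‖ ≤ 1} = 1 := by
  have := volume_box hV hdr (n := n) fun _ => 0
  simpa [box] using this

theorem measurableSet_unit_box {n : ℕ} : MeasurableSet {r : Fin n → F | ∀ i, ‖r i‖ ≤ 1} :=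
  measurableSet_box fun _ => 1

variable (F) in
/-- The set `N K`. -/
def setNK : Set (G2 F) := {x | ∃ r, ∃ k ∈ groupK F, x = nElt r * k}

/-- For fixed `x`, the volume of `{n | n⁻¹ x ∈ K}`. -/
theorem volume_nElt_inv (hV : IsNormalizedNorm F) (hdr : dr (Metric.closedBall 0 1) = 1)
    (x : G2 F) : (Measure.pi fun _ : Fin 6 => dr) {r | (nElt r)⁻¹ * x ∈ groupK F} =
      if x ∈ setNK F then 1 else 0 := by
  by_cases hx : x ∈ setNK F
  · rw [if_pos hx]
    obtain ⟨s, k, hk, rfl⟩ := hx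
    have : {r | (nElt r)⁻¹ * (nElt s * k) ∈ groupK F} = shiftN s ⁻¹' {r | ∀ i, ‖r i‖ ≤ 1} := by
      ext r
      simp only [Set.mem_ofPred_eq, Set.mem_preimage]
      rw [← nElt_mem_K_iff, ← nElt_inv_mul, ← mul_assoc, Subgroup.mul_mem_cancel_right _ hk,
        ← inv_mem_iff, _root_.mul_inv_rev, inv_inv]
    rw [this, (measurePreserving_shiftN (dr := dr) s).measure_preimage
      measurableSet_unit_box.nullMeasurableSet, volume_unit_box hV hdr]
  · rw [if_neg hx]
    convert measure_empty (μ := Measure.pi fun _ : Fin 6 => dr)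
    ext r
    simp only [Set.mem_ofPred_eq, Set.mem_empty_iff_false, iff_false]
    exact fun h => hx ⟨r, _, h, by rw [mul_inv_cancel_left]⟩

theorem setNK_mul_iff {x k : G2 F} (hk : k ∈ groupK F) : x * k ∈ setNK F ↔ x ∈ setNK F := by
  constructor
  · rintro ⟨r, k', hk', h⟩
    exact ⟨r, k' * k⁻¹, mul_mem hk' (inv_mem hk), by rw [← mul_assoc, ← h]; group⟩
  · rintro ⟨r, k', hk', rfl⟩
    exact ⟨r, k' * k, mul_mem hk' hk, by group⟩

theorem hasCompactSupport_of_gn {X : Type*} [Zero X] {φ : G2 F → X} {c : ℝ}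
    (h : ∀ x, φ x ≠ 0 → gn x ≤ c) : HasCompactSupport φ :=
  HasCompactSupport.of_support_subset_isCompact (isCompact_gn_le c) h

variable [MeasurableSpace (G2 F)] [BorelSpace (G2 F)] {μ : Measure (G2 F)} [μ.IsHaarMeasure]

theorem RightK.integrable {φ : G2 F → ℂ} (hφ : RightK φ) {c : ℝ}
    (h : ∀ x, φ x ≠ 0 → gn x ≤ c) : Integrable φ μ :=
  hφ.continuous.integrable_of_hasCompactSupport (hasCompactSupport_of_gn h)

/-- The integral over `N K` of a right-`K`-invariant function. -/
theorem integral_setNK (hV : IsNormalizedNorm F) (hdr : dr (Metric.closedBall 0 1) = 1)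
    (hμ : μ (maxCompact F) = 1) {φ : G2 F → ℂ} (hφ : RightK φ) {c : ℝ}
    (hc : ∀ x, φ x ≠ 0 → gn x ≤ c) :
    ∫ x, (setNK F).indicator φ x ∂μ = ∫ r, φ (nElt r) ∂𝛑 dr := by
  set ν := Measure.pi fun _ : Fin 6 => dr with hν
  set H : (Fin 6 → F) → G2 F → ℂ := fun r x =>
    {r | (nElt r)⁻¹ * x ∈ groupK F}.indicator (fun _ => φ x) r with hH
  have hms : ∀ x : G2 F, MeasurableSet {r | (nElt r)⁻¹ * x ∈ groupK F} := fun x =>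
    (isOpen_groupK.preimage (continuous_nElt.inv.mul continuous_const)).measurableSet
  have hvol : ∀ x, ν {r | (nElt r)⁻¹ * x ∈ groupK F} ≠ ⊤ := fun x => by
    rw [volume_nElt_inv hV hdr]; split_ifs <;> simp
  have hint : Integrable φ μ := hφ.integrable hc
  have hNK : MeasurableSet (setNK F) := by
    have hc : Continuous ((setNK F).indicator fun _ => (1 : ℂ)) := RightK.continuous fun k hk g => by
      simp only [Set.indicator_apply, setNK_mul_iff hk]
    convert (hc.measurable (measurableSet_singleton (1 : ℂ)))
    ext x
    simp [Set.indicator_apply]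
  have hjoint : AEStronglyMeasurable (Function.uncurry H) (ν.prod μ) := by
    have hO : MeasurableSet {p : (Fin 6 → F) × G2 F | (nElt p.1)⁻¹ * p.2 ∈ groupK F} :=
      (isOpen_groupK.preimage
        ((continuous_nElt.comp continuous_fst).inv.mul continuous_snd)).measurableSet
    have : Function.uncurry H = {p : (Fin 6 → F) × G2 F | (nElt p.1)⁻¹ * p.2 ∈ groupK F}.indicator
        fun p => φ p.2 := by
      ext ⟨r, x⟩
      simp only [Function.uncurry_apply_pair, hH, Set.indicator_apply, Set.mem_ofPred_eq]
    rw [this]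
    exact ((hφ.continuous.comp continuous_snd).stronglyMeasurable.indicator hO).aestronglyMeasurable
  have hinner : ∀ x, ∫ r, H r x ∂ν = (setNK F).indicator φ x := by
    intro x
    simp only [hH]
    rw [integral_indicator (hms x), setIntegral_const, Measure.real, volume_nElt_inv hV hdr,
      Set.indicator_apply]
    split_ifs <;> simp
  have hV' : ∀ x, ∫ r, ‖H r x‖ ∂ν = (setNK F).indicator (fun x => ‖φ x‖) x := by
    intro x
    have : ∀ r, ‖H r x‖ = {r | (nElt r)⁻¹ * x ∈ groupK F}.indicator (fun _ => ‖φ x‖) r := by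
      intro r; simp only [hH, norm_indicator_eq_indicator_norm]
    simp_rw [this]
    rw [integral_indicator (hms x), setIntegral_const, Measure.real, volume_nElt_inv hV hdr,
      Set.indicator_apply]
    split_ifs <;> simp
  have hHint : Integrable (Function.uncurry H) (ν.prod μ) := by
    rw [integrable_prod_iff' hjoint]
    refine ⟨.of_forall fun x => ?_, ?_⟩
    · simp only [Function.uncurry_apply_pair, hH]
      exact (integrable_indicator_iff (hms x)).2 (integrableOn_const (hvol x))
    · simp only [Function.uncurry_apply_pair]
      simp_rw [hV']
      exact hint.norm.indicator hNK
  simp_rw [← hinner]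
  rw [← integral_integral_swap hHint]
  refine integral_congr_ae (.of_forall fun r => ?_)
  simp only
  rw [← integral_mul_left_eq_self (fun x => H r x) (nElt r)]
  have : ∀ x, H r (nElt r * x) = (groupK F : Set (G2 F)).indicator (fun _ => φ (nElt r)) x := by
    intro x
    simp only [hH, Set.indicator_apply, Set.mem_ofPred_eq, inv_mul_cancel_left, SetLike.mem_coe]
    split_ifs with h
    · exact hφ x h _
    · rfl
  simp_rw [this]
  rw [integral_indicator isOpen_groupK.measurableSet, setIntegral_const, Measure.real]
  have hμ' : μ (groupK F : Set (G2 F)) = 1 := hμ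
  rw [hμ']
  simp

end Integration

variable [ProperSpace F] [MeasurableSpace F] [BorelSpace F] {dr : Measure F} [dr.IsAddHaarMeasure]

section Ball

/-! ## The ball of radius `q` -/

theorem nElt_eq (r : Fin 6 → F) : nElt r = xA (r 0) * uElt ![r 1, r 2, r 3, r 4, r 5] := by
  rw [nElt]; congr 2; ext i; fin_cases i <;> rfl

theorem norm_mul_le_zpow (hV : IsNormalizedNorm F) {x y : F} {m n k : ℤ} (hx : ‖x‖ ≤ 𝐪 ^ m)
    (hy : ‖y‖ ≤ 𝐪 ^ n) (hk : m + n = k) : ‖x * y‖ ≤ 𝐪 ^ k := by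
  rw [norm_mul, ← hk, zpow_add₀ (q_pos hV).ne']
  exact mul_le_mul hx hy (norm_nonneg _) (zpow_nonneg (q_pos hV).le _)

theorem norm_le_zpow_mono (hV : IsNormalizedNorm F) {x : F} {m n : ℤ} (hx : ‖x‖ ≤ 𝐪 ^ m)
    (h : m ≤ n) : ‖x‖ ≤ 𝐪 ^ n :=
  hx.trans (zpow_le_zpow_right₀ (one_lt_q hV).le h)

/-- The exponents of the weights of the torus element `torusElt t₁ t₂` with `‖t₁‖ = q ^ (-a)`,
`‖t₂‖ = q ^ (-(a + b))`. -/
def torusExp (a b : ℤ) : Fin 8 → ℤ := ![a, b, a - b, 0, 0, b - a, -b, -a]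

theorem norm_act_torusElt (hV : IsNormalizedNorm F) {t₁ t₂ : Fˣ} {a b : ℤ}
    (h1 : ‖(t₁ : F)‖ = 𝐪 ^ (-a)) (h2 : ‖(t₂ : F)‖ = 𝐪 ^ (-(a + b))) (v : Fin 8 → F) (i : Fin 8) :
    ‖act (torusElt t₁ t₂) v i‖ = 𝐪 ^ (-torusExp a b i) * ‖v i‖ := by
  have hq := (q_pos hV).ne'
  rw [act_torusElt]
  fin_cases i <;> simp only [Fin.zero_eta, Fin.mk_one, Fin.reduceFinMk, Matrix.cons_val, norm_mul,
    norm_div, norm_zpow, norm_inv, h1, h2, torusExp, neg_zero, zpow_zero, one_mul, ← zpow_natCast,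
    ← _root_.zpow_mul, ← zpow_sub₀ hq, one_div, ← _root_.zpow_neg] <;>
    congr 2 <;> push_cast <;> ring

theorem norm_act_bas_le (hV : IsNormalizedNorm F) {t₁ t₂ : Fˣ} {a b : ℤ}
    (h1 : ‖(t₁ : F)‖ = 𝐪 ^ (-a)) (h2 : ‖(t₂ : F)‖ = 𝐪 ^ (-(a + b))) {x : G2 F}
    (hx : gn (torusElt t₁ t₂ * x) ≤ 𝐪) (i j : Fin 8) {n : ℤ} (hn : torusExp a b i + 1 = n) :
    ‖act x (bas j) i‖ ≤ 𝐪 ^ n := by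
  have h := (norm_apply_le_gn (torusElt t₁ t₂ * x) i j).trans hx
  have hq := q_pos hV
  rw [← act_bas, act_mul, norm_act_torusElt hV h1 h2, _root_.zpow_neg,
    inv_mul_le_iff₀ (zpow_pos hq _)] at h
  rwa [← hn, zpow_add₀ hq.ne', zpow_one]

/-- The exponents of the roots in `U`. -/
def rootsExp (a b : ℤ) : Fin 5 → ℤ := ![2 * b - a, b, a, 2 * a - b, a + b]

theorem norm_rootsU (hV : IsNormalizedNorm F) {t₁ t₂ : Fˣ} {a b : ℤ}
    (h1 : ‖(t₁ : F)‖ = 𝐪 ^ (-a)) (h2 : ‖(t₂ : F)‖ = 𝐪 ^ (-(a + b))) (i : Fin 5) :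
    ‖rootsU t₁ t₂ i‖ = 𝐪 ^ (-rootsExp a b i) := by
  have hq := (q_pos hV).ne'
  fin_cases i <;> simp only [rootsU, Fin.zero_eta, Fin.mk_one, Fin.reduceFinMk, Matrix.cons_val,
    norm_div, norm_zpow, h1, h2, rootsExp, ← zpow_natCast,
    ← _root_.zpow_mul, ← zpow_sub₀ hq] <;> congr 1 <;> push_cast <;> ring

theorem norm_rootA (hV : IsNormalizedNorm F) {t₁ t₂ : Fˣ} {a b : ℤ}
    (h1 : ‖(t₁ : F)‖ = 𝐪 ^ (-a)) (h2 : ‖(t₂ : F)‖ = 𝐪 ^ (-(a + b))) :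
    ‖(t₁ : F) ^ 2 / t₂‖ = 𝐪 ^ (-(a - b)) := by
  rw [norm_div, norm_pow, h1, h2, ← zpow_natCast, ← _root_.zpow_mul, ← zpow_sub₀ (q_pos hV).ne']
  congr 1; push_cast; ring

theorem exists_exponents (hV : IsNormalizedNorm F) (t₁ t₂ : Fˣ) :
    ∃ a b : ℤ, ‖(t₁ : F)‖ = 𝐪 ^ (-a) ∧ ‖(t₂ : F)‖ = 𝐪 ^ (-(a + b)) := by
  obtain ⟨m, hm⟩ := norm_eq_zpow hV t₁.ne_zero
  obtain ⟨n, hn⟩ := norm_eq_zpow hV t₂.ne_zero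
  exact ⟨-m, m - n, by rw [hm, neg_neg], by rw [hn]; congr 1; ring⟩

theorem norm_rootsU_mul_le (hV : IsNormalizedNorm F) {t₁ t₂ : Fˣ} {a b : ℤ}
    (h1 : ‖(t₁ : F)‖ = 𝐪 ^ (-a)) (h2 : ‖(t₂ : F)‖ = 𝐪 ^ (-(a + b))) {c : Fin 5 → F}
    (hc : ∀ i, ‖c i‖ ≤ 𝐪 ^ rootsExp a b i) (i : Fin 5) : ‖rootsU t₁ t₂ i * c i‖ ≤ 1 := by
  rw [norm_mul, norm_rootsU hV h1 h2, _root_.zpow_neg, inv_mul_le_iff₀ (zpow_pos (q_pos hV) _),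
    mul_one]
  exact hc i

/-- Right `K`-invariant and left `U(𝒪)`-invariant functions which are supported in the ball of
radius `q`. -/
structure BallFun (h : G2 F → ℂ) : Prop where
  right : RightK h
  left : ∀ r : Fin 5 → F, (∀ i, ‖r i‖ ≤ 1) → ∀ x, h (uElt r * x) = h x
  supp : ∀ x, h x ≠ 0 → gn x ≤ 𝐪

theorem BallFun.torus_mul {h : G2 F → ℂ} (H : BallFun h) (t₁ t₂ : Fˣ) (y : F) {c d : Fin 5 → F}
    (hc : ∀ i, ‖rootsU t₁ t₂ i * conjA y c i‖ ≤ 1) (hd : ∀ i, ‖d i‖ ≤ 1) :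
    h (torusElt t₁ t₂ * (xA y * uElt (mulU c d))) = h (torusElt t₁ t₂ * xA y) := by
  have : torusElt t₁ t₂ * (xA y * uElt (mulU c d)) =
      uElt (fun i => rootsU t₁ t₂ i * conjA y c i) * (torusElt t₁ t₂ * xA y * uElt d) := by
    rw [← uElt_mul_uElt, ← mul_assoc (xA y), xA_mul_uElt, ← mul_assoc, ← mul_assoc,
      torusElt_mul_uElt]
    group
  rw [this, H.left _ hc, H.right _ (uElt_mem_K hd)]

theorem conjA_zero (c : Fin 5 → F) : conjA 0 c = c := by
  ext i; fin_cases i <;> simp [conjA]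

theorem BallFun.torus_mul_uElt {h : G2 F → ℂ} (H : BallFun h) (t₁ t₂ : Fˣ) {c d : Fin 5 → F}
    (hc : ∀ i, ‖rootsU t₁ t₂ i * c i‖ ≤ 1) (hd : ∀ i, ‖d i‖ ≤ 1) :
    h (torusElt t₁ t₂ * uElt (mulU c d)) = h (torusElt t₁ t₂) := by
  have := H.torus_mul t₁ t₂ 0 (c := c) (d := d) (by rwa [conjA_zero]) hd
  simpa using this

theorem integral_comp_triangular {n : ℕ} (p : Fin n → (Fin n → F) → F)
    (hm : ∀ i, Continuous (p i) := by
      intro i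
      fin_cases i <;> simp only [Fin.zero_eta, Fin.mk_one, Fin.reduceFinMk, Matrix.cons_val] <;>
        fun_prop)
    (hp : ∀ i r r', (∀ j < i, r j = r' j) → p i r = p i r' := by
      intro i r r' h
      fin_cases i <;> simp only [Fin.zero_eta, Fin.mk_one, Fin.reduceFinMk, Matrix.cons_val] <;>
        simp (disch := decide) only [h])
    {f : (Fin n → F) → ℂ} (hf : Measurable f) :
    ∫ r, f (fun i => r i + p i r) ∂𝛑 dr = ∫ r, f r ∂𝛑 dr := by
  have h := measurePreserving_triangular dr p (fun i => (hm i).measurable) hp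
  rw [← h.map_eq, integral_map h.aemeasurable (hf.stronglyMeasurable.aestronglyMeasurable), h.map_eq]

theorem integral_fin_succ {n : ℕ} (f : F → ℂ) (g : (Fin n → F) → ℂ) :
    ∫ r : Fin (n + 1) → F, f (r 0) * g (fun i => r i.succ) ∂𝛑 dr =
      (∫ x, f x ∂dr) * ∫ r, g r ∂𝛑 dr := by
  have h := measurePreserving_piFinSuccAbove (fun _ : Fin (n + 1) => dr) 0
  rw [← integral_prod_mul, ← h.integral_comp' (g := fun z : F × (Fin n → F) => f z.1 * g z.2)]
  rfl

theorem prod_zpow_eq_zpow_sum {ι : Type*} {x : ℂ} (hx : x ≠ 0) (m : ι → ℤ) (s : Finset ι) :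
    ∏ i ∈ s, x ^ m i = x ^ ∑ i ∈ s, m i := by
  induction s using Finset.induction_on with
  | empty => simp
  | insert i s hi ih => rw [Finset.prod_insert hi, Finset.sum_insert hi, zpow_add₀ hx, ih]

theorem integral_box_const (hV : IsNormalizedNorm F) (hdr : dr (Metric.closedBall 0 1) = 1)
    {n : ℕ} (m : Fin n → ℤ) (c : ℂ) :
    ∫ r : Fin n → F, (if ∀ i, ‖r i‖ ≤ 𝐪 ^ m i then c else 0) ∂𝛑 dr =
      (𝐪 : ℂ) ^ (∑ i, m i) * c := by
  have h : (fun r : Fin n → F => if ∀ i, ‖r i‖ ≤ 𝐪 ^ m i then c else 0) =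
      (box fun i => 𝐪 ^ m i).indicator fun _ => c := by
    ext r; simp only [Set.indicator_apply, box, Set.mem_ofPred_eq]
  have hq := q_pos hV
  have hq' : (𝐪 : ℂ) ≠ 0 := by exact_mod_cast hq.ne'
  rw [h, integral_indicator (measurableSet_box _), setIntegral_const, Measure.real,
    volume_box hV hdr, ENNReal.toReal_ofReal (Finset.prod_nonneg fun i _ => (zpow_pos hq _).le),
    Complex.real_smul]
  congr 1
  push_cast
  exact prod_zpow_eq_zpow_sum hq' m _

/-- Integration over `N = U x_α(F)` in the opposite order. -/
theorem integral_nElt_swap {f : G2 F → ℂ} (hf : Continuous f) :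
    ∫ r : Fin 6 → F, f (nElt r) ∂𝛑 dr =
      ∫ r : Fin 6 → F, f (uElt (fun i => r i.succ) * xA (r 0)) ∂𝛑 dr := by
  have hg : Continuous fun r : Fin 6 → F => f (uElt (fun i => r i.succ) * xA (r 0)) :=
    hf.comp ((continuous_uElt.comp (continuous_pi fun i => continuous_apply i.succ)).mul
      (continuous_xA.comp (continuous_apply 0)))
  rw [← integral_comp_triangular (fun i (r : Fin 6 → F) => (![0, 0, r 0 * r 1,
    2 * r 0 * r 2 + r 0 ^ 2 * r 1, 3 * r 0 * r 3 + 3 * r 0 ^ 2 * r 2 + r 0 ^ 3 * r 1,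
    -3 * r 0 * r 2 ^ 2 - 3 * r 0 ^ 2 * r 1 * r 2 - r 0 ^ 3 * r 1 ^ 2] : Fin 6 → F) i)
    (hf := hg.measurable)]
  refine integral_congr_ae (.of_forall fun r => ?_)
  simp only [nElt, xA_mul_uElt]
  congr 3
  · ext i
    fin_cases i <;> simp [conjA]
  · simp

theorem integral_closedBall_one (hdr : dr (Metric.closedBall 0 1) = 1) :
    ∫ x : F, (if ‖x‖ ≤ 1 then (1 : ℂ) else 0) ∂dr = 1 := by
  have : (fun x : F => if ‖x‖ ≤ 1 then (1 : ℂ) else 0) =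
      (Metric.closedBall 0 1).indicator fun _ => 1 := by
    ext x; simp only [Set.indicator_apply, mem_closedBall_zero_iff]
  rw [this, integral_indicator measurableSet_closedBall, setIntegral_const, Measure.real, hdr]
  simp

/-- If `t n` lies in the ball only for `n ∈ U x_α(𝒪)`, the integral over `N` reduces to one over
`U`. -/
theorem BallFun.integral_of_y_le (hdr : dr (Metric.closedBall 0 1) = 1) {h : G2 F → ℂ}
    (H : BallFun h) (t : G2 F)
    (ht : ∀ (r : Fin 5 → F) (y : F), gn (t * (uElt r * xA y)) ≤ 𝐪 → ‖y‖ ≤ 1) :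
    ∫ r : Fin 6 → F, h (t * nElt r) ∂𝛑 dr =
      ∫ r : Fin 5 → F, h (t * uElt r) ∂𝛑 dr := by
  rw [integral_nElt_swap (f := fun x => h (t * x)) (H.right.comp_mul_left t).continuous]
  have : ∀ r : Fin 6 → F, h (t * (uElt (fun i => r i.succ) * xA (r 0))) =
      (if ‖r 0‖ ≤ 1 then (1 : ℂ) else 0) * h (t * uElt fun i => r i.succ) := by
    intro r
    split_ifs with hr
    · rw [← mul_assoc, H.right _ (xA_mem_K hr), one_mul]
    · rw [zero_mul]
      by_contra h0
      exact hr (ht _ _ (H.supp _ h0))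
  simp_rw [this]
  rw [integral_fin_succ (fun x : F => if ‖x‖ ≤ 1 then (1 : ℂ) else 0) fun r => h (t * uElt r),
    integral_closedBall_one hdr, one_mul]

section Tori

variable (hV : IsNormalizedNorm F) (hdr : dr (Metric.closedBall 0 1) = 1) {h : G2 F → ℂ}
  (H : BallFun h) {t₁ t₂ : Fˣ}
include hV hdr H

theorem BallFun.integral_neg_one_neg_one (h1 : ‖(t₁ : F)‖ = 𝐪 ^ (-(-1) : ℤ))
    (h2 : ‖(t₂ : F)‖ = 𝐪 ^ (-(-1 + -1) : ℤ)) :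
    ∫ r : Fin 6 → F, h (torusElt t₁ t₂ * nElt r) ∂𝛑 dr = h (torusElt t₁ t₂) := by
  have key : ∀ r : Fin 6 → F, h (torusElt t₁ t₂ * nElt r) =
      if ∀ i, ‖r i‖ ≤ 𝐪 ^ (0 : ℤ) then h (torusElt t₁ t₂) else 0 := by
    intro r
    simp only [zpow_zero]
    split_ifs with hr
    · exact H.right _ (nElt_mem_K hr) _
    · by_contra h0
      have hb := norm_act_bas_le hV h1 h2 (H.supp _ h0)
      have e0 : ∀ j, ‖(nElt r).1.1 0 j‖ ≤ 1 := fun j => by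
        simpa [act_bas] using hb 0 j (n := 0) (by decide)
      have e1 : ∀ j, ‖(nElt r).1.1 1 j‖ ≤ 1 := fun j => by
        simpa [act_bas] using hb 1 j (n := 0) (by decide)
      exact hr (nElt_bounds e0 fun i j => norm_le_one_sub (norm_le_one_mul (e0 _) (e1 _))
        (norm_le_one_mul (e0 _) (e1 _)))
  simp_rw [key]
  rw [integral_box_const hV hdr fun _ => 0]
  simp

theorem BallFun.integral_one_one (h1 : ‖(t₁ : F)‖ = 𝐪 ^ (-1 : ℤ))
    (h2 : ‖(t₂ : F)‖ = 𝐪 ^ (-(1 + 1) : ℤ)) :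
    ∫ r : Fin 6 → F, h (torusElt t₁ t₂ * nElt r) ∂𝛑 dr =
      (𝐪 : ℂ) ^ (6 : ℤ) * h (torusElt t₁ t₂) := by
  rw [H.integral_of_y_le hdr]
  · have key : ∀ r : Fin 5 → F, h (torusElt t₁ t₂ * uElt r) =
        if ∀ i, ‖r i‖ ≤ 𝐪 ^ (![1, 1, 1, 1, 2] : Fin 5 → ℤ) i then h (torusElt t₁ t₂) else 0 := by
      intro r
      split_ifs with hr
      · have := H.torus_mul_uElt t₁ t₂ (c := r) (d := 0)
          (norm_rootsU_mul_le hV h1 h2 hr) (by simp)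
        convert this using 3
        congr 1; ext i; fin_cases i <;> simp [mulU]
      · by_contra h0
        have hb := norm_act_bas_le hV h1 h2 (H.supp _ h0)
        have a0 := hb 5 6 (n := 1) (by decide)
        have a1 := hb 5 7 (n := 1) (by decide)
        have a2 := hb 2 6 (n := 1) (by decide)
        have a3 := hb 2 7 (n := 1) (by decide)
        have a4 := hb 0 6 (n := 2) (by decide)
        simp only [act_uElt, bas6, bas7, Matrix.cons_val, mul_zero, mul_one, add_zero, zero_add,
          sub_zero, zero_sub, norm_neg] at a0 a1 a2 a3 a4
        rw [norm_add_le_iff (norm_mul_le_zpow hV a1 a2 (by norm_num))] at a4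
        exact hr fun i => by fin_cases i <;> assumption
    simp_rw [key]
    rw [integral_box_const hV hdr]
    simp [Fin.sum_univ_five]
  · intro r y hy
    have hb := norm_act_bas_le hV h1 h2 hy 6 7 (n := 0) (by decide)
    simpa [act_mul, act_xA, act_uElt, bas7] using hb

theorem BallFun.integral_zero_one (h1 : ‖(t₁ : F)‖ = 𝐪 ^ (-0 : ℤ))
    (h2 : ‖(t₂ : F)‖ = 𝐪 ^ (-(0 + 1) : ℤ)) :
    ∫ r : Fin 6 → F, h (torusElt t₁ t₂ * nElt r) ∂𝛑 dr =
      (𝐪 : ℂ) ^ (4 : ℤ) * h (torusElt t₁ t₂) := by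
  rw [H.integral_of_y_le hdr]
  · have key : ∀ r : Fin 5 → F, h (torusElt t₁ t₂ * uElt r) =
        if ∀ i, ‖r i‖ ≤ 𝐪 ^ (![2, 1, 0, 0, 1] : Fin 5 → ℤ) i then h (torusElt t₁ t₂) else 0 := by
      intro r
      split_ifs with hr
      · have := H.torus_mul_uElt t₁ t₂ (c := ![r 0, r 1, 0, 0, r 4]) (d := ![0, 0, r 2, r 3, 0])
          (norm_rootsU_mul_le hV h1 h2 fun i => ?_) fun i => ?_
        · convert this using 3
          congr 1; ext i; fin_cases i <;> simp [mulU]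
        · have := hr i
          fin_cases i <;> simpa [rootsExp] using this
        · have := hr i
          fin_cases i <;> simpa using this
      · by_contra h0
        have hb := norm_act_bas_le hV h1 h2 (H.supp _ h0)
        have a0 := hb 5 6 (n := 2) (by decide)
        have a1 := hb 3 6 (n := 1) (by decide)
        have a2 := hb 2 6 (n := 0) (by decide)
        have a3 := hb 2 7 (n := 0) (by decide)
        have a4 := hb 0 6 (n := 1) (by decide)
        simp only [act_uElt, bas6, bas7, Matrix.cons_val, mul_zero, mul_one, add_zero, zero_add,
          sub_zero, zero_sub, norm_neg] at a0 a1 a2 a3 a4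
        rw [norm_add_le_iff (norm_mul_le_zpow hV a1 a2 (by norm_num))] at a4
        exact hr fun i => by fin_cases i <;> assumption
    simp_rw [key]
    rw [integral_box_const hV hdr]
    simp [Fin.sum_univ_five]
  · intro r y hy
    have hb := norm_act_bas_le hV h1 h2 hy 2 3 (n := 0) (by decide)
    simpa [act_mul, act_xA, act_uElt, bas3] using hb

theorem BallFun.integral_neg_one_zero (h1 : ‖(t₁ : F)‖ = 𝐪 ^ (-(-1) : ℤ))
    (h2 : ‖(t₂ : F)‖ = 𝐪 ^ (-(-1 + 0) : ℤ)) :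
    ∫ r : Fin 6 → F, h (torusElt t₁ t₂ * nElt r) ∂𝛑 dr =
      (𝐪 : ℂ) ^ (1 : ℤ) * h (torusElt t₁ t₂) := by
  rw [H.integral_of_y_le hdr]
  · have key : ∀ r : Fin 5 → F, h (torusElt t₁ t₂ * uElt r) =
        if ∀ i, ‖r i‖ ≤ 𝐪 ^ (![1, 0, 0, 0, 0] : Fin 5 → ℤ) i then h (torusElt t₁ t₂) else 0 := by
      intro r
      split_ifs with hr
      · have := H.torus_mul_uElt t₁ t₂ (c := ![r 0, 0, 0, 0, 0]) (d := ![0, r 1, r 2, r 3, r 4])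
          (norm_rootsU_mul_le hV h1 h2 fun i => ?_) fun i => ?_
        · convert this using 3
          congr 1; ext i; fin_cases i <;> simp [mulU]
        · have := hr i
          fin_cases i <;> simpa [rootsExp, zpow_nonneg, (q_pos hV).le] using this
        · have := hr i
          fin_cases i <;> simpa using this
      · by_contra h0
        have hb := norm_act_bas_le hV h1 h2 (H.supp _ h0)
        have a0 := hb 1 2 (n := 1) (by decide)
        have a1 := hb 0 2 (n := 0) (by decide)
        have a2 := hb 0 3 (n := 0) (by decide)
        have a3 := hb 0 5 (n := 0) (by decide)
        have a4 := hb 0 6 (n := 0) (by decide)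
        simp only [act_uElt, bas2, bas3, bas5, bas6, Matrix.cons_val, mul_zero, mul_one, add_zero,
          zero_add, sub_zero, zero_sub, norm_neg] at a0 a1 a2 a3 a4
        rw [norm_add_le_iff (norm_mul_le_zpow hV a1 a2 (by norm_num))] at a4
        exact hr fun i => by fin_cases i <;> assumption
    simp_rw [key]
    rw [integral_box_const hV hdr]
    simp [Fin.sum_univ_five]
  · intro r y hy
    have hb := norm_act_bas_le hV h1 h2 hy 0 1 (n := 0) (by decide)
    simpa [act_mul, act_xA, act_uElt, bas1] using hb

end Tori

end Ball

section BallTori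

theorem integral_closedBall_q (hV : IsNormalizedNorm F) (hdr : dr (Metric.closedBall 0 1) = 1)
    [Fintype (ResField F)] {ϖ : F} (hϖ : ‖ϖ‖ = 𝐪⁻¹) (g : F → ℂ)
    (hg : ∀ x v, ‖v‖ ≤ 1 → g (x + v) = g x) :
    ∫ y : F, (if ‖y‖ ≤ 𝐪 then g y else 0) ∂dr = ∑ ρ : ResField F, g (ϖ⁻¹ * lift ρ) := by
  have hq := q_pos hV
  have hϖ0 : ϖ⁻¹ ≠ 0 := by
    rw [← norm_pos_iff, norm_inv, hϖ, inv_inv]; exact hq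
  have hn : ‖ϖ⁻¹‖ = 𝐪 := by rw [norm_inv, hϖ, inv_inv]
  have h1 := integral_comp_mul hV hdr hϖ0 fun y : F => if ‖y‖ ≤ 𝐪 then g y else 0
  rw [hn] at h1
  have hq' : (𝐪 : ℂ) ≠ 0 := by exact_mod_cast hq.ne'
  have h2 := (measurePreserving_funUnique dr (Fin 1)).integral_comp'
    (g := fun r : F => if ‖ϖ⁻¹ * r‖ ≤ 𝐪 then g (ϖ⁻¹ * r) else 0)
  have hiff : ∀ r : F, ‖ϖ⁻¹ * r‖ ≤ 𝐪 ↔ ‖r‖ ≤ 1 := fun r => by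
    rw [norm_mul, hn, mul_le_iff_le_one_right hq]
  have h3 := integral_eq_sum_residue hV hdr (n := 1)
    (fun r => if ‖ϖ⁻¹ * r 0‖ ≤ 𝐪 then g (ϖ⁻¹ * r 0) else 0)
    (fun r ⟨i, hi⟩ => by
      rw [Subsingleton.elim i 0] at hi
      rw [if_neg]; rw [hiff]; exact hi.not_ge)
    (fun r v hr hv => by
      have a : ‖r 0 + v 0‖ ≤ 1 := norm_le_one_add (hr 0) (hv 0).le
      simp only [hiff, Pi.add_apply]
      rw [if_pos a, if_pos (hr 0), mul_add, hg]
      rw [norm_mul, hn]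
      have := (norm_lt_one_iff hV).1 (hv 0)
      calc 𝐪 * ‖v 0‖ ≤ 𝐪 * 𝐪⁻¹ := by gcongr
        _ = 1 := mul_inv_cancel₀ hq.ne')
  have h4 : ∫ r : Fin 1 → F, (if ‖ϖ⁻¹ * r 0‖ ≤ 𝐪 then g (ϖ⁻¹ * r 0) else 0)
      ∂𝛑 dr = ∫ r : F, (if ‖ϖ⁻¹ * r‖ ≤ 𝐪 then g (ϖ⁻¹ * r) else 0) ∂dr := h2
  rw [h3, h1, pow_one] at h4
  have h5 : ∑ z : Fin 1 → ResField F, (if ‖ϖ⁻¹ * lift (z 0)‖ ≤ 𝐪 then g (ϖ⁻¹ * lift (z 0)) else 0)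
      = ∑ ρ : ResField F, g (ϖ⁻¹ * lift ρ) := by
    rw [← (Equiv.funUnique (Fin 1) (ResField F)).sum_comp]
    refine Finset.sum_congr rfl fun z _ => ?_
    rw [if_pos ((hiff _).2 (norm_lift_le _))]
    rfl
  rw [h5, Complex.ofReal_inv] at h4
  exact (mul_left_cancel₀ (inv_ne_zero hq') h4).symm

theorem integral_box_fst (hV : IsNormalizedNorm F) (hdr : dr (Metric.closedBall 0 1) = 1)
    [Fintype (ResField F)] {ϖ : F} (hϖ : ‖ϖ‖ = 𝐪⁻¹) {n : ℕ} (m : Fin n → ℤ) (g : F → ℂ)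
    (hg : ∀ x v, ‖v‖ ≤ 1 → g (x + v) = g x) :
    ∫ r : Fin (n + 1) → F, (if ‖r 0‖ ≤ 𝐪 ∧ ∀ i : Fin n, ‖r i.succ‖ ≤ 𝐪 ^ m i then g (r 0) else 0)
      ∂𝛑 dr = (𝐪 : ℂ) ^ (∑ i, m i) * ∑ ρ : ResField F, g (ϖ⁻¹ * lift ρ) := by
  have : ∀ r : Fin (n + 1) → F,
      (if ‖r 0‖ ≤ 𝐪 ∧ ∀ i : Fin n, ‖r i.succ‖ ≤ 𝐪 ^ m i then g (r 0) else 0) =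
      (if ‖r 0‖ ≤ 𝐪 then g (r 0) else 0) *
        (if ∀ i : Fin n, ‖r i.succ‖ ≤ 𝐪 ^ m i then 1 else 0) := by
    intro r
    rw [ite_and]
    split_ifs <;> simp
  simp_rw [this]
  rw [integral_fin_succ (fun y : F => if ‖y‖ ≤ 𝐪 then g y else 0)
      fun r => if ∀ i : Fin n, ‖r i‖ ≤ 𝐪 ^ m i then 1 else 0,
    integral_closedBall_q hV hdr hϖ g hg, integral_box_const hV hdr, mul_one, mul_comm]

theorem measurable_box_fst {n : ℕ} (m : Fin n → ℝ) {g : F → ℂ} (hg : Measurable g) :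
    Measurable fun r : Fin (n + 1) → F =>
      if ‖r 0‖ ≤ 𝐪 ∧ ∀ i : Fin n, ‖r i.succ‖ ≤ m i then g (r 0) else 0 := by
  refine Measurable.ite ?_ (hg.comp (measurable_pi_apply 0)) measurable_const
  refine (measurableSet_le (measurable_pi_apply 0).norm measurable_const).inter
    (?_ : MeasurableSet {r : Fin (n + 1) → F | ∀ i : Fin n, ‖r i.succ‖ ≤ m i})
  rw [Set.setOf_forall]
  exact MeasurableSet.iInter fun i =>
    measurableSet_le (measurable_pi_apply i.succ).norm measurable_const

section Tori

variable (hV : IsNormalizedNorm F) (hdr : dr (Metric.closedBall 0 1) = 1) {h : G2 F → ℂ}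
  (H : BallFun h) {t₁ t₂ : Fˣ} [Fintype (ResField F)] {ϖ : F} (hϖ : ‖ϖ‖ = (residueCard F : ℝ)⁻¹)
include hV hdr H hϖ

theorem BallFun.integral_one_zero (h1 : ‖(t₁ : F)‖ = 𝐪 ^ (-1 : ℤ))
    (h2 : ‖(t₂ : F)‖ = 𝐪 ^ (-(1 + 0) : ℤ)) :
    ∫ r : Fin 6 → F, h (torusElt t₁ t₂ * nElt r) ∂𝛑 dr =
      (𝐪 : ℂ) ^ (4 : ℤ) * ∑ ρ : ResField F, h (torusElt t₁ t₂ * xA (ϖ⁻¹ * lift ρ)) := by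
  set g : F → ℂ := fun y => h (torusElt t₁ t₂ * xA y) with hg
  have hgc : Continuous g := (H.right.comp_mul_left _).continuous.comp continuous_xA
  have hgt : ∀ x v, ‖v‖ ≤ 1 → g (x + v) = g x := fun x v hv => by
    simp only [hg]; rw [← xA_mul_xA, ← mul_assoc, H.right _ (xA_mem_K hv)]
  set B : (Fin 6 → F) → ℂ := fun r =>
    if ‖r 0‖ ≤ 𝐪 ∧ ∀ i : Fin 5, ‖r i.succ‖ ≤ 𝐪 ^ (![0, 0, 1, 2, 1] : Fin 5 → ℤ) i
    then g (r 0) else 0 with hB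
  have key : ∀ r : Fin 6 → F, h (torusElt t₁ t₂ * nElt r) =
      B (fun i => r i + (![0, 0, 0, 0, 0, 3 * r 2 * r 3 - r 1 * r 4] : Fin 6 → F) i) := by
    intro r
    simp only [hB]
    rw [nElt_eq]
    split_ifs with hr
    · obtain ⟨hr0, hr⟩ := hr
      have b1 := hr 0
      have b2 := hr 1
      have b3 := hr 2
      have b4 := hr 3
      have b5 := hr 4
      simp only [Matrix.cons_val, Fin.succ_zero_eq_one, Fin.succ_one_eq_two, Fin.reduceSucc,
        add_zero] at b1 b2 b3 b4 b5 hr0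
      have := H.torus_mul t₁ t₂ (r 0)
        (c := ![0, 0, r 3, r 4, r 5 + (3 * r 2 * r 3 - r 1 * r 4)]) (d := ![r 1, r 2, 0, 0, 0])
        (norm_rootsU_mul_le hV h1 h2 fun i => ?_) fun i => ?_
      · convert this using 2
        · congr 3
          ext i; fin_cases i <;> simp [mulU]
          ring
        · simp
      · have h01 : ‖r 0‖ ≤ 𝐪 ^ (1 : ℤ) := by simpa using hr0
        have h3 : ‖(3 : F)‖ ≤ 𝐪 ^ (0 : ℤ) := by
          simpa using IsUltrametricDist.norm_natCast_le_one F 3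
        fin_cases i <;> simp only [Fin.zero_eta, Fin.mk_one, Fin.reduceFinMk, Matrix.cons_val,
          conjA, rootsExp, mul_zero, add_zero, zero_pow (two_ne_zero), sub_zero, norm_zero]
        · exact zpow_nonneg (q_pos hV).le _
        · exact zpow_nonneg (q_pos hV).le _
        · exact b3
        · exact norm_add_le_of_le' b4 (norm_mul_le_zpow hV
            (norm_mul_le_zpow hV h3 h01 (k := 1) (by norm_num)) b3 (by norm_num))
        · exact b5
      · fin_cases i <;> simp only [Fin.zero_eta, Fin.mk_one, Fin.reduceFinMk, Matrix.cons_val,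
          norm_zero, zero_le_one]
        · simpa using b1
        · simpa using b2
    · by_contra h0
      have hb := norm_act_bas_le hV h1 h2 (H.supp _ h0)
      have a0 := hb 6 7 (n := 1) (by decide)
      have a1 := hb 5 6 (n := 0) (by decide)
      have a2 := hb 5 7 (n := 0) (by decide)
      have a3 := hb 3 7 (n := 1) (by decide)
      have a4 := hb 2 7 (n := 2) (by decide)
      have a5 := hb 1 7 (n := 1) (by decide)
      simp only [act_mul, act_xA, act_uElt, bas6, bas7, Matrix.cons_val, mul_zero, mul_one, add_zero,
        zero_add, sub_zero, zero_sub, norm_neg] at a0 a1 a2 a3 a4 a5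
      have m1 : ‖r 0 * r 2‖ ≤ 𝐪 ^ (1 : ℤ) := norm_mul_le_zpow hV a0 a2 (by norm_num)
      have a3' : ‖r 3‖ ≤ 𝐪 ^ (1 : ℤ) := by
        have : r 3 = (r 3 - r 0 * -r 2) - r 0 * r 2 := by ring
        rw [this]; exact norm_sub_le_of_le' a3 m1
      have a4' : ‖r 4‖ ≤ 𝐪 ^ (2 : ℤ) := by
        have : r 4 = (r 4 + r 0 * r 3 - r 0 * -r 3 - r 0 ^ 2 * -r 2) - r 0 * r 3 - r 0 * r 3
            - r 0 * (r 0 * r 2) := by ring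
        rw [this]
        have m2 : ‖r 0 * r 3‖ ≤ 𝐪 ^ (2 : ℤ) := norm_mul_le_zpow hV a0 a3' (by norm_num)
        exact norm_sub_le_of_le' (norm_sub_le_of_le' (norm_sub_le_of_le' a4 m2) m2)
          (norm_mul_le_zpow hV a0 m1 (by norm_num))
      have a5' : ‖r 5 + (3 * r 2 * r 3 - r 1 * r 4)‖ ≤ 𝐪 ^ (1 : ℤ) := by
        have : r 5 + (3 * r 2 * r 3 - r 1 * r 4) =
          r 2 * r 3 - (r 1 * r 4 - 2 * r 2 * r 3 - r 5) := by ring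
        rw [this]
        exact norm_sub_le_of_le' (norm_mul_le_zpow hV a2 a3' (by norm_num)) a5
      refine hr ⟨by simpa using a0, fun i => ?_⟩
      fin_cases i <;> simp only [Fin.zero_eta, Fin.mk_one, Fin.reduceFinMk, Matrix.cons_val,
        Fin.succ_zero_eq_one, Fin.succ_one_eq_two, Fin.reduceSucc, add_zero] <;> assumption
  simp_rw [key]
  rw [integral_comp_triangular (fun i r => (![0, 0, 0, 0, 0, 3 * r 2 * r 3 - r 1 * r 4] : Fin 6 → F) i)
      (hf := measurable_box_fst _ hgc.measurable),
    integral_box_fst hV hdr hϖ _ g hgt]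
  simp [Fin.sum_univ_five, hg]

theorem BallFun.integral_zero_neg_one (h1 : ‖(t₁ : F)‖ = 𝐪 ^ (-0 : ℤ))
    (h2 : ‖(t₂ : F)‖ = 𝐪 ^ (-(0 + -1) : ℤ)) :
    ∫ r : Fin 6 → F, h (torusElt t₁ t₂ * nElt r) ∂𝛑 dr =
      (𝐪 : ℂ) ^ (1 : ℤ) * ∑ ρ : ResField F, h (torusElt t₁ t₂ * xA (ϖ⁻¹ * lift ρ)) := by
  set g : F → ℂ := fun y => h (torusElt t₁ t₂ * xA y) with hg
  have hgc : Continuous g := (H.right.comp_mul_left _).continuous.comp continuous_xA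
  have hgt : ∀ x v, ‖v‖ ≤ 1 → g (x + v) = g x := fun x v hv => by
    simp only [hg]; rw [← xA_mul_xA, ← mul_assoc, H.right _ (xA_mem_K hv)]
  set B : (Fin 6 → F) → ℂ := fun r =>
    if ‖r 0‖ ≤ 𝐪 ∧ ∀ i : Fin 5, ‖r i.succ‖ ≤ 𝐪 ^ (![0, 0, 0, 1, 0] : Fin 5 → ℤ) i
    then g (r 0) else 0 with hB
  have key : ∀ r : Fin 6 → F, h (torusElt t₁ t₂ * nElt r) =
      B (fun i => r i + (![0, 0, 0, 0, 0, -(r 1 * r 4)] : Fin 6 → F) i) := by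
    intro r
    simp only [hB]
    rw [nElt_eq]
    split_ifs with hr
    · obtain ⟨hr0, hr⟩ := hr
      have b1 := hr 0
      have b2 := hr 1
      have b3 := hr 2
      have b4 := hr 3
      have b5 := hr 4
      simp only [Matrix.cons_val, Fin.succ_zero_eq_one, Fin.succ_one_eq_two, Fin.reduceSucc,
        add_zero, zpow_zero] at b1 b2 b3 b4 b5 hr0
      have := H.torus_mul t₁ t₂ (r 0) (c := ![0, 0, 0, r 4, 0])
        (d := ![r 1, r 2, r 3, 0, r 5 + -(r 1 * r 4)])
        (norm_rootsU_mul_le hV h1 h2 fun i => ?_) fun i => ?_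
      · convert this using 2
        · congr 3
          ext i; fin_cases i <;> simp [mulU]
          ring
        · simp
      · fin_cases i <;> simp only [Fin.zero_eta, Fin.mk_one, Fin.reduceFinMk, Matrix.cons_val,
          conjA, rootsExp, mul_zero, add_zero, zero_pow (two_ne_zero), sub_zero, norm_zero]
        · exact zpow_nonneg (q_pos hV).le _
        · exact zpow_nonneg (q_pos hV).le _
        · exact zpow_nonneg (q_pos hV).le _
        · exact b4
        · exact zpow_nonneg (q_pos hV).le _
      · fin_cases i <;> simp only [Fin.zero_eta, Fin.mk_one, Fin.reduceFinMk, Matrix.cons_val,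
          norm_zero, zero_le_one] <;> assumption
    · by_contra h0
      have hb := norm_act_bas_le hV h1 h2 (H.supp _ h0)
      have a0 := hb 0 1 (n := 1) (by decide)
      have a1 := hb 1 2 (n := 0) (by decide)
      have a2 := hb 1 3 (n := 0) (by decide)
      have a3 := hb 1 5 (n := 0) (by decide)
      have a4 := hb 0 5 (n := 1) (by decide)
      have a5 := hb 1 7 (n := 0) (by decide)
      simp only [act_mul, act_xA, act_uElt, bas1, bas2, bas3, bas5, bas7, Matrix.cons_val, mul_zero,
        mul_one, add_zero, zero_add, sub_zero, zero_sub, norm_neg] at a0 a1 a2 a3 a4 a5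
      have a4' : ‖r 4‖ ≤ 𝐪 ^ (1 : ℤ) := by
        have : r 4 = -(-r 4 + r 0 * -r 3) - r 0 * r 3 := by ring
        rw [this]
        exact norm_sub_le_of_le' (by rwa [norm_neg]) (norm_mul_le_zpow hV a0 a3 (by norm_num))
      have a5' : ‖r 5 + -(r 1 * r 4)‖ ≤ 𝐪 ^ (0 : ℤ) := by
        have : r 5 + -(r 1 * r 4) = -(r 1 * r 4 - 2 * r 2 * r 3 - r 5) - 2 * r 2 * r 3 := by ring
        have h2' : ‖(2 : F)‖ ≤ 𝐪 ^ (0 : ℤ) := by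
          simpa using IsUltrametricDist.norm_natCast_le_one F 2
        rw [this]
        exact norm_sub_le_of_le' (by rwa [norm_neg]) (norm_mul_le_zpow hV
          (norm_mul_le_zpow hV h2' a2 (k := 0) (by norm_num)) a3 (by norm_num))
      refine hr ⟨by simpa using a0, fun i => ?_⟩
      fin_cases i <;> simp only [Fin.zero_eta, Fin.mk_one, Fin.reduceFinMk, Matrix.cons_val,
        Fin.succ_zero_eq_one, Fin.succ_one_eq_two, Fin.reduceSucc, add_zero] <;> assumption
  simp_rw [key]
  rw [integral_comp_triangular (fun i r => (![0, 0, 0, 0, 0, -(r 1 * r 4)] : Fin 6 → F) i)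
      (hf := measurable_box_fst _ hgc.measurable),
    integral_box_fst hV hdr hϖ _ g hgt]
  simp [Fin.sum_univ_five, hg]

end Tori

end BallTori

section Cone

/-! ## Character sums over the twisted cubic cone -/

theorem sum_ne_zero_mulShift {k : Type*} [Field k] [Fintype k] {χ : AddChar k ℂ}
    (hχ : χ.IsPrimitive) (a : k) : ∑ x ∈ Finset.univ.filter (fun x : k => ¬x = 0), χ (x * a) =
      (if a = 0 then (Fintype.card k : ℂ) else 0) - 1 := by
  have h := AddChar.sum_mulShift a hχ
  rw [← Finset.sum_filter_add_sum_filter_not _ fun x : k => x = 0] at h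
  have h0 : Finset.univ.filter (fun x : k => x = 0) = {0} := by ext; simp
  rw [h0, Finset.sum_singleton, zero_mul, AddChar.map_zero_eq_one] at h
  rw [eq_sub_iff_add_eq, add_comm]
  exact_mod_cast h

theorem sum_cone {k : Type*} [Field k] [Fintype k] {χ : AddChar k ℂ} (hχ : χ ≠ 1) (c : Fin 3 → k) :
    ∑ z : Fin 4 → k, (if z 1 ^ 2 = z 0 * z 2 ∧ z 0 * z 3 = z 1 * z 2 ∧ z 2 ^ 2 = z 1 * z 3 then
      χ (c 0 * z 0 + c 1 * z 1 + c 2 * z 2) else 0) =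
    Fintype.card k * (Finset.univ.filter fun m : k => c 0 + c 1 * m + c 2 * m ^ 2 = 0).card := by
  have hp : χ.IsPrimitive := AddChar.IsPrimitive.of_ne_one hχ
  rw [← Finset.sum_filter, ← Finset.sum_filter_add_sum_filter_not _ fun z : Fin 4 → k => z 0 = 0]
  have hA : ∑ z ∈ (Finset.univ.filter fun z : Fin 4 → k => z 1 ^ 2 = z 0 * z 2 ∧
      z 0 * z 3 = z 1 * z 2 ∧ z 2 ^ 2 = z 1 * z 3).filter (fun z => z 0 = 0),
      χ (c 0 * z 0 + c 1 * z 1 + c 2 * z 2) = Fintype.card k := by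
    rw [Fintype.card, Finset.cast_card]
    refine Finset.sum_bij' (fun z _ => z 3) (fun m _ => ![0, 0, 0, m]) ?_ ?_ ?_ ?_ ?_
    · simp
    · simp
    · intro z hz
      simp only [Finset.mem_filter, Finset.mem_univ, true_and] at hz
      obtain ⟨⟨h1, h2, h3⟩, h0⟩ := hz
      have z1 : z 1 = 0 := by simpa [h0] using h1
      have z2 : z 2 = 0 := by simpa [z1] using h3
      ext i; fin_cases i <;> simp [h0, z1, z2]
    · simp
    · intro z hz
      simp only [Finset.mem_filter, Finset.mem_univ, true_and] at hz
      obtain ⟨⟨h1, h2, h3⟩, h0⟩ := hz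
      have z1 : z 1 = 0 := by simpa [h0] using h1
      have z2 : z 2 = 0 := by simpa [z1] using h3
      simp [h0, z1, z2]
  have hB : ∑ z ∈ (Finset.univ.filter fun z : Fin 4 → k => z 1 ^ 2 = z 0 * z 2 ∧
      z 0 * z 3 = z 1 * z 2 ∧ z 2 ^ 2 = z 1 * z 3).filter (fun z => ¬z 0 = 0),
      χ (c 0 * z 0 + c 1 * z 1 + c 2 * z 2) =
      ∑ p ∈ (Finset.univ : Finset k) ×ˢ (Finset.univ.filter fun x : k => ¬x = 0),
        χ (p.2 * (c 0 + c 1 * p.1 + c 2 * p.1 ^ 2)) := by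
    refine Finset.sum_bij' (fun z _ => (z 1 / z 0, z 0))
      (fun p _ => ![p.2, p.2 * p.1, p.2 * p.1 ^ 2, p.2 * p.1 ^ 3]) ?_ ?_ ?_ ?_ ?_
    · intro z hz
      simp only [Finset.mem_filter, Finset.mem_univ, true_and] at hz
      simp [hz.2]
    · intro p hp
      simp only [Finset.mem_product, Finset.mem_filter, Finset.mem_univ, true_and] at hp
      simp only [Finset.mem_filter, Finset.mem_univ, true_and, Matrix.cons_val]
      exact ⟨⟨by ring, by ring, by ring⟩, hp⟩
    · intro z hz
      simp only [Finset.mem_filter, Finset.mem_univ, true_and] at hz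
      obtain ⟨⟨h1, h2, h3⟩, h0⟩ := hz
      have e2 : z 2 = z 1 ^ 2 / z 0 := by field_simp; linear_combination -h1
      have e3 : z 3 = z 1 * z 2 / z 0 := by field_simp; linear_combination h2
      ext i; fin_cases i
      · simp
      · simp; field_simp
      · simp [e2]; field_simp
      · simp [e3, e2]; field_simp
    · intro p hp
      simp only [Finset.mem_product, Finset.mem_filter, Finset.mem_univ, true_and] at hp
      ext <;> simp [hp]
    · intro z hz
      simp only [Finset.mem_filter, Finset.mem_univ, true_and] at hz
      obtain ⟨⟨h1, h2, h3⟩, h0⟩ := hz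
      have e2 : z 2 = z 1 ^ 2 / z 0 := by field_simp; linear_combination -h1
      congr 1
      rw [e2]
      field_simp
  rw [hA, hB, Finset.sum_product]
  simp_rw [sum_ne_zero_mulShift hp]
  rw [Finset.sum_sub_distrib, ← Finset.sum_filter, Finset.sum_const, Finset.sum_const]
  simp only [nsmul_eq_mul, mul_one, Finset.card_univ]
  ring

theorem norm_scaled_le_one (hV : IsNormalizedNorm F) {ϖ x : F} (hϖ : ‖ϖ‖ = 𝐪⁻¹) :
    ‖ϖ⁻¹ * x‖ ≤ 1 ↔ ‖x‖ < 1 := by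
  rw [norm_mul, norm_inv, hϖ, inv_inv, norm_lt_one_iff hV, mul_comm, ← le_div_iff₀ (q_pos hV),
    one_div]

/-- The additive character of the residue field induced by an unramified character. -/
def resChar (hV : IsNormalizedNorm F) {ψ : AddChar F Circle} (hψ : Unramified ψ) {ϖ : F}
    (hϖ : ‖ϖ‖ = 𝐪⁻¹) : AddChar (ResField F) ℂ where
  toFun z := ψ (ϖ⁻¹ * lift z)
  map_zero_eq_one' := by
    rw [hψ.eq_one]; · rfl
    rw [norm_scaled_le_one hV hϖ, norm_lift_lt_one_iff]
  map_add_eq_mul' z w := by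
    rw [← AddChar_coe_add, ← mul_add]
    have e : ϖ⁻¹ * lift (z + w) = ϖ⁻¹ * (lift z + lift w) +
        ϖ⁻¹ * (lift (z + w) - (lift z + lift w)) := by ring
    rw [e, hψ.apply_add]
    rw [norm_scaled_le_one hV hϖ, ← red_eq_red_iff (norm_lift_le _)
      (norm_le_one_add (norm_lift_le _) (norm_lift_le _)), red_add (norm_lift_le _) (norm_lift_le _)]
    simp only [red_lift]

theorem resChar_red (hV : IsNormalizedNorm F) {ψ : AddChar F Circle} (hψ : Unramified ψ) {ϖ : F}
    (hϖ : ‖ϖ‖ = 𝐪⁻¹) {x : F} (hx : ‖x‖ ≤ 1) :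
    resChar hV hψ hϖ (red x) = ψ (ϖ⁻¹ * x) := by
  change (ψ (ϖ⁻¹ * lift (red x)) : ℂ) = _
  have e : ϖ⁻¹ * x = ϖ⁻¹ * lift (red x) + ϖ⁻¹ * (x - lift (red x)) := by ring
  rw [e, hψ.apply_add]
  rw [norm_scaled_le_one hV hϖ, ← red_eq_red_iff hx (norm_lift_le _), red_lift]

theorem resChar_ne_one (hV : IsNormalizedNorm F) {ψ : AddChar F Circle} (hψ : Unramified ψ)
    {ϖ : F} (hϖ : ‖ϖ‖ = 𝐪⁻¹) : resChar hV hψ hϖ ≠ 1 := by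
  obtain ⟨v, hv, hne⟩ := hψ.exists_ne_one hV
  intro h
  have hϖ0 : ϖ ≠ 0 := by
    rw [← norm_pos_iff, hϖ]; exact inv_pos.2 (q_pos hV)
  have hv1 : ‖ϖ * v‖ ≤ 1 := by
    rw [norm_mul, hϖ, hv, inv_mul_cancel₀ (q_pos hV).ne']
  have := resChar_red hV hψ hϖ hv1
  rw [h, inv_mul_cancel_left₀ hϖ0, AddChar.one_apply] at this
  exact hne (Circle.ext this.symm)

/-! ## Balls in `U` -/

/-- The set of the first four coordinates of the `r` with `gn (uElt r * t) ≤ q ^ (a + N)`, where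
`t` is a dominant torus element with exponents `a ≥ b ≥ 0` and `e = a - b`. -/
def omegaSet (N e : ℤ) : Set (Fin 4 → F) :=
  {r | ‖r 0‖ ≤ 𝐪 ^ (N + e) ∧ ‖r 1‖ ≤ 𝐪 ^ N ∧ ‖r 2‖ ≤ 𝐪 ^ N ∧ ‖r 3‖ ≤ 𝐪 ^ N ∧
    ‖r 1 ^ 2 - r 0 * r 2‖ ≤ 𝐪 ^ (N + e) ∧ ‖r 0 * r 3 - r 1 * r 2‖ ≤ 𝐪 ^ (N + e) ∧
    ‖r 2 ^ 2 - r 1 * r 3‖ ≤ 𝐪 ^ N}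

theorem norm_le_of_eq_neg {x y : F} {c : ℝ} (h : ‖x‖ ≤ c) (e : y = -x) : ‖y‖ ≤ c := by
  rwa [e, norm_neg]

theorem gn_uElt_mul_torusElt_le_iff (hV : IsNormalizedNorm F) {t₁ t₂ : Fˣ} {a b : ℤ}
    (h1 : ‖(t₁ : F)‖ = 𝐪 ^ (-a)) (h2 : ‖(t₂ : F)‖ = 𝐪 ^ (-(a + b))) (hab : b ≤ a) (hb : 0 ≤ b)
    {N : ℤ} (hN : 0 ≤ N) (r : Fin 5 → F) :
    gn (uElt r * torusElt t₁ t₂) ≤ 𝐪 ^ (a + N) ↔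
      (fun i : Fin 4 => r i.castSucc) ∈ omegaSet (F := F) N (a - b) ∧
        ‖r 4 + (2 * r 1 * r 2 - r 0 * r 3)‖ ≤ 𝐪 ^ N := by
  have hq := q_pos hV
  have hone : ∀ {n : ℤ}, 0 ≤ n → ‖(1 : F)‖ ≤ 𝐪 ^ n := fun hn => by
    rw [norm_one]; exact one_le_zpow₀ (one_lt_q hV).le hn
  have hent : gn (uElt r * torusElt t₁ t₂) ≤ 𝐪 ^ (a + N) ↔
      ∀ i j, ‖act (uElt r) (bas j) i‖ ≤ 𝐪 ^ (a + N + torusExp a b j) := by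
    rw [gn_le_iff (zpow_pos hq _).le]
    refine forall_congr' fun i => forall_congr' fun j => ?_
    have e : act (torusElt t₁ t₂) (bas j) = (torusElt t₁ t₂).1.1 j j • bas j := by
      ext l
      rw [Pi.smul_apply, smul_eq_mul, act_bas]
      by_cases hl : l = j
      · subst hl; simp [bas]
      · have : (torusElt t₁ t₂).1.1 l j = 0 := Matrix.diagonal_apply_ne _ hl
        rw [this]; simp [bas, hl]
    have e' := norm_act_torusElt hV h1 h2 (bas j) j
    rw [act_bas, show (bas j : Fin 8 → F) j = 1 by simp [bas], norm_one, mul_one] at e'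
    rw [← act_bas, act_mul, e, act_smul, Pi.smul_apply, smul_eq_mul, norm_mul, e', _root_.zpow_neg,
      inv_mul_le_iff₀ (zpow_pos hq _), zpow_add₀ hq.ne' (a + N), mul_comm]
  rw [hent]
  simp only [omegaSet, Set.mem_ofPred_eq]
  change _ ↔ (‖r 0‖ ≤ _ ∧ ‖r 1‖ ≤ _ ∧ ‖r 2‖ ≤ _ ∧ ‖r 3‖ ≤ _ ∧ ‖r 1 ^ 2 - r 0 * r 2‖ ≤ _ ∧
    ‖r 0 * r 3 - r 1 * r 2‖ ≤ _ ∧ ‖r 2 ^ 2 - r 1 * r 3‖ ≤ _) ∧ _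
  constructor
  · intro h
    have a0 := h 5 6
    have a1 := h 5 7
    have a2 := h 3 7
    have a3 := h 2 7
    have a4 := h 1 6
    have a5 := h 0 6
    have a6 := h 0 7
    have a7 := h 1 7
    simp only [act_uElt, bas6, bas7, Matrix.cons_val, mul_zero, mul_one, add_zero, torusExp,
        zero_add, sub_zero, zero_sub, norm_neg] at a0 a1 a2 a3 a4 a5 a6 a7
    have n1 : a + N + -a = N := by ring
    have n2 : a + N + -b = N + (a - b) := by ring
    rw [n1] at a1 a2 a3 a6 a7
    rw [n2] at a0 a4 a5
    have a7' : ‖r 4 + (2 * r 1 * r 2 - r 0 * r 3)‖ ≤ 𝐪 ^ N := by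
      exact norm_le_of_eq_neg a7 (by ring)
    refine ⟨⟨a0, a1, a2, a3, ?_, ?_, ?_⟩, a7'⟩
    · exact norm_le_of_eq_neg a4 (by ring)
    · have : r 0 * r 3 - r 1 * r 2 = (r 4 + r 1 * r 2) - (r 4 + (2 * r 1 * r 2 - r 0 * r 3)) := by
        ring
      rw [this]
      exact norm_sub_le_of_le' a5 (norm_le_zpow_mono hV a7' (by omega))
    · exact norm_le_of_eq_neg a6 (by ring)
  · rintro ⟨⟨a0, a1, a2, a3, a4, a5, a6⟩, a7⟩ i j
    have z : ∀ n : ℤ, ‖(0 : F)‖ ≤ 𝐪 ^ n := fun n => by rw [norm_zero]; exact (zpow_pos hq _).le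
    have a4' : ‖r 0 * r 2 - r 1 ^ 2‖ ≤ 𝐪 ^ (N + (a - b)) := by
      exact norm_le_of_eq_neg a4 (by ring)
    have a6' : ‖r 1 * r 3 - r 2 ^ 2‖ ≤ 𝐪 ^ N := by
      exact norm_le_of_eq_neg a6 (by ring)
    have a7' : ‖r 0 * r 3 - 2 * r 1 * r 2 - r 4‖ ≤ 𝐪 ^ N := by
      exact norm_le_of_eq_neg a7 (by ring)
    have a5' : ‖r 4 + r 1 * r 2‖ ≤ 𝐪 ^ (N + (a - b)) := by
      have : r 4 + r 1 * r 2 = (r 4 + (2 * r 1 * r 2 - r 0 * r 3)) + (r 0 * r 3 - r 1 * r 2) := by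
        ring
      rw [this]
      exact norm_add_le_of_le' (norm_le_zpow_mono hV a7 (by omega)) a5
    rw [act_uElt]
    fin_cases j <;> fin_cases i <;>
      simp only [Fin.zero_eta, Fin.mk_one, Fin.reduceFinMk, bas0, bas1, bas2, bas3, bas4, bas5,
        bas6, bas7, Matrix.cons_val, mul_zero, mul_one, add_zero, torusExp, zero_add, sub_zero,
        zero_sub, norm_neg] <;>
      first
      | exact z _
      | exact hone (by omega)
      | exact norm_le_zpow_mono hV a0 (by omega)
      | exact norm_le_zpow_mono hV a1 (by omega)
      | exact norm_le_zpow_mono hV a2 (by omega)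
      | exact norm_le_zpow_mono hV a3 (by omega)
      | exact norm_le_zpow_mono hV a4' (by omega)
      | exact norm_le_zpow_mono hV a5' (by omega)
      | exact norm_le_zpow_mono hV a6' (by omega)
      | exact norm_le_zpow_mono hV a7' (by omega)

theorem integral_fin_last {n : ℕ} (f : F → ℂ) (g : (Fin n → F) → ℂ) :
    ∫ r : Fin (n + 1) → F, g (fun i => r i.castSucc) * f (r (Fin.last n)) ∂𝛑 dr =
      (∫ r, g r ∂𝛑 dr) * ∫ x, f x ∂dr := by
  have h := measurePreserving_piFinSuccAbove (fun _ : Fin (n + 1) => dr) (Fin.last n)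
  rw [mul_comm, ← integral_prod_mul,
    ← h.integral_comp' (g := fun z : F × (Fin n → F) => f z.1 * g z.2)]
  refine integral_congr_ae (.of_forall fun r => ?_)
  simp only [MeasurableEquiv.piFinSuccAbove_apply, Fin.insertNthEquiv_symm_apply]
  have e : (Fin.last n).removeNth r = fun i => r i.castSucc := by
    ext i; simp [Fin.removeNth]
  rw [mul_comm, ← e]

theorem measurableSet_omegaSet (N e : ℤ) : MeasurableSet (omegaSet (F := F) N e) := by
  have hm : ∀ {f : (Fin 4 → F) → F} (c : ℝ), Continuous f → IsClosed {r | ‖f r‖ ≤ c} :=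
    fun c hf => isClosed_le hf.norm continuous_const
  exact ((hm _ (by fun_prop)).inter ((hm _ (by fun_prop)).inter ((hm _ (by fun_prop)).inter
    ((hm _ (by fun_prop)).inter ((hm (f := fun r => r 1 ^ 2 - r 0 * r 2) _ (by fun_prop)).inter
    ((hm (f := fun r => r 0 * r 3 - r 1 * r 2) _ (by fun_prop)).inter
    (hm (f := fun r => r 2 ^ 2 - r 1 * r 3) _ (by fun_prop)))))))).measurableSet

/-- The Fourier transform of `omegaSet`. -/
def omegaInt (dr : Measure F) (ψ : AddChar F Circle) (N e : ℤ) (c : Fin 3 → F) : ℂ :=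
  ∫ r : Fin 4 → F, (if r ∈ omegaSet (F := F) N e then
    (ψ (c 0 * r 0 + c 1 * r 1 + c 2 * r 2) : ℂ) else 0) ∂𝛑 dr

theorem integral_ball_uElt (hV : IsNormalizedNorm F) (hdr : dr (Metric.closedBall 0 1) = 1)
    {ψ : AddChar F Circle} (hψ : Unramified ψ) {t₁ t₂ : Fˣ} {a b : ℤ}
    (h1 : ‖(t₁ : F)‖ = 𝐪 ^ (-a)) (h2 : ‖(t₂ : F)‖ = 𝐪 ^ (-(a + b))) (hab : b ≤ a) (hb : 0 ≤ b)
    {N : ℤ} (hN : 0 ≤ N) (c : Fin 3 → F) :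
    ∫ r : Fin 5 → F, (if gn (uElt r * torusElt t₁ t₂) ≤ 𝐪 ^ (a + N) then
      (ψ (c 0 * r 0 + c 1 * r 1 + c 2 * r 2) : ℂ) else 0) ∂𝛑 dr =
      (𝐪 : ℂ) ^ N * omegaInt dr ψ N (a - b) c := by
  simp_rw [gn_uElt_mul_torusElt_le_iff hV h1 h2 hab hb hN]
  set g : (Fin 4 → F) → ℂ := fun r => if r ∈ omegaSet (F := F) N (a - b) then
    (ψ (c 0 * r 0 + c 1 * r 1 + c 2 * r 2) : ℂ) else 0 with hg
  set f : F → ℂ := fun x => if ‖x‖ ≤ 𝐪 ^ N then 1 else 0 with hf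
  have hgm : Measurable g := by
    refine Measurable.ite (measurableSet_omegaSet _ _) ?_ measurable_const
    exact (hψ.continuous_coe.comp (by fun_prop)).measurable
  have hfm : Measurable f := Measurable.ite
    (measurableSet_le measurable_norm measurable_const) measurable_const measurable_const
  have hBm : Measurable fun r : Fin 5 → F => g (fun i => r i.castSucc) * f (r (Fin.last 4)) :=
    (hgm.comp (measurable_pi_lambda _ fun i => measurable_pi_apply _)).mul
      (hfm.comp (measurable_pi_apply _))
  have hf1 : ∫ x, f x ∂dr = (𝐪 : ℂ) ^ N := by
    have : f = (Metric.closedBall 0 (𝐪 ^ N)).indicator fun _ => 1 := by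
      ext x; simp only [hf, Set.indicator_apply, mem_closedBall_zero_iff]
    rw [this, integral_indicator measurableSet_closedBall, setIntegral_const, Measure.real,
      volume_closedBall hV hdr, ENNReal.toReal_ofReal (zpow_pos (q_pos hV) _).le]
    simp
  rw [omegaInt, mul_comm, ← hf1, ← integral_fin_last,
    ← integral_comp_triangular (fun i (r : Fin 5 → F) =>
      (![0, 0, 0, 0, 2 * r 1 * r 2 - r 0 * r 3] : Fin 5 → F) i) (hf := hBm)]
  · refine integral_congr_ae (.of_forall fun r => ?_)
    have e : (fun i : Fin 4 => r i.castSucc +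
        (![0, 0, 0, 0, 2 * r 1 * r 2 - r 0 * r 3] : Fin 5 → F) i.castSucc) =
        fun i => r i.castSucc := by
      ext i; fin_cases i <;> simp
    simp only [e]
    have e' : r (Fin.last 4) + (![0, 0, 0, 0, 2 * r 1 * r 2 - r 0 * r 3] : Fin 5 → F) (Fin.last 4) =
      r 4 + (2 * r 1 * r 2 - r 0 * r 3) := rfl
    rw [e', ite_and]
    simp only [hg, hf]
    split_ifs <;> simp

/-- The number of points of the projective line over the residue field, without infinity, at which
the quadratic form with coefficients `c` vanishes. -/
def rootCount [Fintype (ResField F)] (c : Fin 3 → F) : ℕ :=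
  (Finset.univ.filter fun m : ResField F => red (c 0) + red (c 1) * m + red (c 2) * m ^ 2 = 0).card

theorem omegaInt_one_zero (hV : IsNormalizedNorm F) (hdr : dr (Metric.closedBall 0 1) = 1)
    {ψ : AddChar F Circle} (hψ : Unramified ψ) [Fintype (ResField F)] {c : Fin 3 → F}
    (hc : ∀ i, ‖c i‖ ≤ 1) : omegaInt dr ψ 1 0 c = (𝐪 : ℂ) * rootCount c := by
  obtain ⟨ϖ, hϖ⟩ := hV.1
  have hq := q_pos hV
  have hq' : (𝐪 : ℂ) ≠ 0 := by exact_mod_cast hq.ne'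
  have hϖ0 : ϖ ≠ 0 := by rw [← norm_pos_iff, hϖ]; exact inv_pos.2 hq
  have hn : ‖ϖ⁻¹‖ = 𝐪 := by rw [norm_inv, hϖ, inv_inv]
  have hlin : ∀ x : F, ‖ϖ⁻¹ * x‖ ≤ 𝐪 ↔ ‖x‖ ≤ 1 := fun x => by
    rw [norm_mul, hn, mul_le_iff_le_one_right hq]
  have hmem : ∀ x : Fin 4 → F, (fun i => ϖ⁻¹ * x i) ∈ omegaSet (F := F) 1 0 ↔
      (∀ i, ‖x i‖ ≤ 1) ∧ ‖x 1 ^ 2 - x 0 * x 2‖ < 1 ∧ ‖x 0 * x 3 - x 1 * x 2‖ < 1 ∧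
        ‖x 2 ^ 2 - x 1 * x 3‖ < 1 := by
    intro x
    have q1 : (ϖ⁻¹ * x 1) ^ 2 - ϖ⁻¹ * x 0 * (ϖ⁻¹ * x 2) =
      ϖ⁻¹ * (ϖ⁻¹ * (x 1 ^ 2 - x 0 * x 2)) := by ring
    have q2 : ϖ⁻¹ * x 0 * (ϖ⁻¹ * x 3) - ϖ⁻¹ * x 1 * (ϖ⁻¹ * x 2) =
      ϖ⁻¹ * (ϖ⁻¹ * (x 0 * x 3 - x 1 * x 2)) := by ring
    have q3 : (ϖ⁻¹ * x 2) ^ 2 - ϖ⁻¹ * x 1 * (ϖ⁻¹ * x 3) =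
      ϖ⁻¹ * (ϖ⁻¹ * (x 2 ^ 2 - x 1 * x 3)) := by ring
    simp only [omegaSet, Set.mem_ofPred_eq, add_zero, zpow_one, q1, q2, q3, hlin,
      norm_scaled_le_one hV hϖ, Fin.forall_fin_succ]
    simp only [Fin.forall_fin_zero, Fin.succ_zero_eq_one, Fin.succ_one_eq_two, and_true, and_assoc]
    rfl
  have h := integral_comp_pi_mul hV hdr (c := fun _ : Fin 4 => ϖ⁻¹) (fun _ => inv_ne_zero hϖ0)
    fun r => if r ∈ omegaSet (F := F) 1 0 then
      (ψ (c 0 * r 0 + c 1 * r 1 + c 2 * r 2) : ℂ) else 0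
  have hred := integral_eq_sum_residue hV hdr (n := 4)
    (fun x => if (fun i => ϖ⁻¹ * x i) ∈ omegaSet (F := F) 1 0 then
      (ψ (c 0 * (ϖ⁻¹ * x 0) + c 1 * (ϖ⁻¹ * x 1) + c 2 * (ϖ⁻¹ * x 2)) : ℂ) else 0)
  have hval : ∀ x : Fin 4 → F, (∀ i, ‖x i‖ ≤ 1) →
      (if (fun i => ϖ⁻¹ * x i) ∈ omegaSet (F := F) 1 0 then
      (ψ (c 0 * (ϖ⁻¹ * x 0) + c 1 * (ϖ⁻¹ * x 1) + c 2 * (ϖ⁻¹ * x 2)) : ℂ) else 0) =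
      if red (x 1) ^ 2 = red (x 0) * red (x 2) ∧ red (x 0) * red (x 3) = red (x 1) * red (x 2) ∧
        red (x 2) ^ 2 = red (x 1) * red (x 3) then
      resChar hV hψ hϖ (red (c 0) * red (x 0) + red (c 1) * red (x 1) + red (c 2) * red (x 2))
      else 0 := by
    intro x hx
    have hp : ∀ i j, ‖x i * x j‖ ≤ 1 := fun i j => norm_le_one_mul (hx i) (hx j)
    have hp2 : ∀ i, ‖x i ^ 2‖ ≤ 1 := fun i => norm_le_one_pow (hx i) 2
    have hc' : ∀ i j, ‖c i * x j‖ ≤ 1 := fun i j => norm_le_one_mul (hc i) (hx j)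
    have e1 : red (x 1) ^ 2 = red (x 0) * red (x 2) ↔ ‖x 1 ^ 2 - x 0 * x 2‖ < 1 := by
      rw [← red_eq_red_iff (hp2 _) (hp _ _), red_mul (hx _) (hx _), sq (x 1),
        red_mul (hx _) (hx _), sq]
    have e2 : red (x 0) * red (x 3) = red (x 1) * red (x 2) ↔ ‖x 0 * x 3 - x 1 * x 2‖ < 1 := by
      rw [← red_eq_red_iff (hp _ _) (hp _ _), red_mul (hx _) (hx _), red_mul (hx _) (hx _)]
    have e3 : red (x 2) ^ 2 = red (x 1) * red (x 3) ↔ ‖x 2 ^ 2 - x 1 * x 3‖ < 1 := by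
      rw [← red_eq_red_iff (hp2 _) (hp _ _), red_mul (hx _) (hx _), sq (x 2),
        red_mul (hx _) (hx _), sq]
    rw [e1, e2, e3]
    simp only [hmem]
    rw [← red_mul (hc _) (hx _), ← red_mul (hc _) (hx _), ← red_mul (hc _) (hx _),
      ← red_add (hc' _ _) (hc' _ _), ← red_add (norm_le_one_add (hc' _ _) (hc' _ _)) (hc' _ _),
      resChar_red hV hψ hϖ (norm_le_one_add (norm_le_one_add (hc' _ _) (hc' _ _)) (hc' _ _))]
    refine if_congr ?_ ?_ rfl
    · exact ⟨fun h => h.2, fun h => ⟨hx, h⟩⟩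
    · congr 2; ring
  rw [hred] at h
  · simp_rw [hval _ fun i => norm_lift_le _, red_lift] at h
    rw [sum_cone (resChar_ne_one hV hψ hϖ) fun i => red (c i)] at h
    have hcard : (Fintype.card (ResField F) : ℂ) = 𝐪 := by
      rw [← Nat.card_eq_fintype_card]; simp [residueCard]
    rw [hcard] at h
    have h4 : ((∏ _ : Fin 4, ‖ϖ⁻¹‖⁻¹ : ℝ) : ℂ) = ((𝐪 : ℂ) ^ 4)⁻¹ := by
      rw [Finset.prod_const, hn]
      simp
    rw [h4] at h
    exact (mul_left_cancel₀ (inv_ne_zero (pow_ne_zero _ hq')) h).symm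
  · rintro r ⟨i, hi⟩
    rw [if_neg]
    rw [hmem]
    exact fun hh => hi.not_ge (hh.1 i)
  · intro r v hr hv
    have hrv : ∀ i, ‖(r + v) i‖ ≤ 1 := fun i => norm_le_one_add (hr i) (hv i).le
    rw [hval _ hrv, hval _ hr]
    have : ∀ i, red ((r + v) i) = red (r i) := fun i => by
      rw [red_eq_red_iff (hrv i) (hr i)]
      simpa using hv i
    simp only [this]

end Cone

section Partition

/-! ## The Iwasawa decomposition of the ball of radius `q` -/

theorem torusElt_mul_nElt (t₁ t₂ : Fˣ) (r : Fin 6 → F) :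
    ∃ r', torusElt t₁ t₂ * nElt r = nElt r' * torusElt t₁ t₂ := by
  refine ⟨Fin.cons (t₁ ^ 2 / t₂ * r 0) fun i => rootsU t₁ t₂ i * r i.succ, ?_⟩
  rw [nElt, nElt, ← mul_assoc, torusElt_mul_xA, mul_assoc, torusElt_mul_uElt]
  simp only [Fin.cons_zero, Fin.cons_succ, mul_assoc]

theorem exists_eq_torus_mul_nElt (x : G2 F) :
    ∃ (t₁ t₂ : Fˣ) (r : Fin 6 → F), ∃ k ∈ groupK F, x = torusElt t₁ t₂ * nElt r * k := by
  obtain ⟨r, y, t₁, t₂, k, hk, rfl⟩ := iwasawa x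
  have e : uElt r * xA y = nElt (Fin.cons y (conjA (-y) r)) := by
    rw [nElt]
    simp only [Fin.cons_zero, Fin.cons_succ]
    have := xA_mul_uElt (-y) r
    rw [← xA_inv, inv_mul_eq_iff_eq_mul, ← mul_assoc, eq_mul_inv_iff_mul_eq] at this
    exact this
  obtain ⟨r', h⟩ := torusElt_mul_nElt t₁⁻¹ t₂⁻¹ (Fin.cons y (conjA (-y) r))
  refine ⟨t₁, t₂, r', k, hk, ?_⟩
  rw [e]
  congr 1
  rw [← torusElt_inv, inv_mul_eq_iff_eq_mul, ← mul_assoc, eq_mul_inv_iff_mul_eq] at h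
  exact h

/-- The torus component in the Iwasawa decomposition. -/
theorem height_torus_nElt (t₁ t₂ : Fˣ) (r : Fin 6 → F) {k : G2 F} (hk : k ∈ groupK F) :
    ‖act (torusElt t₁ t₂ * nElt r * k)⁻¹ (bas 0)‖ = ‖(t₁ : F)‖⁻¹ ∧
    wedgeNorm (act (torusElt t₁ t₂ * nElt r * k)⁻¹ (bas 0))
      (act (torusElt t₁ t₂ * nElt r * k)⁻¹ (bas 1)) = ‖(t₂ : F)‖⁻¹ := by
  have e0 : act (torusElt t₁ t₂ * nElt r * k)⁻¹ (bas 0) =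
      act k⁻¹ ((t₁ : F)⁻¹ • bas 0 + (0 : F) • bas 1) := by
    rw [_root_.mul_inv_rev, _root_.mul_inv_rev, act_mul, act_mul, torusElt_inv, nElt,
      _root_.mul_inv_rev, act_mul, xA_inv, uElt_inv]
    congr 1
    rw [act_torusElt, act_xA, act_uElt, bas0, bas1]
    apply ext8 <;> simp
  have e1 : act (torusElt t₁ t₂ * nElt r * k)⁻¹ (bas 1) =
      act k⁻¹ ((-(t₁ / t₂ * r 0) : F) • bas 0 + (t₁ / t₂ : F) • bas 1) := by
    rw [_root_.mul_inv_rev, _root_.mul_inv_rev, act_mul, act_mul, torusElt_inv, nElt,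
      _root_.mul_inv_rev, act_mul, xA_inv, uElt_inv]
    congr 1
    rw [act_torusElt, act_xA, act_uElt, bas0, bas1]
    apply ext8 <;> simp <;> ring
  have hk' := inv_mem hk
  have hw : wedgeNorm (bas 0 : Fin 8 → F) (bas 1) = 1 := by
    refine le_antisymm ((wedgeNorm_le_iff zero_le_one).2 fun i j => ?_) ?_
    · have h : ∀ i j, ‖(bas i : Fin 8 → F) j‖ ≤ 1 := fun i j => by
        by_cases h : j = i <;> simp [bas, h]
      exact norm_le_one_sub (norm_le_one_mul (h _ _) (h _ _)) (norm_le_one_mul (h _ _) (h _ _))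
    · have := norm_minor_le (bas 0 : Fin 8 → F) (bas 1) 0 1
      simpa [bas0, bas1] using this
  constructor
  · rw [e0, norm_act_K hk', zero_smul, add_zero, norm_smul, norm_inv]
    have : ‖(bas 0 : Fin 8 → F)‖ = 1 := by
      rw [bas, Pi.norm_single, norm_one]
    rw [this, mul_one]
  · rw [e0, e1, wedgeNorm_act_K hk', wedgeNorm_combination, hw, mul_one, zero_mul, sub_zero,
      norm_mul, norm_inv, norm_div]
    have := norm_ne_zero_iff.2 t₁.ne_zero
    field_simp

theorem torus_inv_mul_mem_setNK_iff (t₁ t₂ : Fˣ) (x : G2 F) :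
    (torusElt t₁ t₂)⁻¹ * x ∈ setNK F ↔ ‖act x⁻¹ (bas 0)‖ = ‖(t₁ : F)‖⁻¹ ∧
      wedgeNorm (act x⁻¹ (bas 0)) (act x⁻¹ (bas 1)) = ‖(t₂ : F)‖⁻¹ := by
  constructor
  · rintro ⟨r, k, hk, h⟩
    rw [inv_mul_eq_iff_eq_mul, ← mul_assoc] at h
    rw [h]
    exact height_torus_nElt t₁ t₂ r hk
  · rintro ⟨h1, h2⟩
    obtain ⟨s₁, s₂, r, k, hk, rfl⟩ := exists_eq_torus_mul_nElt x
    obtain ⟨g1, g2⟩ := height_torus_nElt s₁ s₂ r hk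
    rw [g1, _root_.inv_inj] at h1
    rw [g2, _root_.inv_inj] at h2
    obtain ⟨r', hr'⟩ := torusElt_mul_nElt (t₁⁻¹ * s₁) (t₂⁻¹ * s₂) r
    refine ⟨r', torusElt (t₁⁻¹ * s₁) (t₂⁻¹ * s₂) * k, mul_mem (torusElt_mem_K ?_ ?_) hk, ?_⟩
    · rw [Units.val_mul, norm_mul, h1, ← norm_mul, ← Units.val_mul]; simp
    · rw [Units.val_mul, norm_mul, h2, ← norm_mul, ← Units.val_mul]; simp
    · rw [← mul_assoc, ← mul_assoc, ← mul_assoc, torusElt_inv, torusElt_mul, hr']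

theorem act_nElt_bas_self (r : Fin 6 → F) {i : Fin 8} (h3 : i ≠ 3) (h4 : i ≠ 4) :
    act (nElt r) (bas i) i = 1 := by
  rw [nElt_eq, act_mul, act_xA, act_uElt]
  fin_cases i <;> simp_all [bas0, bas1, bas2, bas5, bas6, bas7]

/-- The exponents of the tori which meet the ball of radius `q`. -/
def ballExps : Finset (ℤ × ℤ) := {(0, 0), (1, 1), (-1, -1), (1, 0), (0, 1), (0, -1), (-1, 0)}

theorem mem_ballExps_of_gn_le (hV : IsNormalizedNorm F) {t₁ t₂ : Fˣ} {a b : ℤ}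
    (h1 : ‖(t₁ : F)‖ = 𝐪 ^ (-a)) (h2 : ‖(t₂ : F)‖ = 𝐪 ^ (-(a + b))) {r : Fin 6 → F}
    (hg : gn (torusElt t₁ t₂ * nElt r) ≤ 𝐪) : (a, b) ∈ ballExps := by
  have key : ∀ i : Fin 8, i ≠ 3 → i ≠ 4 → 0 ≤ torusExp a b i + 1 := fun i h3 h4 => by
    have := norm_act_bas_le hV h1 h2 hg i i rfl
    rw [act_nElt_bas_self r h3 h4, norm_one] at this
    by_contra! hlt
    exact absurd this (not_le.2 (zpow_lt_one_of_neg₀ (one_lt_q hV) hlt))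
  have k0 := key 0 (by decide) (by decide)
  have k1 := key 1 (by decide) (by decide)
  have k2 := key 2 (by decide) (by decide)
  have k5 := key 5 (by decide) (by decide)
  have k6 := key 6 (by decide) (by decide)
  have k7 := key 7 (by decide) (by decide)
  simp only [torusExp, Matrix.cons_val] at k0 k1 k2 k5 k6 k7
  have ha : a = -1 ∨ a = 0 ∨ a = 1 := by omega
  have hb : b = -1 ∨ b = 0 ∨ b = 1 := by omega
  rcases ha with rfl | rfl | rfl <;> rcases hb with rfl | rfl | rfl <;>
    first | decide | (exfalso; omega)

/-- The torus element with exponents `a`, `b`. -/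
def torusPow (ϖ : Fˣ) (a b : ℤ) : G2 F := torusElt (ϖ ^ a) (ϖ ^ (a + b))

theorem norm_unit_zpow {ϖ : Fˣ} (hϖ : ‖(ϖ : F)‖ = 𝐪⁻¹) (a : ℤ) :
    ‖((ϖ ^ a : Fˣ) : F)‖ = 𝐪 ^ (-a) := by
  rw [Units.val_zpow_eq_zpow_val, norm_zpow, hϖ, _root_.inv_zpow, _root_.zpow_neg]

variable [MeasurableSpace (G2 F)] [BorelSpace (G2 F)] {μ : Measure (G2 F)} [μ.IsHaarMeasure]

theorem integral_ball (hV : IsNormalizedNorm F) (hdr : dr (Metric.closedBall 0 1) = 1)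
    (hμ : μ (maxCompact F) = 1) {ϖ : Fˣ} (hϖ : ‖(ϖ : F)‖ = 𝐪⁻¹) {φ : G2 F → ℂ} (hφ : RightK φ)
    (hs : ∀ x, φ x ≠ 0 → gn x ≤ 𝐪) :
    ∫ x, φ x ∂μ = ∑ p ∈ ballExps, ∫ r : Fin 6 → F, φ (torusPow ϖ p.1 p.2 * nElt r)
      ∂𝛑 dr := by
  have hpt : ∀ x, φ x = ∑ p ∈ ballExps,
      (setNK F).indicator (fun z => φ (torusPow ϖ p.1 p.2 * z)) ((torusPow ϖ p.1 p.2)⁻¹ * x) := by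
    intro x
    by_cases hx : φ x = 0
    · rw [hx, Finset.sum_eq_zero]
      intro p _
      simp only [Set.indicator_apply, mul_inv_cancel_left, hx, ite_self]
    · obtain ⟨t₁, t₂, r, k, hk, rfl⟩ := exists_eq_torus_mul_nElt x
      obtain ⟨a, ha⟩ := norm_eq_zpow hV t₁.ne_zero
      obtain ⟨b, hb⟩ := norm_eq_zpow hV t₂.ne_zero
      have h1 : ‖(t₁ : F)‖ = 𝐪 ^ (-(-a)) := by rw [neg_neg, ha]
      have h2 : ‖(t₂ : F)‖ = 𝐪 ^ (-(-a + (a - b))) := by rw [hb]; congr 1; ring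
      have hgn := hs _ hx
      rw [gn_mul_K _ hk] at hgn
      have hmem := mem_ballExps_of_gn_le hV h1 h2 hgn
      have hin : ∀ p : ℤ × ℤ, (torusPow ϖ p.1 p.2)⁻¹ * (torusElt t₁ t₂ * nElt r * k) ∈ setNK F ↔
          p = (-a, a - b) := by
        intro p
        obtain ⟨g1, g2⟩ := height_torus_nElt t₁ t₂ r hk
        have inj := zpow_right_injective₀ (q_pos hV) (one_lt_q hV).ne'
        rw [torusPow, torus_inv_mul_mem_setNK_iff, g1, g2, norm_unit_zpow hϖ, norm_unit_zpow hϖ,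
          _root_.inv_inj, _root_.inv_inj, h1, h2, inj.eq_iff, inj.eq_iff, Prod.ext_iff]
        constructor <;> rintro ⟨_, _⟩ <;> constructor <;> simp_all <;> omega
      rw [Finset.sum_eq_single_of_mem _ hmem]
      · rw [Set.indicator_of_mem ((hin _).2 rfl), mul_inv_cancel_left]
      · intro p _ hp
        rw [Set.indicator_of_notMem (fun h => hp ((hin p).1 h))]
  have hsupp : ∀ t x : G2 F, φ (t * x) ≠ 0 → gn x ≤ gn t⁻¹ * 𝐪 := fun t x h => by
    calc gn x = gn (t⁻¹ * (t * x)) := by rw [inv_mul_cancel_left]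
      _ ≤ gn t⁻¹ * gn (t * x) := gn_mul_le _ _
      _ ≤ gn t⁻¹ * 𝐪 := by have := hs _ h; have := gn_nonneg t⁻¹; gcongr
  have hK : ∀ t : G2 F, RightK ((setNK F).indicator fun z => φ (t * z)) := fun t k hk g => by
    simp only [Set.indicator_apply, setNK_mul_iff hk, ← mul_assoc, hφ k hk]
  calc ∫ x, φ x ∂μ = ∫ x, ∑ p ∈ ballExps,
      (setNK F).indicator (fun z => φ (torusPow ϖ p.1 p.2 * z)) ((torusPow ϖ p.1 p.2)⁻¹ * x) ∂μ :=
        integral_congr_ae (Filter.Eventually.of_forall hpt)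
    _ = _ := by
      rw [integral_finsetSum]
      · refine Finset.sum_congr rfl fun p _ => ?_
        rw [integral_mul_left_eq_self
          ((setNK F).indicator fun z => φ (torusPow ϖ p.1 p.2 * z)) (torusPow ϖ p.1 p.2)⁻¹]
        exact integral_setNK hV hdr hμ (hφ.comp_mul_left _) (hsupp _)
      · intro p _
        refine Integrable.comp_mul_left (g := (torusPow ϖ p.1 p.2)⁻¹)
          ((hK (torusPow ϖ p.1 p.2)).integrable fun x hx => hsupp (torusPow ϖ p.1 p.2) x ?_)
        intro h0
        apply hx
        simp [Set.indicator_apply, h0]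

end Partition

section BallIntegral

theorem gn_torusElt_le (hV : IsNormalizedNorm F) {t₁ t₂ : Fˣ} {a b : ℤ}
    (h1 : ‖(t₁ : F)‖ = 𝐪 ^ (-a)) (h2 : ‖(t₂ : F)‖ = 𝐪 ^ (-(a + b))) (hab : (a, b) ∈ ballExps) :
    gn (torusElt t₁ t₂) ≤ 𝐪 := by
  have hq := q_pos hV
  rw [gn_le_iff hq.le]
  intro i j
  have hb : ‖(bas j : Fin 8 → F) i‖ ≤ 1 := by
    by_cases h : i = j <;> simp [bas, h]
  rw [← act_bas, norm_act_torusElt hV h1 h2]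
  have hw : ∀ i, -torusExp a b i ≤ 1 := by
    simp only [ballExps, Finset.mem_insert, Finset.mem_singleton, Prod.mk.injEq] at hab
    rcases hab with ⟨rfl, rfl⟩ | ⟨rfl, rfl⟩ | ⟨rfl, rfl⟩ | ⟨rfl, rfl⟩ | ⟨rfl, rfl⟩ | ⟨rfl, rfl⟩ |
      ⟨rfl, rfl⟩ <;> decide
  calc 𝐪 ^ (-torusExp a b i) * ‖(bas j : Fin 8 → F) i‖ ≤ 𝐪 ^ (1 : ℤ) * 1 := by
        gcongr
        · exact (one_lt_q hV).le
        · exact hw i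
    _ = 𝐪 := by simp

theorem BallFun.integral_zero_zero (hV : IsNormalizedNorm F)
    (hdr : dr (Metric.closedBall 0 1) = 1) {ψ : AddChar F Circle} (hψ : Unramified ψ)
    [Fintype (ResField F)] {c : Fin 3 → F} (hc : ∀ i, ‖c i‖ ≤ 1) {h : G2 F → ℂ} (H : BallFun h)
    {C : ℂ} (hh : ∀ r : Fin 5 → F, gn (uElt r) ≤ 𝐪 →
      h (uElt r) = (ψ (c 0 * r 0 + c 1 * r 1 + c 2 * r 2) : ℂ) * C) :
    ∫ r : Fin 6 → F, h (nElt r) ∂𝛑 dr = (𝐪 : ℂ) ^ 2 * rootCount c * C := by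
  have h1 := H.integral_of_y_le hdr 1 fun r y hy => by
    rw [one_mul] at hy
    have hb := (norm_apply_le_gn _ 2 5).trans hy
    rw [← act_bas, act_mul, act_xA, act_uElt] at hb
    simp only [bas5, Matrix.cons_val, mul_zero, mul_one, add_zero, zero_add, sub_zero, zero_sub,
      norm_neg, norm_pow] at hb
    have : ‖y‖ < 𝐪 ^ (0 + 1 : ℤ) := by
      rw [zero_add, zpow_one]
      by_contra! hlt
      have := one_lt_q hV
      nlinarith
    simpa using norm_le_zpow_of_lt hV this
  simp only [one_mul] at h1
  rw [h1]
  have h2 : ∀ r : Fin 5 → F, h (uElt r) = (if gn (uElt r * torusElt 1 1) ≤ 𝐪 ^ (0 + 1 : ℤ) then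
      (ψ (c 0 * r 0 + c 1 * r 1 + c 2 * r 2) : ℂ) else 0) * C := by
    intro r
    rw [torusElt_one, mul_one, zero_add, zpow_one]
    split_ifs with hr
    · exact hh r hr
    · rw [zero_mul]
      by_contra h0
      exact hr (H.supp _ h0)
  simp_rw [h2]
  rw [integral_mul_const, integral_ball_uElt hV hdr hψ (t₁ := 1) (t₂ := 1) (a := 0) (b := 0)
    (by simp) (by simp) le_rfl le_rfl zero_le_one, sub_zero, omegaInt_one_zero hV hdr hψ hc,
    zpow_one]
  ring

section Group

variable [MeasurableSpace (G2 F)] [BorelSpace (G2 F)] {μ : Measure (G2 F)} [μ.IsHaarMeasure]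

/-- The integral over the ball of radius `q` of a right-`K`-invariant function which transforms
under `U` by a character that is trivial on `U(𝒪)`. -/
theorem integral_ball_equivariant (hV : IsNormalizedNorm F)
    (hdr : dr (Metric.closedBall 0 1) = 1) (hμ : μ (maxCompact F) = 1) {ϖ : Fˣ}
    (hϖ : ‖(ϖ : F)‖ = 𝐪⁻¹) {ψ : AddChar F Circle} (hψ : Unramified ψ) [Fintype (ResField F)]
    {c : Fin 3 → F} (hc : ∀ i, ‖c i‖ ≤ 1) {Φ : G2 F → ℂ} (hK : RightK Φ)
    (hU : ∀ r x, Φ (uElt r * x) = (ψ (c 0 * r 0 + c 1 * r 1 + c 2 * r 2) : ℂ) * Φ x) :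
    ∫ x, (if gn x ≤ 𝐪 then Φ x else 0) ∂μ =
      (𝐪 : ℂ) ^ 2 * rootCount c * Φ 1 + (𝐪 : ℂ) ^ 6 * Φ (torusPow ϖ 1 1) + Φ (torusPow ϖ (-1) (-1)) +
      (𝐪 : ℂ) ^ 4 * (∑ ρ : ResField F, Φ (torusPow ϖ 1 0 * xA ((ϖ : F)⁻¹ * lift ρ)) +
        Φ (torusPow ϖ 0 1)) +
      (𝐪 : ℂ) * (∑ ρ : ResField F, Φ (torusPow ϖ 0 (-1) * xA ((ϖ : F)⁻¹ * lift ρ)) +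
        Φ (torusPow ϖ (-1) 0)) := by
  set h : G2 F → ℂ := fun x => if gn x ≤ 𝐪 then Φ x else 0 with hh
  have hpos : ∀ {x : G2 F}, gn x ≤ 𝐪 → h x = Φ x := fun hx => if_pos hx
  have H : BallFun h :=
    { right := fun k hk g => by simp only [hh, gn_mul_K g hk, hK k hk]
      left := fun r hr x => by
        have hl : ‖c 0 * r 0 + c 1 * r 1 + c 2 * r 2‖ ≤ 1 := norm_le_one_add (norm_le_one_add
          (norm_le_one_mul (hc _) (hr _)) (norm_le_one_mul (hc _) (hr _)))
          (norm_le_one_mul (hc _) (hr _))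
        simp only [hh, gn_K_mul x (uElt_mem_K hr), hU, hψ.eq_one hl, Circle.coe_one, one_mul]
      supp := fun x hx => by
        by_contra h0
        exact hx (if_neg h0) }
  have htt : ∀ p ∈ ballExps, h (torusPow ϖ p.1 p.2) = Φ (torusPow ϖ p.1 p.2) := fun p hp =>
    hpos (gn_torusElt_le hV (norm_unit_zpow hϖ _) (norm_unit_zpow hϖ _) hp)
  have htx : ∀ p ∈ ballExps, p.1 - p.2 = 1 → ∀ ρ : ResField F,
      h (torusPow ϖ p.1 p.2 * xA ((ϖ : F)⁻¹ * lift ρ)) =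
      Φ (torusPow ϖ p.1 p.2 * xA ((ϖ : F)⁻¹ * lift ρ)) := fun p hp h1 ρ => by
    apply hpos
    rw [torusPow, torusElt_mul_xA, gn_K_mul _ (xA_mem_K ?_)]
    · exact gn_torusElt_le hV (norm_unit_zpow hϖ _) (norm_unit_zpow hϖ _) hp
    · have e : ((ϖ ^ p.1 : Fˣ) : F) ^ 2 / ((ϖ ^ (p.1 + p.2) : Fˣ) : F) = ϖ := by
        rw [← Units.val_pow_eq_pow_val, ← Units.val_div_eq_div_val, ← zpow_natCast, ← _root_.zpow_mul,
          div_eq_mul_inv, ← _root_.zpow_sub]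
        have : p.1 * ((2 : ℕ) : ℤ) - (p.1 + p.2) = 1 := by push_cast; linarith
        rw [this, zpow_one]
      rw [e, mul_inv_cancel_left₀ ϖ.ne_zero]
      exact norm_lift_le ρ
  rw [integral_ball hV hdr hμ hϖ H.right H.supp]
  have n1 := norm_unit_zpow hϖ
  rw [ballExps, Finset.sum_insert (by decide), Finset.sum_insert (by decide),
    Finset.sum_insert (by decide), Finset.sum_insert (by decide), Finset.sum_insert (by decide),
    Finset.sum_insert (by decide), Finset.sum_singleton]
  simp only
  have e00 : torusPow ϖ 0 0 = 1 := by simp [torusPow]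
  have i00 : ∫ r : Fin 6 → F, h (torusPow ϖ 0 0 * nElt r) ∂𝛑 dr =
      (𝐪 : ℂ) ^ 2 * rootCount c * Φ 1 := by
    simp only [e00, one_mul]
    refine H.integral_zero_zero hV hdr hψ hc fun r hr => ?_
    rw [hpos hr, ← hU, mul_one]
  have i11 := H.integral_one_one hV hdr (n1 1) (n1 (1 + 1))
  have im11 := H.integral_neg_one_neg_one hV hdr (n1 (-1)) (n1 (-1 + -1))
  have i10 := H.integral_one_zero hV hdr hϖ (n1 1) (n1 (1 + 0))
  have i01 := H.integral_zero_one hV hdr (n1 0) (n1 (0 + 1))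
  have i0m := H.integral_zero_neg_one hV hdr hϖ (n1 0) (n1 (0 + -1))
  have im0 := H.integral_neg_one_zero hV hdr (n1 (-1)) (n1 (-1 + 0))
  change _ = _ * h (torusPow ϖ 1 1) at i11
  change _ = h (torusPow ϖ (-1) (-1)) at im11
  change _ = _ * ∑ ρ : ResField F, h (torusPow ϖ 1 0 * xA ((ϖ : F)⁻¹ * lift ρ)) at i10
  change _ = _ * h (torusPow ϖ 0 1) at i01
  change _ = _ * ∑ ρ : ResField F, h (torusPow ϖ 0 (-1) * xA ((ϖ : F)⁻¹ * lift ρ)) at i0m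
  change _ = _ * h (torusPow ϖ (-1) 0) at im0
  rw [htt (1, 1) (by decide)] at i11
  rw [htt (-1, -1) (by decide)] at im11
  rw [Finset.sum_congr rfl fun ρ _ => htx (1, 0) (by decide) (by decide) ρ] at i10
  rw [htt (0, 1) (by decide)] at i01
  rw [Finset.sum_congr rfl fun ρ _ => htx (0, -1) (by decide) (by decide) ρ] at i0m
  rw [htt (-1, 0) (by decide)] at im0
  unfold torusPow at i00 i11 im11 i10 i01 i0m im0 ⊢
  rw [i00, i11, im11, i10, i01, i0m, im0]
  have z6 : (𝐪 : ℂ) ^ (6 : ℤ) = (𝐪 : ℂ) ^ 6 := by norm_cast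
  have z4 : (𝐪 : ℂ) ^ (4 : ℤ) = (𝐪 : ℂ) ^ 4 := by norm_cast
  have z1 : (𝐪 : ℂ) ^ (1 : ℤ) = 𝐪 := zpow_one _
  simp only [z6, z4, z1]
  ring

end Group

/-! ## The Satake transform -/

theorem norm_rootChar (m n : ℤ) (t₁ t₂ : Fˣ) : ‖rootChar m n t₁ t₂‖ =
    (‖(t₁ : F)‖ ^ 2 / ‖(t₂ : F)‖) ^ m * (‖(t₂ : F)‖ ^ 2 / ‖(t₁ : F)‖ ^ 3) ^ n := by
  rw [rootChar, Units.val_mul, norm_mul, Units.val_zpow_eq_zpow_val, Units.val_zpow_eq_zpow_val,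
    norm_zpow, norm_zpow, Units.val_div_eq_div_val, Units.val_div_eq_div_val, norm_div, norm_div]
  simp only [Units.val_pow_eq_pow_val, norm_pow]

theorem prod_posRoots {x y : ℝ} (hx : x ≠ 0) (hy : y ≠ 0) :
    ∏ γ ∈ posRoots, (x ^ 2 / y) ^ γ.1 * (y ^ 2 / x ^ 3) ^ γ.2 = (x * y) ^ 2 := by
  rw [posRoots, Finset.prod_insert (by decide), Finset.prod_insert (by decide),
    Finset.prod_insert (by decide), Finset.prod_insert (by decide), Finset.prod_insert (by decide),
    Finset.prod_singleton]
  have e2 : ∀ x : ℝ, x ^ (2 : ℤ) = x ^ 2 := fun x => by norm_cast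
  have e3 : ∀ x : ℝ, x ^ (3 : ℤ) = x ^ 3 := fun x => by norm_cast
  simp only [e2, e3, zpow_one, zpow_zero, one_mul, mul_one]
  field_simp

theorem sqrt_prod_posRoots (t₁ t₂ : Fˣ) :
    Real.sqrt (∏ γ ∈ posRoots, ‖rootChar γ.1 γ.2 t₁ t₂‖) = ‖(t₁ : F)‖ * ‖(t₂ : F)‖ := by
  simp_rw [norm_rootChar]
  rw [prod_posRoots (norm_ne_zero_iff.2 t₁.ne_zero) (norm_ne_zero_iff.2 t₂.ne_zero),
    Real.sqrt_sq (by positivity)]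

/-- The characteristic function of `K`. -/
def indK (g : G2 F) : ℂ := if g ∈ groupK F then 1 else 0

/-- The characteristic function of the ball of radius `q`. -/
def indBall (g : G2 F) : ℂ := if gn g ≤ 𝐪 then 1 else 0

theorem isHecke_of_gn {f : ℝ → ℂ} {c : ℝ} (hf : ∀ x, f x ≠ 0 → x ≤ c) :
    IsHecke fun g : G2 F => f (gn g) :=
  ⟨hasCompactSupport_of_gn fun x hx => hf _ hx, fun k hk g => by
    rw [mem_maxCompact_iff_groupK] at hk
    simp only [gn_K_mul g hk, gn_mul_K g hk, and_self]⟩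

theorem isSatakePreimage_indK (hV : IsNormalizedNorm F)
    (hdr : dr (Metric.closedBall 0 1) = 1) : IsSatakePreimage dr trivialMult (indK (F := F)) := by
  refine ⟨?_, fun a b t₁ t₂ h1 h2 => ?_⟩
  · have : (indK : G2 F → ℂ) = fun g => (fun x : ℝ => if x ≤ 1 then (1 : ℂ) else 0) (gn g) := by
      ext g; simp only [indK, mem_groupK_iff]
    rw [this]
    refine isHecke_of_gn (f := fun x : ℝ => if x ≤ 1 then (1 : ℂ) else 0) (c := 1) fun x hx => ?_
    by_contra h
    exact hx (if_neg h)
  · rw [satakeTransform, sqrt_prod_posRoots]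
    change _ * ∫ r : Fin 6 → F, indK (torusElt t₁ t₂ * nElt r) ∂_ = _
    by_cases hab : (a, b) = (0, 0)
    · obtain ⟨rfl, rfl⟩ := Prod.mk.inj hab
      rw [neg_zero, zpow_zero] at h1 h2
      have : ∀ r : Fin 6 → F, (indK (torusElt t₁ t₂ * nElt r) : ℂ) =
          if ∀ i, ‖r i‖ ≤ 𝐪 ^ (0 : ℤ) then 1 else 0 := fun r => by
        simp only [indK, Subgroup.mul_mem_cancel_left _ (torusElt_mem_K h1 h2), nElt_mem_K_iff,
          zpow_zero]
      simp_rw [this]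
      rw [integral_box_const hV hdr fun _ => 0, h1, h2]
      simp [trivialMult]
    · have : ∀ r : Fin 6 → F, (indK (torusElt t₁ t₂ * nElt r) : ℂ) = 0 := fun r => by
        refine if_neg fun hk => hab ?_
        obtain ⟨g1, g2⟩ := height_torus_nElt t₁ t₂ r (one_mem _)
        obtain ⟨g3, g4⟩ := height_torus_nElt (1 : Fˣ) 1 0 hk
        have e : torusElt 1 1 * nElt 0 * (torusElt t₁ t₂ * nElt r) =
            torusElt t₁ t₂ * nElt r * 1 := by
          have : (nElt 0 : G2 F) = 1 := by
            rw [nElt, show (fun i : Fin 5 => (0 : Fin 6 → F) i.succ) = 0 from rfl, uElt_zero,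
              Pi.zero_apply, xA_zero, mul_one]
          rw [this, torusElt_one]; group
        rw [e, g1, h1, Units.val_one, norm_one, inv_one, ← _root_.zpow_neg, neg_neg,
          zpow_eq_one_iff_right₀ (q_pos hV).le (one_lt_q hV).ne'] at g3
        rw [e, g2, h2, Units.val_one, norm_one, inv_one, ← _root_.zpow_neg, neg_neg,
          zpow_eq_one_iff_right₀ (q_pos hV).le (one_lt_q hV).ne'] at g4
        rw [g3, g4]
      simp_rw [this]
      rw [trivialMult, if_neg hab]
      simp

theorem isSatakePreimage_indBall (hV : IsNormalizedNorm F)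
    (hdr : dr (Metric.closedBall 0 1) = 1) {ψ : AddChar F Circle} (hψ : Unramified ψ) :
    IsSatakePreimage dr standardMult (fun g : G2 F => ((𝐪 : ℂ) ^ 3)⁻¹ * indBall g) := by
  have := finite_resField hV
  have := Fintype.ofFinite (ResField F)
  obtain ⟨ϖ, hϖ⟩ := hV.1
  have hq := q_pos hV
  have hq' : (residueCard F : ℂ) ≠ 0 := by exact_mod_cast hq.ne'
  refine ⟨?_, fun a b' t₁ t₂ h1 h2 => ?_⟩
  · refine isHecke_of_gn (f := fun x => ((𝐪 : ℂ) ^ 3)⁻¹ * if x ≤ 𝐪 then 1 else 0) (c := 𝐪)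
      fun x hx => ?_
    by_contra h
    exact hx (by simp [h])
  obtain ⟨b, rfl⟩ : ∃ b, b' = a + b := ⟨b' - a, by ring⟩
  have hpos : ∀ {x : G2 F}, gn x ≤ 𝐪 → indBall x = 1 := fun hx => if_pos hx
  have H : BallFun (indBall : G2 F → ℂ) :=
    { right := fun k hk g => by simp only [indBall, gn_mul_K g hk]
      left := fun r hr x => by simp only [indBall, gn_K_mul x (uElt_mem_K hr)]
      supp := fun x hx => by
        by_contra h0
        exact hx (if_neg h0) }
  rw [satakeTransform, sqrt_prod_posRoots]
  change _ * ∫ r : Fin 6 → F, _ * indBall (torusElt t₁ t₂ * nElt r) ∂_ = _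
  rw [integral_const_mul]
  have hcard : ((Finset.univ : Finset (ResField F)).card : ℂ) = 𝐪 := by
    rw [Finset.card_univ, ← Nat.card_eq_fintype_card]; simp [residueCard]
  by_cases hab : (a, b) ∈ ballExps
  · have hgt := hpos (gn_torusElt_le hV h1 h2 hab)
    have hgx : a - b = 1 → ∀ ρ : ResField F, indBall (torusElt t₁ t₂ * xA (ϖ⁻¹ * lift ρ)) = 1 := by
      intro h ρ
      apply hpos
      rw [torusElt_mul_xA, gn_K_mul _ (xA_mem_K ?_)]
      · exact gn_torusElt_le hV h1 h2 hab
      · rw [norm_mul, norm_mul, norm_div, norm_pow, h1, h2, norm_inv, hϖ, inv_inv, ← zpow_natCast,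
          ← _root_.zpow_mul, ← zpow_sub₀ hq.ne',
          show -a * ((2 : ℕ) : ℤ) - -(a + b) = -1 by push_cast; linarith, ← mul_assoc,
          _root_.zpow_neg, zpow_one, inv_mul_cancel₀ hq.ne', one_mul]
        exact norm_lift_le ρ
    simp only [ballExps, Finset.mem_insert, Finset.mem_singleton, Prod.mk.injEq] at hab
    rcases hab with ⟨rfl, rfl⟩ | ⟨rfl, rfl⟩ | ⟨rfl, rfl⟩ | ⟨rfl, rfl⟩ | ⟨rfl, rfl⟩ | ⟨rfl, rfl⟩ |
      ⟨rfl, rfl⟩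
    · have h1' : ‖(t₁ : F)‖ = 1 := by simpa using h1
      have h2' : ‖(t₂ : F)‖ = 1 := by simpa using h2
      have e : ∀ r : Fin 6 → F, indBall (torusElt t₁ t₂ * nElt r) = indBall (nElt r) := fun r => by
        simp only [indBall, gn_K_mul _ (torusElt_mem_K h1' h2')]
      have i := H.integral_zero_zero hV hdr hψ (c := 0) (C := 1) (by simp) fun r hr => by
        rw [hpos hr]; simp
      have hroot : ((rootCount (0 : Fin 3 → F) : ℕ) : ℂ) = 𝐪 := by
        rw [← hcard]; simp [rootCount, (red_eq_zero_iff (F := F) (x := 0) (by simp)).2 (by simp)]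
      simp_rw [e]
      rw [i, hroot, h1', h2']
      simp only [standardMult]
      norm_num
      field_simp
    · rw [H.integral_one_one hV hdr h1 h2, hgt, h1, h2]
      simp only [standardMult]
      norm_num
      field_simp
    · rw [H.integral_neg_one_neg_one hV hdr h1 h2, hgt, h1, h2]
      simp only [standardMult]
      norm_num
      field_simp
    · rw [H.integral_one_zero hV hdr hϖ h1 h2, Finset.sum_congr rfl fun ρ _ => hgx (by decide) ρ,
        Finset.sum_const, nsmul_eq_mul, hcard, h1, h2]
      simp only [standardMult]
      norm_num
      field_simp
    · rw [H.integral_zero_one hV hdr h1 h2, hgt, h1, h2]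
      simp only [standardMult]
      norm_num
      field_simp
    · rw [H.integral_zero_neg_one hV hdr hϖ h1 h2, Finset.sum_congr rfl fun ρ _ => hgx (by decide) ρ,
        Finset.sum_const, nsmul_eq_mul, hcard, h1, h2]
      simp only [standardMult]
      norm_num
      field_simp
    · rw [H.integral_neg_one_zero hV hdr h1 h2, hgt, h1, h2]
      simp only [standardMult]
      norm_num
      field_simp
  · have : ∀ r : Fin 6 → F, (indBall (torusElt t₁ t₂ * nElt r) : ℂ) = 0 := fun r =>
      if_neg fun hg => hab (mem_ballExps_of_gn_le hV h1 h2 hg)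
    simp_rw [this]
    rw [standardMult, if_neg]
    · simp
    · intro hm
      apply hab
      simp only [Finset.mem_insert, Finset.mem_singleton, Prod.mk.injEq, ballExps] at hm ⊢
      omega

end BallIntegral

section Uniqueness

/-! ## Injectivity of the Satake transform -/

/-- The maximum of the norms of the minors of size two. -/
def wn (g : G2 F) : ℝ := ‖fun i j => wedgeNorm (g.1.1 i) (g.1.1 j)‖

theorem wn_le_iff {g : G2 F} {c : ℝ} (hc : 0 ≤ c) :
    wn g ≤ c ↔ ∀ i j k l, ‖g.1.1 i k * g.1.1 j l - g.1.1 i l * g.1.1 j k‖ ≤ c := by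
  have h : ∀ i j, ‖wedgeNorm (g.1.1 i) (g.1.1 j)‖ = wedgeNorm (g.1.1 i) (g.1.1 j) := fun i j =>
    Real.norm_of_nonneg (norm_nonneg _)
  simp only [wn, pi_norm_le_iff_of_nonneg hc, h, wedgeNorm_le_iff hc]

theorem norm_minor_le_wn (g : G2 F) (i j k l : Fin 8) :
    ‖g.1.1 i k * g.1.1 j l - g.1.1 i l * g.1.1 j k‖ ≤ wn g :=
  (wn_le_iff (norm_nonneg _)).1 le_rfl i j k l

theorem wn_K_mul (g : G2 F) {k : G2 F} (hk : k ∈ groupK F) : wn (k * g) = wn g := by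
  have h : ∀ k ∈ groupK F, ∀ g : G2 F, wn (k * g) ≤ wn g := fun k hk g => by
    refine (wn_le_iff (norm_nonneg _)).2 fun i j a b => ?_
    have h1 := norm_minor_le (act (k * g) (bas a)) (act (k * g) (bas b)) i j
    rw [act_mul, act_mul, wedgeNorm_act_K hk] at h1
    simp only [← act_mul, act_bas] at h1
    refine (le_of_eq ?_).trans (h1.trans ((wedgeNorm_le_iff (norm_nonneg _)).2 fun i' j' => ?_))
    · congr 1; ring
    · rw [act_bas, act_bas, act_bas, act_bas]
      refine (le_of_eq ?_).trans (norm_minor_le_wn g i' j' a b)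
      congr 1; ring
  refine le_antisymm (h k hk g) ?_
  have := h k⁻¹ (inv_mem hk) (k * g)
  rwa [inv_mul_cancel_left] at this

theorem wn_mul_K (g : G2 F) {k : G2 F} (hk : k ∈ groupK F) : wn (g * k) = wn g := by
  have h : ∀ k ∈ groupK F, ∀ g : G2 F, wn (g * k) ≤ wn g := fun k hk g => by
    refine (wn_le_iff (norm_nonneg _)).2 fun i j a b => ?_
    have hk1 : ∀ i j, ‖(k.1.1)ᵀ i j‖ ≤ 1 := fun i j =>
      (norm_apply_le_gn k j i).trans (mem_groupK_iff.1 hk)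
    have h1 := wedgeNorm_mulVec_le zero_le_one hk1 (g.1.1 i) (g.1.1 j)
    have e : ∀ i, (k.1.1)ᵀ *ᵥ (g.1.1 i) = (g * k).1.1 i := fun i => by
      ext l
      change _ = (g.1.1 * k.1.1) i l
      rw [Matrix.mul_apply]
      simp only [Matrix.mulVec, dotProduct, Matrix.transpose_apply, mul_comm]
    rw [e, e, one_pow, one_mul] at h1
    exact (norm_minor_le _ _ a b).trans (h1.trans ((wedgeNorm_le_iff (norm_nonneg _)).2
      fun i' j' => norm_minor_le_wn g i j i' j'))
  refine le_antisymm (h k hk g) ?_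
  have := h k⁻¹ (inv_mem hk) (g * k)
  rwa [mul_inv_cancel_right] at this

theorem KEquiv.wn_eq {g h : G2 F} (H : KEquiv g h) : wn g = wn h := by
  obtain ⟨k, hk, k', hk', rfl⟩ := H
  rw [wn_mul_K _ hk', wn_K_mul _ hk]

theorem IsHecke.of_kEquiv {f : G2 F → ℂ} (hf : IsHecke f) {g h : G2 F} (H : KEquiv g h) :
    f g = f h := by
  obtain ⟨k, hk, k', hk', rfl⟩ := H
  rw [(hf.2 k' hk' _).2, (hf.2 k hk _).1]

theorem IsHecke.rightK {f : G2 F → ℂ} (hf : IsHecke f) : RightK f := fun k hk g => (hf.2 k hk g).2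

theorem torusElt_apply (t₁ t₂ : Fˣ) (i j : Fin 8) : (torusElt t₁ t₂).1.1 i j =
    if i = j then (torusElt t₁ t₂).1.1 i i else 0 := by
  split_ifs with h
  · rw [h]
  · exact Matrix.diagonal_apply_ne _ h

/-- The maximum of the minors of an antidominant torus element. -/
theorem wn_torusElt_inv_le {s₁ s₂ : Fˣ} (h : Dominant s₁ s₂) :
    wn (torusElt s₁⁻¹ s₂⁻¹) ≤ ‖(s₂ : F)‖⁻¹ := by
  obtain ⟨h1, h2⟩ := h
  have p1 := norm_pos_iff.2 s₁.ne_zero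
  have p2 := norm_pos_iff.2 s₂.ne_zero
  rw [norm_div] at h1 h2
  set x := ‖(s₁ : F)‖ with hx
  set z := ‖(s₂ : F)‖ with hz
  obtain ⟨y, hy, py⟩ : ∃ y, z = x * y ∧ 0 < y := ⟨z / x, by field_simp, by positivity⟩
  have hxy : z / x = y := by rw [hy]; field_simp
  rw [hxy] at h1 h2
  have hy1 : y ≤ 1 := by nlinarith
  have hx1 : x ≤ 1 := h1.trans hy1
  set w : Fin 8 → ℝ := fun i => ‖(torusElt s₁⁻¹ s₂⁻¹).1.1 i i‖ with hw
  have hwv : ∀ i, w i = ![x⁻¹, y⁻¹, y / x, 1, 1, x / y, y, x] i := by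
    have e2 : ‖(s₂ : F)‖ = x * y := by rw [← hz, hy]
    intro i
    fin_cases i <;> simp [hw, torusElt, e2, ← hx] <;> field_simp
  have w0 : w 0 = x⁻¹ := hwv 0
  have hwi : ∀ i, i ≠ 0 → w i ≤ y⁻¹ := by
    have hyi : 1 ≤ y⁻¹ := (one_le_inv₀ py).2 hy1
    intro i hi
    rw [hwv]
    fin_cases i
    · exact absurd rfl hi
    · exact le_rfl
    · change y / x ≤ y⁻¹
      rw [div_le_iff₀ p1, inv_mul_eq_div, le_div_iff₀ py]
      nlinarith
    · exact hyi
    · exact hyi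
    · change x / y ≤ y⁻¹
      rw [div_le_iff₀ py, inv_mul_cancel₀ py.ne']
      exact hx1
    · exact hy1.trans hyi
    · exact hx1.trans hyi
  have hyx : y⁻¹ ≤ x⁻¹ := inv_anti₀ p1 h1
  have hz' : z⁻¹ = x⁻¹ * y⁻¹ := by rw [hy, mul_inv]
  have hwp : ∀ i j, i ≠ j → w i * w j ≤ z⁻¹ := by
    intro i j hij
    have hw0 : ∀ i, 0 ≤ w i := fun i => norm_nonneg _
    have hwx : ∀ i, w i ≤ x⁻¹ := fun i => by
      by_cases hi : i = 0
      · rw [hi, w0]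
      · exact (hwi i hi).trans hyx
    rw [hz']
    by_cases hj : j = 0
    · rw [mul_comm]
      exact mul_le_mul (hwx j) (hwi i (hj ▸ hij)) (hw0 _) (by positivity)
    · exact mul_le_mul (hwx i) (hwi j hj) (hw0 _) (by positivity)
  have hz0 : 0 ≤ z⁻¹ := by rw [hz']; positivity
  refine (wn_le_iff hz0).2 fun i j k l => ?_
  rw [torusElt_apply _ _ i k, torusElt_apply _ _ j l, torusElt_apply _ _ i l,
    torusElt_apply _ _ j k]
  by_cases hij : i = j
  · subst hij
    rw [mul_comm, sub_self, norm_zero]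
    exact hz0
  · have := hwp i j hij
    simp only [hw, ← norm_mul] at this
    by_cases h1 : i = k <;> by_cases h2 : j = l <;> by_cases h3 : i = l <;> by_cases h4 : j = k <;>
      simp_all

theorem wn_mul_ge {t₁ t₂ : Fˣ} (r : Fin 6 → F) (i j : Fin 8) :
    ‖(t₂ : F)‖ * ‖(nElt r).1.1 0 i * (nElt r).1.1 1 j - (nElt r).1.1 0 j * (nElt r).1.1 1 i‖ ≤
      wn (torusElt t₁ t₂ * nElt r) := by
  refine (le_of_eq ?_).trans (norm_minor_le_wn _ 0 1 i j)
  rw [← norm_mul]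
  congr 1
  simp only [← act_bas, act_mul, act_torusElt, Matrix.cons_val]
  have := t₁.ne_zero
  field_simp

theorem gn_mul_ge {t₁ t₂ : Fˣ} (r : Fin 6 → F) (j : Fin 8) :
    ‖(t₁ : F)‖ * ‖(nElt r).1.1 0 j‖ ≤ gn (torusElt t₁ t₂ * nElt r) := by
  refine (le_of_eq ?_).trans (norm_apply_le_gn _ 0 j)
  rw [← norm_mul]
  congr 1
  simp only [← act_bas, act_mul, act_torusElt, Matrix.cons_val]

theorem nElt_apply_zero (r : Fin 6 → F) : (nElt r).1.1 0 0 = 1 ∧ (nElt r).1.1 1 1 = 1 ∧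
    (nElt r).1.1 1 0 = 0 := by
  simp only [← act_bas, nElt_eq, act_mul, act_xA, act_uElt, bas0, bas1]
  simp

/-- An antidominant torus element maximizes `gn * wn` on its left translates under `N` only on
`N(𝒪)`. -/
theorem nElt_mem_K_of_gn_mul_wn_le {s₁ s₂ : Fˣ} (h : Dominant s₁ s₂) {r : Fin 6 → F}
    (hle : gn (torusElt s₁⁻¹ s₂⁻¹ * nElt r) * wn (torusElt s₁⁻¹ s₂⁻¹ * nElt r) ≤
      gn (torusElt s₁⁻¹ s₂⁻¹) * wn (torusElt s₁⁻¹ s₂⁻¹)) : ∀ i, ‖r i‖ ≤ 1 := by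
  have hg : gn (torusElt s₁⁻¹ s₂⁻¹) = ‖(s₁ : F)‖⁻¹ := by
    rw [← torusElt_inv, gn_inv, gn_torusElt_of_dominant h]
  have hw := wn_torusElt_inv_le h
  rw [hg] at hle
  have p1 : 0 < ‖(s₁ : F)‖⁻¹ := inv_pos.2 (norm_pos_iff.2 s₁.ne_zero)
  have p2 : 0 < ‖(s₂ : F)‖⁻¹ := inv_pos.2 (norm_pos_iff.2 s₂.ne_zero)
  set G := gn (torusElt s₁⁻¹ s₂⁻¹ * nElt r) with hG
  set W := wn (torusElt s₁⁻¹ s₂⁻¹ * nElt r) with hW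
  have e1 : ‖((s₁⁻¹ : Fˣ) : F)‖ = ‖(s₁ : F)‖⁻¹ := by simp
  have e2 : ‖((s₂⁻¹ : Fˣ) : F)‖ = ‖(s₂ : F)‖⁻¹ := by simp
  have hle' : G * W ≤ ‖(s₁ : F)‖⁻¹ * ‖(s₂ : F)‖⁻¹ := hle.trans (by gcongr)
  have g0 := fun j => gn_mul_ge (t₁ := s₁⁻¹) (t₂ := s₂⁻¹) r j
  have w0 := fun i j => wn_mul_ge (t₁ := s₁⁻¹) (t₂ := s₂⁻¹) r i j
  rw [e1] at g0
  rw [e2] at w0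
  obtain ⟨n00, n11, n10⟩ := nElt_apply_zero r
  have gG : ‖(s₁ : F)‖⁻¹ ≤ G := by
    have := g0 0
    rwa [n00, norm_one, mul_one] at this
  have wW : ‖(s₂ : F)‖⁻¹ ≤ W := by
    have := w0 0 1
    rwa [n00, n11, n10, mul_zero, sub_zero, one_mul, norm_one, mul_one] at this
  have hG1 : G ≤ ‖(s₁ : F)‖⁻¹ := by
    by_contra! hlt
    exact absurd hle' (not_le.2 (mul_lt_mul hlt wW p2 (p1.le.trans gG)))
  have hW1 : W ≤ ‖(s₂ : F)‖⁻¹ := by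
    by_contra! hlt
    exact absurd hle' (not_le.2 (mul_lt_mul' gG hlt p2.le (p1.trans_le gG)))
  refine nElt_bounds (fun j => ?_) fun i j => ?_
  · have := (g0 j).trans hG1
    exact (mul_le_iff_le_one_right p1).1 this
  · have := (w0 i j).trans hW1
    exact (mul_le_iff_le_one_right p2).1 this

theorem RightK.isClosed_support {f : G2 F → ℂ} (hf : RightK f) : IsClosed (Function.support f) := by
  have h : RightK fun g => if f g = 0 then (0 : ℝ) else 1 := fun k hk g => by simp only [hf k hk]
  have : Function.support f = (fun g => if f g = 0 then (0 : ℝ) else 1) ⁻¹' {1} := by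
    ext g
    by_cases hg : f g = 0 <;> simp [hg]
  rw [this]
  exact isClosed_singleton.preimage h.continuous

theorem eq_zero_of_satakeTransform (hV : IsNormalizedNorm F) (h2 : ‖(2 : F)‖ = 1)
    (hdr : dr (Metric.closedBall 0 1) = 1) {f : G2 F → ℂ} (hf : IsHecke f)
    (hs : ∀ t₁ t₂, satakeTransform dr f t₁ t₂ = 0) : f = 0 := by
  by_contra hne
  obtain ⟨g₁, hg₁⟩ := Function.ne_iff.1 hne
  have hcont : Continuous fun g : G2 F => gn g * wn g := by
    have hw : RightK (wn : G2 F → ℝ) := fun k hk g => wn_mul_K g hk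
    exact continuous_gn.mul hw.continuous
  have hcomp : IsCompact (Function.support f) := by
    have := hf.1
    rwa [HasCompactSupport, tsupport, hf.rightK.isClosed_support.closure_eq] at this
  obtain ⟨g₀, hg₀, hmax⟩ := hcomp.exists_isMaxOn ⟨g₁, hg₁⟩ hcont.continuousOn
  obtain ⟨s₁, s₂, hd, hk⟩ := cartan h2 g₀
  have hk' := hk.trans (KEquiv.torus_of_conj weylLong_mem_K (weylLong_mul_torusElt s₁ s₂))
  set t := torusElt s₁⁻¹ s₂⁻¹ with ht
  have hft : f t ≠ 0 := by rw [← hf.of_kEquiv hk']; exact hg₀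
  have key : ∀ r : Fin 6 → F, f (t * nElt r) = if ∀ i, ‖r i‖ ≤ 𝐪 ^ (0 : ℤ) then f t else 0 := by
    intro r
    simp only [zpow_zero]
    split_ifs with hr
    · exact hf.rightK _ (nElt_mem_K hr) _
    · by_contra h0
      refine hr (nElt_mem_K_of_gn_mul_wn_le hd ?_)
      rw [← ht, ← hk'.gn_eq, ← hk'.wn_eq]
      exact hmax h0
  have h := hs s₁⁻¹ s₂⁻¹
  rw [satakeTransform, sqrt_prod_posRoots, mul_eq_zero] at h
  rcases h with h | h
  · have : ‖((s₁⁻¹ : Fˣ) : F)‖ * ‖((s₂⁻¹ : Fˣ) : F)‖ ≠ 0 :=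
      mul_ne_zero (norm_ne_zero_iff.2 (Units.ne_zero _)) (norm_ne_zero_iff.2 (Units.ne_zero _))
    exact this (by exact_mod_cast h)
  · change ∫ r : Fin 6 → F, f (t * nElt r) ∂_ = 0 at h
    simp_rw [key] at h
    rw [integral_box_const hV hdr fun _ => 0] at h
    simp at h
    exact hft h

theorem integrable_torus_nElt {f : G2 F → ℂ} (hf : IsHecke f) (t : G2 F) :
    Integrable (fun r : Fin 6 → F => f (t * nElt r)) (𝛑 dr) := by
  have hc : Continuous fun r : Fin 6 → F => f (t * nElt r) :=
    hf.rightK.continuous.comp (continuous_const.mul continuous_nElt)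
  refine hc.integrable_of_hasCompactSupport ?_
  obtain ⟨c, hcb⟩ := (hf.1 : IsCompact (tsupport f)).bddAbove_image continuous_gn.continuousOn
  set R : ℝ := max 1 (gn t⁻¹ * c) with hR
  have hR1 : 1 ≤ R := le_max_left _ _
  refine HasCompactSupport.intro (K := Set.pi Set.univ fun _ : Fin 6 => Metric.closedBall 0 (R ^ 4))
    (isCompact_univ_pi fun _ => isCompact_closedBall 0 _) fun r hr => ?_
  by_contra h0
  apply hr
  have hgn : gn (nElt r) ≤ R := by
    have h1 : gn (t * nElt r) ≤ c := hcb ⟨_, subset_tsupport f h0, rfl⟩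
    calc gn (nElt r) = gn (t⁻¹ * (t * nElt r)) := by rw [inv_mul_cancel_left]
      _ ≤ gn t⁻¹ * gn (t * nElt r) := gn_mul_le _ _
      _ ≤ gn t⁻¹ * c := by have := gn_nonneg t⁻¹; gcongr
      _ ≤ R := le_max_right _ _
  have hent : ∀ i j, ‖act (nElt r) (bas j) i‖ ≤ R := fun i j => by
    rw [act_bas]; exact (norm_apply_le_gn _ i j).trans hgn
  have a0 := hent 0 1
  have a1 := hent 1 2
  have a2 := hent 1 3
  have a3 := hent 1 5
  have a4 := hent 0 5
  have a5 := hent 0 6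
  simp only [nElt_eq, act_mul, act_xA, act_uElt, bas1, bas2, bas3, bas5, bas6, Matrix.cons_val,
    mul_zero, mul_one, add_zero, zero_add, sub_zero, zero_sub, norm_neg] at a0 a1 a2 a3 a4 a5
  have hRR : ∀ {m n : ℕ} {x : F}, ‖x‖ ≤ R ^ m → m ≤ n → ‖x‖ ≤ R ^ n := fun h hmn =>
    h.trans (pow_le_pow_right₀ hR1 hmn)
  have hmul : ∀ {m n : ℕ} {x y : F}, ‖x‖ ≤ R ^ m → ‖y‖ ≤ R ^ n → ‖x * y‖ ≤ R ^ (m + n) :=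
    fun hx hy => by
      rw [norm_mul, pow_add]
      exact mul_le_mul hx hy (norm_nonneg _) (by positivity)
  rw [← pow_one R] at a0 a1 a2 a3 a4 a5
  have a4' : ‖r 4‖ ≤ R ^ 2 := by
    have : r 4 = -(-r 4 + r 0 * -r 3) - r 0 * r 3 := by ring
    rw [this]
    refine norm_sub_le_of_le' ?_ (hmul a0 a3)
    rw [norm_neg]
    exact hRR a4 (by norm_num)
  have a5' : ‖r 5‖ ≤ R ^ 3 := by
    have : r 5 = (r 5 + r 2 * r 3 + r 0 * (r 1 * r 3 - r 2 ^ 2)) - r 2 * r 3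
        - r 0 * (r 1 * r 3 - r 2 * r 2) := by ring
    rw [this]
    exact norm_sub_le_of_le' (norm_sub_le_of_le' (hRR a5 (by norm_num)) (hRR (hmul a2 a3)
      (by norm_num))) (hmul a0 (norm_sub_le_of_le' (hmul a1 a3) (hmul a2 a2)))
  refine Set.mem_univ_pi.2 fun i => ?_
  rw [mem_closedBall_zero_iff]
  fin_cases i
  · exact hRR a0 (by norm_num)
  · exact hRR a1 (by norm_num)
  · exact hRR a2 (by norm_num)
  · exact hRR a3 (by norm_num)
  · exact hRR a4' (by norm_num)
  · exact hRR a5' (by norm_num)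

theorem IsHecke.sub {f g : G2 F → ℂ} (hf : IsHecke f) (hg : IsHecke g) : IsHecke (f - g) := by
  refine ⟨hf.1.sub hg.1, fun k hk x => ?_⟩
  simp only [Pi.sub_apply, (hf.2 k hk x).1, (hf.2 k hk x).2, (hg.2 k hk x).1, (hg.2 k hk x).2,
    and_self]

theorem satakeTransform_sub {f g : G2 F → ℂ} (hf : IsHecke f) (hg : IsHecke g) (t₁ t₂ : Fˣ) :
    satakeTransform dr (f - g) t₁ t₂ = satakeTransform dr f t₁ t₂ - satakeTransform dr g t₁ t₂ := by
  simp only [satakeTransform, Pi.sub_apply]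
  rw [← mul_sub]
  congr 1
  exact integral_sub (integrable_torus_nElt hf _) (integrable_torus_nElt hg _)

theorem IsSatakePreimage.unique (hV : IsNormalizedNorm F) (h2 : ‖(2 : F)‖ = 1)
    (hdr : dr (Metric.closedBall 0 1) = 1) {m : ℤ × ℤ → ℂ} {f g : G2 F → ℂ}
    (hf : IsSatakePreimage dr m f) (hg : IsSatakePreimage dr m g) : f = g := by
  rw [← sub_eq_zero]
  refine eq_zero_of_satakeTransform hV h2 hdr (hf.1.sub hg.1) fun t₁ t₂ => ?_
  obtain ⟨a, ha⟩ := norm_eq_zpow hV t₁.ne_zero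
  obtain ⟨b, hb⟩ := norm_eq_zpow hV t₂.ne_zero
  rw [satakeTransform_sub hf.1 hg.1, hf.2 (-a) (-b) t₁ t₂ (by rw [neg_neg, ha])
    (by rw [neg_neg, hb]), hg.2 (-a) (-b) t₁ t₂ (by rw [neg_neg, ha]) (by rw [neg_neg, hb]), sub_self]

theorem heckeElt_eq (hV : IsNormalizedNorm F) (h2 : ‖(2 : F)‖ = 1)
    (hdr : dr (Metric.closedBall 0 1) = 1) {m : ℤ × ℤ → ℂ} {f : G2 F → ℂ}
    (hf : IsSatakePreimage dr m f) : heckeElt dr m = f :=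
  (Classical.epsilon_spec ⟨f, hf⟩ : IsSatakePreimage dr m (heckeElt dr m)).unique hV h2 hdr hf

theorem functionP_eq (hV : IsNormalizedNorm F) (h2 : ‖(2 : F)‖ = 1)
    (hdr : dr (Metric.closedBall 0 1) = 1) {ψ : AddChar F Circle} (hψ : Unramified ψ) (s : ℂ)
    (g : G2 F) : functionP dr s g =
      (polyP₀ F ((residueCard F : ℂ) ^ (2 - 5 * s)) * indK g
        - polyP₁ F ((residueCard F : ℂ) ^ (2 - 5 * s)) * (((𝐪 : ℂ) ^ 3)⁻¹ * indBall g))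
        / (localZeta F (5 * s - 1) * localZeta F (5 * s + 1) * localZeta F (5 * s - 2)) := by
  rw [functionP, heckeElt_eq hV h2 hdr (isSatakePreimage_indK hV hdr),
    heckeElt_eq hV h2 hdr (isSatakePreimage_indBall hV hdr hψ)]

variable [MeasurableSpace (G2 F)] [BorelSpace (G2 F)] {μ : Measure (G2 F)} [μ.IsHaarMeasure]

theorem RightK.integrable_mul_indicator {f : G2 F → ℂ} (hf : RightK f) (g : G2 F) (c : ℝ) :
    Integrable (fun x => if gn x ≤ c then f (g * x) else 0) μ := by
  refine RightK.integrable (fun k hk x => ?_) (c := c) fun x hx => ?_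
  · simp only [gn_mul_K x hk, ← mul_assoc, hf k hk]
  · by_contra h
    exact hx (if_neg h)

theorem integrable_conv (hV : IsNormalizedNorm F) (h2 : ‖(2 : F)‖ = 1)
    (hdr : dr (Metric.closedBall 0 1) = 1) {ψ : AddChar F Circle} (hψ : Unramified ψ) (s : ℂ)
    {f : G2 F → ℂ} (hf : RightK f) (g : G2 F) :
    Integrable (fun x => f (g * x⁻¹) * functionP dr s x) μ ∧
    ∫ x, f (g * x⁻¹) * functionP dr s x ∂μ =
      (polyP₀ F ((residueCard F : ℂ) ^ (2 - 5 * s)) * ∫ x, (if gn x ≤ 1 then f (g * x) else 0) ∂μ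
        - polyP₁ F ((residueCard F : ℂ) ^ (2 - 5 * s)) * (((𝐪 : ℂ) ^ 3)⁻¹ *
          ∫ x, (if gn x ≤ 𝐪 then f (g * x) else 0) ∂μ))
        / (localZeta F (5 * s - 1) * localZeta F (5 * s + 1) * localZeta F (5 * s - 2)) := by
  have := isInvInvariant μ h2
  have e : ∀ x, f (g * x) * functionP dr s x⁻¹ =
      (polyP₀ F ((residueCard F : ℂ) ^ (2 - 5 * s)) * (if gn x ≤ 1 then f (g * x) else 0)
        - polyP₁ F ((residueCard F : ℂ) ^ (2 - 5 * s)) * (((𝐪 : ℂ) ^ 3)⁻¹ *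
          (if gn x ≤ 𝐪 then f (g * x) else 0)))
        / (localZeta F (5 * s - 1) * localZeta F (5 * s + 1) * localZeta F (5 * s - 2)) := by
    intro x
    rw [functionP_eq hV h2 hdr hψ]
    simp only [indK, indBall, gn_inv, mem_groupK_iff]
    split_ifs <;> ring
  have i1 := hf.integrable_mul_indicator (μ := μ) g 1
  have iq := hf.integrable_mul_indicator (μ := μ) g 𝐪
  have hint : Integrable (fun x => f (g * x) * functionP dr s x⁻¹) μ := by
    simp_rw [e]
    exact ((i1.const_mul _).sub ((iq.const_mul _).const_mul _)).div_const _
  constructor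
  · have := hint.comp_inv
    simpa only [inv_inv] using this
  · rw [← integral_inv_eq_self]
    simp only [inv_inv]
    simp_rw [e]
    rw [integral_div, integral_sub (i1.const_mul _) ((iq.const_mul _).const_mul _),
      integral_const_mul, integral_const_mul, integral_const_mul]

theorem integral_indicator_K (hμ : μ (maxCompact F) = 1) {f : G2 F → ℂ} (hf : RightK f) (g : G2 F) :
    ∫ x, (if gn x ≤ 1 then f (g * x) else 0) ∂μ = f g := by
  have : (fun x => if gn x ≤ 1 then f (g * x) else 0) =
      (groupK F : Set (G2 F)).indicator fun _ => f g := by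
    ext x
    simp only [Set.indicator_apply, SetLike.mem_coe, mem_groupK_iff]
    split_ifs with h
    · exact hf x (mem_groupK_iff.2 h) g
    · rfl
  have hμ' : μ (groupK F : Set (G2 F)) = 1 := hμ
  rw [this, integral_indicator isOpen_groupK.measurableSet, setIntegral_const, Measure.real, hμ']
  simp

end Uniqueness

section ConvolutionValues

/-! ## Numbers of roots over the residue field -/

theorem card_resField [Fintype (ResField F)] : Fintype.card (ResField F) = residueCard F := by
  rw [← Nat.card_eq_fintype_card]; rfl

theorem red_ne_zero {x : F} (h : ‖x‖ = 1) : red x ≠ 0 := by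
  rw [Ne, red_eq_zero_iff h.le, h]; exact lt_irrefl 1

section RootCount

variable [Fintype (ResField F)] {c : Fin 3 → F}

theorem rootCount_of_lt (h0 : ‖c 0‖ < 1) (h1 : ‖c 1‖ < 1) (h2 : ‖c 2‖ < 1) :
    rootCount c = residueCard F := by
  rw [rootCount, (red_eq_zero_iff h0.le).2 h0, (red_eq_zero_iff h1.le).2 h1,
    (red_eq_zero_iff h2.le).2 h2, ← card_resField]
  simp [Finset.card_univ]

theorem rootCount_const (h0 : ‖c 0‖ = 1) (h1 : ‖c 1‖ < 1) (h2 : ‖c 2‖ < 1) :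
    rootCount c = 0 := by
  rw [rootCount, (red_eq_zero_iff h1.le).2 h1, (red_eq_zero_iff h2.le).2 h2]
  simp [red_ne_zero h0]

theorem rootCount_linear (h0 : ‖c 0‖ < 1) (h1 : ‖c 1‖ = 1) (h2 : ‖c 2‖ < 1) :
    rootCount c = 1 := by
  rw [rootCount, (red_eq_zero_iff h0.le).2 h0, (red_eq_zero_iff h2.le).2 h2, Finset.card_eq_one]
  refine ⟨0, ?_⟩
  ext m
  simp [red_ne_zero h1]

theorem rootCount_square (h0 : ‖c 0‖ < 1) (h1 : ‖c 1‖ < 1) (h2 : ‖c 2‖ = 1) :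
    rootCount c = 1 := by
  rw [rootCount, (red_eq_zero_iff h0.le).2 h0, (red_eq_zero_iff h1.le).2 h1, Finset.card_eq_one]
  refine ⟨0, ?_⟩
  ext m
  simp [red_ne_zero h2]

theorem rootCount_product (h0 : ‖c 0‖ < 1) (h1 : ‖c 1‖ = 1) (h2 : ‖c 2‖ = 1) :
    rootCount c = 2 := by
  have n1 := red_ne_zero h1
  have n2 := red_ne_zero h2
  rw [rootCount, (red_eq_zero_iff h0.le).2 h0, Finset.card_eq_two]
  refine ⟨0, -red (c 1) / red (c 2), ?_, ?_⟩
  · exact (div_ne_zero (neg_ne_zero.2 n1) n2).symm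
  · ext m
    simp only [Finset.mem_filter, Finset.mem_univ, true_and, zero_add, Finset.mem_insert,
      Finset.mem_singleton, eq_div_iff n2]
    have : red (c 1) * m + red (c 2) * m ^ 2 = m * (m * red (c 2) - -red (c 1)) := by ring
    rw [this, mul_eq_zero, sub_eq_zero]

theorem sum_resField_two {a b : ℂ} {f : ResField F → ℂ} (h0 : f 0 = a) (h : ∀ ρ, ρ ≠ 0 → f ρ = b) :
    ∑ ρ, f ρ = a + ((residueCard F : ℂ) - 1) * b := by
  rw [← Finset.add_sum_erase _ _ (Finset.mem_univ (0 : ResField F)), h0,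
    Finset.sum_congr rfl fun ρ hρ => h ρ (Finset.ne_of_mem_erase hρ), Finset.sum_const,
    Finset.card_erase_of_mem (Finset.mem_univ _), Finset.card_univ, card_resField, nsmul_eq_mul,
    Nat.cast_pred]
  rw [← card_resField (F := F)]
  exact Fintype.card_pos

theorem sum_resField_three {a b : ℂ} {f : ResField F → ℂ} {ρ₁ : ResField F} (h1 : ρ₁ ≠ 0)
    (h0 : f 0 = a) (h1' : f ρ₁ = a) (h : ∀ ρ, ρ ≠ 0 → ρ ≠ ρ₁ → f ρ = b) :
    ∑ ρ, f ρ = 2 * a + ((residueCard F : ℂ) - 2) * b := by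
  have := sum_resField_two (f := fun ρ => if ρ = ρ₁ then b else f ρ) (a := a) (b := b)
    (by simp [h1.symm, h0]) fun ρ hρ => by
      by_cases he : ρ = ρ₁
      · simp [he]
      · simp [he, h ρ hρ he]
  have e : ∑ ρ, f ρ = (∑ ρ, if ρ = ρ₁ then b else f ρ) + (a - b) := by
    rw [← Finset.add_sum_erase _ _ (Finset.mem_univ ρ₁),
      ← Finset.add_sum_erase Finset.univ (fun ρ => if ρ = ρ₁ then b else f ρ) (Finset.mem_univ ρ₁),
      if_pos rfl, h1', Finset.sum_congr rfl fun ρ hρ => (if_neg (Finset.ne_of_mem_erase hρ)).symm]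
    ring
  rw [e, this]
  ring

end RootCount

/-- The exponent which governs the value of `F*` at `x_α(y) t`. -/
def depth (y : F) (a b : ℤ) : ℤ := a - logA y (a - b) - logA (1 + y) (a - b)

/-- The coefficients of the character `Ψ(m u m⁻¹)` of `U`, for `m = x_α(y) t`. -/
def charCoeff (y : F) (t₁ t₂ : Fˣ) : Fin 3 → F :=
  ![y * (1 + y) * rootsU t₁ t₂ 0, (1 + 2 * y) * rootsU t₁ t₂ 1, rootsU t₁ t₂ 2]

theorem norm_le_zpow_logA (hV : IsNormalizedNorm F) (y : F) (e : ℤ) :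
    ‖y‖ ≤ 𝐪 ^ (logA y e - e) := by
  have hq := q_pos hV
  rw [zpow_sub₀ hq.ne', zpow_logA hV, le_div_iff₀ (zpow_pos hq _)]
  exact le_max_right _ _

theorem norm_eq_zpow_logA (hV : IsNormalizedNorm F) {y : F} {e : ℤ} (h : logA y e ≠ 0) :
    ‖y‖ = 𝐪 ^ (logA y e - e) := by
  have hq := q_pos hV
  refine (norm_le_zpow_logA hV y e).antisymm ?_
  have h1 := (logA_eq_zero_iff hV y e).not.1 h
  rw [not_le, _root_.zpow_neg, inv_lt_iff_one_lt_mul₀ (zpow_pos hq _), mul_comm] at h1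
  rw [zpow_sub₀ hq.ne', zpow_logA hV, div_le_iff₀ (zpow_pos hq _)]
  exact max_le (by rw [mul_comm] at h1; exact h1.le) le_rfl

theorem norm_charCoeff_le (hV : IsNormalizedNorm F) {y : F} {t₁ t₂ : Fˣ} {a b : ℤ}
    (h1 : ‖(t₁ : F)‖ = 𝐪 ^ (-a)) (h2 : ‖(t₂ : F)‖ = 𝐪 ^ (-(a + b))) (hk : 0 ≤ depth y a b) (i) :
    ‖charCoeff y t₁ t₂ i‖ ≤ 1 := by
  have n1 := logA_nonneg hV y (a - b)
  have n2 := logA_nonneg hV (1 + y) (a - b)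
  have y1 := norm_le_zpow_logA hV y (a - b)
  have y2 := norm_le_zpow_logA hV (1 + y) (a - b)
  have hr := fun i => (norm_rootsU hV h1 h2 i).le
  rw [depth] at hk
  have key : ‖charCoeff y t₁ t₂ i‖ ≤ 𝐪 ^ (0 : ℤ) := by
    fin_cases i
    · change ‖y * (1 + y) * rootsU t₁ t₂ 0‖ ≤ _
      exact norm_le_zpow_mono hV (norm_mul_le_zpow hV (norm_mul_le_zpow hV y1 y2 rfl)
        (hr 0) rfl) (by simp only [rootsExp, Matrix.cons_val]; omega)
    · change ‖(1 + 2 * y) * rootsU t₁ t₂ 1‖ ≤ _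
      have : ‖1 + 2 * y‖ ≤ 𝐪 ^ b := by
        rw [show 1 + 2 * y = y + (1 + y) by ring]
        exact norm_add_le_of_le' (norm_le_zpow_mono hV y1 (by omega))
          (norm_le_zpow_mono hV y2 (by omega))
      exact norm_mul_le_zpow hV this (hr 1) (by simp [rootsExp])
    · change ‖rootsU t₁ t₂ 2‖ ≤ _
      exact norm_le_zpow_mono hV (hr 2) (by simp only [rootsExp, Matrix.cons_val]; omega)
  simpa using key

/-- If the character is trivial on `U(𝒪)`, the exponent is non-negative. -/
theorem depth_nonneg (hV : IsNormalizedNorm F) (hh2 : ‖(2 : F)‖ = 1) {y : F} {t₁ t₂ : Fˣ}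
    {a b : ℤ} (h1 : ‖(t₁ : F)‖ = 𝐪 ^ (-a)) (h2 : ‖(t₂ : F)‖ = 𝐪 ^ (-(a + b)))
    (hc : ∀ i, ‖charCoeff y t₁ t₂ i‖ ≤ 1) : 0 ≤ depth y a b := by
  have hq := q_pos hV
  have hq1 := one_lt_q hV
  have c0 : ‖y * (1 + y)‖ ≤ 𝐪 ^ (2 * b - a) := by
    have := hc 0
    change ‖y * (1 + y) * rootsU t₁ t₂ 0‖ ≤ 1 at this
    rwa [norm_mul, norm_rootsU hV h1 h2, _root_.zpow_neg, ← div_eq_mul_inv,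
      div_le_one (zpow_pos hq _)] at this
  have c1 : ‖1 + 2 * y‖ ≤ 𝐪 ^ b := by
    have := hc 1
    change ‖(1 + 2 * y) * rootsU t₁ t₂ 1‖ ≤ 1 at this
    rwa [norm_mul, norm_rootsU hV h1 h2, _root_.zpow_neg, ← div_eq_mul_inv,
      div_le_one (zpow_pos hq _)] at this
  have ha : 0 ≤ a := by
    have := hc 2
    change ‖rootsU t₁ t₂ 2‖ ≤ 1 at this
    rw [norm_rootsU hV h1 h2] at this
    by_contra! hlt
    refine absurd this (not_le.2 (one_lt_zpow₀ hq1 ?_))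
    simp only [rootsExp, Matrix.cons_val]
    omega
  have hb : 0 ≤ b := by
    by_contra! hlt
    have e : (1 : F) = (1 + 2 * y) ^ 2 - 2 * (2 * (y * (1 + y))) := by ring
    have l1 : ‖(1 + 2 * y) ^ 2‖ < 1 := by
      rw [norm_pow]
      exact pow_lt_one₀ (norm_nonneg _) (c1.trans_lt (zpow_lt_one_of_neg₀ hq1 hlt)) two_ne_zero
    have l2 : ‖2 * (2 * (y * (1 + y)))‖ < 1 := by
      rw [norm_mul, norm_mul, hh2, one_mul, one_mul]
      exact c0.trans_lt (zpow_lt_one_of_neg₀ hq1 (by omega))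
    have := (norm_sub_le_max' ((1 + 2 * y) ^ 2) (2 * (2 * (y * (1 + y))))).trans_lt (max_lt l1 l2)
    rw [← e, norm_one] at this
    exact lt_irrefl _ this
  have inj := zpow_right_injective₀ hq hq1.ne'
  have n1 := logA_nonneg hV y (a - b)
  have n2 := logA_nonneg hV (1 + y) (a - b)
  rw [depth]
  have one_case : ∀ z w : F, ‖w‖ = ‖1 + z‖ ∨ ‖w‖ = ‖1 + z‖ → ‖z‖ ≤ 𝐪 ^ (-(a - b)) →
      logA w (a - b) ≤ a := by
    intro z w hw hz
    have hw' : ‖w‖ = ‖1 + z‖ := by tauto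
    rcases eq_or_ne (logA w (a - b)) 0 with h0 | h0
    · omega
    have h3 := norm_eq_zpow_logA hV h0
    have h4 : ‖w‖ ≤ 𝐪 ^ max 0 (-(a - b)) := by
      rw [hw']
      exact norm_add_le_of_le' (by rw [norm_one]; exact one_le_zpow₀ hq1.le (le_max_left _ _))
        (norm_le_zpow_mono hV hz (le_max_right _ _))
    rw [h3] at h4
    have := (zpow_le_zpow_iff_right₀ hq1).1 h4
    omega
  rcases eq_or_ne (logA y (a - b)) 0 with z1 | z1
  · have := one_case y (1 + y) (Or.inl rfl) ((logA_eq_zero_iff hV y _).1 z1)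
    omega
  rcases eq_or_ne (logA (1 + y) (a - b)) 0 with z2 | z2
  · have := one_case (-(1 + y)) y (Or.inl (by rw [← norm_neg]; congr 1; ring))
      (by rw [norm_neg]; exact (logA_eq_zero_iff hV _ _).1 z2)
    omega
  · rw [norm_mul, norm_eq_zpow_logA hV z1, norm_eq_zpow_logA hV z2, ← zpow_add₀ hq.ne'] at c0
    have := (zpow_le_zpow_iff_right₀ hq1).1 c0
    omega

end ConvolutionValues

section Convolution

/-! ## Exponents of translates -/

/-- The sum of the exponents of `max(1, |y| q^e)` and `max(1, |1 + y| q^e)`. -/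
def spread (y : F) (e : ℤ) : ℤ := logA y e + logA (1 + y) e

theorem depth_eq (y : F) (a b : ℤ) : depth y a b = a - spread y (a - b) := by
  rw [depth, spread]; ring

theorem logA_zero (hV : IsNormalizedNorm F) (e : ℤ) : logA (0 : F) e = 0 := by
  rw [logA_eq_zero_iff hV, norm_zero]
  exact zpow_nonneg (q_pos hV).le _

theorem logA_of_le (hV : IsNormalizedNorm F) {y : F} {n e : ℤ} (hy : ‖y‖ ≤ 𝐪 ^ n)
    (h : n + e ≤ 0) : logA y e = 0 :=
  (logA_eq_zero_iff hV y e).2 (norm_le_zpow_mono hV hy (by omega))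

theorem logA_of_norm_one (hV : IsNormalizedNorm F) {y : F} {e : ℤ} (hy : ‖y‖ = 1) (h : 0 ≤ e) :
    logA y e = e := by
  rw [logA_eq hV (n := 0) (by simpa using hy) (by omega), zero_add]

theorem norm_mul_lift_of_ne {τ : F} {n : ℝ} (hτ : ‖τ‖ = n) {ρ : ResField F} (hρ : ρ ≠ 0) :
    ‖τ * lift ρ‖ = n := by
  have : ‖lift ρ‖ = 1 := (norm_lift_le ρ).antisymm (not_lt.1 ((norm_lift_lt_one_iff ρ).not.2 hρ))
  rw [norm_mul, this, hτ, mul_one]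

theorem norm_mul_lift_le {τ : F} {n : ℝ} (hτ : ‖τ‖ = n) (ρ : ResField F) : ‖τ * lift ρ‖ ≤ n := by
  rw [norm_mul, hτ]
  exact mul_le_of_le_one_right (hτ ▸ norm_nonneg _) (norm_lift_le ρ)

theorem norm_mul_lift_zero (hV : IsNormalizedNorm F) {τ : F} {n : ℤ} (hτ : ‖τ‖ = 𝐪 ^ n) :
    ‖τ * lift (0 : ResField F)‖ ≤ 𝐪 ^ (n - 1) := by
  refine norm_mul_le_zpow hV hτ.le (n := -1) ?_ (by ring)
  rw [_root_.zpow_neg_one, ← norm_lt_one_iff hV]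
  exact (norm_lift_lt_one_iff _).2 rfl

section Spread

variable (hV : IsNormalizedNorm F) {τ : F} {e : ℤ} (hτ : ‖τ‖ = (residueCard F : ℝ) ^ (-e))
include hV

theorem spread_zero_of_nonneg (he : 0 ≤ e) : spread (0 : F) e = e := by
  rw [spread, logA_zero hV, add_zero, zero_add, logA_of_norm_one hV norm_one he]

theorem spread_zero_of_nonpos (he : e ≤ 0) : spread (0 : F) e = 0 := by
  rw [spread, logA_zero hV, add_zero, zero_add, logA_of_le hV (n := 0) (by simp) (by omega)]

include hτ

theorem spread_lift_pos (he : 0 < e) (ρ : ResField F) :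
    spread (τ * lift ρ) (e + 1) = if ρ = 0 then e + 1 else e + 2 := by
  have hq1 := one_lt_q hV
  have h1 : ‖1 + τ * lift ρ‖ = 1 := by
    rw [norm_add_eq_of_lt, norm_one]
    rw [norm_one]
    exact (norm_mul_lift_le hτ ρ).trans_lt (zpow_lt_one_of_neg₀ hq1 (by omega))
  rw [spread, logA_of_norm_one hV h1 (by omega)]
  split_ifs with h
  · rw [h, logA_of_le (n := -e - 1) hV (norm_mul_lift_zero hV hτ) (by omega), zero_add]
  · rw [logA_eq (n := -e) hV (norm_mul_lift_of_ne hτ h) (by omega)]; ring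

theorem spread_lift_neg (he : e < 0) (ρ : ResField F) :
    spread (τ * lift ρ) (e + 1) = if ρ = 0 then 0 else 2 := by
  have hq1 := one_lt_q hV
  rw [spread]
  split_ifs with h
  · have := norm_mul_lift_zero hV hτ
    rw [h, logA_of_le (n := -e - 1) hV this (by omega), zero_add,
      logA_of_le hV (n := -e - 1) _ (by omega)]
    exact norm_add_le_of_le' (by rw [norm_one]; exact one_le_zpow₀ hq1.le (by omega)) this
  · have h1 := norm_mul_lift_of_ne hτ h
    have h2 : ‖1 + τ * lift ρ‖ = 𝐪 ^ (-e) := by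
      rw [add_comm, norm_add_eq_of_lt, h1]
      rw [h1, norm_one]
      exact one_lt_zpow₀ hq1 (by omega)
    rw [logA_eq (n := -e) hV h1 (by omega), logA_eq (n := -e) hV h2 (by omega)]; ring

omit hτ in
theorem spread_lift_unit (hτ : ‖τ‖ = 1) (ρ : ResField F) :
    spread (τ * lift ρ) 1 = if ρ = 0 ∨ ρ = red (-τ⁻¹) then 1 else 2 := by
  have hq1 := one_lt_q hV
  have hτ0 : τ ≠ 0 := norm_pos_iff.1 (by rw [hτ]; exact one_pos)
  have hτ' : ‖τ‖ = 𝐪 ^ (0 : ℤ) := by simpa using hτ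
  have hi : ‖-τ⁻¹‖ = 1 := by rw [norm_neg, norm_inv, hτ, inv_one]
  have h0 : ρ = 0 ↔ logA (τ * lift ρ) 1 = 0 := by
    constructor
    · rintro rfl
      exact logA_of_le (n := 0 - 1) hV (norm_mul_lift_zero hV hτ') (by omega)
    · intro h
      by_contra h0
      rw [logA_eq (n := 0) hV (norm_mul_lift_of_ne hτ' h0) (by omega)] at h
      omega
  have h1 : ρ = red (-τ⁻¹) ↔ logA (1 + τ * lift ρ) 1 = 0 := by
    rw [logA_eq_zero_iff hV, _root_.zpow_neg_one, ← norm_lt_one_iff hV]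
    have e1 : 1 + τ * lift ρ = τ * (lift ρ - -τ⁻¹) := by field_simp; ring
    rw [e1, norm_mul, hτ, one_mul, ← red_eq_red_iff (norm_lift_le ρ) hi.le, red_lift]
  have hne : red (-τ⁻¹) ≠ 0 := red_ne_zero hi
  have one : ∀ x : F, ‖x‖ ≤ 1 → logA x 1 ≠ 0 → logA x 1 = 1 := by
    intro x hx hx0
    have := norm_eq_zpow_logA hV hx0
    have h2 := logA_nonneg hV x 1
    rw [this] at hx
    have h3 : 𝐪 ^ (logA x 1 - 1) ≤ 𝐪 ^ (0 : ℤ) := by simpa using hx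
    have := (zpow_le_zpow_iff_right₀ hq1).1 h3
    omega
  have b0 : ‖τ * lift ρ‖ ≤ 1 := norm_mul_lift_le hτ ρ
  have b1 : ‖1 + τ * lift ρ‖ ≤ 1 := norm_add_le_of_le' norm_one.le b0
  rw [spread]
  split_ifs with h
  · rcases h with h | h
    · rw [h0.1 h, one _ b1 (h1.not.1 (by rw [h]; exact hne.symm)), zero_add]
    · rw [h1.1 h, one _ b0 (h0.not.1 (by rw [h]; exact hne)), add_zero]
  · rw [not_or] at h
    rw [one _ b0 (h0.not.1 h.1), one _ b1 (h1.not.1 h.2)]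
    rfl

theorem logA_add_lift {y : F} (h : logA y e ≠ 0) (ρ : ResField F) :
    logA (y + τ * lift ρ) (e + 1) = logA y e + 1 := by
  have h0 := logA_nonneg hV y e
  have hy := norm_eq_zpow_logA hV h
  have hlt : ‖τ * lift ρ‖ < ‖y‖ := by
    rw [hy]
    exact (norm_mul_lift_le hτ ρ).trans_lt ((zpow_lt_zpow_iff_right₀ (one_lt_q hV)).2
      (by omega : -e < logA y e - e))
  rw [logA_eq hV (n := logA y e - e) (by rw [norm_add_eq_of_lt hlt, hy]) (by omega)]
  ring

theorem spread_add_lift {y : F} (h : logA y e ≠ 0) (h' : logA (1 + y) e ≠ 0) (ρ : ResField F) :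
    spread (y + τ * lift ρ) (e + 1) = spread y e + 2 := by
  rw [spread, ← add_assoc, logA_add_lift hV hτ h, logA_add_lift hV hτ h', spread]
  ring

omit hτ in
theorem spread_sub_one {y : F} (h : logA y e ≠ 0) (h' : logA (1 + y) e ≠ 0) :
    spread y (e - 1) = spread y e - 2 := by
  have h0 := logA_nonneg hV y e
  have h0' := logA_nonneg hV (1 + y) e
  rw [spread, logA_eq hV (norm_eq_zpow_logA hV h) (by omega),
    logA_eq hV (norm_eq_zpow_logA hV h') (by omega), spread]
  ring

end Spread

/-! ## The local factors -/

theorem geomS_succ (X : ℂ) {k : ℤ} (hk : 0 ≤ k) : geomS X (k + 1) = geomS X k + X ^ (k + 1) := by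
  lift k to ℕ using hk
  rw [geomS, geomS, show ((k : ℤ) + 1 + 1).toNat = k + 1 + 1 by omega,
    show ((k : ℤ) + 1).toNat = k + 1 by omega, Finset.sum_range_succ _ (k + 1)]
  norm_cast

theorem geomS_zero (X : ℂ) : geomS X 0 = 1 := by simp [geomS]

/-- The values of the geometric sums near a positive index. -/
theorem geomS_near {X : ℂ} (hX : X ≠ 0) {k : ℤ} (hk : 0 < k) : ∃ W, X ^ k = X * W ∧
    geomS X (k + 1) = geomS X k + X ^ 2 * W ∧ geomS X (k + 2) = geomS X k + X ^ 2 * W + X ^ 3 * W ∧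
    geomS X (k - 1) = geomS X k - X * W ∧ geomS X (k - 2) = geomS X k - X * W - W := by
  have e1 := geomS_succ X hk.le
  have e2 := geomS_succ X (show 0 ≤ k + 1 by omega)
  have e3 := geomS_succ X (show 0 ≤ k - 1 by omega)
  rw [show k - 1 + 1 = k by ring] at e3
  have e4 : geomS X (k - 1) = geomS X (k - 2) + X ^ (k - 1) := by
    rcases eq_or_ne k 1 with rfl | h1
    · rw [geomS_of_neg X (k := 1 - 2) (by norm_num)]
      simp [geomS_zero]
    · have := geomS_succ X (show 0 ≤ k - 2 by omega)
      rwa [show k - 2 + 1 = k - 1 by ring] at this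
  refine ⟨X ^ (k - 1), ?_, ?_, ?_, ?_, ?_⟩
  · rw [zpow_sub_one₀ hX]; field_simp
  · rw [e1, zpow_sub_one₀ hX, zpow_add_one₀ hX]; field_simp
  · rw [show k + 2 = k + 1 + 1 by ring, e2, e1, zpow_sub_one₀ hX, zpow_add_one₀ hX,
      zpow_add_one₀ hX, zpow_add_one₀ hX]; field_simp
  · rw [e3, zpow_sub_one₀ hX]; field_simp; ring
  · rw [eq_sub_iff_add_eq, ← e4, e3, zpow_sub_one₀ hX]; field_simp; ring

/-- The combination of values of `F*` in `F* * P`. -/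
def hecke (q Y ν S Sp Sm A₁ A₂ B₁ B₂ : ℂ) : ℂ :=
  ((q ^ 2 * Y) ^ 4 / q ^ 2 + (1 / q ^ 2 + 1 / q) * (q ^ 2 * Y) ^ 3 + (q ^ 2 * Y) ^ 2 / q +
    (1 / q + 1) * (q ^ 2 * Y) + 1) * S -
  Y ^ 2 * (q ^ 2 * ν * S + q ^ 6 * Y ^ 2 * Sp + (Y ^ 2)⁻¹ * Sm + q ^ 4 * Y * (A₁ + A₂) +
    q * Y⁻¹ * (B₁ + B₂))

section Hecke

variable {q Y : ℂ} (hq : q ≠ 0) (hY : Y ≠ 0) (S W : ℂ)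
include hq hY

theorem hecke_off : hecke q Y q S (S + ((q * Y)⁻¹) ^ 2 * W) (S - (q * Y)⁻¹ * W)
    (q * (S - (q * Y)⁻¹ * W)) (S + ((q * Y)⁻¹) ^ 2 * W + ((q * Y)⁻¹) ^ 3 * W)
    (q * (S - (q * Y)⁻¹ * W - W)) (S + ((q * Y)⁻¹) ^ 2 * W) = 0 := by
  rw [hecke]; field_simp; ring

theorem hecke_off_zero : hecke q Y 0 1 (1 + (q * Y)⁻¹) 0 0 (1 + (q * Y)⁻¹ + ((q * Y)⁻¹) ^ 2)
    0 (1 + (q * Y)⁻¹) = 0 := by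
  rw [hecke]; field_simp; ring

theorem hecke_pos : hecke q Y q S (S + ((q * Y)⁻¹) ^ 2 * W) (S - (q * Y)⁻¹ * W)
    (S + (q - 1) * (S - (q * Y)⁻¹ * W)) (S + ((q * Y)⁻¹) ^ 2 * W)
    (S - (q * Y)⁻¹ * W + (q - 1) * (S - (q * Y)⁻¹ * W - W)) S =
    (1 + q * Y) * ((1 - q * Y) * (1 + q ^ 2 * Y)) * ((q * Y)⁻¹ * W) := by
  rw [hecke]; field_simp; ring

theorem hecke_pos_zero : hecke q Y 1 1 (1 + (q * Y)⁻¹) 0 1 (1 + (q * Y)⁻¹) 0 1 =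
    (1 + q * Y) * ((1 - q * Y) * (1 + q ^ 2 * Y)) := by
  rw [hecke]; field_simp; ring

theorem hecke_diag : hecke q Y q S (S + ((q * Y)⁻¹) ^ 2 * W) (S - (q * Y)⁻¹ * W)
    (2 * S + (q - 2) * (S - (q * Y)⁻¹ * W)) S
    (2 * (S - (q * Y)⁻¹ * W) + (q - 2) * (S - (q * Y)⁻¹ * W - W)) (S - (q * Y)⁻¹ * W) =
    (1 + 2 * (q * Y)) * ((1 - q * Y) * (1 + q ^ 2 * Y)) * ((q * Y)⁻¹ * W) := by
  rw [hecke]; field_simp; ring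

theorem hecke_diag_zero : hecke q Y 2 1 (1 + (q * Y)⁻¹) 0 2 1 0 0 =
    (1 + 2 * (q * Y)) * ((1 - q * Y) * (1 + q ^ 2 * Y)) := by
  rw [hecke]; field_simp; ring

theorem hecke_neg : hecke q Y q S (S + ((q * Y)⁻¹) ^ 2 * W) (S - (q * Y)⁻¹ * W)
    (S + ((q * Y)⁻¹) ^ 2 * W + (q - 1) * (S - (q * Y)⁻¹ * W)) S
    (S + (q - 1) * (S - (q * Y)⁻¹ * W - W)) (S - (q * Y)⁻¹ * W) =
    (1 + q * Y) * ((1 - q * Y) * (1 + q ^ 2 * Y)) * ((q * Y)⁻¹ * W) := by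
  rw [hecke]; field_simp; ring

theorem hecke_neg_zero : hecke q Y 1 1 (1 + (q * Y)⁻¹) 0 (1 + (q * Y)⁻¹) 1 1 0 =
    (1 + q * Y) * ((1 - q * Y) * (1 + q ^ 2 * Y)) := by
  rw [hecke]; field_simp; ring

end Hecke

end Convolution

section ConvolutionValues

/-! ## Powers of `q` -/

section Powers

variable (hV : IsNormalizedNorm F)
include hV

theorem q_ne_zero : 𝐐 ≠ 0 := by exact_mod_cast (q_pos hV).ne'

theorem q_cpow_ne_zero (z : ℂ) : 𝐐 ^ z ≠ 0 := by
  rw [Ne, Complex.cpow_eq_zero_iff]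
  exact fun h => q_ne_zero hV h.1

theorem cpow_q_add_int (z : ℂ) (n : ℤ) : 𝐐 ^ (z + n) = 𝐐 ^ z * 𝐐 ^ n := by
  rw [Complex.cpow_add _ _ (q_ne_zero hV), Complex.cpow_intCast]

theorem cpow_X (s : ℂ) : 𝐐 ^ (5 * s - 1) = (𝐐 * 𝐐 ^ (-(5 * s)))⁻¹ := by
  have := cpow_q_add_int hV (5 * s) (-1)
  rw [show 5 * s - 1 = 5 * s + ((-1 : ℤ) : ℂ) by push_cast; ring, this, Complex.cpow_neg,
    _root_.zpow_neg_one, _root_.mul_inv_rev, inv_inv]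

theorem zeta_factor {s : ℂ} (hs : 1 < s.re) :
    localZeta F (5 * s - 1) ^ 2 * localZeta F (10 * s - 4) /
      (localZeta F (5 * s - 1) * localZeta F (5 * s + 1) * localZeta F (5 * s - 2)) *
      ((1 - 𝐐 * 𝐐 ^ (-(5 * s))) * (1 + 𝐐 ^ 2 * 𝐐 ^ (-(5 * s)))) = (localZeta F (5 * s + 1))⁻¹ := by
  have z1 := localZeta_mul hV (z := 5 * s - 1) (by simp; linarith)
  have z2 := localZeta_mul hV (z := 10 * s - 4) (by simp; linarith)
  have z3 := localZeta_mul hV (z := 5 * s - 2) (by simp; linarith)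
  have z4 := localZeta_mul hV (z := 5 * s + 1) (by simp; linarith)
  have n4 := left_ne_zero_of_mul_eq_one z4
  have e1 : 𝐐 ^ (-(5 * s - 1)) = 𝐐 * 𝐐 ^ (-(5 * s)) := by
    rw [Complex.cpow_neg, cpow_X hV, inv_inv]
  have e3 : 𝐐 ^ (-(5 * s - 2)) = 𝐐 ^ 2 * 𝐐 ^ (-(5 * s)) := by
    rw [show -(5 * s - 2) = -(5 * s) + ((2 : ℤ) : ℂ) by push_cast; ring, cpow_q_add_int hV,
      mul_comm]
    norm_cast
  have e2 : 𝐐 ^ (-(10 * s - 4)) = (𝐐 ^ 2 * 𝐐 ^ (-(5 * s))) ^ 2 := by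
    rw [← e3, sq, ← Complex.cpow_add _ _ (q_ne_zero hV)]
    congr 1; ring
  rw [e1] at z1
  rw [e2] at z2
  rw [e3] at z3
  have n1 := left_ne_zero_of_mul_eq_one z1
  have n3 := left_ne_zero_of_mul_eq_one z3
  generalize 𝐐 * 𝐐 ^ (-(5 * s)) = u at *
  generalize 𝐐 ^ 2 * 𝐐 ^ (-(5 * s)) = v at *
  have n3' := right_ne_zero_of_mul_eq_one z3
  generalize localZeta F (5 * s - 1) = Z1 at *
  generalize localZeta F (10 * s - 4) = Z2 at *
  generalize localZeta F (5 * s - 2) = Z3 at *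
  generalize localZeta F (5 * s + 1) = Z4 at *
  have key : Z1 * Z2 * ((1 - u) * (1 + v)) =
      Z3 := by
    apply mul_right_cancel₀ n3'
    linear_combination z2 - z3 + Z2 * (1 - v ^ 2) * z1
  field_simp
  linear_combination key

theorem toralValue_eq {s : ℂ} {t₁ t₂ : Fˣ} {a b : ℤ} (h1 : ‖(t₁ : F)‖ = 𝐪 ^ (-a))
    (h2 : ‖(t₂ : F)‖ = 𝐪 ^ (-(a + b))) : toralValue F s t₁ t₂ =
    if b < a then (1 + 𝐐 * 𝐐 ^ (-(5 * s))) / localZeta F (5 * s + 1) *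
      ((𝐐 ^ b)⁻¹ * (𝐐 ^ (-(5 * s))) ^ a)
    else if a < b then (1 + 𝐐 * 𝐐 ^ (-(5 * s))) / localZeta F (5 * s + 1) *
      ((𝐐 ^ a)⁻¹ * (𝐐 ^ (-(5 * s))) ^ b)
    else (1 + 2 * (𝐐 * 𝐐 ^ (-(5 * s)))) / localZeta F (5 * s + 1) *
      ((𝐐 ^ a)⁻¹ * (𝐐 ^ (-(5 * s))) ^ a) := by
  have hq := q_pos hV
  have hT : ∀ n : ℤ, ((𝐪 ^ (-n) : ℝ) : ℂ) ^ (5 * s) = (𝐐 ^ (-(5 * s))) ^ n := fun n => by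
    rw [cpow_zpow_q hV, Complex.cpow_neg, _root_.zpow_neg, _root_.inv_zpow]
  have hT' : ∀ n : ℤ, ((𝐪 ^ (-n) : ℝ) : ℂ) = (𝐐 ^ n)⁻¹ := fun n => by
    rw [_root_.zpow_neg]; push_cast; rfl
  have hQ1 : 𝐐 ^ (1 - 5 * s) = 𝐐 * 𝐐 ^ (-(5 * s)) := by
    rw [show 1 - 5 * s = -(5 * s) + ((1 : ℤ) : ℂ) by push_cast; ring, cpow_q_add_int hV,
      zpow_one, mul_comm]
  have hab : ‖(t₂ : F) / t₁‖ = 𝐪 ^ (-b) := by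
    rw [norm_div, h1, h2, ← zpow_sub₀ hq.ne']; congr 1; ring
  have i1 : 𝐪 ^ (-(a - b)) < 1 ↔ b < a := by
    rw [← zpow_zero 𝐪, zpow_lt_zpow_iff_right₀ (one_lt_q hV)]; omega
  have i2 : 1 < 𝐪 ^ (-(a - b)) ↔ a < b := by
    rw [← zpow_zero 𝐪, zpow_lt_zpow_iff_right₀ (one_lt_q hV)]; omega
  simp only [toralValue, norm_rootA hV h1 h2, i1, i2, hab, h1, hQ1,
    Complex.cpow_add _ _ (show ((𝐪 ^ (-a) : ℝ) : ℂ) ≠ 0 by exact_mod_cast (zpow_pos hq _).ne'), hT,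
    Complex.cpow_one]
  simp only [hT']
  congr 1
  · ring
  · congr 1 <;> ring

end Powers

theorem functionF_rightK (ψ : AddChar F Circle) (s : ℂ) : RightK (functionF ψ dr s) :=
  fun _ hk g => functionF_mul_K ψ s g hk

variable [MeasurableSpace (G2 F)] [BorelSpace (G2 F)] {μ : Measure (G2 F)} [μ.IsHaarMeasure]

section

variable (hV : IsNormalizedNorm F) (hh2 : ‖(2 : F)‖ = 1) (hdr : dr (Metric.closedBall 0 1) = 1)
  {ψ : AddChar F Circle} (hψ : Unramified ψ)
include hV hh2 hdr hψ

theorem heckeConv_eq (s : ℂ) (g : G2 F) (hμ : μ (maxCompact F) = 1) :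
    heckeConv μ (functionF ψ dr s) (functionP dr s) g =
      (polyP₀ F (𝐐 ^ (2 - 5 * s)) * functionF ψ dr s g - polyP₁ F (𝐐 ^ (2 - 5 * s)) *
        ((𝐐 ^ 3)⁻¹ * ∫ x, (if gn x ≤ 𝐪 then functionF ψ dr s (g * x) else 0) ∂μ)) /
        (localZeta F (5 * s - 1) * localZeta F (5 * s + 1) * localZeta F (5 * s - 2)) := by
  rw [heckeConv, (integrable_conv hV hh2 hdr hψ s (functionF_rightK ψ s) g).2,
    integral_indicator_K hμ (functionF_rightK ψ s), Complex.ofReal_natCast]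

theorem heckeConv_uElt_mul (s : ℂ) (r : Fin 5 → F) (g : G2 F) :
    heckeConv μ (functionF ψ dr s) (functionP dr s) (uElt r * g) =
      splitChar ψ r * heckeConv μ (functionF ψ dr s) (functionP dr s) g := by
  simp only [heckeConv, mul_assoc (uElt r), functionF_uElt_mul, mul_assoc (splitChar ψ r),
    integral_const_mul]

theorem heckeConv_mul_K (hμ : μ (maxCompact F) = 1) (s : ℂ) (g : G2 F) {k : G2 F}
    (hk : k ∈ groupK F) : heckeConv μ (functionF ψ dr s) (functionP dr s) (g * k) =
      heckeConv μ (functionF ψ dr s) (functionP dr s) g := by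
  rw [heckeConv_eq hV hh2 hdr hψ s _ hμ, heckeConv_eq hV hh2 hdr hψ s _ hμ,
    functionF_mul_K ψ s g hk]
  have := integral_mul_left_eq_self (μ := μ)
    (fun x => if gn x ≤ 𝐪 then functionF ψ dr s (g * x) else 0) k
  simp only [gn_K_mul _ hk, ← mul_assoc] at this
  rw [this]

end

end ConvolutionValues

section ConvolutionTorus

theorem torus_mul_torusPow (y : F) (t₁ t₂ ϖ : Fˣ) (a b : ℤ) :
    xA y * torusElt t₁ t₂ * torusPow ϖ a b =
      xA y * torusElt (t₁ * ϖ ^ a) (t₂ * ϖ ^ (a + b)) := by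
  rw [torusPow, mul_assoc, torusElt_mul]

theorem torus_mul_torusPow_mul_xA (y z : F) (t₁ t₂ ϖ : Fˣ) {a b : ℤ} (h : a - b = 1) :
    xA y * torusElt t₁ t₂ * (torusPow ϖ a b * xA ((ϖ : F)⁻¹ * z)) =
      xA (y + t₁ ^ 2 / t₂ * z) * torusElt (t₁ * ϖ ^ a) (t₂ * ϖ ^ (a + b)) := by
  have hϖ := ϖ.ne_zero
  have e : (((ϖ ^ a : Fˣ) : F) ^ 2 / ((ϖ ^ (a + b) : Fˣ) : F)) * ((ϖ : F)⁻¹ * z) = z := by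
    obtain rfl : b = a - 1 := by omega
    rw [Units.val_zpow_eq_zpow_val, Units.val_zpow_eq_zpow_val,
      show a + (a - 1) = a + a - 1 by ring, zpow_sub_one₀ hϖ, zpow_add₀ hϖ]
    have := zpow_ne_zero a hϖ
    field_simp
  rw [torusPow, torusElt_mul_xA, e, ← mul_assoc, mul_assoc (xA y), torusElt_mul_xA, ← mul_assoc,
    xA_mul_xA, mul_assoc, torusElt_mul]

theorem torus_mul_uElt (y : F) (t₁ t₂ : Fˣ) (r : Fin 5 → F) :
    xA y * torusElt t₁ t₂ * uElt r =
      uElt (conjA y fun i => rootsU t₁ t₂ i * r i) * (xA y * torusElt t₁ t₂) := by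
  rw [mul_assoc, torusElt_mul_uElt, ← mul_assoc, xA_mul_uElt, mul_assoc]

theorem splitChar_conj (ψ : AddChar F Circle) (y : F) (t₁ t₂ : Fˣ) (r : Fin 5 → F) :
    splitChar ψ (conjA y fun i => rootsU t₁ t₂ i * r i) = (ψ (charCoeff y t₁ t₂ 0 * r 0 +
      charCoeff y t₁ t₂ 1 * r 1 + charCoeff y t₁ t₂ 2 * r 2) : ℂ) := by
  rw [splitChar]
  congr 2
  simp only [conjA, charCoeff, Matrix.cons_val]
  ring

/-- A right `K`-invariant function which transforms under `U` by the split character vanishes at the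
elements whose character is not trivial on `U(𝒪)`. -/
theorem eq_zero_of_depth_neg (hV : IsNormalizedNorm F) (hh2 : ‖(2 : F)‖ = 1)
    {ψ : AddChar F Circle} (hψ : Unramified ψ) {Φ : G2 F → ℂ} (hK : RightK Φ)
    (hU : ∀ r g, Φ (uElt r * g) = splitChar ψ r * Φ g) {y : F} {t₁ t₂ : Fˣ} {a b : ℤ}
    (h1 : ‖(t₁ : F)‖ = 𝐪 ^ (-a)) (h2 : ‖(t₂ : F)‖ = 𝐪 ^ (-(a + b))) (hk : depth y a b < 0) :
    Φ (xA y * torusElt t₁ t₂) = 0 := by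
  have : ¬ ∀ i, ‖charCoeff y t₁ t₂ i‖ ≤ 1 := fun hc =>
    absurd (depth_nonneg hV hh2 h1 h2 hc) (by omega)
  push Not at this
  obtain ⟨i, hi⟩ := this
  rw [← not_le, ← hψ (charCoeff y t₁ t₂ i)] at hi
  push Not at hi
  obtain ⟨v, hv, hne⟩ := hi
  set r : Fin 5 → F :=
    ![if i = 0 then v else 0, if i = 1 then v else 0, if i = 2 then v else 0, 0, 0] with hr
  have hr1 : ∀ j, ‖r j‖ ≤ 1 := by
    intro j
    fin_cases j <;> simp only [hr, Fin.zero_eta, Fin.mk_one, Fin.reduceFinMk, Matrix.cons_val] <;>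
      (try split_ifs) <;> simp [hv]
  have h := hK _ (uElt_mem_K hr1) (xA y * torusElt t₁ t₂)
  rw [torus_mul_uElt, hU, splitChar_conj,
    show charCoeff y t₁ t₂ 0 * r 0 + charCoeff y t₁ t₂ 1 * r 1 + charCoeff y t₁ t₂ 2 * r 2 =
      charCoeff y t₁ t₂ i * v by fin_cases i <;> simp [hr]] at h
  refine by_contra fun h0 => hne (Circle.ext ?_)
  rw [(mul_eq_right₀ h0).1 h, Circle.coe_one]

variable [MeasurableSpace (G2 F)] [BorelSpace (G2 F)] {μ : Measure (G2 F)} [μ.IsHaarMeasure]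

section

variable (hV : IsNormalizedNorm F) (hh2 : ‖(2 : F)‖ = 1) (hdr : dr (Metric.closedBall 0 1) = 1)
  {ψ : AddChar F Circle} (hψ : Unramified ψ)
include hV hh2 hdr hψ

/-- `F* * P` on `x_α(y) T` in terms of exponents, when the character is trivial on `U(𝒪)`. -/
theorem heckeConv_torus [Fintype (ResField F)] (hμ : μ (maxCompact F) = 1) {s : ℂ} (hs : 1 < s.re)
    {y : F} {t₁ t₂ : Fˣ} {a b : ℤ} (h1 : ‖(t₁ : F)‖ = 𝐪 ^ (-a)) (h2 : ‖(t₂ : F)‖ = 𝐪 ^ (-(a + b)))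
    (hk : 0 ≤ depth y a b) {X : ℂ} (hX : X = 𝐐 ^ (5 * s - 1)) :
    heckeConv μ (functionF ψ dr s) (functionP dr s) (xA y * torusElt t₁ t₂) =
      localZeta F (5 * s - 1) ^ 2 * localZeta F (10 * s - 4) /
      (localZeta F (5 * s - 1) * localZeta F (5 * s + 1) * localZeta F (5 * s - 2)) *
      (𝐐 ^ (-(5 * s))) ^ (a + b) * hecke 𝐐 (𝐐 ^ (-(5 * s))) (rootCount (charCoeff y t₁ t₂))
        (geomS X (depth y a b)) (geomS X (depth y a b + 1)) (geomS X (depth y a b - 1))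
        (∑ ρ : ResField F, geomS X (a + 1 - spread (y + t₁ ^ 2 / t₂ * lift ρ) (a - b + 1)))
        (geomS X (a - spread y (a - b - 1)))
        (∑ ρ : ResField F, geomS X (a - spread (y + t₁ ^ 2 / t₂ * lift ρ) (a - b + 1)))
        (geomS X (a - 1 - spread y (a - b - 1))) := by
  have hq := q_pos hV
  have hQ := q_ne_zero hV
  have hY := q_cpow_ne_zero hV (-(5 * s))
  obtain ⟨ϖ', hϖ'⟩ := hV.1
  have hϖ0 : ϖ' ≠ 0 := norm_pos_iff.1 (by rw [hϖ']; positivity)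
  obtain ⟨ϖ, hϖ⟩ : ∃ ϖ : Fˣ, ‖(ϖ : F)‖ = 𝐪⁻¹ := ⟨Units.mk0 ϖ' hϖ0, hϖ'⟩
  have hc := norm_charCoeff_le hV h1 h2 hk
  have hF : ∀ (y' : F) (a' b' : ℤ), functionF ψ dr s
      (xA y' * torusElt (t₁ * ϖ ^ a') (t₂ * ϖ ^ (a' + b'))) =
      localZeta F (5 * s - 1) ^ 2 * localZeta F (10 * s - 4) *
        (𝐐 ^ (-(5 * s))) ^ (a + b + (a' + b')) *
        geomS X (a + a' - spread y' (a - b + (a' - b'))) := by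
    intro y' a' b'
    rw [functionF_exponents hV hdr hψ hs y' (a := a + a') (b := b + b'), ← hX,
      ← depth, depth_eq, show a + a' - (b + b') = a - b + (a' - b') by ring,
      show a + a' + (b + b') = a + b + (a' + b') by ring]
    · rw [Units.val_mul, norm_mul, h1, norm_unit_zpow hϖ, ← zpow_add₀ hq.ne']; congr 1; ring
    · rw [Units.val_mul, norm_mul, h2, norm_unit_zpow hϖ, ← zpow_add₀ hq.ne']; congr 1; ring
  have hF0 : functionF ψ dr s (xA y * torusElt t₁ t₂) = localZeta F (5 * s - 1) ^ 2 *
      localZeta F (10 * s - 4) * (𝐐 ^ (-(5 * s))) ^ (a + b) * geomS X (depth y a b) := by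
    rw [functionF_exponents hV hdr hψ hs y h1 h2, ← hX, ← depth]
  have hball := integral_ball_equivariant hV hdr hμ hϖ hψ hc
    (Φ := fun x => functionF ψ dr s (xA y * torusElt t₁ t₂ * x))
    ((functionF_rightK ψ s).comp_mul_left _) fun r x => by
      rw [← mul_assoc, torus_mul_uElt, mul_assoc, functionF_uElt_mul, splitChar_conj]
  simp only [torus_mul_torusPow,
    torus_mul_torusPow_mul_xA _ _ t₁ t₂ ϖ (show (1 : ℤ) - 0 = 1 by norm_num),
    torus_mul_torusPow_mul_xA _ _ t₁ t₂ ϖ (show (0 : ℤ) - -1 = 1 by norm_num),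
    hF, mul_one, hF0, ← Finset.mul_sum] at hball
  rw [heckeConv_eq hV hh2 hdr hψ s _ hμ, hball, hF0, Complex.ofReal_natCast]
  have hP : 𝐐 ^ (2 - 5 * s) = 𝐐 ^ 2 * 𝐐 ^ (-(5 * s)) := by
    rw [show 2 - 5 * s = -(5 * s) + ((2 : ℤ) : ℂ) by push_cast; ring, cpow_q_add_int hV,
      mul_comm]
    norm_cast
  simp only [hP, polyP₀, polyP₁, hecke, depth_eq]
  have hz : ∀ n : ℤ, (𝐐 ^ (-(5 * s))) ^ (a + b + n) =
    (𝐐 ^ (-(5 * s))) ^ (a + b) * (𝐐 ^ (-(5 * s))) ^ n := fun n => zpow_add₀ hY _ _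
  simp only [hz]
  norm_num
  rw [show a + 1 - spread y (a - b) = a - spread y (a - b) + 1 by ring,
    show a + -1 - spread y (a - b) = a - spread y (a - b) - 1 by ring,
    show a - b + -1 = a - b - 1 by ring, show a + -1 = a - 1 by ring]
  generalize 𝐐 ^ (-(5 * s)) = Y at *
  rw [div_mul_eq_mul_div, div_mul_eq_mul_div]
  congr 1
  generalize Y ^ (a + b) = Z
  generalize localZeta F (5 * s - 1) ^ 2 * localZeta F (10 * s - 4) = C
  field_simp

theorem heckeConv_of_depth_neg (hμ : μ (maxCompact F) = 1) (s : ℂ)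
    {y : F} {t₁ t₂ : Fˣ} {a b : ℤ} (h1 : ‖(t₁ : F)‖ = 𝐪 ^ (-a)) (h2 : ‖(t₂ : F)‖ = 𝐪 ^ (-(a + b)))
    (hk : depth y a b < 0) :
    heckeConv μ (functionF ψ dr s) (functionP dr s) (xA y * torusElt t₁ t₂) = 0 :=
  eq_zero_of_depth_neg hV hh2 hψ
    (fun _ hk g => heckeConv_mul_K hV hh2 hdr hψ hμ s g hk)
    (fun r g => heckeConv_uElt_mul hV hh2 hdr hψ s r g) h1 h2 hk

theorem heckeConv_off [Fintype (ResField F)] (hμ : μ (maxCompact F) = 1) {s : ℂ} (hs : 1 < s.re)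
    {y : F} {t₁ t₂ : Fˣ} {a b : ℤ} (h1 : ‖(t₁ : F)‖ = 𝐪 ^ (-a)) (h2 : ‖(t₂ : F)‖ = 𝐪 ^ (-(a + b)))
    (hy : logA y (a - b) ≠ 0) (hy' : logA (1 + y) (a - b) ≠ 0) :
    heckeConv μ (functionF ψ dr s) (functionP dr s) (xA y * torusElt t₁ t₂) = 0 := by
  have hq := q_pos hV
  have hq1 := one_lt_q hV
  have hQ := q_ne_zero hV
  have hY := q_cpow_ne_zero hV (-(5 * s))
  rcases lt_or_ge (depth y a b) 0 with hk | hk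
  · exact heckeConv_of_depth_neg hV hh2 hdr hψ hμ s h1 h2 hk
  have hτ := norm_rootA hV h1 h2
  have n1 := logA_nonneg hV y (a - b)
  have n2 := logA_nonneg hV (1 + y) (a - b)
  have hd := depth_eq y a b
  have hd' : depth y a b = a - logA y (a - b) - logA (1 + y) (a - b) := rfl
  have hr := norm_rootsU hV h1 h2
  have c0 : ‖charCoeff y t₁ t₂ 0‖ = 𝐪 ^ (-depth y a b) := by
    change ‖y * (1 + y) * rootsU t₁ t₂ 0‖ = _
    rw [norm_mul, norm_mul, norm_eq_zpow_logA hV hy, norm_eq_zpow_logA hV hy', hr,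
      ← zpow_add₀ hq.ne', ← zpow_add₀ hq.ne']
    congr 1
    simp only [rootsExp, Matrix.cons_val]
    rw [hd']; ring
  have c1 : ‖charCoeff y t₁ t₂ 1‖ < 1 := by
    change ‖(1 + 2 * y) * rootsU t₁ t₂ 1‖ < 1
    have e : ‖1 + 2 * y‖ ≤ 𝐪 ^ (b - 1) := by
      rw [show 1 + 2 * y = y + (1 + y) by ring]
      exact norm_add_le_of_le' (norm_le_zpow_mono hV (norm_eq_zpow_logA hV hy).le (by omega))
        (norm_le_zpow_mono hV (norm_eq_zpow_logA hV hy').le (by omega))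
    have := norm_mul_le_zpow hV (k := -1) e (hr 1).le
      (by simp only [rootsExp, Matrix.cons_val]; omega)
    exact this.trans_lt (zpow_lt_one_of_neg₀ hq1 (by norm_num))
  have c2 : ‖charCoeff y t₁ t₂ 2‖ < 1 := by
    change ‖rootsU t₁ t₂ 2‖ < 1
    rw [hr]
    refine zpow_lt_one_of_neg₀ hq1 ?_
    simp only [rootsExp, Matrix.cons_val]
    omega
  rw [heckeConv_torus hV hh2 hdr hψ hμ hs h1 h2 hk (cpow_X hV s).symm]
  have hX : (𝐐 * 𝐐 ^ (-(5 * s)))⁻¹ ≠ 0 := inv_ne_zero (mul_ne_zero hQ hY)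
  have e1 : ∀ ρ : ResField F, spread (y + t₁ ^ 2 / t₂ * lift ρ) (a - b + 1) = spread y (a - b) + 2 :=
    fun ρ => spread_add_lift hV hτ hy hy' ρ
  simp only [e1, spread_sub_one hV hy hy', Finset.sum_const,
    Finset.card_univ, card_resField, nsmul_eq_mul,
    show a + 1 - (spread y (a - b) + 2) = depth y a b - 1 by omega,
    show a - (spread y (a - b) - 2) = depth y a b + 2 by omega,
    show a - (spread y (a - b) + 2) = depth y a b - 2 by omega,
    show a - 1 - (spread y (a - b) - 2) = depth y a b + 1 by omega]
  rcases hk.eq_or_lt with h0 | hpos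
  · rw [← h0, neg_zero, zpow_zero] at c0
    rw [rootCount_const c0 c1 c2, ← h0, geomS_of_neg _ (k := 0 - 1) (by norm_num),
      geomS_of_neg _ (k := 0 - 2) (by norm_num), show (0 : ℤ) + 2 = 0 + 1 + 1 by norm_num,
      geomS_succ _ (by norm_num : (0 : ℤ) ≤ 0 + 1), geomS_succ _ le_rfl, geomS_zero]
    have := hecke_off_zero hQ hY
    rw [Nat.cast_zero, mul_zero]
    norm_num at this ⊢
    exact Or.inr this
  · rw [rootCount_of_lt (c0 ▸ zpow_lt_one_of_neg₀ hq1 (by omega)) c1 c2]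
    obtain ⟨W, -, e1, e2, e3, e4⟩ := geomS_near hX hpos
    rw [e1, e2, e3, e4, hecke_off hQ hY, mul_zero]

theorem heckeConv_torusElt [Fintype (ResField F)] (hμ : μ (maxCompact F) = 1) {s : ℂ}
    (hs : 1 < s.re) {t₁ t₂ : Fˣ} {a b : ℤ} (h1 : ‖(t₁ : F)‖ = 𝐪 ^ (-a))
    (h2 : ‖(t₂ : F)‖ = 𝐪 ^ (-(a + b))) (ha : 0 ≤ a) (hb : 0 ≤ b) :
    heckeConv μ (functionF ψ dr s) (functionP dr s) (torusElt t₁ t₂) = toralValue F s t₁ t₂ := by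
  have hq := q_pos hV
  have hq1 := one_lt_q hV
  have hQ := q_ne_zero hV
  have hY := q_cpow_ne_zero hV (-(5 * s))
  have hX : (𝐐 * 𝐐 ^ (-(5 * s)))⁻¹ ≠ 0 := inv_ne_zero (mul_ne_zero hQ hY)
  have hτ := norm_rootA hV h1 h2
  have hr := norm_rootsU hV h1 h2
  have c0 : ‖charCoeff 0 t₁ t₂ 0‖ < 1 := by
    change ‖0 * (1 + 0) * rootsU t₁ t₂ 0‖ < 1
    simp
  have c1 : ‖charCoeff 0 t₁ t₂ 1‖ = 𝐪 ^ (-b) := by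
    change ‖(1 + 2 * 0) * rootsU t₁ t₂ 1‖ = _
    rw [mul_zero, add_zero, one_mul, hr]
    simp only [rootsExp, Matrix.cons_val]
  have c2 : ‖charCoeff 0 t₁ t₂ 2‖ = 𝐪 ^ (-a) := by
    change ‖rootsU t₁ t₂ 2‖ = _
    rw [hr]
    simp only [rootsExp, Matrix.cons_val]
  have hlt : ∀ {n : ℤ}, 0 < n → 𝐪 ^ (-n) < 1 := fun hn => zpow_lt_one_of_neg₀ hq1 (by omega)
  have hd : depth (0 : F) a b = min a b := by
    rw [depth_eq]
    rcases le_total b a with h | h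
    · rw [spread_zero_of_nonneg hV (by omega)]; omega
    · rw [spread_zero_of_nonpos hV (by omega)]; omega
  have hm : ∀ m : ℤ, geomS (𝐐 * 𝐐 ^ (-(5 * s)))⁻¹ (0 - m) = if 0 < m then 0 else
      geomS (𝐐 * 𝐐 ^ (-(5 * s)))⁻¹ (0 - m) := fun m => by
    split_ifs with h
    · exact geomS_of_neg _ (by omega)
    · rfl
  have hz := zeta_factor hV hs
  have hfin : ∀ (n : ℤ) (P A H : ℂ), H = P * ((1 - 𝐐 * 𝐐 ^ (-(5 * s))) *
      (1 + 𝐐 ^ 2 * 𝐐 ^ (-(5 * s)))) * ((𝐐 * 𝐐 ^ (-(5 * s)))⁻¹) ^ n →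
      A = P / localZeta F (5 * s + 1) * ((𝐐 ^ (-(5 * s))) ^ (a + b) *
        ((𝐐 * 𝐐 ^ (-(5 * s)))⁻¹) ^ n) →
      localZeta F (5 * s - 1) ^ 2 * localZeta F (10 * s - 4) /
      (localZeta F (5 * s - 1) * localZeta F (5 * s + 1) * localZeta F (5 * s - 2)) *
      (𝐐 ^ (-(5 * s))) ^ (a + b) * H = A := by
    intro n P A H hH hA
    rw [hA, hH, div_eq_mul_inv P, ← hz]
    ring
  have hE : ∀ n m : ℤ, (𝐐 ^ (-(5 * s))) ^ (n + m) * ((𝐐 * 𝐐 ^ (-(5 * s)))⁻¹) ^ n =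
      (𝐐 ^ n)⁻¹ * (𝐐 ^ (-(5 * s))) ^ m := fun n m => by
    rw [zpow_add₀ hY, _root_.inv_zpow, mul_zpow]
    have := zpow_ne_zero n hY
    have := zpow_ne_zero n hQ
    field_simp
  rw [← one_mul (torusElt t₁ t₂), ← xA_zero, heckeConv_torus hV hh2 hdr hψ hμ hs h1 h2
    (by omega) (cpow_X hV s).symm, hd, toralValue_eq hV h1 h2]
  simp only [zero_add]
  rcases lt_trichotomy b a with h | h | h
  · rw [if_pos h]
    refine hfin b (1 + 𝐐 * 𝐐 ^ (-(5 * s))) _ _ ?_ (by rw [add_comm a b, hE])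
    have es := spread_lift_pos (e := a - b) hV hτ (by omega)
    have s1 : ∀ n : ℤ, ∑ ρ : ResField F, geomS (𝐐 * 𝐐 ^ (-(5 * s)))⁻¹
        (n - spread (t₁ ^ 2 / t₂ * lift ρ) (a - b + 1)) =
        geomS (𝐐 * 𝐐 ^ (-(5 * s)))⁻¹ (n - (a - b + 1)) +
          (𝐐 - 1) * geomS (𝐐 * 𝐐 ^ (-(5 * s)))⁻¹ (n - (a - b + 2)) := fun n =>
      sum_resField_two (by rw [es, if_pos rfl]) fun ρ hρ => by rw [es, if_neg hρ]
    rw [s1, s1, spread_zero_of_nonneg hV (by omega), min_eq_right h.le,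
      show a + 1 - (a - b + 1) = b by ring, show a - (a - b + 1) = b - 1 by ring,
      show a + 1 - (a - b + 2) = b - 1 by ring, show a - (a - b + 2) = b - 2 by ring,
      show a - (a - b - 1) = b + 1 by ring, show a - 1 - (a - b - 1) = b by ring]
    rcases hb.eq_or_lt with rfl | hpos
    · rw [rootCount_linear c0 (by simpa using c1) (c2 ▸ hlt (by omega)), geomS_succ _ le_rfl,
        hm 1, hm 2, geomS_zero]
      simpa using hecke_pos_zero hQ hY
    · rw [rootCount_of_lt c0 (c1 ▸ hlt hpos) (c2 ▸ hlt (by omega))]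
      obtain ⟨W, e0, e1, -, e3, e4⟩ := geomS_near hX hpos
      rw [e0, e1, e3, e4, hecke_pos hQ hY]
  · subst h
    have hτ1 : ‖(t₁ : F) ^ 2 / t₂‖ = 1 := by rw [hτ]; simp
    rw [if_neg (lt_irrefl _), if_neg (lt_irrefl _)]
    refine hfin b (1 + 2 * (𝐐 * 𝐐 ^ (-(5 * s)))) _ _ ?_ (by rw [hE])
    have es := spread_lift_unit hV hτ1
    have hτ0 : (t₁ : F) ^ 2 / t₂ ≠ 0 := norm_pos_iff.1 (by rw [hτ1]; exact one_pos)
    have s1 : ∀ n : ℤ, ∑ ρ : ResField F, geomS (𝐐 * 𝐐 ^ (-(5 * s)))⁻¹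
        (n - spread (t₁ ^ 2 / t₂ * lift ρ) (b - b + 1)) =
        2 * geomS (𝐐 * 𝐐 ^ (-(5 * s)))⁻¹ (n - 1) +
          (𝐐 - 2) * geomS (𝐐 * 𝐐 ^ (-(5 * s)))⁻¹ (n - 2) := fun n => by
      rw [sub_self, zero_add]
      exact sum_resField_three (red_ne_zero (by rw [norm_neg, norm_inv, hτ1, inv_one]))
        (by rw [es, if_pos (Or.inl rfl)]) (by rw [es, if_pos (Or.inr rfl)])
        fun ρ h0 h1 => by rw [es, if_neg (by tauto)]
    rw [s1, s1, spread_zero_of_nonpos hV (by omega), min_self, sub_zero, sub_zero,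
      show b + 1 - 1 = b by ring, show b + 1 - 2 = b - 1 by ring]
    rcases hb.eq_or_lt with rfl | hpos
    · rw [rootCount_product c0 (by simpa using c1) (by simpa using c2), geomS_succ _ le_rfl,
        hm 1, hm 2, geomS_zero]
      simpa using hecke_diag_zero hQ hY
    · rw [rootCount_of_lt c0 (c1 ▸ hlt hpos) (c2 ▸ hlt hpos)]
      obtain ⟨W, e0, e1, -, e3, e4⟩ := geomS_near hX hpos
      rw [e0, e1, e3, e4, hecke_diag hQ hY]
  · rw [if_neg h.le.not_gt, if_pos h]
    refine hfin a (1 + 𝐐 * 𝐐 ^ (-(5 * s))) _ _ ?_ (by rw [hE])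
    have es := spread_lift_neg (e := a - b) hV hτ (by omega)
    have s1 : ∀ n : ℤ, ∑ ρ : ResField F, geomS (𝐐 * 𝐐 ^ (-(5 * s)))⁻¹
        (n - spread (t₁ ^ 2 / t₂ * lift ρ) (a - b + 1)) =
        geomS (𝐐 * 𝐐 ^ (-(5 * s)))⁻¹ n +
          (𝐐 - 1) * geomS (𝐐 * 𝐐 ^ (-(5 * s)))⁻¹ (n - 2) := fun n =>
      sum_resField_two (by rw [es, if_pos rfl, sub_zero]) fun ρ hρ => by rw [es, if_neg hρ]
    rw [s1, s1, spread_zero_of_nonpos hV (by omega), min_eq_left h.le, sub_zero, sub_zero,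
      show a + 1 - 2 = a - 1 by ring]
    rcases ha.eq_or_lt with rfl | hpos
    · rw [rootCount_square c0 (c1 ▸ hlt h) (by simpa using c2), geomS_succ _ le_rfl,
        hm 1, hm 2, geomS_zero]
      simpa using hecke_neg_zero hQ hY
    · rw [rootCount_of_lt c0 (c1 ▸ hlt (by omega)) (c2 ▸ hlt hpos)]
      obtain ⟨W, e0, e1, -, e3, e4⟩ := geomS_near hX hpos
      rw [e0, e1, e3, e4, hecke_neg hQ hY]

theorem functionF_symS_mul {s : ℂ} (hs : 1 < s.re) (g : G2 F) :
    functionF ψ dr s (symS F * g) = functionF ψ dr s g := by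
  obtain ⟨r, y, t₁, t₂, k, hk, rfl⟩ := iwasawa g
  obtain ⟨a, b, h1, h2⟩ := exists_exponents hV t₁ t₂
  have h2' : ‖((-1 * t₂ : Fˣ) : F)‖ = 𝐪 ^ (-(a + b)) := by simpa using h2
  have e : symS F * (uElt r * xA y * torusElt t₁ t₂ * k) =
      uElt (conjS r) * (xA (-1 - y) * torusElt t₁ (-1 * t₂)) * k := by
    rw [mul_assoc (uElt r), ← mul_assoc (symS F), ← mul_assoc (symS F), symS_mul_uElt,
      mul_assoc (uElt (conjS r)), ← mul_assoc (symS F), symS_mul_xA, mul_assoc (xA (-1 - y)),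
      torusElt_mul, one_mul]
  have hl : ∀ x : F, ∀ e, logA (-x) e = logA x e := fun x e => by rw [logA, logA, norm_neg]
  rw [e, functionF_mul_K _ _ _ hk, functionF_mul_K _ _ _ hk, mul_assoc, functionF_uElt_mul,
    functionF_uElt_mul, functionF_exponents hV hdr hψ hs _ h1 h2',
    functionF_exponents hV hdr hψ hs _ h1 h2, show -1 - y = -(1 + y) by ring, hl,
    show 1 + -(1 + y) = -y by ring, hl, sub_right_comm]
  congr 1
  rw [splitChar, splitChar]
  congr 2
  simp only [conjS, Matrix.cons_val]
  ring

theorem heckeConv_symS_mul {s : ℂ} (hs : 1 < s.re) (g : G2 F) :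
    heckeConv μ (functionF ψ dr s) (functionP dr s) (symS F * g) =
      heckeConv μ (functionF ψ dr s) (functionP dr s) g := by
  simp only [heckeConv, mul_assoc (symS F), functionF_symS_mul hV hh2 hdr hψ hs]

end

end ConvolutionTorus

section FourierTransform

/-! ## Growth on `U` -/

theorem norm_uElt_le (r : Fin 5 → F) (i : Fin 4) : ‖r i.castSucc‖ ≤ gn (uElt r) := by
  have h := fun i => norm_apply_le_gn (uElt r) i 7
  simp only [← act_bas, act_uElt, bas7] at h
  have h0 := norm_apply_le_gn (uElt r) 5 6
  simp only [← act_bas, act_uElt, bas6] at h0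
  have h1 := h 5
  have h2 := h 3
  have h3 := h 2
  simp only [Matrix.cons_val, mul_zero, mul_one, add_zero, zero_add, sub_zero, zero_sub,
    norm_neg] at h0 h1 h2 h3
  fin_cases i <;> assumption

theorem norm_uElt_four_le (r : Fin 5 → F) : ‖r 4‖ ≤ gn (uElt r) ^ 2 := by
  have h := norm_apply_le_gn (uElt r) 0 6
  rw [← act_bas, act_uElt, bas6] at h
  simp only [Matrix.cons_val, mul_zero, mul_one, add_zero, zero_add, sub_zero] at h
  have h1 := norm_uElt_le r 1
  have h2 := norm_uElt_le r 2
  have h3 := one_le_gn (uElt r)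
  have e : r 4 = (r 4 + r 1 * r 2) - r 1 * r 2 := by ring
  rw [e]
  refine norm_sub_le_of_le' (h.trans (le_self_pow₀ h3 two_ne_zero)) ?_
  rw [norm_mul, sq]
  exact mul_le_mul h1 h2 (norm_nonneg _) (by positivity)

theorem prod_max_one_le (r : Fin 5 → F) : ∏ i, max 1 ‖r i‖ ≤ gn (uElt r) ^ 6 := by
  have h3 := one_le_gn (uElt r)
  have h := fun i => max_le h3 (norm_uElt_le r i)
  have h4 : max 1 ‖r 4‖ ≤ gn (uElt r) ^ 2 := max_le (one_le_pow₀ h3) (norm_uElt_four_le r)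
  rw [Fin.prod_univ_castSucc]
  calc _ ≤ (∏ _ : Fin 4, gn (uElt r)) * gn (uElt r) ^ 2 :=
        mul_le_mul (Finset.prod_le_prod (fun _ _ => by positivity) fun i _ => h i) h4
          (by positivity) (by positivity)
    _ = _ := by rw [Finset.prod_const, Finset.card_univ, Fintype.card_fin]; ring

theorem hasSum_geometric_tail {K : Type*} [NormedField K] {z : K} (hz : ‖z‖ < 1) (m : ℕ) :
    HasSum (fun n : ℕ => if m ≤ n then z ^ n else 0) (z ^ m * (1 - z)⁻¹) := by
  have h := (hasSum_geometric_of_norm_lt_one hz).mul_left (z ^ m)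
  rw [← hasSum_nat_add_iff' m, Finset.sum_eq_zero fun i hi => if_neg (by simpa using hi), sub_zero]
  have e : (fun n => if m ≤ n + m then z ^ (n + m) else 0) = fun n => z ^ m * z ^ n := by
    ext n
    rw [if_pos (by omega), pow_add, mul_comm]
  rwa [e]

theorem gn_eq_pow (hV : IsNormalizedNorm F) (g : G2 F) : ∃ n : ℕ, gn g = 𝐪 ^ n := by
  obtain ⟨i, j, h⟩ := gn_attained g
  obtain ⟨n, hn⟩ := norm_eq_zpow hV (x := g.1.1 i j) (norm_pos_iff.1 (h ▸ gn_pos g))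
  have h1 := one_le_gn g
  rw [← h, hn] at h1
  have h2 : 0 ≤ n := by
    by_contra! hlt
    exact absurd h1 (not_le.2 (zpow_lt_one_of_neg₀ (one_lt_q hV) hlt))
  lift n to ℕ using h2
  exact ⟨n, by rw [← h, hn, zpow_natCast]⟩

theorem mul_uElt_gn_le (g : G2 F) (r : Fin 5 → F) : gn (uElt r) ≤ gn (uElt r * g) * gn g := by
  have := gn_mul_le (uElt r * g) g⁻¹
  rwa [mul_inv_cancel_right, gn_inv] at this

theorem norm_ofReal_cpow {x : ℝ} (hx : 0 < x) (z : ℂ) : ‖((x⁻¹ : ℝ) : ℂ) ^ z‖ = x ^ (-z.re) := by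
  rw [Complex.norm_cpow_eq_rpow_re_of_pos (inv_pos.2 hx), Real.inv_rpow hx.le, Real.rpow_neg hx.le]

theorem integrable_gn_rpow (hV : IsNormalizedNorm F) (hdr : dr (Metric.closedBall 0 1) = 1)
    {w : ℝ} (hw : 6 < w) (g : G2 F) :
    Integrable (fun r : Fin 5 → F => gn (uElt r * g) ^ (-w)) (𝛑 dr) := by
  have h0 : Integrable (fun r : Fin 5 → F => ∏ i, (max 1 ‖r i‖) ^ (-(w / 6)))
      (𝛑 dr) :=
    Integrable.fintype_prod fun _ => integrable_max_one_norm_rpow hV hdr (by linarith)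
  have hcont : Continuous fun r : Fin 5 → F => gn (uElt r * g) ^ (-w) :=
    (continuous_gn.comp (continuous_uElt.mul continuous_const)).rpow_const
      fun r => Or.inl (gn_pos _).ne'
  refine (h0.const_mul (gn g ^ w)).mono' hcont.aestronglyMeasurable
    (.of_forall fun r => ?_)
  have p1 := gn_pos (uElt r * g)
  have p2 := gn_pos g
  have p3 := gn_pos (uElt r)
  rw [Real.norm_of_nonneg (by positivity),
    Real.finsetProd_rpow _ _ fun i _ => le_max_of_le_left zero_le_one]
  have e1 : (∏ i, max 1 ‖r i‖) ^ (w / 6) ≤ (gn (uElt r * g) * gn g) ^ w := by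
    calc _ ≤ (gn (uElt r) ^ 6) ^ (w / 6) :=
          Real.rpow_le_rpow (Finset.prod_nonneg fun _ _ => by positivity) (prod_max_one_le r)
            (by linarith)
      _ = gn (uElt r) ^ w := by
          rw [← Real.rpow_natCast, ← Real.rpow_mul p3.le]; congr 1; push_cast; ring
      _ ≤ _ := Real.rpow_le_rpow p3.le (mul_uElt_gn_le g r) (by linarith)
  have hp : 0 < ∏ i, max 1 ‖r i‖ := Finset.prod_pos fun _ _ => by positivity
  rw [Real.mul_rpow p1.le p2.le] at e1
  rw [Real.rpow_neg p1.le, Real.rpow_neg hp.le, ← div_eq_mul_inv, le_div_iff₀ (by positivity),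
    inv_mul_le_iff₀ (by positivity)]
  exact e1

/-- The Fourier coefficient of the characteristic function of a ball. -/
def ballCoeff (ψ : AddChar F Circle) (dr : Measure F) (g : G2 F) (c : ℝ) : ℂ :=
  ∫ r : Fin 5 → F, (if gn (uElt r * g) ≤ c then star (splitChar ψ r) else 0)
    ∂𝛑 dr

theorem norm_star_splitChar (ψ : AddChar F Circle) (r : Fin 5 → F) :
    ‖star (splitChar ψ r)‖ = 1 := by rw [norm_star, splitChar, norm_AddChar]

theorem continuous_splitChar {ψ : AddChar F Circle} (hψ : Unramified ψ) :
    Continuous (splitChar ψ) :=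
  hψ.continuous_coe.comp ((continuous_apply 1).add (continuous_apply 2))

theorem continuous_functionD (hh2 : ‖(2 : F)‖ = 1) (s : ℂ) :
    Continuous (functionD s : G2 F → ℂ) := by
  have e : (functionD s : G2 F → ℂ) = fun g => (((gn g)⁻¹ : ℝ) : ℂ) ^ (5 * s + 1) :=
    funext (functionD_eq hh2 s)
  rw [e]
  refine Continuous.cpow ?_ continuous_const fun g => Or.inl ?_
  · exact Complex.continuous_ofReal.comp (continuous_gn.inv₀ fun g => (gn_pos _).ne')
  · rw [Complex.ofReal_re]; exact inv_pos.2 (gn_pos _)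

theorem continuous_functionD_mul (hh2 : ‖(2 : F)‖ = 1) {ψ : AddChar F Circle} (hψ : Unramified ψ)
    (s : ℂ) (g : G2 F) :
    Continuous fun r : Fin 5 → F => functionD s (uElt r * g) * star (splitChar ψ r) :=
  ((continuous_functionD hh2 s).comp (continuous_uElt.mul continuous_const)).mul
    (continuous_splitChar hψ).star

section

variable (hV : IsNormalizedNorm F) (hh2 : ‖(2 : F)‖ = 1) (hdr : dr (Metric.closedBall 0 1) = 1)
  {ψ : AddChar F Circle} (hψ : Unramified ψ) {s : ℂ} (hs : 1 < s.re)
include hV hh2 hdr hψ hs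

theorem integrable_functionD (g : G2 F) :
    Integrable (fun r : Fin 5 → F => functionD s (uElt r * g) * star (splitChar ψ r))
      (𝛑 dr) := by
  have hw : 6 < (5 * s + 1).re := by simp; linarith
  refine (integrable_gn_rpow hV hdr hw g).mono'
    (continuous_functionD_mul hh2 hψ s g).aestronglyMeasurable
    (.of_forall fun r => ?_)
  rw [norm_mul, norm_star_splitChar, mul_one, functionD_eq hh2, norm_ofReal_cpow (gn_pos _)]

theorem norm_cpow_q_lt_one : ‖𝐐 ^ (-(5 * s + 1))‖ < 1 := by
  have h : 𝐐 = ((𝐪 : ℝ) : ℂ) := by simp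
  rw [h, Complex.norm_cpow_eq_rpow_re_of_pos (q_pos hV)]
  refine Real.rpow_lt_one_of_one_lt_of_neg (one_lt_q hV) ?_
  simp; linarith

/-- The Fourier transform of `D` as a series of Fourier coefficients of balls. -/
theorem hasSum_fourierTransform (g : G2 F) :
    HasSum (fun n : ℕ => (1 - 𝐐 ^ (-(5 * s + 1))) * ((𝐐 ^ (-(5 * s + 1))) ^ n *
      ballCoeff ψ dr g (𝐪 ^ n))) (fourierTransform ψ dr (functionD s) g) := by
  have hlt := norm_cpow_q_lt_one hV hh2 hdr hψ hs
  have hq1 := one_lt_q hV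
  set Z := 𝐐 ^ (-(5 * s + 1)) with hZ
  have hZ1 : (1 - Z) ≠ 0 := sub_ne_zero.2 fun h => by rw [← h, norm_one] at hlt; exact lt_irrefl _ hlt
  have hgn : ∀ {m : ℕ} {x : G2 F}, gn x = 𝐪 ^ m → functionD s x = Z ^ m := by
    intro m x hx
    rw [functionD_eq hh2, hx, ← zpow_natCast, ← _root_.zpow_neg, cpow_zpow_q hV, hZ,
      Complex.cpow_neg, _root_.zpow_neg, zpow_natCast, inv_pow]
  have hle : ∀ {m n : ℕ} {x : G2 F}, gn x = 𝐪 ^ m → (gn x ≤ 𝐪 ^ n ↔ m ≤ n) := fun hx => by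
    rw [hx, pow_le_pow_iff_right₀ hq1]
  have key := hasSum_integral_of_dominated_convergence (μ := Measure.pi fun _ : Fin 5 => dr)
    (F := fun (n : ℕ) (r : Fin 5 → F) => (1 - Z) * (Z ^ n *
      (if gn (uElt r * g) ≤ 𝐪 ^ n then star (splitChar ψ r) else 0)))
    (f := fun r => functionD s (uElt r * g) * star (splitChar ψ r))
    (fun n r => ‖1 - Z‖ * (if gn (uElt r * g) ≤ 𝐪 ^ n then ‖Z‖ ^ n else 0)) ?_ ?_ ?_ ?_ ?_
  · simp only [integral_const_mul] at key
    exact key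
  · intro n
    refine Measurable.aestronglyMeasurable (Measurable.const_mul (Measurable.const_mul ?_ _) _)
    exact Measurable.ite (measurableSet_le (continuous_gn.comp
      (continuous_uElt.mul continuous_const)).measurable measurable_const)
      (continuous_splitChar hψ).star.measurable measurable_const
  · intro n
    refine .of_forall fun r => ?_
    rw [norm_mul, norm_mul, norm_pow]
    split_ifs
    · rw [norm_star_splitChar, mul_one]
    · simp
  · refine .of_forall fun r => ?_
    obtain ⟨m, hm⟩ := gn_eq_pow hV (uElt r * g)
    simp only [hle hm]
    have h := (hasSum_geometric_tail (z := ‖Z‖) (by rwa [norm_norm]) m).mul_left ‖1 - Z‖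
    exact h.summable
  · have e : ∀ r : Fin 5 → F, ∑' n : ℕ, ‖1 - Z‖ * (if gn (uElt r * g) ≤ 𝐪 ^ n then ‖Z‖ ^ n else 0) =
        ‖1 - Z‖ * (1 - ‖Z‖)⁻¹ * ‖functionD s (uElt r * g) * star (splitChar ψ r)‖ := by
      intro r
      obtain ⟨m, hm⟩ := gn_eq_pow hV (uElt r * g)
      simp only [hle hm]
      have h := (hasSum_geometric_tail (z := ‖Z‖) (by rwa [norm_norm]) m).mul_left ‖1 - Z‖
      rw [h.tsum_eq, norm_mul, norm_star_splitChar, hgn hm,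
        norm_pow]
      ring
    simp_rw [e]
    exact (integrable_functionD hV hh2 hdr hψ hs g).norm.const_mul _
  · refine .of_forall fun r => ?_
    obtain ⟨m, hm⟩ := gn_eq_pow hV (uElt r * g)
    have h := ((hasSum_geometric_tail hlt m).mul_left (1 - Z)).mul_right (star (splitChar ψ r))
    rw [mul_comm (Z ^ m), mul_inv_cancel_left₀ hZ1] at h
    rw [hgn hm]
    have e : (fun n : ℕ => (1 - Z) * (Z ^ n *
        (if gn (uElt r * g) ≤ 𝐪 ^ n then star (splitChar ψ r) else 0))) =
        fun n : ℕ => (1 - Z) * (if m ≤ n then Z ^ n else 0) * star (splitChar ψ r) := by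
      ext n
      simp only [hle hm]
      split_ifs <;> ring
    rw [e]
    exact h

end

end FourierTransform

section OmegaValues

/-- A character sum over the union of a quadratic cone and a plane. -/
theorem sum_quadratic_cone {k : Type*} [Field k] [Fintype k] {χ : AddChar k ℂ} (hχ : χ ≠ 1)
    {a b : k} (ha : a ≠ 0) (hb : b ≠ 0) :
    ∑ z : Fin 4 → k, (if z 0 * z 2 = 0 ∧ z 0 * z 3 = 0 ∧ z 2 ^ 2 = z 1 * z 3 then
      χ (a * z 1 + b * z 2) else 0) = Fintype.card k := by
  have hp : χ.IsPrimitive := AddChar.IsPrimitive.of_ne_one hχ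
  rw [← Finset.sum_filter, ← Finset.sum_filter_add_sum_filter_not _ fun z : Fin 4 → k => z 3 = 0]
  have hA : ∑ z ∈ (Finset.univ.filter fun z : Fin 4 → k => z 0 * z 2 = 0 ∧ z 0 * z 3 = 0 ∧
      z 2 ^ 2 = z 1 * z 3).filter (fun z => z 3 = 0), χ (a * z 1 + b * z 2) =
      ∑ p ∈ (Finset.univ : Finset k) ×ˢ (Finset.univ : Finset k), χ (p.2 * a) := by
    refine Finset.sum_bij' (fun z _ => (z 0, z 1)) (fun p _ => ![p.1, p.2, 0, 0]) ?_ ?_ ?_ ?_ ?_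
    · simp
    · simp
    · intro z hz
      simp only [Finset.mem_filter, Finset.mem_univ, true_and] at hz
      obtain ⟨⟨-, -, h3⟩, h0⟩ := hz
      have z2 : z 2 = 0 := by simpa [h0] using h3
      ext i; fin_cases i <;> simp [h0, z2]
    · simp
    · intro z hz
      simp only [Finset.mem_filter, Finset.mem_univ, true_and] at hz
      obtain ⟨⟨-, -, h3⟩, h0⟩ := hz
      have z2 : z 2 = 0 := by simpa [h0] using h3
      simp [z2, mul_comm]
  have hB : ∑ z ∈ (Finset.univ.filter fun z : Fin 4 → k => z 0 * z 2 = 0 ∧ z 0 * z 3 = 0 ∧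
      z 2 ^ 2 = z 1 * z 3).filter (fun z => ¬z 3 = 0), χ (a * z 1 + b * z 2) =
      ∑ p ∈ (Finset.univ : Finset k) ×ˢ (Finset.univ.filter fun x : k => ¬x = 0),
        χ (p.2 * (a * p.1 ^ 2 + b * p.1)) := by
    refine Finset.sum_bij' (fun z _ => (z 2 / z 3, z 3))
      (fun p _ => ![0, p.2 * p.1 ^ 2, p.2 * p.1, p.2]) ?_ ?_ ?_ ?_ ?_
    · intro z hz
      simp only [Finset.mem_filter, Finset.mem_univ, true_and] at hz
      simp [hz.2]
    · intro p hp
      simp only [Finset.mem_product, Finset.mem_filter, Finset.mem_univ, true_and] at hp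
      simp only [Finset.mem_filter, Finset.mem_univ, true_and, Matrix.cons_val]
      exact ⟨⟨by ring, by ring, by ring⟩, hp⟩
    · intro z hz
      simp only [Finset.mem_filter, Finset.mem_univ, true_and] at hz
      obtain ⟨⟨-, h2, h3⟩, h0⟩ := hz
      have z0 : z 0 = 0 := (mul_eq_zero.1 h2).resolve_right h0
      have e1 : z 1 = z 2 ^ 2 / z 3 := by field_simp; linear_combination -h3
      ext i; fin_cases i
      · simp [z0]
      · simp [e1]; field_simp
      · simp; field_simp
      · simp
    · intro p hp
      simp only [Finset.mem_product, Finset.mem_filter, Finset.mem_univ, true_and] at hp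
      ext <;> simp [hp]
    · intro z hz
      simp only [Finset.mem_filter, Finset.mem_univ, true_and] at hz
      obtain ⟨⟨-, h2, h3⟩, h0⟩ := hz
      have e1 : z 1 = z 2 ^ 2 / z 3 := by field_simp; linear_combination -h3
      congr 1
      rw [e1]
      field_simp
  have h0 : ∑ x : k, χ (x * a) = 0 := by rw [AddChar.sum_mulShift a hp, if_neg ha]; simp
  have hc : (Finset.univ.filter fun m : k => a * m ^ 2 + b * m = 0).card = 2 := by
    rw [Finset.card_eq_two]
    refine ⟨0, -b / a, (div_ne_zero (neg_ne_zero.2 hb) ha).symm, ?_⟩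
    ext m
    simp only [Finset.mem_filter, Finset.mem_univ, true_and, Finset.mem_insert,
      Finset.mem_singleton, eq_div_iff ha]
    rw [show a * m ^ 2 + b * m = m * (m * a - -b) by ring, mul_eq_zero, sub_eq_zero]
  rw [hA, hB, Finset.sum_product, Finset.sum_product]
  simp_rw [h0, sum_ne_zero_mulShift hp]
  rw [Finset.sum_sub_distrib, ← Finset.sum_filter, Finset.sum_const, Finset.sum_const, hc]
  simp only [nsmul_eq_mul, Finset.card_univ]
  simp
  ring

theorem Unramified.exists_apply_mul_ne_one {ψ : AddChar F Circle} (hψ : Unramified ψ)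
    (hV : IsNormalizedNorm F) {c : F} {n : ℤ} (hc : 𝐪 ^ (-n) < ‖c‖) :
    ∃ x, ‖x‖ ≤ 𝐪 ^ n ∧ ψ (c * x) ≠ 1 := by
  have hq := q_pos hV
  obtain ⟨ϖ, hϖ⟩ := hV.1
  have hn : ‖ϖ ^ (-n)‖ = 𝐪 ^ n := by
    rw [norm_zpow, hϖ, _root_.inv_zpow, _root_.zpow_neg, inv_inv]
  have h : ¬ ‖c * ϖ ^ (-n)‖ ≤ 1 := by
    rw [norm_mul, hn, not_le]
    rwa [_root_.zpow_neg, inv_lt_iff_one_lt_mul₀ (zpow_pos hq _)] at hc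
  rw [← hψ (c * ϖ ^ (-n))] at h
  push Not at h
  obtain ⟨y, hy, hne⟩ := h
  refine ⟨ϖ ^ (-n) * y, ?_, by rwa [← mul_assoc]⟩
  rw [norm_mul, hn]
  exact mul_le_of_le_one_right (zpow_pos hq _).le hy

theorem omegaSet_scale {N e : ℤ} {d : Fin 4 → F} (hd : ∀ i, ‖d i‖ = 1) (h1 : d 1 ^ 2 = d 0 * d 2)
    (h2 : d 0 * d 3 = d 1 * d 2) (h3 : d 2 ^ 2 = d 1 * d 3) (r : Fin 4 → F) :
    (fun i => d i * r i) ∈ omegaSet (F := F) N e ↔ r ∈ omegaSet (F := F) N e := by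
  simp only [omegaSet, Set.mem_ofPred_eq, norm_mul, hd, one_mul]
  have e1 : (d 1 * r 1) ^ 2 - d 0 * r 0 * (d 2 * r 2) = d 1 * d 1 * (r 1 ^ 2 - r 0 * r 2) := by
    linear_combination (r 0 * r 2) * h1
  have e2 : d 0 * r 0 * (d 3 * r 3) - d 1 * r 1 * (d 2 * r 2) =
      d 1 * d 2 * (r 0 * r 3 - r 1 * r 2) := by
    linear_combination (r 0 * r 3) * h2
  have e3 : (d 2 * r 2) ^ 2 - d 1 * r 1 * (d 3 * r 3) = d 2 * d 2 * (r 2 ^ 2 - r 1 * r 3) := by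
    linear_combination (r 1 * r 3) * h3
  rw [e1, e2, e3]
  simp only [norm_mul, hd, one_mul]

/-- The character of `F ^ 4` with coefficients `c`. -/
def linChar (ψ : AddChar F Circle) (c : Fin 3 → F) (r : Fin 4 → F) : ℂ :=
  ψ (c 0 * r 0 + c 1 * r 1 + c 2 * r 2)

theorem omegaInt_eq_setIntegral (ψ : AddChar F Circle) (N e : ℤ) (c : Fin 3 → F) :
    omegaInt dr ψ N e c = ∫ r in omegaSet (F := F) N e, linChar ψ c r ∂𝛑 dr := by
  rw [← integral_indicator (measurableSet_omegaSet N e)]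
  rfl

theorem setIntegral_eq_zero_of_translate {ψ : AddChar F Circle} {c : Fin 3 → F}
    {S : Set (Fin 4 → F)} (hS : MeasurableSet S) (i : Fin 3) {B : ℝ}
    (h : ∀ r ∈ S, ∀ x, ‖x‖ ≤ B → r + Pi.single i.castSucc x ∈ S)
    (hx : ∃ x, ‖x‖ ≤ B ∧ ψ (c i * x) ≠ 1) :
    ∫ r in S, linChar ψ c r ∂𝛑 dr = 0 := by
  obtain ⟨x, hx, hne⟩ := hx
  rw [← integral_indicator hS]
  refine integral_eq_zero_of_translate _ _ (Pi.single i.castSucc x) (ψ (c i * x) : ℂ)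
    (fun h1 => hne (Circle.ext h1)) fun r => ?_
  have hiff : r + Pi.single i.castSucc x ∈ S ↔ r ∈ S := by
    refine ⟨fun hr => ?_, fun hr => h r hr x hx⟩
    have := h _ hr (-x) (by rwa [norm_neg])
    rwa [Pi.single_neg, add_neg_cancel_right] at this
  simp only [Set.indicator_apply, hiff]
  split_ifs with hr
  · rw [linChar, linChar, ← AddChar_coe_add]
    congr 2
    fin_cases i <;> simp <;> ring
  · simp

theorem integrableOn_linChar (hV : IsNormalizedNorm F) (hdr : dr (Metric.closedBall 0 1) = 1)
    {ψ : AddChar F Circle} (hψ : Unramified ψ) (c : Fin 3 → F) {N e : ℤ} {S : Set (Fin 4 → F)}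
    (hS : S ⊆ omegaSet (F := F) N e) :
    IntegrableOn (linChar ψ c) S (𝛑 dr) := by
  have hcont : Continuous (linChar ψ c) := hψ.continuous_coe.comp (by fun_prop)
  have hb : S ⊆ (box fun i => 𝐪 ^ (![N + e, N, N, N] : Fin 4 → ℤ) i : Set (Fin 4 → F)) := by
    intro r hr
    obtain ⟨h0, h1, h2, h3, -⟩ := hS hr
    intro i
    fin_cases i <;> assumption
  refine Measure.integrableOn_of_bounded (M := 1) ?_ hcont.aestronglyMeasurable
    (.of_forall fun r => by rw [linChar, norm_AddChar])
  refine ((measure_mono hb).trans_lt ?_).ne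
  rw [volume_box hV hdr]
  exact ENNReal.ofReal_lt_top

/-- Vanishing by averaging over the torus elements congruent to `1` modulo `ϖ ^ (N - 1)`. -/
theorem setIntegral_eq_zero_of_scale (hV : IsNormalizedNorm F)
    (hdr : dr (Metric.closedBall 0 1) = 1) [Fintype (ResField F)] {ψ : AddChar F Circle}
    (hψ : Unramified ψ) {c : Fin 3 → F} {N e : ℤ} {S : Set (Fin 4 → F)} (hS : MeasurableSet S)
    (hSΩ : S ⊆ omegaSet (F := F) N e) {ϖ : F} (hϖ : ‖ϖ‖ = 𝐪⁻¹) {i : Fin 3} (hc : ‖c i‖ = 1)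
    (hi : ∀ r ∈ S, ‖r i.castSucc‖ = 𝐪 ^ N) (d : ResField F → Fin 4 → F)
    (hd : ∀ ρ j, ‖d ρ j‖ = 1) (hdS : ∀ ρ r, (fun j => d ρ j * r j) ∈ S ↔ r ∈ S)
    (hdc : ∀ ρ r, linChar ψ c (fun j => d ρ j * r j) =
      linChar ψ c r * ψ (c i * (ϖ ^ (N - 1) * lift ρ) * r i.castSucc)) :
    ∫ r in S, linChar ψ c r ∂𝛑 dr = 0 := by
  have hq := q_pos hV
  have hϖ0 : ϖ ≠ 0 := norm_pos_iff.1 (by rw [hϖ]; positivity)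
  set f : (Fin 4 → F) → ℂ := S.indicator (linChar ψ c) with hf
  have hint : Integrable f (𝛑 dr) :=
    (integrable_indicator_iff hS).2 (integrableOn_linChar hV hdr hψ c hSΩ)
  have hd0 : ∀ ρ j, d ρ j ≠ 0 := fun ρ j => norm_pos_iff.1 (by rw [hd]; exact one_pos)
  have h1 : ∀ ρ, ∫ r, f (fun j => d ρ j * r j) ∂𝛑 dr =
      ∫ r, f r ∂𝛑 dr := by
    intro ρ
    rw [integral_comp_pi_mul hV hdr (hd0 ρ)]
    simp [hd]
  have hfd : ∀ ρ r, f (fun j => d ρ j * r j) =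
      f r * ψ (c i * (ϖ ^ (N - 1) * lift ρ) * r i.castSucc) := by
    intro ρ r
    simp only [hf, Set.indicator_apply, hdS]
    split_ifs
    · exact hdc ρ r
    · simp
  have hsum : ∀ r : Fin 4 → F, ∑ ρ, f (fun j => d ρ j * r j) = 0 := by
    intro r
    simp only [hfd, ← Finset.mul_sum]
    by_cases hr : r ∈ S
    · have hw : ‖c i * ϖ ^ N * r i.castSucc‖ = 1 := by
        rw [norm_mul, norm_mul, hc, norm_zpow, hϖ, hi r hr, _root_.inv_zpow, one_mul,
          inv_mul_cancel₀ (zpow_pos hq _).ne']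
      have e : ∀ ρ : ResField F, (ψ (c i * (ϖ ^ (N - 1) * lift ρ) * r i.castSucc) : ℂ) =
          resChar hV hψ hϖ (ρ * red (c i * ϖ ^ N * r i.castSucc)) := by
        intro ρ
        conv_rhs => rw [← red_lift ρ]
        rw [← red_mul (norm_lift_le ρ) hw.le,
          resChar_red hV hψ hϖ (norm_le_one_mul (norm_lift_le ρ) hw.le), zpow_sub_one₀ hϖ0]
        congr 2; ring
      have hp := AddChar.IsPrimitive.of_ne_one (resChar_ne_one hV hψ hϖ)
      simp only [e]
      rw [AddChar.sum_mulShift _ hp, if_neg (red_ne_zero hw)]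
      simp
    · simp [hf, hr]
  have h2 : (Fintype.card (ResField F) : ℂ) * ∫ r, f r ∂𝛑 dr = 0 := by
    rw [← nsmul_eq_mul, ← Finset.card_univ, ← Finset.sum_const]
    rw [← Finset.sum_congr rfl fun ρ _ => h1 ρ, ← integral_finsetSum]
    · simp only [hsum, integral_zero]
    · intro ρ _
      simp only [hfd]
      refine hint.mul_bdd (c := 1) ?_ (.of_forall fun r => by rw [norm_AddChar])
      exact (hψ.continuous_coe.comp (by fun_prop)).aestronglyMeasurable
  rw [← integral_indicator hS]
  refine (mul_eq_zero.1 h2).resolve_left ?_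
  rw [card_resField]
  exact q_ne_zero hV

theorem omegaInt_eq_zero_of_lt (hV : IsNormalizedNorm F) {ψ : AddChar F Circle}
    (hψ : Unramified ψ) {c : Fin 3 → F} {N e : ℤ} (hN : 0 ≤ N) (hc : 𝐪 ^ (-e) < ‖c 0‖) :
    omegaInt dr ψ N e c = 0 := by
  rw [omegaInt_eq_setIntegral]
  refine setIntegral_eq_zero_of_translate (measurableSet_omegaSet N e) 0 (B := 𝐪 ^ e) ?_
    (hψ.exists_apply_mul_ne_one hV hc)
  rintro r ⟨h0, h1, h2, h3, h4, h5, h6⟩ x hx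
  have e0 : (r + Pi.single (0 : Fin 3).castSucc x : Fin 4 → F) 0 = r 0 + x := by simp
  have e1 : (r + Pi.single (0 : Fin 3).castSucc x : Fin 4 → F) 1 = r 1 := by simp
  have e2 : (r + Pi.single (0 : Fin 3).castSucc x : Fin 4 → F) 2 = r 2 := by simp
  have e3 : (r + Pi.single (0 : Fin 3).castSucc x : Fin 4 → F) 3 = r 3 := by simp
  simp only [omegaSet, Set.mem_ofPred_eq, e0, e1, e2, e3]
  refine ⟨norm_add_le_of_le' h0 (norm_le_zpow_mono hV hx (by omega)), h1, h2, h3, ?_, ?_, h6⟩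
  · rw [show r 1 ^ 2 - (r 0 + x) * r 2 = (r 1 ^ 2 - r 0 * r 2) - x * r 2 by ring]
    exact norm_sub_le_of_le' h4 (norm_mul_le_zpow hV hx h2 (by ring))
  · rw [show (r 0 + x) * r 3 - r 1 * r 2 = (r 0 * r 3 - r 1 * r 2) + x * r 3 by ring]
    exact norm_add_le_of_le' h5 (norm_mul_le_zpow hV hx h3 (by ring))

theorem omegaInt_zero (hV : IsNormalizedNorm F) (hdr : dr (Metric.closedBall 0 1) = 1)
    {ψ : AddChar F Circle} (hψ : Unramified ψ) {c : Fin 3 → F} {e : ℤ} (he : 0 ≤ e)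
    (h0 : c 0 = 0) (hc : ∀ i, ‖c i‖ ≤ 1) : omegaInt dr ψ 0 e c = 𝐐 ^ e := by
  have hq := q_pos hV
  have hbox : omegaSet (F := F) 0 e = box fun i => 𝐪 ^ (![e, 0, 0, 0] : Fin 4 → ℤ) i := by
    ext r
    simp only [omegaSet, box, Set.mem_ofPred_eq, zero_add]
    constructor
    · rintro ⟨h0, h1, h2, h3, -⟩ i
      fin_cases i <;> assumption
    · intro h
      have h0 := h 0
      have h1 := h 1
      have h2 := h 2
      have h3 := h 3
      simp only [Matrix.cons_val] at h0 h1 h2 h3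
      have m : ∀ {x y : F} {n : ℤ}, ‖x‖ ≤ 𝐪 ^ n → ‖y‖ ≤ 𝐪 ^ (0 : ℤ) → ‖x * y‖ ≤ 𝐪 ^ n :=
        fun hx hy => norm_mul_le_zpow hV hx hy (by ring)
      have u : ∀ {x : F}, ‖x‖ ≤ 𝐪 ^ (0 : ℤ) → ‖x‖ ≤ 𝐪 ^ e :=
        fun hx => norm_le_zpow_mono hV hx he
      refine ⟨h0, h1, h2, h3, ?_, ?_, ?_⟩
      · exact norm_sub_le_of_le' (by rw [sq]; exact u (m h1 h1)) (m h0 h2)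
      · exact norm_sub_le_of_le' (m h0 h3) (u (m h1 h2))
      · exact norm_sub_le_of_le' (by rw [sq]; exact m h2 h2) (m h1 h3)
  rw [omegaInt_eq_setIntegral]
  have h1 : Set.EqOn (linChar ψ c) (fun _ => 1) (omegaSet (F := F) 0 e) := by
    rintro r ⟨-, r1, r2, -⟩
    rw [zpow_zero] at r1 r2
    rw [linChar, h0, zero_mul, zero_add, hψ.eq_one, Circle.coe_one]
    exact norm_le_one_add (norm_le_one_mul (hc 1) r1) (norm_le_one_mul (hc 2) r2)
  rw [setIntegral_congr_fun (measurableSet_omegaSet 0 e) h1, setIntegral_const, hbox, Measure.real,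
    volume_box hV hdr, ENNReal.toReal_ofReal (Finset.prod_nonneg fun _ _ => by positivity),
    Fin.prod_univ_four]
  simp

theorem omegaInt_one_of_pos (hV : IsNormalizedNorm F) (hdr : dr (Metric.closedBall 0 1) = 1)
    {ψ : AddChar F Circle} (hψ : Unramified ψ) [Fintype (ResField F)] {c : Fin 3 → F} {e : ℤ}
    (he : 0 < e) (h0 : c 0 = 0) (h1 : ‖c 1‖ = 1) (h2 : ‖c 2‖ = 1) :
    omegaInt dr ψ 1 e c = 𝐐 ^ (e + 1) := by
  obtain ⟨ϖ, hϖ⟩ := hV.1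
  have hq := q_pos hV
  have hQ := q_ne_zero hV
  have hϖ0 : ϖ ≠ 0 := by rw [← norm_pos_iff, hϖ]; exact inv_pos.2 hq
  have hn : ‖ϖ⁻¹‖ = 𝐪 := by rw [norm_inv, hϖ, inv_inv]
  have hlin : ∀ (n : ℤ) (x : F), ‖ϖ ^ (-n) * x‖ ≤ 𝐪 ^ n ↔ ‖x‖ ≤ 1 := fun n x => by
    rw [norm_mul, norm_zpow, hϖ, _root_.inv_zpow, _root_.zpow_neg, inv_inv,
      mul_le_iff_le_one_right (zpow_pos hq _)]
  have hlt : ∀ (n : ℤ) (x : F), ‖ϖ ^ (-(n + 1)) * x‖ ≤ 𝐪 ^ n ↔ ‖x‖ < 1 := fun n x => by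
    have : ϖ ^ (-(n + 1)) * x = ϖ ^ (-n) * (ϖ⁻¹ * x) := by
      rw [_root_.zpow_neg, _root_.zpow_neg, zpow_add_one₀ hϖ0, _root_.mul_inv_rev]; ring
    rw [this, hlin, norm_scaled_le_one hV hϖ]
  set d : Fin 4 → F := ![ϖ ^ (-(1 + e)), ϖ ^ (-1 : ℤ), ϖ ^ (-1 : ℤ), ϖ ^ (-1 : ℤ)] with hd
  have hd0 : ∀ i, d i ≠ 0 := by intro i; fin_cases i <;> exact zpow_ne_zero _ hϖ0
  have hmem : ∀ x : Fin 4 → F, (fun i => d i * x i) ∈ omegaSet (F := F) 1 e ↔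
      (∀ i, ‖x i‖ ≤ 1) ∧ ‖x 0 * x 2‖ < 1 ∧ ‖x 0 * x 3‖ < 1 ∧ ‖x 2 ^ 2 - x 1 * x 3‖ < 1 := by
    intro x
    have hz : ∀ m n : ℤ, ϖ ^ (m + n) = ϖ ^ m * ϖ ^ n := fun m n => zpow_add₀ hϖ0 m n
    have q1 : ϖ ^ (-(1 + e)) * x 0 * (ϖ ^ (-1 : ℤ) * x 2) = ϖ ^ (-((1 + e) + 1)) * (x 0 * x 2) := by
      rw [show -((1 + e) + 1) = -(1 + e) + -1 by ring, hz]; ring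
    have q2 : ϖ ^ (-(1 + e)) * x 0 * (ϖ ^ (-1 : ℤ) * x 3) = ϖ ^ (-((1 + e) + 1)) * (x 0 * x 3) := by
      rw [show -((1 + e) + 1) = -(1 + e) + -1 by ring, hz]; ring
    have q3 : (ϖ ^ (-1 : ℤ) * x 2) ^ 2 - ϖ ^ (-1 : ℤ) * x 1 * (ϖ ^ (-1 : ℤ) * x 3) =
        ϖ ^ (-((1 : ℤ) + 1)) * (x 2 ^ 2 - x 1 * x 3) := by
      rw [show -((1 : ℤ) + 1) = -1 + -1 by ring, hz]; ring
    have small : ∀ {y z : F}, ‖y‖ ≤ 1 → ‖z‖ ≤ 1 →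
        ‖ϖ ^ (-1 : ℤ) * y * (ϖ ^ (-1 : ℤ) * z)‖ ≤ 𝐪 ^ (1 + e) := fun hy hz =>
      norm_le_zpow_mono hV (norm_mul_le_zpow hV ((hlin 1 _).2 hy) ((hlin 1 _).2 hz) rfl)
        (by omega)
    simp only [omegaSet, Set.mem_ofPred_eq, hd, Matrix.cons_val, q3, hlin, hlt]
    constructor
    · rintro ⟨a0, a1, a2, a3, a4, a5, a6⟩
      refine ⟨fun i => by fin_cases i <;> assumption, ?_, ?_, a6⟩
      · rwa [sq, norm_sub_rev, norm_sub_le_iff (small a1 a1), q1, hlt] at a4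
      · rwa [norm_sub_le_iff (small a1 a2), q2, hlt] at a5
    · rintro ⟨a, a4, a5, a6⟩
      refine ⟨a 0, a 1, a 2, a 3, ?_, ?_, a6⟩
      · rwa [sq, norm_sub_rev, norm_sub_le_iff (small (a 1) (a 1)), q1, hlt]
      · rwa [norm_sub_le_iff (small (a 1) (a 2)), q2, hlt]
  have h := integral_comp_pi_mul hV hdr hd0
    fun r => if r ∈ omegaSet (F := F) 1 e then
      (ψ (c 0 * r 0 + c 1 * r 1 + c 2 * r 2) : ℂ) else 0
  have hred := integral_eq_sum_residue hV hdr (n := 4)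
    (fun x => if (fun i => d i * x i) ∈ omegaSet (F := F) 1 e then
      (ψ (c 0 * (d 0 * x 0) + c 1 * (d 1 * x 1) + c 2 * (d 2 * x 2)) : ℂ) else 0)
  have hval : ∀ x : Fin 4 → F, (∀ i, ‖x i‖ ≤ 1) →
      (if (fun i => d i * x i) ∈ omegaSet (F := F) 1 e then
      (ψ (c 0 * (d 0 * x 0) + c 1 * (d 1 * x 1) + c 2 * (d 2 * x 2)) : ℂ) else 0) =
      if red (x 0) * red (x 2) = 0 ∧ red (x 0) * red (x 3) = 0 ∧
        red (x 2) ^ 2 = red (x 1) * red (x 3) then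
      resChar hV hψ hϖ (red (c 1) * red (x 1) + red (c 2) * red (x 2)) else 0 := by
    intro x hx
    have hp : ∀ i j, ‖x i * x j‖ ≤ 1 := fun i j => norm_le_one_mul (hx i) (hx j)
    have hp2 : ∀ i, ‖x i ^ 2‖ ≤ 1 := fun i => norm_le_one_pow (hx i) 2
    have c1 : ‖c 1 * x 1‖ ≤ 1 := norm_le_one_mul h1.le (hx 1)
    have c2 : ‖c 2 * x 2‖ ≤ 1 := norm_le_one_mul h2.le (hx 2)
    have e3 : red (x 2) ^ 2 = red (x 1) * red (x 3) ↔ ‖x 2 ^ 2 - x 1 * x 3‖ < 1 := by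
      rw [← red_eq_red_iff (hp2 _) (hp _ _), red_mul (hx _) (hx _), sq (x 2),
        red_mul (hx _) (hx _), sq]
    rw [e3, ← red_mul (hx _) (hx _), ← red_mul (hx _) (hx _), red_eq_zero_iff (hp _ _),
      red_eq_zero_iff (hp _ _), ← red_mul h1.le (hx _), ← red_mul h2.le (hx _), ← red_add c1 c2,
      resChar_red hV hψ hϖ (norm_le_one_add c1 c2)]
    refine if_congr ?_ ?_ rfl
    · rw [hmem]; exact ⟨fun h => h.2, fun h => ⟨hx, h⟩⟩
    · congr 2
      simp only [hd, Matrix.cons_val, h0, _root_.zpow_neg_one]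
      ring
  rw [hred] at h
  · simp_rw [hval _ fun i => norm_lift_le _, red_lift] at h
    rw [sum_quadratic_cone (resChar_ne_one hV hψ hϖ) (red_ne_zero h1) (red_ne_zero h2),
      card_resField, Complex.ofReal_natCast] at h
    have h4 : ((∏ i : Fin 4, ‖d i‖⁻¹ : ℝ) : ℂ) = (𝐐 ^ 4)⁻¹ * (𝐐 ^ e)⁻¹ := by
      have hdn : ∀ n : ℤ, ‖ϖ ^ (-n)‖ = 𝐪 ^ n := fun n => by
        rw [norm_zpow, hϖ, _root_.inv_zpow, _root_.zpow_neg, inv_inv]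
      rw [Fin.prod_univ_four]
      change ((‖ϖ ^ (-(1 + e))‖⁻¹ * ‖ϖ ^ (-1 : ℤ)‖⁻¹ * ‖ϖ ^ (-1 : ℤ)‖⁻¹ * ‖ϖ ^ (-1 : ℤ)‖⁻¹ : ℝ) : ℂ)
        = _
      rw [hdn, hdn, zpow_add₀ hq.ne', zpow_one]
      push_cast
      field_simp
    rw [h4] at h
    have h5 := zpow_ne_zero e hQ
    have h6 : 𝐐 = (𝐐 ^ e)⁻¹ * omegaInt dr ψ 1 e c := by
      apply mul_left_cancel₀ (inv_ne_zero (pow_ne_zero 4 hQ))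
      rw [h, mul_assoc]; rfl
    rw [zpow_add_one₀ hQ, eq_inv_mul_iff_mul_eq₀ h5 |>.1 h6]
  · rintro r ⟨i, hi⟩
    rw [if_neg]
    rw [hmem]
    exact fun hh => hi.not_ge (hh.1 i)
  · intro r v hr hv
    have hrv : ∀ i, ‖(r + v) i‖ ≤ 1 := fun i => norm_le_one_add (hr i) (hv i).le
    rw [hval _ hrv, hval _ hr]
    have : ∀ i, red ((r + v) i) = red (r i) := fun i => by
      rw [red_eq_red_iff (hrv i) (hr i)]
      simpa using hv i
    simp only [this]

theorem omegaInt_two_le (hV : IsNormalizedNorm F) (hdr : dr (Metric.closedBall 0 1) = 1)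
    {ψ : AddChar F Circle} (hψ : Unramified ψ) [Fintype (ResField F)] {c : Fin 3 → F} {N e : ℤ}
    (hN : 2 ≤ N) (he : 0 ≤ e) (h0 : c 0 = 0) (h1 : ‖c 1‖ = 1) (h2 : ‖c 2‖ = 1) :
    omegaInt dr ψ N e c = 0 := by
  obtain ⟨ϖ, hϖ⟩ := hV.1
  have hq := q_pos hV
  have hq1 := one_lt_q hV
  set Ω := omegaSet (F := F) N e with hΩ
  have hΩm : MeasurableSet Ω := measurableSet_omegaSet N e
  set T : Fin 4 → Set (Fin 4 → F) := fun i => {r | ‖r i‖ ≤ 𝐪 ^ (N - 1)} with hT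
  have hTm : ∀ i, MeasurableSet (T i) := fun i =>
    (isClosed_le (continuous_apply i).norm continuous_const).measurableSet
  have hTn : ∀ {i} {r : Fin 4 → F}, ‖r i‖ ≤ 𝐪 ^ N → r ∉ T i → ‖r i‖ = 𝐪 ^ N := fun h h' => by
    refine h.antisymm (not_lt.1 fun hlt => h' ?_)
    exact (norm_lt_zpow_iff hV).1 hlt
  have hsplit : ∀ {S : Set (Fin 4 → F)}, S ⊆ Ω → ∀ i,
      ∫ r in S ∩ T i, linChar ψ c r ∂𝛑 dr +
      ∫ r in S \ T i, linChar ψ c r ∂𝛑 dr =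
      ∫ r in S, linChar ψ c r ∂𝛑 dr := fun hS i =>
    integral_inter_add_sdiff (hTm i) (integrableOn_linChar hV hdr hψ c hS)
  -- the units by which the coordinates are scaled
  set m : ResField F → F := fun ρ => 1 + ϖ ^ (N - 1) * lift ρ with hm
  have hm1 : ∀ ρ, ‖m ρ‖ = 1 := by
    intro ρ
    rw [hm, norm_add_eq_of_lt, norm_one]
    rw [norm_one]
    refine (norm_mul_lift_le (n := 𝐪 ^ (-(N - 1))) ?_ ρ).trans_lt
      (zpow_lt_one_of_neg₀ hq1 (by omega))
    rw [norm_zpow, hϖ, _root_.inv_zpow, _root_.zpow_neg]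
  have hm0 : ∀ ρ, m ρ ≠ 0 := fun ρ => norm_pos_iff.1 (by rw [hm1]; exact one_pos)
  have hmd : ∀ ρ (j : Fin 4), ‖(![(m ρ)⁻¹, 1, m ρ, m ρ ^ 2] : Fin 4 → F) j‖ = 1 := by
    intro ρ j
    fin_cases j <;> simp [hm1]
  have hmd' : ∀ ρ (j : Fin 4), ‖(![m ρ ^ 2, m ρ, 1, (m ρ)⁻¹] : Fin 4 → F) j‖ = 1 := by
    intro ρ j
    fin_cases j <;> simp [hm1]
  have z2 : ∫ r in Ω \ T 2, linChar ψ c r ∂𝛑 dr = 0 := by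
    refine setIntegral_eq_zero_of_scale hV hdr hψ (hΩm.diff (hTm 2)) Set.diff_subset hϖ (i := 2)
      h2 (fun r hr => hTn hr.1.2.2.1 hr.2) (fun ρ => ![(m ρ)⁻¹, 1, m ρ, m ρ ^ 2]) hmd ?_ ?_
    · intro ρ r
      have := hm0 ρ
      refine and_congr (omegaSet_scale (hmd ρ) ?_ ?_ ?_ r) (not_congr ?_)
      · simp only [Matrix.cons_val]; field_simp
      · simp only [Matrix.cons_val]; field_simp
      · simp only [Matrix.cons_val]; ring
      · simp only [hT, Set.mem_ofPred_eq, norm_mul, hmd, one_mul]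
    · intro ρ r
      rw [linChar, linChar, ← AddChar_coe_add]
      congr 2
      simp only [Matrix.cons_val, h0, hm]
      change _ = 0 * r 0 + c 1 * r 1 + c 2 * r 2 + c 2 * (ϖ ^ (N - 1) * lift ρ) * r 2
      ring
  have z1 : ∫ r in (Ω ∩ T 2) \ T 1, linChar ψ c r ∂𝛑 dr = 0 := by
    refine setIntegral_eq_zero_of_scale hV hdr hψ ((hΩm.inter (hTm 2)).diff (hTm 1))
      (Set.diff_subset.trans Set.inter_subset_left) hϖ (i := 1)
      h1 (fun r hr => hTn hr.1.1.2.1 hr.2) (fun ρ => ![m ρ ^ 2, m ρ, 1, (m ρ)⁻¹]) hmd' ?_ ?_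
    · intro ρ r
      have := hm0 ρ
      refine and_congr (and_congr (omegaSet_scale (hmd' ρ) ?_ ?_ ?_ r) ?_) (not_congr ?_)
      · simp only [Matrix.cons_val]; ring
      · simp only [Matrix.cons_val]; field_simp
      · simp only [Matrix.cons_val]; field_simp
      · simp only [hT, Set.mem_ofPred_eq, norm_mul, hmd', one_mul]
      · simp only [hT, Set.mem_ofPred_eq, norm_mul, hmd', one_mul]
    · intro ρ r
      rw [linChar, linChar, ← AddChar_coe_add]
      congr 2
      simp only [Matrix.cons_val, h0, hm]
      change _ = 0 * r 0 + c 1 * r 1 + c 2 * r 2 + c 1 * (ϖ ^ (N - 1) * lift ρ) * r 1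
      ring
  have hW : Ω ∩ T 2 ∩ T 1 ⊆ Ω := Set.inter_subset_left.trans Set.inter_subset_left
  have hWm : MeasurableSet (Ω ∩ T 2 ∩ T 1) := (hΩm.inter (hTm 2)).inter (hTm 1)
  have hlt : 𝐪 ^ (-1 : ℤ) < 1 := zpow_lt_one_of_neg₀ hq1 (by norm_num)
  have z3 : ∫ r in (Ω ∩ T 2 ∩ T 1) ∩ T 3, linChar ψ c r ∂𝛑 dr = 0 := by
    refine setIntegral_eq_zero_of_translate (hWm.inter (hTm 3)) 1 (B := 𝐪 ^ (1 : ℤ)) ?_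
      (hψ.exists_apply_mul_ne_one hV (by rwa [h1]))
    rintro r ⟨⟨⟨⟨a0, a1, a2, a3, a4, a5, a6⟩, (b2 : ‖r 2‖ ≤ _)⟩, (b1 : ‖r 1‖ ≤ _)⟩,
      (b3 : ‖r 3‖ ≤ _)⟩ x hx
    have e0 : (r + Pi.single (1 : Fin 3).castSucc x : Fin 4 → F) 0 = r 0 := by simp
    have e1 : (r + Pi.single (1 : Fin 3).castSucc x : Fin 4 → F) 1 = r 1 + x := by simp
    have e2 : (r + Pi.single (1 : Fin 3).castSucc x : Fin 4 → F) 2 = r 2 := by simp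
    have e3 : (r + Pi.single (1 : Fin 3).castSucc x : Fin 4 → F) 3 = r 3 := by simp
    have b1' : ‖r 1 + x‖ ≤ 𝐪 ^ (N - 1) :=
      norm_add_le_of_le' b1 (norm_le_zpow_mono hV hx (by omega))
    simp only [hΩ, hT, omegaSet, Set.mem_inter_iff, Set.mem_ofPred_eq, e0, e1, e2, e3]
    refine ⟨⟨⟨⟨a0, norm_le_zpow_mono hV b1' (by omega), a2, a3, ?_, ?_, ?_⟩, b2⟩, b1'⟩, b3⟩
    · rw [show (r 1 + x) ^ 2 - r 0 * r 2 = (r 1 ^ 2 - r 0 * r 2) + (r 1 + (r 1 + x)) * x by ring]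
      exact norm_add_le_of_le' a4 (norm_le_zpow_mono hV
        (norm_mul_le_zpow hV (norm_add_le_of_le' b1 b1') hx rfl) (by omega))
    · rw [show r 0 * r 3 - (r 1 + x) * r 2 = (r 0 * r 3 - r 1 * r 2) - x * r 2 by ring]
      exact norm_sub_le_of_le' a5 (norm_le_zpow_mono hV
        (norm_mul_le_zpow hV hx b2 rfl) (by omega))
    · rw [show r 2 ^ 2 - (r 1 + x) * r 3 = (r 2 ^ 2 - r 1 * r 3) - x * r 3 by ring]
      exact norm_sub_le_of_le' a6 (norm_le_zpow_mono hV
        (norm_mul_le_zpow hV hx b3 rfl) (by omega))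
  have z4 : ∫ r in (Ω ∩ T 2 ∩ T 1) \ T 3, linChar ψ c r ∂𝛑 dr = 0 := by
    refine setIntegral_eq_zero_of_translate (hWm.diff (hTm 3)) 2 (B := 𝐪 ^ (1 : ℤ)) ?_
      (hψ.exists_apply_mul_ne_one hV (by rwa [h2]))
    rintro r ⟨⟨⟨⟨a0, a1, a2, a3, a4, a5, a6⟩, (b2 : ‖r 2‖ ≤ _)⟩, (b1 : ‖r 1‖ ≤ _)⟩, b3⟩ x hx
    have n3 := hTn a3 b3
    have n0 : ‖r 0‖ ≤ 𝐪 ^ (N + e - 1) := by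
      have : ‖r 0 * r 3‖ ≤ 𝐪 ^ (N + e - 1 + N) := by
        rw [show r 0 * r 3 = (r 0 * r 3 - r 1 * r 2) + r 1 * r 2 by ring]
        exact norm_add_le_of_le' (norm_le_zpow_mono hV a5 (by omega)) (norm_le_zpow_mono hV
          (norm_mul_le_zpow hV b1 b2 rfl) (by omega))
      rwa [norm_mul, n3, zpow_add₀ hq.ne' _ N, mul_le_mul_iff_left₀ (zpow_pos hq _)] at this
    have e0 : (r + Pi.single (2 : Fin 3).castSucc x : Fin 4 → F) 0 = r 0 := by simp
    have e1 : (r + Pi.single (2 : Fin 3).castSucc x : Fin 4 → F) 1 = r 1 := by simp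
    have e2 : (r + Pi.single (2 : Fin 3).castSucc x : Fin 4 → F) 2 = r 2 + x := by simp
    have e3 : (r + Pi.single (2 : Fin 3).castSucc x : Fin 4 → F) 3 = r 3 := by simp
    have b2' : ‖r 2 + x‖ ≤ 𝐪 ^ (N - 1) :=
      norm_add_le_of_le' b2 (norm_le_zpow_mono hV hx (by omega))
    change _ ∧ ¬ _
    simp only [hΩ, hT, omegaSet, Set.mem_inter_iff, Set.mem_ofPred_eq, e0, e1, e2, e3]
    refine ⟨⟨⟨⟨a0, a1, norm_le_zpow_mono hV b2' (by omega), a3, ?_, ?_, ?_⟩, b2'⟩, b1⟩, b3⟩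
    · rw [show r 1 ^ 2 - r 0 * (r 2 + x) = (r 1 ^ 2 - r 0 * r 2) - r 0 * x by ring]
      exact norm_sub_le_of_le' a4 (norm_mul_le_zpow hV n0 hx (by ring))
    · rw [show r 0 * r 3 - r 1 * (r 2 + x) = (r 0 * r 3 - r 1 * r 2) - r 1 * x by ring]
      exact norm_sub_le_of_le' a5 (norm_le_zpow_mono hV
        (norm_mul_le_zpow hV b1 hx rfl) (by omega))
    · rw [show (r 2 + x) ^ 2 - r 1 * r 3 = (r 2 ^ 2 - r 1 * r 3) + (r 2 + (r 2 + x)) * x by ring]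
      exact norm_add_le_of_le' a6 (norm_mul_le_zpow hV (norm_add_le_of_le' b2 b2') hx (by ring))
  rw [omegaInt_eq_setIntegral, ← hsplit subset_rfl 2, z2, add_zero,
    ← hsplit Set.inter_subset_left 1, z1, add_zero, ← hsplit hW 3, z3, z4, add_zero]

end OmegaValues

section FourierSymmetries

theorem star_addChar (ψ : AddChar F Circle) (x : F) : star (ψ x : ℂ) = ψ (-x) := by
  rw [AddChar.map_neg_eq_inv, Circle.coe_inv_eq_conj]
  rfl

theorem splitChar_mulU (ψ : AddChar F Circle) (r s : Fin 5 → F) :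
    splitChar ψ (mulU r s) = splitChar ψ r * splitChar ψ s := by
  rw [splitChar, splitChar, splitChar, ← AddChar_coe_add]
  congr 2
  simp only [mulU, Matrix.cons_val]
  ring

theorem splitChar_conjS (ψ : AddChar F Circle) (r : Fin 5 → F) :
    splitChar ψ (conjS r) = splitChar ψ r := by
  rw [splitChar, splitChar]
  congr 2
  simp only [conjS, Matrix.cons_val]
  ring

theorem splitChar_conjW (ψ : AddChar F Circle) (r : Fin 5 → F) :
    splitChar ψ (conjW r) = splitChar ψ r := by
  rw [splitChar, splitChar]
  congr 2
  simp only [conjW, Matrix.cons_val]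
  ring

theorem splitChar_mul_star (ψ : AddChar F Circle) (r : Fin 5 → F) :
    splitChar ψ r * star (splitChar ψ r) = 1 := by
  rw [splitChar, star_addChar, ← AddChar_coe_add, add_neg_cancel, AddChar.map_zero_eq_one,
    Circle.coe_one]

theorem integral_comp_mulU {f : (Fin 5 → F) → ℂ} (hf : Measurable f) (s : Fin 5 → F) :
    ∫ r, f (mulU r s) ∂𝛑 dr = ∫ r, f r ∂𝛑 dr := by
  rw [← integral_comp_triangular (fun i (r : Fin 5 → F) => (![s 0, s 1, s 2, s 3,
    s 4 - 3 * r 2 * s 1 + r 3 * s 0] : Fin 5 → F) i) (hf := hf)]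
  · congr 1
    ext r
    congr 1
    ext i
    fin_cases i <;> simp only [mulU, Fin.zero_eta, Fin.mk_one, Fin.reduceFinMk, Matrix.cons_val] <;>
      ring

theorem integral_comp_conjA {f : (Fin 5 → F) → ℂ} (hf : Measurable f) (y : F) :
    ∫ r, f (conjA y r) ∂𝛑 dr = ∫ r, f r ∂𝛑 dr := by
  rw [← integral_comp_triangular (fun i (r : Fin 5 → F) => (![0, y * r 0,
    2 * y * r 1 + y ^ 2 * r 0, 3 * y * r 2 + 3 * y ^ 2 * r 1 + y ^ 3 * r 0,
    -3 * y * r 1 ^ 2 - 3 * y ^ 2 * r 0 * r 1 - y ^ 3 * r 0 ^ 2] : Fin 5 → F) i) (hf := hf)]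
  · congr 1
    ext r
    congr 1
    ext i
    fin_cases i <;> simp [conjA]

theorem integral_comp_conjS (hV : IsNormalizedNorm F) (hdr : dr (Metric.closedBall 0 1) = 1)
    {f : (Fin 5 → F) → ℂ} (hf : Measurable f) :
    ∫ r, f (conjS r) ∂𝛑 dr = ∫ r, f r ∂𝛑 dr := by
  have hd : ∀ i, (![1, -1, 1, -1, -1] : Fin 5 → F) i ≠ 0 := by intro i; fin_cases i <;> simp
  have h1 := integral_comp_pi_mul (dr := dr) hV hdr hd f
  rw [show (∏ i, ‖(![1, -1, 1, -1, -1] : Fin 5 → F) i‖⁻¹) = 1 by simp [Fin.prod_univ_five],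
    Complex.ofReal_one, one_mul] at h1
  rw [← h1, ← integral_comp_triangular (fun i (r : Fin 5 → F) => (![0, r 0,
    2 * r 1 + r 0, 3 * r 2 + 3 * r 1 + r 0, -3 * r 1 ^ 2 - 3 * r 0 * r 1 - r 0 ^ 2] :
    Fin 5 → F) i) (f := fun r => f fun i => (![1, -1, 1, -1, -1] : Fin 5 → F) i * r i)]
  · congr 1
    ext r
    congr 1
    ext i
    fin_cases i <;> simp only [conjS, Fin.zero_eta, Fin.mk_one, Fin.reduceFinMk,
      Matrix.cons_val] <;> ring
  · exact hf.comp (by fun_prop)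

theorem integral_comp_perm {n : ℕ} (σ : Equiv.Perm (Fin n)) (f : (Fin n → F) → ℂ) :
    ∫ r, f (fun i => r (σ i)) ∂𝛑 dr = ∫ r, f r ∂𝛑 dr := by
  rw [← (measurePreserving_piCongrLeft (α := fun _ : Fin n => F) (fun _ => dr) σ.symm).integral_comp'
    f]
  congr 1
  ext r
  congr 1
  ext i
  have := MeasurableEquiv.piCongrLeft_apply_apply (β := fun _ : Fin n => F) σ.symm r (σ i)
  rw [Equiv.symm_apply_apply] at this
  exact this.symm

theorem integral_comp_conjW (hV : IsNormalizedNorm F) (hdr : dr (Metric.closedBall 0 1) = 1)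
    {f : (Fin 5 → F) → ℂ} (hf : Measurable f) :
    ∫ r, f (conjW r) ∂𝛑 dr = ∫ r, f r ∂𝛑 dr := by
  set σ : Equiv.Perm (Fin 5) := Equiv.swap 0 3 * Equiv.swap 1 2 with hσ
  have hσv : ∀ i, σ i = ![3, 2, 1, 0, 4] i := by decide
  have hd : ∀ i, (![1, 1, 1, 1, -1] : Fin 5 → F) i ≠ 0 := by intro i; fin_cases i <;> simp
  have h1 := integral_comp_pi_mul (dr := dr) hV hdr hd fun r => f fun i => r (σ i)
  rw [show (∏ i, ‖(![1, 1, 1, 1, -1] : Fin 5 → F) i‖⁻¹) = 1 by simp [Fin.prod_univ_five],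
    Complex.ofReal_one, one_mul] at h1
  rw [← integral_comp_perm σ f, ← h1, ← integral_comp_triangular (fun i (r : Fin 5 → F) =>
    (![0, 0, 0, 0, 3 * r 1 * r 2 - r 0 * r 3] : Fin 5 → F) i)
    (f := fun r => f fun i => (![1, 1, 1, 1, -1] : Fin 5 → F) (σ i) * r (σ i))]
  · congr 1
    ext r
    congr 1
    ext i
    rw [hσv]
    fin_cases i <;> simp only [conjW, Fin.zero_eta, Fin.mk_one, Fin.reduceFinMk,
      Matrix.cons_val] <;> ring
  · exact hf.comp (by fun_prop)

theorem fourierTransform_mul_K (hh2 : ‖(2 : F)‖ = 1) (ψ : AddChar F Circle) (s : ℂ) :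
    RightK (fourierTransform ψ dr (functionD (F := F) s)) := fun k hk g => by
  simp only [fourierTransform, functionD_eq hh2, ← mul_assoc, gn_mul_K _ hk]

theorem fourierTransform_uElt_mul (hh2 : ‖(2 : F)‖ = 1) {ψ : AddChar F Circle} (hψ : Unramified ψ)
    (s : ℂ) (r : Fin 5 → F) (g : G2 F) :
    fourierTransform ψ dr (functionD s) (uElt r * g) =
      splitChar ψ r * fourierTransform ψ dr (functionD s) g := by
  have h := integral_comp_mulU (dr := dr) (continuous_functionD_mul hh2 hψ s g).measurable r
  refine Eq.trans ?_ (congrArg (splitChar ψ r * ·) h)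
  beta_reduce
  rw [← integral_const_mul]
  refine integral_congr_ae (.of_forall fun x => ?_)
  beta_reduce
  rw [← uElt_mul_uElt, mul_assoc, splitChar_mulU, star_mul', mul_left_comm (splitChar ψ r),
    mul_left_comm (splitChar ψ r), splitChar_mul_star, mul_one]

theorem fourierTransform_symS_mul (hV : IsNormalizedNorm F) (hh2 : ‖(2 : F)‖ = 1)
    (hdr : dr (Metric.closedBall 0 1) = 1) {ψ : AddChar F Circle} (hψ : Unramified ψ) (s : ℂ)
    (g : G2 F) :
    fourierTransform ψ dr (functionD s) (symS F * g) = fourierTransform ψ dr (functionD s) g := by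
  refine (integral_comp_conjS hV hdr
    (continuous_functionD_mul hh2 hψ s (symS F * g)).measurable).symm.trans ?_
  refine integral_congr_ae (.of_forall fun r => ?_)
  beta_reduce
  rw [← mul_assoc, ← symS_mul_uElt, splitChar_conjS, functionD_eq hh2, functionD_eq hh2, mul_assoc,
    gn_K_mul _ symS_mem_K]

theorem fourierTransform_symW_mul (hV : IsNormalizedNorm F) (hh2 : ‖(2 : F)‖ = 1)
    (hdr : dr (Metric.closedBall 0 1) = 1) {ψ : AddChar F Circle} (hψ : Unramified ψ) (s : ℂ)
    (g : G2 F) :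
    fourierTransform ψ dr (functionD s) (symW F * g) = fourierTransform ψ dr (functionD s) g := by
  refine (integral_comp_conjW hV hdr
    (continuous_functionD_mul hh2 hψ s (symW F * g)).measurable).symm.trans ?_
  refine integral_congr_ae (.of_forall fun r => ?_)
  beta_reduce
  rw [← mul_assoc, ← symW_mul_uElt, splitChar_conjW, functionD_eq hh2, functionD_eq hh2, mul_assoc,
    gn_K_mul _ symW_mem_K]

end FourierSymmetries

section FourierValues

theorem le_gn_uElt_mul_torusElt (r : Fin 5 → F) (t₁ t₂ : Fˣ) :
    ‖(t₁ : F)‖⁻¹ ≤ gn (uElt r * torusElt t₁ t₂) := by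
  have h := norm_apply_le_gn (uElt r * torusElt t₁ t₂) 7 7
  rw [← act_bas, act_mul, act_torusElt, act_uElt, bas7] at h
  simpa using h

theorem ballCoeff_xA_mul {ψ : AddChar F Circle} (hψ : Unramified ψ) {y : F} (hy : ‖y‖ ≤ 1)
    (g : G2 F) (c : ℝ) :
    ballCoeff ψ dr (xA y * g) c = ∫ r : Fin 5 → F, (if gn (uElt r * g) ≤ c then
      (ψ (![-(y * (1 + y)), -(1 + 2 * y), -1] 0 * r 0 + ![-(y * (1 + y)), -(1 + 2 * y), -1] 1 * r 1 +
        ![-(y * (1 + y)), -(1 + 2 * y), -1] 2 * r 2) : ℂ) else 0) ∂𝛑 dr := by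
  refine (integral_comp_conjA (f := fun r => if gn (uElt r * (xA y * g)) ≤ c then
    star (splitChar ψ r) else 0) ?_ y).symm.trans ?_
  rotate_left
  · refine integral_congr_ae (.of_forall fun r => ?_)
    beta_reduce
    rw [← mul_assoc, ← xA_mul_uElt, mul_assoc, gn_K_mul _ (xA_mem_K hy), splitChar, star_addChar]
    congr 4
    simp only [conjA, Matrix.cons_val]
    ring
  · exact Measurable.ite (measurableSet_le (continuous_gn.comp
      (continuous_uElt.mul continuous_const)).measurable measurable_const)
      (continuous_splitChar hψ).star.measurable measurable_const

section

variable (hV : IsNormalizedNorm F) (hh2 : ‖(2 : F)‖ = 1) (hdr : dr (Metric.closedBall 0 1) = 1)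
  {ψ : AddChar F Circle} (hψ : Unramified ψ)
include hV hh2 hdr hψ

theorem ballCoeff_of_le {y : F} (hy : ‖y‖ ≤ 1) {t₁ t₂ : Fˣ} {a b : ℤ}
    (h1 : ‖(t₁ : F)‖ = 𝐪 ^ (-a)) (h2 : ‖(t₂ : F)‖ = 𝐪 ^ (-(a + b))) (hab : b ≤ a) (hb : 0 ≤ b)
    {N : ℤ} (hN : 0 ≤ N) :
    ballCoeff ψ dr (xA y * torusElt t₁ t₂) (𝐪 ^ (a + N)) =
      𝐐 ^ N * omegaInt dr ψ N (a - b) ![-(y * (1 + y)), -(1 + 2 * y), -1] := by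
  rw [ballCoeff_xA_mul hψ hy, integral_ball_uElt hV hdr hψ h1 h2 hab hb hN, Complex.ofReal_natCast]

theorem ballCoeff_of_lt {y : F} (hy : ‖y‖ ≤ 1) {t₁ t₂ : Fˣ} {a : ℤ} (h1 : ‖(t₁ : F)‖ = 𝐪 ^ (-a))
    {n : ℤ} (hn : n < a) : ballCoeff ψ dr (xA y * torusElt t₁ t₂) (𝐪 ^ n) = 0 := by
  rw [ballCoeff_xA_mul hψ hy, integral_eq_zero_of_ae]
  refine .of_forall fun r => if_neg fun h => ?_
  have := (le_gn_uElt_mul_torusElt r t₁ t₂).trans h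
  rw [h1, _root_.zpow_neg, inv_inv, zpow_le_zpow_iff_right₀ (one_lt_q hV)] at this
  omega

variable {s : ℂ} (hs : 1 < s.re)
include hs

theorem fourierTransform_torusElt_of_le [Fintype (ResField F)] {t₁ t₂ : Fˣ} {a b : ℤ}
    (h1 : ‖(t₁ : F)‖ = 𝐪 ^ (-a)) (h2 : ‖(t₂ : F)‖ = 𝐪 ^ (-(a + b))) (hab : b ≤ a) (hb : 0 ≤ b) :
    fourierTransform ψ dr (functionD s) (torusElt t₁ t₂) = toralValue F s t₁ t₂ := by
  have hq := q_pos hV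
  have hQ := q_ne_zero hV
  have hq1 := one_lt_q hV
  have hτ := norm_rootA hV h1 h2
  have hZ : 𝐐 ^ (-(5 * s + 1)) = 𝐐⁻¹ * 𝐐 ^ (-(5 * s)) := by
    rw [show -(5 * s + 1) = -(5 * s) + ((-1 : ℤ) : ℂ) by push_cast; ring, cpow_q_add_int hV,
      _root_.zpow_neg_one, mul_comm]
  have hζ : (localZeta F (5 * s + 1))⁻¹ = 1 - 𝐐⁻¹ * 𝐐 ^ (-(5 * s)) := by
    rw [localZeta, inv_inv, hZ]
  have h := hasSum_fourierTransform hV hh2 hdr hψ hs (torusElt t₁ t₂)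
  have hball := fun {N : ℤ} (hN : 0 ≤ N) => ballCoeff_of_le (dr := dr) hV hh2 hdr hψ
    (y := 0) (by simp) h1 h2 hab hb hN
  have hlt := fun {n : ℤ} (hn : n < a) => ballCoeff_of_lt (dr := dr) (t₂ := t₂) hV hh2 hdr hψ
    (y := 0) (by simp) h1 hn
  rw [xA_zero, one_mul] at hball hlt
  simp only [zero_mul, neg_zero, mul_zero, add_zero] at hball
  set c : Fin 3 → F := ![0, -1, -1] with hc
  have c0 : c 0 = 0 := rfl
  have c1 : ‖c 1‖ = 1 := by simp [hc]
  have c2 : ‖c 2‖ = 1 := by simp [hc]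
  have hc1 : ∀ i, ‖c i‖ ≤ 1 := fun i => by
    fin_cases i
    · simp [hc]
    · exact c1.le
    · exact c2.le
  lift a to ℕ using hb.trans hab
  have h' := hasSum_sum_of_ne_finset_zero (L := SummationFilter.unconditional ℕ) (s := {a, a + 1})
    (f := fun n : ℕ => (1 - 𝐐 ^ (-(5 * s + 1))) * ((𝐐 ^ (-(5 * s + 1))) ^ n *
      ballCoeff ψ dr (torusElt t₁ t₂) (𝐪 ^ n))) fun n hn => by
    simp only [Finset.mem_insert, Finset.mem_singleton, not_or] at hn
    rcases lt_or_ge n a with hna | hna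
    · rw [← zpow_natCast 𝐪, hlt (by exact_mod_cast hna), mul_zero, mul_zero]
    · rw [← zpow_natCast 𝐪, show (n : ℤ) = (a : ℤ) + (n - a : ℤ) by ring, hball (by omega),
        omegaInt_two_le hV hdr hψ (by omega) (by omega) c0 c1 c2, mul_zero, mul_zero, mul_zero]
  rw [h.unique h', Finset.sum_pair (by omega)]
  have b0 : ballCoeff ψ dr (torusElt t₁ t₂) (𝐪 ^ a) = 𝐐 ^ ((a : ℤ) - b) := by
    rw [← zpow_natCast 𝐪, ← add_zero (a : ℤ), hball le_rfl, add_zero,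
      omegaInt_zero hV hdr hψ (by omega) c0 hc1, zpow_zero, one_mul]
  have b1 : ballCoeff ψ dr (torusElt t₁ t₂) (𝐪 ^ (a + 1)) = 𝐐 * omegaInt dr ψ 1 (a - b) c := by
    rw [← zpow_natCast 𝐪, Nat.cast_add, Nat.cast_one, hball zero_le_one, zpow_one]
  rw [b0, b1, hZ, toralValue_eq hV h1 h2, if_neg hab.not_gt]
  simp only [div_eq_mul_inv, hζ]
  rcases hab.lt_or_eq with hlt' | rfl
  · rw [if_pos hlt', omegaInt_one_of_pos hV hdr hψ (by omega) c0 c1 c2, zpow_add_one₀ hQ,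
      zpow_sub₀ hQ, zpow_natCast, zpow_natCast]
    generalize 𝐐 ^ (-(5 * s)) = Y
    have := zpow_ne_zero b hQ
    rw [mul_pow, mul_pow, pow_succ, pow_succ, inv_pow]
    field_simp
  · rw [if_neg (lt_irrefl _), sub_self, omegaInt_one_zero hV hdr hψ hc1,
      rootCount_product (by rw [c0, norm_zero]; exact one_pos) c1 c2,
      zpow_zero, zpow_natCast, zpow_natCast, Complex.ofReal_natCast]
    generalize 𝐐 ^ (-(5 * s)) = Y
    rw [mul_pow, mul_pow, pow_succ, pow_succ, inv_pow]
    push_cast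
    field_simp

theorem fourierTransform_torusElt [Fintype (ResField F)] {t₁ t₂ : Fˣ} {a b : ℤ}
    (h1 : ‖(t₁ : F)‖ = 𝐪 ^ (-a)) (h2 : ‖(t₂ : F)‖ = 𝐪 ^ (-(a + b))) (ha : 0 ≤ a) (hb : 0 ≤ b) :
    fourierTransform ψ dr (functionD s) (torusElt t₁ t₂) = toralValue F s t₁ t₂ := by
  rcases le_total b a with hab | hab
  · exact fourierTransform_torusElt_of_le hV hh2 hdr hψ hs h1 h2 hab hb
  have hq := q_pos hV
  have h1' : ‖((t₂ / t₁ : Fˣ) : F)‖ = 𝐪 ^ (-b) := by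
    rw [Units.val_div_eq_div_val, norm_div, h1, h2, ← zpow_sub₀ hq.ne']; congr 1; ring
  have h3 := fourierTransform_torusElt_of_le hV hh2 hdr hψ hs h1'
    (by rw [h2, add_comm]) hab ha
  rw [← fourierTransform_symW_mul hV hh2 hdr hψ, symW_mul_torusElt,
    fourierTransform_mul_K hh2 ψ s _ symW_mem_K, h3]
  rw [toralValue_eq hV h1' (by rw [h2, add_comm]), toralValue_eq hV h1 h2]
  rcases hab.lt_or_eq with h | rfl
  · rw [if_pos h, if_neg h.not_gt, if_pos h]
  · rfl

theorem fourierTransform_off_of_norm_le_one {y : F} (hy1 : ‖y‖ ≤ 1) {t₁ t₂ : Fˣ} {a b : ℤ}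
    (h1 : ‖(t₁ : F)‖ = 𝐪 ^ (-a)) (h2 : ‖(t₂ : F)‖ = 𝐪 ^ (-(a + b)))
    (hy : logA y (a - b) ≠ 0) (hy' : logA (1 + y) (a - b) ≠ 0) :
    fourierTransform ψ dr (functionD s) (xA y * torusElt t₁ t₂) = 0 := by
  rcases lt_or_ge (depth y a b) 0 with hk | hk
  · exact eq_zero_of_depth_neg hV hh2 hψ (fourierTransform_mul_K hh2 ψ s)
      (fourierTransform_uElt_mul hh2 hψ s) h1 h2 hk
  have hq := q_pos hV
  have hq1 := one_lt_q hV
  have n1 := logA_nonneg hV y (a - b)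
  have n2 := logA_nonneg hV (1 + y) (a - b)
  have y1 := norm_eq_zpow_logA hV hy
  have y2 := norm_eq_zpow_logA hV hy'
  have hle : ∀ n : ℤ, 𝐪 ^ n ≤ 1 → n ≤ 0 := fun n hn => by
    rwa [← zpow_zero 𝐪, zpow_le_zpow_iff_right₀ hq1] at hn
  have l1 := hle _ (y1 ▸ hy1)
  have l2 := hle _ (y2 ▸ norm_add_le_of_le' (norm_one.le) hy1)
  have l3 : logA y (a - b) = a - b ∨ logA (1 + y) (a - b) = a - b := by
    by_contra! hne
    have m1 : ‖y‖ < 1 := by rw [y1]; exact zpow_lt_one_of_neg₀ hq1 (by omega)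
    have m2 : ‖1 + y‖ < 1 := by rw [y2]; exact zpow_lt_one_of_neg₀ hq1 (by omega)
    have : ‖(1 : F)‖ < 1 := by
      rw [show (1 : F) = (1 + y) + -y by ring]
      exact (IsUltrametricDist.norm_add_le_max _ _).trans_lt (max_lt m2 (by rwa [norm_neg]))
    rw [norm_one] at this
    exact lt_irrefl _ this
  rw [depth] at hk
  have hc : 𝐪 ^ (-(a - b)) < ‖(![-(y * (1 + y)), -(1 + 2 * y), -1] : Fin 3 → F) 0‖ := by
    rw [Matrix.cons_val_zero, norm_neg, norm_mul, y1, y2, ← zpow_add₀ hq.ne']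
    exact (zpow_lt_zpow_iff_right₀ hq1).2 (by omega)
  refine (hasSum_fourierTransform hV hh2 hdr hψ hs _).unique ?_
  refine hasSum_zero.congr_fun fun n => ?_
  rcases lt_or_ge (n : ℤ) a with hna | hna
  · rw [← zpow_natCast 𝐪, ballCoeff_of_lt hV hh2 hdr hψ hy1 h1 hna, mul_zero, mul_zero]
  · rw [← zpow_natCast 𝐪, show (n : ℤ) = a + (n - a : ℤ) by ring,
      ballCoeff_of_le hV hh2 hdr hψ hy1 h1 h2 (by omega) (by omega) (by omega),
      omegaInt_eq_zero_of_lt hV hψ (by omega) hc, mul_zero, mul_zero, mul_zero]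

theorem fourierTransform_off {y : F} {t₁ t₂ : Fˣ} {a b : ℤ}
    (h1 : ‖(t₁ : F)‖ = 𝐪 ^ (-a)) (h2 : ‖(t₂ : F)‖ = 𝐪 ^ (-(a + b)))
    (hy : logA y (a - b) ≠ 0) (hy' : logA (1 + y) (a - b) ≠ 0) :
    fourierTransform ψ dr (functionD s) (xA y * torusElt t₁ t₂) = 0 := by
  rcases le_or_gt ‖y‖ 1 with hy1 | hy1
  · exact fourierTransform_off_of_norm_le_one hV hh2 hdr hψ hs hy1 h1 h2 hy hy'
  have hq := q_pos hV
  have hq1 := one_lt_q hV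
  have n1 := logA_nonneg hV y (a - b)
  obtain ⟨u, rfl⟩ : ∃ u : Fˣ, (u : F) = y :=
    ⟨Units.mk0 y (norm_pos_iff.1 (one_pos.trans hy1)), rfl⟩
  have y1 := norm_eq_zpow_logA hV hy
  set n := logA (u : F) (a - b) with hn
  have hlt : 0 < n - (a - b) := by
    by_contra! hle
    exact absurd (y1 ▸ hy1) (not_lt.2 (zpow_le_one_of_nonpos₀ hq1.le hle))
  have hu : ‖((u⁻¹ : Fˣ) : F)‖ = 𝐪 ^ (-(n - (a - b))) := by
    rw [Units.val_inv_eq_inv_val, norm_inv, y1, _root_.zpow_neg]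
  have hu1 : ‖((u⁻¹ : Fˣ) : F)‖ < 1 := by rw [hu]; exact zpow_lt_one_of_neg₀ hq1 (by omega)
  have hτ := norm_rootA hV h1 h2
  have hk : ‖(t₁ : F) ^ 2 / t₂ * ((u⁻¹ : Fˣ) : F)‖ ≤ 1 := by
    rw [norm_mul, hτ, hu, ← zpow_add₀ hq.ne']
    exact zpow_le_one_of_nonpos₀ hq1.le (by omega)
  have e : symW F * (xA (u : F) * torusElt t₁ t₂) =
      xA ((u⁻¹ : Fˣ) : F) * torusElt (u⁻¹ * t₁) (-1 * t₂) *
        xAneg ((t₁ : F) ^ 2 / t₂ * ((u⁻¹ : Fˣ) : F)) := by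
    rw [← mul_assoc, symW_mul_xA, mul_assoc (_ * _), ← torusElt_mul_xAneg, ← mul_assoc, mul_assoc
      (xA _), torusElt_mul]
  rw [← fourierTransform_symW_mul hV hh2 hdr hψ, e,
    fourierTransform_mul_K hh2 ψ s _ (xAneg_mem_K hk)]
  have hu2 : ‖1 + ((u⁻¹ : Fˣ) : F)‖ = 1 := by
    rw [norm_add_eq_of_lt (by rwa [norm_one]), norm_one]
  refine fourierTransform_off_of_norm_le_one hV hh2 hdr hψ hs hu1.le (a := b + n) (b := a - n)
    ?_ ?_ ?_ ?_
  · rw [Units.val_mul, norm_mul, hu, h1, ← zpow_add₀ hq.ne']; congr 1; ring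
  · rw [Units.val_mul, norm_mul, h2]
    simp only [Units.val_neg, Units.val_one, norm_neg, norm_one, one_mul]
    congr 1; ring
  · rw [Ne, logA_eq_zero_iff hV, hu, zpow_le_zpow_iff_right₀ hq1]; omega
  · rw [Ne, logA_eq_zero_iff hV, hu2, ← zpow_zero 𝐪, zpow_le_zpow_iff_right₀ hq1]; omega

end

end FourierValues

section Conclusion

theorem symS_mem_leviM : symS F ∈ leviM F :=
  mul_mem (Subgroup.subset_closure (Or.inr ⟨-1, Or.inl rfl⟩))
    (Subgroup.subset_closure (Or.inl ⟨1, -1, rfl⟩))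

theorem one_mem_splitStabilizer (ψ : AddChar F Circle) : (1 : G2 F) ∈ splitStabilizer ψ := by
  refine ⟨one_mem _, fun r r' h => ?_⟩
  rw [one_mul, inv_one, mul_one] at h
  rw [uElt_injective h]

theorem symS_inv_mem_splitStabilizer (ψ : AddChar F Circle) :
    (symS F)⁻¹ ∈ splitStabilizer ψ := by
  refine ⟨inv_mem symS_mem_leviM, fun r r' h => ?_⟩
  rw [inv_inv, mul_assoc, inv_mul_eq_iff_eq_mul, symS_mul_uElt, mul_left_inj] at h
  rw [uElt_injective h, splitChar_conjS]

theorem xA_mul_torusElt_of_logA (hV : IsNormalizedNorm F) {y : F} {t₁ t₂ : Fˣ} {a b : ℤ}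
    (h1 : ‖(t₁ : F)‖ = 𝐪 ^ (-a)) (h2 : ‖(t₂ : F)‖ = 𝐪 ^ (-(a + b))) (hy : logA y (a - b) = 0) :
    ∃ k ∈ groupK F, xA y * torusElt t₁ t₂ = torusElt t₁ t₂ * k := by
  have hq := q_pos hV
  refine ⟨xA (y / (t₁ ^ 2 / t₂)), xA_mem_K ?_, ?_⟩
  · rw [norm_div, norm_div, norm_pow, h1, h2, ← zpow_natCast, ← _root_.zpow_mul,
      ← zpow_sub₀ hq.ne', div_le_one (zpow_pos hq _)]
    rw [logA_eq_zero_iff hV] at hy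
    exact norm_le_zpow_mono hV hy (by push_cast; omega)
  · have := t₁.ne_zero; have := t₂.ne_zero
    rw [torusElt_mul_xA]
    congr 2
    field_simp

/-- Representatives of the double cosets `U \ G / K`: the group decomposes into `S_{Ψ_s} U T K` and
the elements away from it. -/
theorem exists_representative (hV : IsNormalizedNorm F) (g : G2 F) :
    (∃ m, (m = 1 ∨ m = (symS F)⁻¹) ∧ ∃ (r : Fin 5 → F) (t₁ t₂ : Fˣ), ∃ k ∈ groupK F,
      g = m * uElt r * torusElt t₁ t₂ * k) ∨
    ∃ (r : Fin 5 → F) (y : F) (t₁ t₂ : Fˣ), ∃ k ∈ groupK F, ∃ a b : ℤ,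
      ‖(t₁ : F)‖ = 𝐪 ^ (-a) ∧ ‖(t₂ : F)‖ = 𝐪 ^ (-(a + b)) ∧ logA y (a - b) ≠ 0 ∧
      logA (1 + y) (a - b) ≠ 0 ∧ g = uElt r * (xA y * torusElt t₁ t₂) * k := by
  obtain ⟨r, y, t₁, t₂, k, hk, rfl⟩ := iwasawa g
  obtain ⟨a, b, h1, h2⟩ := exists_exponents hV t₁ t₂
  by_cases hy : logA y (a - b) = 0
  · obtain ⟨k', hk', e⟩ := xA_mul_torusElt_of_logA hV h1 h2 hy
    exact Or.inl ⟨1, Or.inl rfl, r, t₁, t₂, k' * k, mul_mem hk' hk, by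
      rw [one_mul, mul_assoc (uElt r), e]; simp only [mul_assoc]⟩
  by_cases hy' : logA (1 + y) (a - b) = 0
  · have h2' : ‖((-1 * t₂ : Fˣ) : F)‖ = 𝐪 ^ (-(a + b)) := by simpa using h2
    have hy1 : logA (-1 - y) (a - b) = 0 := by
      rw [← hy', logA, logA, ← norm_neg]
      congr 4
      ring
    obtain ⟨k', hk', e⟩ := xA_mul_torusElt_of_logA hV h1 h2' hy1
    refine Or.inl ⟨(symS F)⁻¹, Or.inr rfl, conjS r, t₁, -1 * t₂, k' * k, mul_mem hk' hk, ?_⟩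
    have e2 : symS F * (uElt r * xA y * torusElt t₁ t₂) =
        uElt (conjS r) * (xA (-1 - y) * torusElt t₁ (-1 * t₂)) := by
      rw [mul_assoc (uElt r), ← mul_assoc (symS F), symS_mul_uElt, mul_assoc (uElt (conjS r)),
        ← mul_assoc (symS F), symS_mul_xA, mul_assoc (xA (-1 - y)), torusElt_mul, one_mul]
    rw [← eq_inv_mul_iff_mul_eq, e] at e2
    rw [e2]
    simp only [mul_assoc]
  · exact Or.inr ⟨r, y, t₁, t₂, k, hk, _, _, h1, h2, hy, hy', by rw [← mul_assoc]⟩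

/-- The properties that determine the common value of `D^{Ψ_s}` and `F* * P`. -/
structure IsSplitModel (ψ : AddChar F Circle) (s : ℂ) (Φ : G2 F → ℂ) : Prop where
  rightK : RightK Φ
  uElt_mul : ∀ r g, Φ (uElt r * g) = splitChar ψ r * Φ g
  symS_mul : ∀ g, Φ (symS F * g) = Φ g
  torusElt_eq : ∀ (t₁ t₂ : Fˣ) (a b : ℤ), ‖(t₁ : F)‖ = 𝐪 ^ (-a) → ‖(t₂ : F)‖ = 𝐪 ^ (-(a + b)) →
    0 ≤ a → 0 ≤ b → Φ (torusElt t₁ t₂) = toralValue F s t₁ t₂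
  off : ∀ (y : F) (t₁ t₂ : Fˣ) (a b : ℤ), ‖(t₁ : F)‖ = 𝐪 ^ (-a) → ‖(t₂ : F)‖ = 𝐪 ^ (-(a + b)) →
    logA y (a - b) ≠ 0 → logA (1 + y) (a - b) ≠ 0 → Φ (xA y * torusElt t₁ t₂) = 0

namespace IsSplitModel

variable {ψ : AddChar F Circle} {s : ℂ} {Φ Φ' : G2 F → ℂ} (H : IsSplitModel ψ s Φ)
include H

theorem eq_zero_of_notMem (hV : IsNormalizedNorm F) {g : G2 F} (hg : g ∉ supportSet ψ) :
    Φ g = 0 := by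
  rcases exists_representative hV g with ⟨m, hm, r, t₁, t₂, k, hk, e⟩ |
    ⟨r, y, t₁, t₂, k, hk, a, b, h1, h2, hy, hy', rfl⟩
  · refine absurd ⟨m, ?_, r, t₁, t₂, k, hk, e⟩ hg
    rcases hm with rfl | rfl
    · exact one_mem_splitStabilizer ψ
    · exact symS_inv_mem_splitStabilizer ψ
  · rw [H.rightK _ hk, H.uElt_mul, H.off y t₁ t₂ a b h1 h2 hy hy', mul_zero]

theorem torusElt_of_le (hV : IsNormalizedNorm F) {t₁ t₂ : Fˣ} (h1 : ‖(t₁ : F)‖ ≤ 1)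
    (h2 : ‖(t₂ : F) / t₁‖ ≤ 1) : Φ (torusElt t₁ t₂) = toralValue F s t₁ t₂ := by
  have hq := q_pos hV
  have hle : ∀ n : ℤ, 𝐪 ^ n ≤ 1 → n ≤ 0 := fun n hn => by
    rwa [← zpow_zero 𝐪, zpow_le_zpow_iff_right₀ (one_lt_q hV)] at hn
  obtain ⟨a, b, h3, h4⟩ := exists_exponents hV t₁ t₂
  rw [norm_div, h3, h4, ← zpow_sub₀ hq.ne'] at h2
  rw [h3] at h1
  have := hle _ h1
  have := hle _ h2
  exact H.torusElt_eq t₁ t₂ a b h3 h4 (by omega) (by omega)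

variable (hV : IsNormalizedNorm F) (hh2 : ‖(2 : F)‖ = 1)
  (hψ : Unramified ψ)
include hV hh2 hψ

theorem torusElt_eq_zero {t₁ t₂ : Fˣ} {a b : ℤ} (h1 : ‖(t₁ : F)‖ = 𝐪 ^ (-a))
    (h2 : ‖(t₂ : F)‖ = 𝐪 ^ (-(a + b))) (hab : a < 0 ∨ b < 0) : Φ (torusElt t₁ t₂) = 0 := by
  rw [← one_mul (torusElt t₁ t₂), ← xA_zero]
  refine eq_zero_of_depth_neg hV hh2 hψ H.rightK H.uElt_mul h1 h2 ?_
  rw [depth, logA_zero hV]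
  have n2 := logA_nonneg hV (1 + 0 : F) (a - b)
  rcases le_or_gt 0 (a - b) with h | h
  · rw [logA_of_norm_one hV (by simp) h]
    omega
  · omega

theorem unique (H' : IsSplitModel ψ s Φ') (g : G2 F) : Φ g = Φ' g := by
  have hT : ∀ t₁ t₂ : Fˣ, Φ (torusElt t₁ t₂) = Φ' (torusElt t₁ t₂) := by
    intro t₁ t₂
    obtain ⟨a, b, h1, h2⟩ := exists_exponents hV t₁ t₂
    by_cases hab : 0 ≤ a ∧ 0 ≤ b
    · rw [H.torusElt_eq _ _ _ _ h1 h2 hab.1 hab.2, H'.torusElt_eq _ _ _ _ h1 h2 hab.1 hab.2]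
    · rw [H.torusElt_eq_zero hV hh2 hψ h1 h2 (by omega),
        H'.torusElt_eq_zero hV hh2 hψ h1 h2 (by omega)]
  rcases exists_representative hV g with ⟨m, hm, r, t₁, t₂, k, hk, rfl⟩ |
    ⟨r, y, t₁, t₂, k, hk, a, b, h1, h2, hy, hy', rfl⟩
  · rw [H.rightK _ hk, H'.rightK _ hk, mul_assoc]
    rcases hm with rfl | rfl
    · rw [one_mul, H.uElt_mul, H'.uElt_mul, hT]
    · rw [← H.symS_mul, ← H'.symS_mul, mul_inv_cancel_left, H.uElt_mul, H'.uElt_mul, hT]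
  · rw [H.rightK _ hk, H'.rightK _ hk, H.uElt_mul, H'.uElt_mul, H.off y t₁ t₂ a b h1 h2 hy hy',
      H'.off y t₁ t₂ a b h1 h2 hy hy']

end IsSplitModel

variable (hV : IsNormalizedNorm F) (hh2 : ‖(2 : F)‖ = 1) (hdr : dr (Metric.closedBall 0 1) = 1)
  {ψ : AddChar F Circle} (hψ : Unramified ψ) {s : ℂ} (hs : 1 < s.re)
include hV hh2 hdr hψ hs

theorem isSplitModel_fourierTransform :
    IsSplitModel ψ s (fourierTransform ψ dr (functionD s)) := by
  have := finite_resField hV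
  have := Fintype.ofFinite (ResField F)
  exact
    { rightK := fourierTransform_mul_K hh2 ψ s
      uElt_mul := fourierTransform_uElt_mul hh2 hψ s
      symS_mul := fourierTransform_symS_mul hV hh2 hdr hψ s
      torusElt_eq := fun _ _ _ _ => fourierTransform_torusElt hV hh2 hdr hψ hs
      off := fun _ _ _ _ _ => fourierTransform_off hV hh2 hdr hψ hs }

theorem isSplitModel_heckeConv [MeasurableSpace (G2 F)] [BorelSpace (G2 F)] {μ : Measure (G2 F)}
    [μ.IsHaarMeasure] (hμ : μ (maxCompact F) = 1) :
    IsSplitModel ψ s (heckeConv μ (functionF ψ dr s) (functionP dr s)) := by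
  have := finite_resField hV
  have := Fintype.ofFinite (ResField F)
  exact
    { rightK := fun _ hk g => heckeConv_mul_K hV hh2 hdr hψ hμ s g hk
      uElt_mul := heckeConv_uElt_mul hV hh2 hdr hψ s
      symS_mul := heckeConv_symS_mul hV hh2 hdr hψ hs
      torusElt_eq := fun _ _ _ _ => heckeConv_torusElt hV hh2 hdr hψ hμ hs
      off := fun _ _ _ _ _ => heckeConv_off hV hh2 hdr hψ hμ hs }

end Conclusion

end
end SplitG2

theorem mainTheorem4 {F : Type*} [NontriviallyNormedField F] [IsUltrametricDist F] [ProperSpace F]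
    [CharZero F] [MeasurableSpace F] [BorelSpace F]
    (hnorm : IsNormalizedNorm F) (h2 : ‖(2 : F)‖ = 1) (h3 : ‖(3 : F)‖ = 1)
    (ψ : AddChar F Circle) (hψ : ∀ x : F, (∀ y : F, ‖y‖ ≤ 1 → ψ (x * y) = 1) ↔ ‖x‖ ≤ 1)
    (dr : Measure F) [dr.IsAddHaarMeasure] (hdr : dr (Metric.closedBall 0 1) = 1)
    [MeasurableSpace (G2 F)] [BorelSpace (G2 F)]
    (μ : Measure (G2 F)) [μ.IsHaarMeasure] (hμ : μ (maxCompact F) = 1)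
    (s : ℂ) (hs : 1 < s.re) :
    -- all the integrals involved converge absolutely
    (∀ g : G2 F, Integrable
      (fun r : Fin 5 → F => functionD s (uElt r * g) * star (splitChar ψ r))
      (Measure.pi fun _ => dr)) ∧
    (∀ g : G2 F, Integrable (integrandF ψ s g) dr) ∧
    (∀ g : G2 F, Integrable
      (fun x : G2 F => functionF ψ dr s (g * x⁻¹) * functionP dr s x) μ) ∧
    -- both functions vanish outside `S_{Ψ_s} U T K`
    (∀ g : G2 F, g ∉ supportSet ψ →
      fourierTransform ψ dr (functionD s) g = 0 ∧
      heckeConv μ (functionF ψ dr s) (functionP dr s) g = 0) ∧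
    -- the common value on toral elements
    (∀ t₁ t₂ : Fˣ, ‖(t₁ : F)‖ ≤ 1 → ‖(t₂ : F) / t₁‖ ≤ 1 →
      fourierTransform ψ dr (functionD s) (torusElt t₁ t₂) = toralValue F s t₁ t₂ ∧
      heckeConv μ (functionF ψ dr s) (functionP dr s) (torusElt t₁ t₂) =
        toralValue F s t₁ t₂) ∧
    -- the identity of functions
    (∀ g : G2 F, fourierTransform ψ dr (functionD s) g =
      heckeConv μ (functionF ψ dr s) (functionP dr s) g) := by
  have H := isSplitModel_fourierTransform hnorm h2 hdr hψ hs
  have H' := isSplitModel_heckeConv (μ := μ) hnorm h2 hdr hψ hs hμ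
  exact ⟨integrable_functionD hnorm h2 hdr hψ hs, integrable_integrandF hnorm hdr hψ hs,
    fun g => (integrable_conv hnorm h2 hdr hψ s (functionF_rightK ψ s) g).1,
    fun g hg => ⟨H.eq_zero_of_notMem hnorm hg, H'.eq_zero_of_notMem hnorm hg⟩,
    fun _ _ h1 h3 => ⟨H.torusElt_of_le hnorm h1 h3, H'.torusElt_of_le hnorm h1 h3⟩,
    H.unique hnorm h2 hψ H'⟩
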